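/- Let $m\ge 0$ and let $a\in\mathbb C$, $b,c\in\mathbb C^m$ satisfy $b_k,\ c_k,\ c_k-b_k\notin\mathbb Z$ for all $k$ and $a-\sum_{p\in K}c_p\notin\mathbb Z$ for every $K\subset\{1,\dots,m\}$ (including $K=\emptyset$). Lauricella's series is $$F_A(a,b,c;x)=\sum_{n\in\mathbb Z_{\ge0}^m}\frac{(a,\sum_k n_k)\prod_k(b_k,n_k)}{\prod_k(c_k,n_k)\,n_k!}\prod_k x_k^{n_k},\qquad (z,n)=z(z+1)\cdots(z+n-1),$$ and $E_A(a,b,c)$ is the system of equations, $k=1,\dots,m$, $$\Bigl[x_k(1-x_k)\partial_k^2-x_k\sum_{i\ne k}x_i\partial_k\partial_i+(c_k-(a+b_k+1)x_k)\partial_k-b_k\sum_{i\neq k}x_i\partial_i-ab_k\Bigr]f=0 .$$ Fix $I=\{i_1<\dots<i_r\}\subset\{1,\dots,m\}$; below $p$ runs over $I$, $q$ over the complement of $I$, and $k$ over $\{1,\dots,m\}$. Define $b^I,c^I$ by $b^I_p=b_p-c_p+1$, $c^I_p=2-c_p$, $b^I_q=b_q$, $c^I_q=c_q$, and put $$f_I(x)=\prod_{p}x_p^{1-c_p}\cdot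 F_A\Bigl(a+r-\sum_p c_p,\ b^I,\ c^I;\ x\Bigr).$$ Let $\varepsilon>0$, $0<\varepsilon_k<\frac14$ with $\varepsilon<1-\sum_k\varepsilon_k$, and let $x_1,\dots,x_m$ be real with $0<x_k<\varepsilon_k$ and $\sum_k x_k(1+\varepsilon_k)<\varepsilon$. Let $$u=\prod_k t_k^{b_k}(1-t_k)^{c_k-b_k-1}\cdot\Bigl(1-\sum_k x_kt_k\Bigr)^{-a},\qquad \varphi=\frac{dt_1\wedge\dots\wedge dt_m}{t_1\cdots t_m},$$ $$u_I=\prod_p s_p^{b_p}(s_p-x_p)^{c_p-b_p-1}\prod_q s_q^{b_q}(1-s_q)^{c_q-b_q-1}\cdot\Bigl(1-\sum_p s_p-\sum_q x_qs_q\Bigr)^{-a},\qquad \varphi_I=\frac{ds_1\wedge\dots\wedge ds_m}{s_1\cdots s_m},$$ and let $M$ and $M_I$ be the complements in $\mathbb C^m$ of the zero sets of the factors of $u$ and of $u_I$. Let $\sigma_I\subset\mathbb R^m$ be the product of an $r$-simplex and $m-r$ intervals given by $s_p\ge\varepsilon_p$, $1-\sum_p s_p\ge\varepsilon$, $\varepsilon_q\le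 s_q\le 1-\varepsilon_q$, with facets $l_j$ ($j$ labels the functions $s_k$, $1-s_q$ and $1-\sum_p s_p$; the last one only if $r\geq 1$), loaded with the branch of $u_I$ for which all its factors have argument $0$, and let $$\tilde\Delta_I=\sigma_I+\sum_{J\ne\emptyset}\Bigl(\prod_{j\in J}\frac1{d_j}\Bigr)\Bigl(\bigcap_{j\in J}l_j\Bigr)\times\prod_{j\in J}S_j$$ be its regularization: $S_j$ is the positively oriented circle on which the $j$-th function has modulus $\varepsilon_k$ (for $s_k$ and for $1-s_k$), respectively $\varepsilon$, starting at $l_j$; the branches are continued from $\sigma_I$, the cells are suitably oriented, and $d_j$ is $e^{2\pi i c_p}-1$ for $s_p$, $e^{2\pi i b_q}-1$ for $s_q$, $e^{2\pi i(c_q-b_q)}-1$ for $1-s_q$, and $e^{-2\pi i a}-1$ for $1-\sum_p s_p$. Let $\Delta_I=(\iota_I)_*\tilde\Delta_I$, where $\iota_I:M_I\to M$ is $t_p=s_p/x_p$, $t_q=s_q$, and where $u$ on $\iota_I(\sigma_I)$ is the branch for which $t_k$, $1-t_q$ and $1-\sum_k x_kt_k$ have argument $0$ and $1-t_p$ has argument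 $-\pi$. Put $F_I=\int_{\tilde\Delta_I}u_I\varphi_I$. Then $\tilde\Delta_I$ is a twisted cycle in $M_I$ with respect to $u_I$, $\Delta_I$ is a twisted cycle in $M$ with respect to $u$, and $$\int_{\Delta_I}u\,\varphi=\int_{\Delta_I}\prod_k t_k^{b_k-1}(1-t_k)^{c_k-b_k-1}\Bigl(1-\sum_k x_kt_k\Bigr)^{-a}dt_1\wedge\dots\wedge dt_m=e^{\pi i(\sum_p b_p-\sum_p c_p+r)}\prod_p x_p^{1-c_p}\cdot F_I .$$ Moreover this integral is a nonzero constant multiple of $f_I(x)$, with a constant that depends only on $a,b,c,I$: $$\int_{\Delta_I}u\,\varphi=e^{\pi i(\sum_p b_p-\sum_p c_p+r)}\prod_p\Gamma(c_p-1)\prod_q\frac{\Gamma(b_q)\Gamma(c_q-b_q)}{\Gamma(c_q)}\cdot\frac{\Gamma(1-a)}{\Gamma(\sum_p c_p-a-r+1)}\cdot f_I(x).$$ Here the series in $f_I$ converges absolutely for $\sum_k|x_k|<1$, and $f_I$ (with principal powers) is a holomorphic solution to $E_A(a,b,c)$ on the domain of all $x\in\mathbb C^m$ with $\sum_k|x_k|<1$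 and no $x_k$ in $(-\infty,0]$. -/

import Mathlib

open scoped ContDiff

noncomputable section

namespace LauricellaFA

/-! ### Twisted chains

For polynomials `P f` (`f : ι`) on `ℂ^m` and exponents `lam f`, put `M = {t | ∀ f, P f t ≠ 0}` and
`u = ∏ f, P f ^ lam f`.  Twisted chains are finite sums of smooth singular cubes in `M`, each of them
loaded with a branch of `u`; a branch of `u` along a cube is given by continuous branches of the
logarithms of the `P f` along it. -/

/-- The unit cube `[0,1]^k`. -/
def unitCube (k : ℕ) : Set (Fin k → ℝ) := Set.Icc 0 1

/-- The complement `M` of the hypersurfaces `P f = 0`. -/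
def complementOf {ι : Type} {m : ℕ} (P : ι → (Fin m → ℂ) → ℂ) : Set (Fin m → ℂ) :=
  {t | ∀ f, P f t ≠ 0}

/-- The data of a loaded singular `k`-cube: the parametrization, and for every `f` a function on the
cube which (see `IsLoaded`) is a branch of `log (P f)` along it.  Only the values on `unitCube k`
are relevant. -/
structure LoadedCube (ι : Type) (m k : ℕ) where
  map : (Fin k → ℝ) → (Fin m → ℂ)
  logBranch : ι → (Fin k → ℝ) → ℂ

/-- The cube is a smooth singular cube in `M`, and `logBranch f` is a continuous branch of
`log (P f)` along it. -/
def LoadedCube.IsLoaded {ι : Type} {m k : ℕ} (P : ι → (Fin m → ℂ) → ℂ)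
    (A : LoadedCube ι m k) : Prop :=
  ContDiffOn ℝ ∞ A.map (unitCube k) ∧
  (∀ y ∈ unitCube k, A.map y ∈ complementOf P) ∧
  ∀ f, ContinuousOn (A.logBranch f) (unitCube k) ∧
    ∀ y ∈ unitCube k, Complex.exp (A.logBranch f y) = P f (A.map y)

/-- The branch of `u = ∏ f, P f ^ lam f` with which the cube is loaded. -/
def LoadedCube.load {ι : Type} [Fintype ι] {m k : ℕ} (lam : ι → ℂ)
    (A : LoadedCube ι m k) (y : Fin k → ℝ) : ℂ :=
  Complex.exp (∑ f, lam f * A.logBranch f y)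

/-- The face `y i = z` of a loaded cube, with the restricted branch. -/
def LoadedCube.face {ι : Type} {m k : ℕ} (A : LoadedCube ι m (k + 1)) (i : Fin (k + 1)) (z : ℝ) :
    LoadedCube ι m k where
  map y := A.map (i.insertNth z y)
  logBranch f y := A.logBranch f (i.insertNth z y)

/-- The boundary operator `∂^u`. -/
def boundary {ι : Type} {m k : ℕ} :
    (LoadedCube ι m (k + 1) →₀ ℂ) →ₗ[ℂ] (LoadedCube ι m k →₀ ℂ) :=
  Finsupp.lsum ℂ fun A => LinearMap.toSpanSingleton ℂ (LoadedCube ι m k →₀ ℂ)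
    (∑ i : Fin (k + 1), ((-1 : ℂ) ^ (i : ℕ)) •
      (Finsupp.single (A.face i 1) (1 : ℂ) - Finsupp.single (A.face i 0) (1 : ℂ)))

/-- Finite sums of loaded cubes in `M`. -/
def twistedChains {ι : Type} {m : ℕ} (P : ι → (Fin m → ℂ) → ℂ) (k : ℕ) :
    Submodule ℂ (LoadedCube ι m k →₀ ℂ) :=
  Finsupp.supported ℂ ℂ {A | A.IsLoaded P}

/-- Loaded cubes are considered up to these relations: a cube loaded with `κ` times a branch is `κ`
times the cube loaded with that branch (`π = 1`), a permutation `π` of the coordinates of the cube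
multiplies it by the sign of `π` (orientation), and degenerate cubes are zero. -/
def nullChains {ι : Type} [Fintype ι] {m : ℕ} (P : ι → (Fin m → ℂ) → ℂ) (lam : ι → ℂ) (k : ℕ) :
    Submodule ℂ (LoadedCube ι m k →₀ ℂ) :=
  Submodule.span ℂ
    ({w | ∃ (A B : LoadedCube ι m k) (π : Equiv.Perm (Fin k)) (κ : ℂ),
        A.IsLoaded P ∧ B.IsLoaded P ∧
        (∀ y ∈ unitCube k, B.map y = A.map (y ∘ π) ∧
          B.load lam y = κ * A.load lam (y ∘ π)) ∧
        w = Finsupp.single B 1 - Finsupp.single A (κ * ((Equiv.Perm.sign π : ℤ) : ℂ))} ∪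
     {w | ∃ (A : LoadedCube ι m k) (i : Fin k),
        A.IsLoaded P ∧
        (∀ y ∈ unitCube k, ∀ y' ∈ unitCube k, (∀ j, j ≠ i → y j = y' j) →
          A.map y = A.map y' ∧ A.load lam y = A.load lam y') ∧
        w = Finsupp.single A 1})

/-- Twisted `k`-cycles in `M` with respect to `u`. -/
def IsTwistedCycle {ι : Type} [Fintype ι] {m : ℕ} (P : ι → (Fin m → ℂ) → ℂ) (lam : ι → ℂ) :
    (k : ℕ) → (LoadedCube ι m k →₀ ℂ) → Prop
  | 0, Δ => Δ ∈ twistedChains P 0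
  | k + 1, Δ => Δ ∈ twistedChains P (k + 1) ∧ boundary Δ ∈ nullChains P lam k

/-- `∫_A u · h dt_1 ∧ ⋯ ∧ dt_m` over one loaded `m`-cube `A`, with the branch of `u` on `A`. -/
def LoadedCube.integral {ι : Type} [Fintype ι] {m : ℕ} (lam : ι → ℂ) (h : (Fin m → ℂ) → ℂ)
    (A : LoadedCube ι m m) : ℂ :=
  ∫ y in unitCube m, A.load lam y * h (A.map y) *
    Matrix.det (Matrix.of fun i j : Fin m =>
      fderivWithin ℝ A.map (unitCube m) y (Pi.single j 1) i)

/-- `∫_Δ u · h dt_1 ∧ ⋯ ∧ dt_m` over a twisted chain, by linear extension. -/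
def twistedIntegral {ι : Type} [Fintype ι] {m : ℕ} (lam : ι → ℂ) (h : (Fin m → ℂ) → ℂ)
    (Δ : LoadedCube ι m m →₀ ℂ) : ℂ :=
  Δ.sum fun A z => z * A.integral lam h

/-- Pushforward of loaded cubes along `Φ : M' → M`, where `P f ∘ Φ = exp (κ f) • P' f` and the branch
of `log (P f)` on the image is the branch of `log (P' f)` plus the chosen logarithm `κ f`. -/
def LoadedCube.push {ι : Type} {m k : ℕ} (Φ : (Fin m → ℂ) → (Fin m → ℂ)) (κ : ι → ℂ)
    (A : LoadedCube ι m k) : LoadedCube ι m k where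
  map y := Φ (A.map y)
  logBranch f y := A.logBranch f y + κ f

def pushforward {ι : Type} {m k : ℕ} (Φ : (Fin m → ℂ) → (Fin m → ℂ)) (κ : ι → ℂ)
    (Δ : LoadedCube ι m k →₀ ℂ) : LoadedCube ι m k →₀ ℂ :=
  Δ.mapDomain (LoadedCube.push Φ κ)

/-! ### The arrangements -/

/-- Labels of the factors of `u`: `atZero k` for `t_k` (or `s_k`), `atOne k` for `1 - t_k`
(or `s_k - x_k`), `last` for the remaining factor `v`. -/
abbrev Factor (m : ℕ) : Type := Fin m ⊕ Fin m ⊕ Unit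

abbrev atZero {m : ℕ} (k : Fin m) : Factor m := Sum.inl k
abbrev atOne {m : ℕ} (k : Fin m) : Factor m := Sum.inr (Sum.inl k)
abbrev last {m : ℕ} : Factor m := Sum.inr (Sum.inr ())

/-- The exponents `b_k`, `c_k - b_k - 1`, `-a`. -/
def exponents {m : ℕ} (a : ℂ) (b c : Fin m → ℂ) : Factor m → ℂ :=
  Sum.elim b (Sum.elim (fun k => c k - b k - 1) (fun _ => -a))

/-- The polynomials `t_k`, `1 - t_k`, `1 - ∑ x_k t_k`. -/
def polyM {m : ℕ} (x : Fin m → ℝ) : Factor m → (Fin m → ℂ) → ℂ :=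
  Sum.elim (fun k t => t k)
    (Sum.elim (fun k t => 1 - t k) (fun _ t => 1 - ∑ k, (x k : ℂ) * t k))

/-- The polynomials `s_k`; `s_k - x_k` for `k ∈ I` and `1 - s_k` for `k ∉ I`;
`1 - ∑_{p ∈ I} s_p - ∑_{q ∉ I} x_q s_q`. -/
def polyMI {m : ℕ} (I : Finset (Fin m)) (x : Fin m → ℝ) : Factor m → (Fin m → ℂ) → ℂ :=
  Sum.elim (fun k s => s k)
    (Sum.elim (fun k s => if k ∈ I then s k - (x k : ℂ) else 1 - s k)
      (fun _ s => 1 - ∑ p ∈ I, s p - ∑ q ∈ Iᶜ, (x q : ℂ) * s q))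

/-- The coefficient of `φ = dt_1 ∧ ⋯ ∧ dt_m / (t_1 ⋯ t_m)`. -/
def phiCoeff {m : ℕ} (t : Fin m → ℂ) : ℂ := (∏ k, t k)⁻¹

/-! ### The regularized cycle

The domain is `σ = {s ∈ ℝ^m | w_v ≥ ε_v}`, where the `w_v` are the functions `s_p` and
`w_last = 1 - ∑ s_p` (`p ∈ I`; barycentric coordinates of an `r`-simplex) and `s_q`, `1 - s_q`
(`q ∉ I`; coordinates of an interval).  For a set `J` of facets of `σ`, the cell
`(⋂_{j ∈ J} l_j) × ∏_{j ∈ J} S_j` is realized by letting `w_j = ε_j e^{2πiθ_j}` for `j ∈ J`, while the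
other coordinates of the simplex, `w_v = ε_v + τ_v · margin` with `τ_v ≥ 0`, `∑ τ_v = 1`, are rescaled
so that `∑ w_v = 1` remains true. -/

/-- The circle of radius `ρ` about `0`, positively oriented and starting at `ρ`. -/
def circ (ρ θ : ℝ) : ℂ := (ρ : ℂ) * Complex.exp (2 * Real.pi * Complex.I * (θ : ℂ))

/-- The continuous logarithm of `circ ρ` starting at `log ρ`. -/
def logCirc (ρ θ : ℝ) : ℂ := (Real.log ρ : ℂ) + 2 * Real.pi * Complex.I * (θ : ℂ)

/-- The facets in `J` have nonempty intersection; `atOne p` with `p ∈ I` is not a facet. -/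
def IsFaceSet {m : ℕ} (I : Finset (Fin m)) (J : Finset (Factor m)) : Prop :=
  (∀ p ∈ I, atOne p ∉ J) ∧
  (∀ q, q ∉ I → ¬ (atZero q ∈ J ∧ atOne q ∈ J)) ∧
  ¬ (last ∈ J ∧ ∀ p ∈ I, atZero p ∈ J)

/-- The indices `p ∈ I` whose facet `s_p = ε_p` is not in `J`. -/
def free {m : ℕ} (I : Finset (Fin m)) (J : Finset (Factor m)) : Finset (Fin m) :=
  I.filter fun p => atZero p ∉ J

/-- `p` is the largest free index. -/
def IsTop {m : ℕ} (I : Finset (Fin m)) (J : Finset (Factor m)) (p : Fin m) : Prop :=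
  p ∈ free I J ∧ ∀ p' ∈ free I J, p' ≤ p

open Classical in
/-- The coordinate of the cube that belongs to the largest free index; if `last ∈ J` it is the angle
of the circle around `1 - ∑ s_p = 0`. -/
def topCoord {m : ℕ} (I : Finset (Fin m)) (J : Finset (Factor m)) (y : Fin m → ℝ) : ℝ :=
  ∑ p with IsTop I J p, y p

open Classical in
/-- The coordinates `τ_p`, `p` free, of a point of the simplex (`τ_last` is `1` minus their sum, and is
`0` if `last ∈ J`): `τ_p = y_p ∏_{p' < p} (1 - y_{p'})`, except that for `last ∈ J` and the largest
free `p` the factor `y_p` is omitted. -/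
def stick {m : ℕ} (I : Finset (Fin m)) (J : Finset (Factor m)) (y : Fin m → ℝ) (p : Fin m) : ℝ :=
  (if last ∈ J ∧ IsTop I J p then 1 else y p) * ∏ p' ∈ (free I J).filter (· < p), (1 - y p')

/-- `1 - ∑_v ε_v + ∑_{v ∈ J} ε_v (1 - e^{2πiθ_v})`, over the coordinates of the simplex. -/
def margin {m : ℕ} (I : Finset (Fin m)) (ε : ℝ) (εs : Fin m → ℝ) (J : Finset (Factor m))
    (y : Fin m → ℝ) : ℂ :=
  1 - ((ε : ℂ) + ∑ p ∈ I, (εs p : ℂ))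
    + (∑ p ∈ I, if atZero p ∈ J then (εs p : ℂ) - circ (εs p) (y p) else 0)
    + (if last ∈ J then (ε : ℂ) - circ ε (topCoord I J y) else 0)

/-- The parametrization of the cell `(⋂_{j ∈ J} l_j) × ∏_{j ∈ J} S_j`. -/
def cellMap {m : ℕ} (I : Finset (Fin m)) (ε : ℝ) (εs : Fin m → ℝ) (J : Finset (Factor m))
    (y : Fin m → ℝ) (k : Fin m) : ℂ :=
  if k ∈ I then
    if atZero k ∈ J then circ (εs k) (y k)
    else (εs k : ℂ) + (stick I J y k : ℂ) * margin I ε εs J y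
  else
    if atZero k ∈ J then circ (εs k) (y k)
    else if atOne k ∈ J then 1 - circ (εs k) (y k)
    else (εs k : ℂ) + (1 - 2 * (εs k : ℂ)) * (y k : ℂ)

/-- The branch of `log s_k` on a cell, continued from the real branch on `σ`. -/
def logZero {m : ℕ} (I : Finset (Fin m)) (ε : ℝ) (εs : Fin m → ℝ) (J : Finset (Factor m))
    (k : Fin m) (y : Fin m → ℝ) : ℂ :=
  if atZero k ∈ J then logCirc (εs k) (y k) else Complex.log (cellMap I ε εs J y k)

/-- The branch of `log (s_k - x_k)` (for `k ∈ I`; note `|x_k| < |s_k|`) or of `log (1 - s_k)`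
(for `k ∉ I`) on a cell, continued from the real branch on `σ`. -/
def logOne {m : ℕ} (I : Finset (Fin m)) (ε : ℝ) (εs x : Fin m → ℝ) (J : Finset (Factor m))
    (k : Fin m) (y : Fin m → ℝ) : ℂ :=
  if k ∈ I then
    logZero I ε εs J k y + Complex.log (1 - (x k : ℂ) / cellMap I ε εs J y k)
  else if atOne k ∈ J then logCirc (εs k) (y k)
  else Complex.log (1 - cellMap I ε εs J y k)

/-- The branch of `log (1 - ∑_{p ∈ I} s_p - ∑_{q ∉ I} x_q s_q)` on a cell (note
`|∑_{q ∉ I} x_q s_q| < |1 - ∑_{p ∈ I} s_p|`), continued from the real branch on `σ`. -/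
def logLast {m : ℕ} (I : Finset (Fin m)) (ε : ℝ) (εs x : Fin m → ℝ) (J : Finset (Factor m))
    (y : Fin m → ℝ) : ℂ :=
  (if last ∈ J then logCirc ε (topCoord I J y)
    else Complex.log (1 - ∑ p ∈ I, cellMap I ε εs J y p)) +
  Complex.log (1 - (∑ q ∈ Iᶜ, (x q : ℂ) * cellMap I ε εs J y q) /
    (1 - ∑ p ∈ I, cellMap I ε εs J y p))

/-- The loaded cell `(⋂_{j ∈ J} l_j) × ∏_{j ∈ J} S_j`. -/
def cell {m : ℕ} (I : Finset (Fin m)) (ε : ℝ) (εs x : Fin m → ℝ) (J : Finset (Factor m)) :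
    LoadedCube (Factor m) m m where
  map := cellMap I ε εs J
  logBranch := Sum.elim (logZero I ε εs J)
    (Sum.elim (logOne I ε εs x J) (fun _ => logLast I ε εs x J))

/-- `e^{2πiz}`. -/
def expTwoPiI (z : ℂ) : ℂ := Complex.exp (2 * Real.pi * Complex.I * z)

/-- The numbers `d_j`: `γ_p - 1` (`p ∈ I`), `β_q - 1` and `γ_q β_q⁻¹ - 1` (`q ∉ I`), `α⁻¹ - 1`. -/
def dCoeff {m : ℕ} (I : Finset (Fin m)) (a : ℂ) (b c : Fin m → ℂ) : Factor m → ℂ :=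
  Sum.elim (fun k => if k ∈ I then expTwoPiI (c k) - 1 else expTwoPiI (b k) - 1)
    (Sum.elim (fun k => expTwoPiI (c k) * (expTwoPiI (b k))⁻¹ - 1)
      (fun _ => (expTwoPiI a)⁻¹ - 1))

/-- The orientation sign of a facet relative to the coordinate order of `cell`. -/
def facetSign {m : ℕ} : Factor m → ℂ := Sum.elim (fun _ => 1) (fun _ => -1)

open Classical in
/-- The regularized cycle `Δ̃_I = σ + ∑_{J ≠ ∅} ∏_{j ∈ J} (± 1 / d_j) (⋂_{j ∈ J} l_j) × ∏_{j ∈ J} S_j`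
in `M_I` (the summand `J = ∅` is `σ`). -/
def tildeDelta {m : ℕ} (a : ℂ) (b c : Fin m → ℂ) (I : Finset (Fin m)) (ε : ℝ)
    (εs x : Fin m → ℝ) : LoadedCube (Factor m) m m →₀ ℂ :=
  ∑ J with IsFaceSet I J,
    Finsupp.single (cell I ε εs x J) (∏ j ∈ J, facetSign j / dCoeff I a b c j)

/-- `t_p = s_p / x_p` for `p ∈ I`, `t_q = s_q` for `q ∉ I`. -/
def iotaMap {m : ℕ} (I : Finset (Fin m)) (x : Fin m → ℝ) (s : Fin m → ℂ) : Fin m → ℂ :=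
  fun k => if k ∈ I then s k / (x k : ℂ) else s k

/-- For `p ∈ I`: `t_p = s_p / x_p` gets the logarithm `log s_p - log x_p`, and
`1 - t_p = -(s_p - x_p) / x_p` gets `log (s_p - x_p) - log x_p - πi`.  So on the real chamber that
contains the image of `σ`, the arguments of `t_k`, `1 - t_q` (`q ∉ I`) and `1 - ∑ x_k t_k` are `0`
and the argument of `1 - t_p` (`p ∈ I`) is `-π`. -/
def iotaLog {m : ℕ} (I : Finset (Fin m)) (x : Fin m → ℝ) : Factor m → ℂ :=
  Sum.elim (fun k => if k ∈ I then -(Real.log (x k) : ℂ) else 0)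
    (Sum.elim (fun k => if k ∈ I then -(Real.log (x k) : ℂ) - Real.pi * Complex.I else 0)
      (fun _ => 0))

/-- `Δ_I = (ι_I)_* Δ̃_I`. -/
def Delta {m : ℕ} (a : ℂ) (b c : Fin m → ℂ) (I : Finset (Fin m)) (ε : ℝ)
    (εs x : Fin m → ℝ) : LoadedCube (Factor m) m m →₀ ℂ :=
  pushforward (iotaMap I x) (iotaLog I x) (tildeDelta a b c I ε εs x)

/-- `F_I = ∫_{Δ̃_I} u_I φ_I`. -/
def FInt {m : ℕ} (a : ℂ) (b c : Fin m → ℂ) (I : Finset (Fin m)) (ε : ℝ)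
    (εs x : Fin m → ℝ) : ℂ :=
  twistedIntegral (exponents a b c) phiCoeff (tildeDelta a b c I ε εs x)

/-! ### Lauricella's series and system -/

/-- `(z, n) = z (z + 1) ⋯ (z + n - 1)`. -/
def poch (z : ℂ) (n : ℕ) : ℂ := (ascPochhammer ℂ n).eval z

def lauricellaTerm {m : ℕ} (a : ℂ) (b c x : Fin m → ℂ) (n : Fin m → ℕ) : ℂ :=
  poch a (∑ k, n k) * (∏ k, poch (b k) (n k)) /
    ((∏ k, poch (c k) (n k)) * ∏ k, ((n k).factorial : ℂ)) * ∏ k, x k ^ n k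

/-- Lauricella's series `F_A (a, b, c; x)`. -/
def lauricellaFA {m : ℕ} (a : ℂ) (b c x : Fin m → ℂ) : ℂ :=
  ∑' n : Fin m → ℕ, lauricellaTerm a b c x n

/-- The partial derivative with respect to `x_k`. -/
def pd {m : ℕ} (k : Fin m) (f : (Fin m → ℂ) → ℂ) (x : Fin m → ℂ) : ℂ :=
  fderiv ℂ f x (Pi.single k 1)

/-- `f` is a holomorphic solution to the system `E_A (a, b, c)` on the open set `U`. -/
def IsSolutionEA {m : ℕ} (a : ℂ) (b c : Fin m → ℂ) (U : Set (Fin m → ℂ))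
    (f : (Fin m → ℂ) → ℂ) : Prop :=
  DifferentiableOn ℂ f U ∧ ∀ k : Fin m, ∀ x ∈ U,
    x k * (1 - x k) * pd k (pd k f) x
      - x k * (∑ i ∈ Finset.univ.erase k, x i * pd k (pd i f) x)
      + (c k - (a + b k + 1) * x k) * pd k f x
      - b k * (∑ i ∈ Finset.univ.erase k, x i * pd i f x)
      - a * b k * f x = 0

/-- The parameters `a + r - ∑ c_p`, `b^I`, `c^I`. -/
def aI {m : ℕ} (a : ℂ) (c : Fin m → ℂ) (I : Finset (Fin m)) : ℂ := a + (I.card : ℂ) - ∑ p ∈ I, c p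
def bI {m : ℕ} (b c : Fin m → ℂ) (I : Finset (Fin m)) (k : Fin m) : ℂ :=
  if k ∈ I then b k + (1 - c k) else b k
def cI {m : ℕ} (c : Fin m → ℂ) (I : Finset (Fin m)) (k : Fin m) : ℂ :=
  if k ∈ I then c k + 2 * (1 - c k) else c k

/-- `f_I = ∏_{p ∈ I} x_p^{1 - c_p} · F_A (a + r - ∑ c_p, b^I, c^I; x)`, with principal powers. -/
def localSolution {m : ℕ} (a : ℂ) (b c : Fin m → ℂ) (I : Finset (Fin m)) (x : Fin m → ℂ) : ℂ :=
  (∏ p ∈ I, x p ^ (1 - c p)) * lauricellaFA (aI a c I) (bI b c I) (cI c I) x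

/-- The convergence domain `D_A`. -/
def domainDA (m : ℕ) : Set (Fin m → ℂ) := {x | ∑ k, ‖x k‖ < 1}

/-- The points of `D_A` none of whose coordinates lies on the cut `(-∞, 0]`: a simply connected
domain in the complement of the singular locus of `E_A`, containing all small positive real `x`. -/
def cutDomain (m : ℕ) : Set (Fin m → ℂ) := {x ∈ domainDA m | ∀ k, x k ∈ Complex.slitPlane}

/-- `∏_{p ∈ I} Γ(c_p - 1) · ∏_{q ∉ I} Γ(b_q) Γ(c_q - b_q) / Γ(c_q) · Γ(1 - a) / Γ(∑ c_p - a - r + 1)`. -/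
def gammaFactor {m : ℕ} (a : ℂ) (b c : Fin m → ℂ) (I : Finset (Fin m)) : ℂ :=
  (∏ p ∈ I, Complex.Gamma (c p - 1)) *
    (∏ q ∈ Iᶜ, Complex.Gamma (b q) * Complex.Gamma (c q - b q) / Complex.Gamma (c q)) *
    (Complex.Gamma (1 - a) / Complex.Gamma ((∑ p ∈ I, c p) - a - (I.card : ℂ) + 1))

/-- `e^{πi(∑ b_p - ∑ c_p + r)}`. -/
def phaseFactor {m : ℕ} (b c : Fin m → ℂ) (I : Finset (Fin m)) : ℂ :=
  Complex.exp (Real.pi * Complex.I * ((∑ p ∈ I, b p) - (∑ p ∈ I, c p) + (I.card : ℂ)))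

end LauricellaFA

end

open LauricellaFA

namespace LauricellaFA

/-! ### Power series in several variables -/

/-! The integral is evaluated by expanding the integrand in powers of `x` and recognizing every term
as a Dirichlet integral. On the cells `|x_p| < |s_p|` and `|∑ x_q s_q| < |1 - ∑ s_p|`. So `u_I φ_I`
is a product of powers of the facet functions `s_k`, `1 - s_q`, `1 - ∑ s_p`, times `∏ (1 - x_p /
s_p) ^ (c_p - b_p - 1)` and `(1 - ∑ x_q s_q / (1 - ∑ s_p)) ^ (-a)` (`load_mul_phiCoeff`). The last
two have binomial and multinomial expansions that are dominated uniformly on each cell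
(`hasSum_mixedCoeff`, `hasSum_cell_integral`). Every term shifts the exponents of the facet
functions by integers. This leaves the numbers `d_j` unchanged, so all terms are integrals of
products `∏ w_v ^ e_v` over the same regularized cycle (`hasSum_FInt`).

Such an integral is first computed when all exponents have positive real part. Each cell is a
polynomial chart restricted to unit circles in its angle coordinates (`cellMap_eq`). A circle
integral divided by its `d_j` equals the integral over the radius, because both have the moments `1
/ (ν + n)` against power series (`integral_circleWeight`). Hence the weighted cell of `J`
contributes the integral over the real region in which exactly the facet functions in `J` are
smaller than their radii (`cellWeight_mul_cellIntegral`). These regions tile the open simplex times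
intervals (`iUnion_facetRegion_ae_eq`), and stick breaking coordinates turn the total into a product
of beta integrals (`integral_simplexCube_facetProd`). Finally all exponents are shifted by a common
`ζ`. Both sides are holomorphic in `ζ` off a countable set, whose complement in `ℂ` is connected,
and the identity theorem removes the positivity assumption (`regularizedIntegral_eq`). The gamma
quotients of the terms reduce to Pochhammer symbols times `gammaFactor`
(`dirichletValue_shiftedExponents`), which gives `FInt_eq`.

That the chain is a cycle is a cancellation modulo null chains. The two end faces of a circle differ
by the monodromy, so together they give `d_j` times the starting face. The factor `1 / d_j` turns
this into a multiple of the coefficient of the cell without `j`, and it cancels the face of that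
cell on the facet `l_j` (`cellCoeff_smul_faces`, `sum_faces_eq_zero`). The faces created by the
stick breaking parametrization are degenerate, or match up to a permutation of coordinates
(`faceClass_top`). The cycle `Δ_I` is the image under a linear map that multiplies all loads by one
constant and preserves `φ`; this constant is the phase times the powers of `x_p`
(`twistedIntegral_Delta`).

For the differential system put `θ_k = x_k ∂_k`. The `k`-th operator multiplied by `x_k` is `θ_k
(θ_k + c_k - 1) - x_k (∑ θ_i + a) (θ_k + b_k)`. It acts on `x ^ ρ` times a power series through a
recurrence of the coefficients and the indicial equation `ρ_k (ρ_k + c_k - 1) = 0`, whose roots are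
`0` and `1 - c_k` (`isSolutionEA_twistedSum`). -/

theorem poch_zero (z : ℂ) : poch z 0 = 1 := by simp [poch]

theorem poch_succ (z : ℂ) (n : ℕ) : poch z (n + 1) = poch z n * (z + n) :=
  ascPochhammer_succ_eval n z

theorem poch_ne_zero {z : ℂ} (hz : ∀ n : ℤ, z ≠ n) (n : ℕ) : poch z n ≠ 0 := by
  intro h
  obtain ⟨k, -, hk⟩ := (ascPochhammer_eval_eq_zero_iff n z).1 h
  exact hz (-k) (by push_cast; rw [hk, neg_neg])

/-- The binomial series of `(1 - z) ^ (-A)`. -/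
theorem hasSum_binomial (A : ℂ) {z : ℂ} (hz : ‖z‖ < 1) :
    HasSum (fun n : ℕ => poch A n / (n.factorial : ℂ) * z ^ n)
      (Complex.exp (-A * Complex.log (1 - z))) := by
  have h := (Complex.one_div_one_sub_cpow_hasFPowerSeriesOnBall_zero A).hasSum (y := z)
    (by simpa [Metric.mem_eball, edist_zero_right, enorm_eq_nnnorm, ← NNReal.coe_lt_one] using hz)
  have hz1 : 1 - z ≠ 0 := by
    intro h0
    rw [← sub_eq_zero.1 h0] at hz
    simp at hz
  -- The falling factorial of `A + n - 1` read backwards is the rising factorial of `A`.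
  have hcoef : ∀ n : ℕ, Ring.choose (A + n - 1) n = poch A n / (n.factorial : ℂ) := by
    intro n
    rw [Ring.choose_eq_smul, Polynomial.descPochhammer_smeval_eq_ascPochhammer,
      Polynomial.ascPochhammer_smeval_cast, Polynomial.ascPochhammer_smeval_eq_eval, poch,
      smul_eq_mul, div_eq_inv_mul]
    congr 2
    ring
  have hval : Complex.exp (-A * Complex.log (1 - z)) = 1 / (1 - (0 + z)) ^ A := by
    rw [zero_add, Complex.cpow_def_of_ne_zero hz1, one_div, ← Complex.exp_neg]
    congr 1
    ring
  have hterm : (fun n : ℕ => poch A n / (n.factorial : ℂ) * z ^ n) = fun n : ℕ =>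
      (FormalMultilinearSeries.ofScalars ℂ (fun n : ℕ => Ring.choose (A + n - 1) n) n)
        fun _ => z := by
    funext n
    rw [← hcoef, FormalMultilinearSeries.ofScalars_apply_eq, smul_eq_mul]
  rw [hterm, hval]
  exact h

theorem hasSum_of_eq {α β : Type*} [AddCommMonoid α] [TopologicalSpace α] {f g : β → α} {s : α}
    (h : HasSum f s) (he : ∀ b, g b = f b) : HasSum g s := by
  rwa [funext he]

theorem hasSum_multinomial_fiber {ι R : Type*} [Fintype ι] [DecidableEq ι] [CommSemiring R]
    [TopologicalSpace R] (w : ι → R) (N : ℕ) :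
    HasSum (fun c : {n : ι → ℕ // ∑ k, n k = N} =>
      ((Nat.multinomial Finset.univ c.1 : R) * ∏ k, w k ^ c.1 k)) ((∑ k, w k) ^ N) := by
  let _ : Fintype {n : ι → ℕ // ∑ k, n k = N} :=
    Fintype.subtype (Finset.piAntidiag Finset.univ N) (by simp)
  rw [Finset.sum_pow_eq_sum_piAntidiag, Finset.sum_subtype (p := fun n : ι → ℕ => ∑ k, n k = N)
    _ (by simp)]
  exact hasSum_fintype _

/-- Grouping the multi-indices by total degree leaves finite fibres, on each of which the
multinomial theorem applies, and a single series in the degree. -/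
theorem hasSum_multinomial {ι : Type*} [Fintype ι] [DecidableEq ι] (g : ℕ → ℂ) (z : ι → ℂ)
    (h : Summable fun N => ‖g N‖ * (∑ k, ‖z k‖) ^ N) :
    HasSum (fun n : ι → ℕ => g (∑ k, n k) *
      ((Nat.multinomial Finset.univ n : ℂ) * ∏ k, z k ^ n k)) (∑' N, g N * (∑ k, z k) ^ N) := by
  rw [← (Equiv.sigmaFiberEquiv fun n : ι → ℕ => ∑ k, n k).hasSum_iff]
  refine HasSum.sigma_of_hasSum (g := fun N => g N * (∑ k, z k) ^ N) ?_ ?_ ?_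
  · refine Summable.hasSum (Summable.of_norm_bounded h fun N => ?_)
    rw [norm_mul, norm_pow]
    gcongr
    exact norm_sum_le _ _
  · intro N
    refine hasSum_of_eq ((hasSum_multinomial_fiber z N).mul_left (g N)) ?_
    rintro ⟨n, hn⟩
    simp [Equiv.sigmaFiberEquiv, hn]
  -- The norms over a fibre add up to a multinomial expansion as well, now of `(∑ k, ‖z k‖) ^ N`;
  -- this is where `h` is needed in normed form.
  · rw [← summable_norm_iff]
    have key2 : ∀ N, HasSum (fun c : {n : ι → ℕ // ∑ k, n k = N} =>
        ‖((fun n : ι → ℕ => g (∑ k, n k) *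
          ((Nat.multinomial Finset.univ n : ℂ) * ∏ k, z k ^ n k)) ∘
          (Equiv.sigmaFiberEquiv fun n : ι → ℕ => ∑ k, n k)) ⟨N, c⟩‖)
        (‖g N‖ * (∑ k, ‖z k‖) ^ N) := by
      intro N
      refine hasSum_of_eq ((hasSum_multinomial_fiber (fun k => ‖z k‖) N).mul_left ‖g N‖) ?_
      rintro ⟨n, hn⟩
      simp [Equiv.sigmaFiberEquiv, hn]
    refine (summable_sigma_of_nonneg fun _ => norm_nonneg _).2 ⟨fun N => (key2 N).summable, ?_⟩
    exact h.congr fun N => ((key2 N).tsum_eq).symm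

theorem hasSum_prod_pi_option {α : Type} [Fintype α] (f : Option α → ℕ → ℂ) (S : Option α → ℂ)
    (h : HasSum (f none) (S none))
    (h1 : HasSum (fun n : α → ℕ => ∏ k, f (some k) (n k)) (∏ k, S (some k))) :
    HasSum (fun n : Option α → ℕ => ∏ k, f k (n k)) (∏ k, S k) := by
  rw [← (Equiv.piOptionEquivProd (β := fun _ : Option α => ℕ)).symm.hasSum_iff]
  have hs : Summable fun x : ℕ × (α → ℕ) => f none x.1 * ∏ k, f (some k) (x.2 k) :=
    summable_mul_of_summable_norm (f := f none) (g := fun n : α → ℕ => ∏ k, f (some k) (n k))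
      h.summable.norm h1.summable.norm
  have h2 := HasSum.mul (f := f none) (g := fun n : α → ℕ => ∏ k, f (some k) (n k)) h h1 hs
  rw [Fintype.prod_option]
  refine hasSum_of_eq h2 fun n => ?_
  simp [Fintype.prod_option, Equiv.piOptionEquivProd]

/-- Convergent families of complex numbers converge absolutely, so finitely many of them can be
multiplied out; the induction on the index type splits off one coordinate of `n` at a time. -/
theorem hasSum_prod_pi {ι : Type} [Fintype ι] (f : ι → ℕ → ℂ) (S : ι → ℂ)
    (h : ∀ k, HasSum (f k) (S k)) : HasSum (fun n : ι → ℕ => ∏ k, f k (n k)) (∏ k, S k) := by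
  revert f S
  apply Fintype.induction_empty_option (P := fun ι _ => ∀ (f : ι → ℕ → ℂ) (S : ι → ℂ),
    (∀ k, HasSum (f k) (S k)) → HasSum (fun n : ι → ℕ => ∏ k, f k (n k)) (∏ k, S k))
  · intro α β _ e ih f S h
    let _ := Fintype.ofEquiv β e.symm
    have h1 := ih (fun k => f (e k)) (fun k => S (e k)) fun k => h (e k)
    rw [← (Equiv.arrowCongr e (Equiv.refl ℕ)).hasSum_iff]
    rw [← Equiv.prod_comp e]
    refine hasSum_of_eq h1 fun n => ?_
    rw [Function.comp_apply, ← Equiv.prod_comp e]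
    simp
  · intro f S _
    rw [Fintype.prod_empty]
    exact hasSum_of_eq (hasSum_unique (fun _ : PEmpty → ℕ => (1 : ℂ))) fun n => by simp
  · intro α _ ih f S h
    exact hasSum_prod_pi_option f S (h none) (ih _ _ fun k => h (some k))

/-! ### Convergence of Lauricella's series -/

/-- The binomial series converges at `1 / R`, so its terms are bounded. -/
theorem bounded_poch_div_factorial (A : ℂ) {R : ℝ} (hR : 1 < R) :
    ∃ C, 0 ≤ C ∧ ∀ n : ℕ, ‖poch A n‖ ≤ C * R ^ n * n.factorial := by
  have hR0 : 0 < R := by linarith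
  have hs := (hasSum_binomial A (z := ((R⁻¹ : ℝ) : ℂ))
    (by simpa [abs_of_pos hR0] using inv_lt_one_of_one_lt₀ hR)).summable
  obtain ⟨C, hC⟩ := (hs.tendsto_atTop_zero.norm).bddAbove_range
  refine ⟨max C 0, le_max_right _ _, fun n => ?_⟩
  have h := hC ⟨n, rfl⟩
  simp only [norm_mul, norm_div, norm_pow, Complex.norm_real, Complex.norm_natCast, norm_inv,
    Real.norm_of_nonneg hR0.le, inv_pow] at h
  have hf : (0 : ℝ) < n.factorial := by positivity
  have hp : 0 < R ^ n := by positivity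
  rw [div_mul_eq_mul_div, div_le_iff₀ hf, mul_inv_le_iff₀ hp] at h
  calc ‖poch A n‖ ≤ C * n.factorial * R ^ n := h
    _ ≤ max C 0 * n.factorial * R ^ n := by gcongr; exact le_max_left _ _
    _ = _ := by ring

theorem tendsto_add_div_add (b c : ℂ) :
    Filter.Tendsto (fun n : ℕ => (b + n) / (c + n)) Filter.atTop (nhds 1) := by
  have h : ∀ z : ℂ, Filter.Tendsto (fun n : ℕ => z / n + 1) Filter.atTop (nhds 1) := by
    intro z
    simpa using (tendsto_const_div_atTop_nhds_zero_nat z).add_const 1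
  have := (h b).div (h c) one_ne_zero
  rw [div_one] at this
  refine this.congr' ?_
  filter_upwards [Filter.eventually_gt_atTop 0] with n hn
  have : (n : ℂ) ≠ 0 := by exact_mod_cast hn.ne'
  rw [Pi.div_apply, div_add_one this, div_add_one this, div_div_div_cancel_right₀ this]

/-- Consecutive quotients have the ratio `(b + n) / (c + n)`, which tends to `1`; by the ratio test
the series at `1 / R` converges, and its terms are bounded. -/
theorem bounded_poch_div_poch {b c : ℂ} (hb : ∀ n : ℤ, b ≠ n) (hc : ∀ n : ℤ, c ≠ n) {R : ℝ}
    (hR : 1 < R) : ∃ C, 0 ≤ C ∧ ∀ n : ℕ, ‖poch b n / poch c n‖ ≤ C * R ^ n := by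
  have hR0 : 0 < R := by linarith
  have hs : Summable fun n : ℕ => poch b n / poch c n * ((R⁻¹ : ℝ) : ℂ) ^ n := by
    have hne : ∀ n : ℕ, poch b n / poch c n * ((R⁻¹ : ℝ) : ℂ) ^ n ≠ 0 := fun n =>
      mul_ne_zero (div_ne_zero (poch_ne_zero hb n) (poch_ne_zero hc n))
        (pow_ne_zero _ (by exact_mod_cast (inv_pos.2 hR0).ne'))
    refine summable_of_ratio_test_tendsto_lt_one (inv_lt_one_of_one_lt₀ hR)
      (Filter.Eventually.of_forall hne) ?_
    have := ((tendsto_add_div_add b c).norm.mul_const (R⁻¹))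
    rw [norm_one, one_mul] at this
    refine this.congr fun n => ?_
    have hd := hne n
    have hcn : c + n ≠ 0 := fun h => hc (-n) (by push_cast; exact eq_neg_of_add_eq_zero_left h)
    rw [← norm_div, poch_succ, poch_succ, pow_succ, mul_div_mul_comm (poch b n),
      mul_mul_mul_comm (poch b n / poch c n), mul_div_cancel_left₀ _ hd, norm_mul,
      Complex.norm_real, Real.norm_of_nonneg (inv_nonneg.2 hR0.le)]
  obtain ⟨C, hC⟩ := (hs.tendsto_atTop_zero.norm).bddAbove_range
  refine ⟨max C 0, le_max_right _ _, fun n => ?_⟩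
  have h := hC ⟨n, rfl⟩
  simp only [norm_mul, norm_pow, Complex.norm_real, norm_inv,
    Real.norm_of_nonneg hR0.le, inv_pow] at h
  have hp : 0 < R ^ n := by positivity
  rw [mul_inv_le_iff₀ hp] at h
  exact h.trans (by gcongr; exact le_max_left _ _)

theorem multinomial_univ_cast {m : ℕ} (n : Fin m → ℕ) :
    (Nat.multinomial Finset.univ n : ℝ) =
      ((∑ k, n k).factorial : ℝ) / ∏ k, ((n k).factorial : ℝ) := by
  rw [eq_div_iff (by positivity), mul_comm]
  exact_mod_cast Nat.multinomial_spec (s := Finset.univ) (f := n)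

/-- Up to geometric factors arbitrarily close to `1`, the coefficients are multinomial coefficients,
so a geometric series in `∑ ‖x k‖`, multiplied out, is a majorant. -/
theorem summable_lauricellaTerm {m : ℕ} (a : ℂ) (b c : Fin m → ℂ)
    (hb : ∀ k (n : ℤ), b k ≠ n) (hc : ∀ k (n : ℤ), c k ≠ n) {x : Fin m → ℂ}
    (hx : x ∈ domainDA m) : Summable (lauricellaTerm a b c x) := by
  have hx1 : ∑ k, ‖x k‖ < 1 := hx
  -- One factor `R` pays for the growth of `poch a`, the other for the quotients of `poch (b k)` by
  -- `poch (c k)`.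
  obtain ⟨R, hR, hRx⟩ : ∃ R : ℝ, 1 < R ∧ R * (R * ∑ k, ‖x k‖) < 1 := by
    have hcont : Filter.Tendsto (fun R : ℝ => R * (R * ∑ k, ‖x k‖)) (nhdsWithin 1 (Set.Ioi 1))
        (nhds (1 * (1 * ∑ k, ‖x k‖))) :=
      (Continuous.tendsto (by fun_prop) 1).mono_left nhdsWithin_le_nhds
    rw [one_mul, one_mul] at hcont
    obtain ⟨R, h1, h2⟩ := ((hcont.eventually_lt_const hx1).and self_mem_nhdsWithin).exists
    exact ⟨R, h2, h1⟩
  have hR0 : 0 < R := by linarith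
  obtain ⟨C, hC0, hC⟩ := bounded_poch_div_factorial a hR
  choose D hD0 hD using fun k => bounded_poch_div_poch (hb k) (hc k) hR
  have hz : ∑ k, ‖(((R * (R * ‖x k‖) : ℝ)) : ℂ)‖ < 1 := by
    rw [Finset.mul_sum, Finset.mul_sum] at hRx
    refine lt_of_le_of_lt (le_of_eq (Finset.sum_congr rfl fun k _ => ?_)) hRx
    rw [Complex.norm_real, Real.norm_of_nonneg (by positivity)]
  have hs := (hasSum_multinomial (fun _ => 1) (fun k => ((R * (R * ‖x k‖) : ℝ) : ℂ)) (by
    simpa using summable_geometric_of_lt_one (by positivity) hz)).summable.norm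
  refine Summable.of_norm_bounded (hs.mul_left (C * ∏ k, D k)) fun n => ?_
  have hnn : ∀ k, ‖(((R * (R * ‖x k‖) : ℝ)) : ℂ)‖ = R * R * ‖x k‖ := fun k => by
    rw [Complex.norm_real, Real.norm_of_nonneg (by positivity), mul_assoc]
  simp only [one_mul, norm_mul, norm_prod, norm_pow, hnn, Complex.norm_natCast,
    multinomial_univ_cast, lauricellaTerm, norm_div]
  have e1 : ‖poch a (∑ k, n k)‖ * (∏ k, ‖poch (b k) (n k)‖) /
      ((∏ k, ‖poch (c k) (n k)‖) * ∏ k, ((n k).factorial : ℝ)) * ∏ k, ‖x k‖ ^ n k =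
      ‖poch a (∑ k, n k)‖ * (∏ k, ‖poch (b k) (n k) / poch (c k) (n k)‖) *
        ((∏ k, ((n k).factorial : ℝ))⁻¹ * ∏ k, ‖x k‖ ^ n k) := by
    simp only [norm_div, Finset.prod_div_distrib]
    rw [div_mul_eq_mul_div, mul_div_assoc', div_mul_eq_mul_div]
    rw [div_mul_eq_div_div, div_eq_mul_inv _ (∏ k, ((n k).factorial : ℝ))]
    ring
  rw [e1]
  calc _ ≤ (C * R ^ (∑ k, n k) * (∑ k, n k).factorial) * (∏ k, (D k * R ^ n k)) *
        ((∏ k, ((n k).factorial : ℝ))⁻¹ * ∏ k, ‖x k‖ ^ n k) := by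
        gcongr with k
        · exact hC _
        · exact hD k _
    _ = _ := by
        simp only [mul_pow, Finset.prod_mul_distrib, Finset.prod_pow_eq_pow_sum]
        ring

end LauricellaFA

noncomputable section

namespace LauricellaFA

/-! ### Termwise differentiation and the system `E_A` -/

/-- The power series with coefficients `A` converges on `D_A`. -/
def ConvergesDA {m : ℕ} (A : (Fin m → ℕ) → ℂ) : Prop :=
  ∀ x ∈ domainDA m, Summable fun n => A n * ∏ k, x k ^ n k

def powerSum {m : ℕ} (A : (Fin m → ℕ) → ℂ) (x : Fin m → ℂ) : ℂ :=
  ∑' n, A n * ∏ k, x k ^ n k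

/-- The room between `‖x k‖` and `R k` absorbs the polynomial factors in `n` that differentiation
produces. -/
theorem exists_radii {m : ℕ} {x : Fin m → ℂ} (hx : x ∈ domainDA m) :
    ∃ R : Fin m → ℝ, (∀ k, 0 < R k) ∧ (∀ k, ‖x k‖ < R k) ∧ ∑ k, R k < 1 := by
  have hx1 : ∑ k, ‖x k‖ < 1 := hx
  have hcont : Filter.Tendsto (fun δ : ℝ => ∑ k, (‖x k‖ + δ)) (nhdsWithin 0 (Set.Ioi 0))
      (nhds (∑ k, (‖x k‖ + 0))) :=
    (Continuous.tendsto (by fun_prop) 0).mono_left nhdsWithin_le_nhds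
  simp only [add_zero] at hcont
  obtain ⟨δ, h1, h2⟩ := ((hcont.eventually_lt_const hx1).and self_mem_nhdsWithin).exists
  have h2' : (0 : ℝ) < δ := h2
  exact ⟨fun k => ‖x k‖ + δ, fun k => by positivity, fun k => by simpa using h2', h1⟩

theorem ofReal_mem_domainDA {m : ℕ} {R : Fin m → ℝ} (h0 : ∀ k, 0 < R k) (h1 : ∑ k, R k < 1) :
    (fun k => (R k : ℂ)) ∈ domainDA m := by
  change ∑ k, ‖(R k : ℂ)‖ < 1
  simpa [abs_of_pos, h0] using h1

/-- Since `j (‖x k‖ / R k) ^ j` is bounded, the series at the larger radii is a majorant up to a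
constant. -/
theorem ConvergesDA.natCast_mul {m : ℕ} {A : (Fin m → ℕ) → ℂ} (hA : ConvergesDA A) (k : Fin m) :
    ConvergesDA fun n => (n k : ℂ) * A n := by
  intro x hx
  obtain ⟨R, hR0, hxR, hR1⟩ := exists_radii hx
  have hs := (hA _ (ofReal_mem_domainDA hR0 hR1)).norm
  have hq : ‖x k‖ / R k < 1 := (div_lt_one (hR0 k)).2 (hxR k)
  have ht : Filter.Tendsto (fun j : ℕ => (j : ℝ) * (‖x k‖ / R k) ^ j) Filter.atTop (nhds 0) :=
    tendsto_self_mul_const_pow_of_lt_one (by have := hR0 k; positivity) hq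
  obtain ⟨C, hC⟩ := ht.bddAbove_range
  have hC' : ∀ j : ℕ, (j : ℝ) * ‖x k‖ ^ j ≤ C * R k ^ j := fun j => by
    have := hC ⟨j, rfl⟩
    simp only [div_pow] at this
    rwa [mul_div_assoc', div_le_iff₀ (pow_pos (hR0 k) j)] at this
  refine Summable.of_norm_bounded (hs.mul_left C) fun n => ?_
  simp only [norm_mul, norm_prod, norm_pow, Complex.norm_real, Complex.norm_natCast,
    Real.norm_of_nonneg (hR0 _).le]
  rw [← Finset.mul_prod_erase _ _ (Finset.mem_univ k),
    ← Finset.mul_prod_erase _ (fun k => R k ^ n k) (Finset.mem_univ k)]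
  calc (n k : ℝ) * ‖A n‖ * (‖x k‖ ^ n k * ∏ i ∈ Finset.univ.erase k, ‖x i‖ ^ n i) =
      ‖A n‖ * ((n k * ‖x k‖ ^ n k) * ∏ i ∈ Finset.univ.erase k, ‖x i‖ ^ n i) := by ring
    _ ≤ ‖A n‖ * ((C * R k ^ n k) * ∏ i ∈ Finset.univ.erase k, R i ^ n i) := by
        have h0 : 0 ≤ C * R k ^ n k :=
          le_trans (by positivity) (hC' (n k))
        have h1 : ∏ i ∈ Finset.univ.erase k, ‖x i‖ ^ n i ≤ ∏ i ∈ Finset.univ.erase k, R i ^ n i :=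
          Finset.prod_le_prod (fun i _ => by positivity)
            fun i _ => pow_le_pow_left₀ (norm_nonneg _) (hxR i).le _
        exact mul_le_mul_of_nonneg_left (mul_le_mul (hC' _) h1 (by positivity) h0) (norm_nonneg _)
    _ = _ := by ring

theorem ConvergesDA.add {m : ℕ} {A B : (Fin m → ℕ) → ℂ} (hA : ConvergesDA A)
    (hB : ConvergesDA B) : ConvergesDA fun n => A n + B n := fun x hx => by
  simpa [add_mul] using (hA x hx).add (hB x hx)

theorem ConvergesDA.const_mul {m : ℕ} {A : (Fin m → ℕ) → ℂ} (hA : ConvergesDA A) (z : ℂ) :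
    ConvergesDA fun n => z * A n := fun x hx => by
  simpa [mul_assoc] using (hA x hx).mul_left z

theorem ConvergesDA.affine_mul {m : ℕ} {A : (Fin m → ℕ) → ℂ} (hA : ConvergesDA A) (k : Fin m)
    (z : ℂ) : ConvergesDA fun n => ((n k : ℂ) + z) * A n := fun x hx => by
  have := (hA.natCast_mul k).add (hA.const_mul z) x hx
  simpa [add_mul] using this

theorem isOpen_domainDA (m : ℕ) : IsOpen (domainDA m) :=
  isOpen_lt (by fun_prop) continuous_const

theorem isOpen_cutDomain (m : ℕ) : IsOpen (cutDomain m) := by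
  have : cutDomain m = domainDA m ∩ ⋂ k, {x | x k ∈ Complex.slitPlane} := by
    ext x; simp [cutDomain]
  rw [this]
  exact (isOpen_domainDA m).inter (isOpen_iInter_of_finite fun k =>
    Complex.isOpen_slitPlane.preimage (continuous_apply k))

/-- The derivative of a monomial. -/
def monomialDeriv {m : ℕ} (n : Fin m → ℕ) (x : Fin m → ℂ) : (Fin m → ℂ) →L[ℂ] ℂ :=
  ∑ k, (∏ i ∈ Finset.univ.erase k, x i ^ n i) •
    (((n k : ℂ) * x k ^ (n k - 1)) • ContinuousLinearMap.proj (R := ℂ) (φ := fun _ => ℂ) k)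

theorem hasFDerivAt_monomial {m : ℕ} (n : Fin m → ℕ) (x : Fin m → ℂ) :
    HasFDerivAt (fun x : Fin m → ℂ => ∏ k, x k ^ n k) (monomialDeriv n x) x := by
  have := HasFDerivAt.finsetProd (u := Finset.univ) (x := x)
    (g := fun k (x : Fin m → ℂ) => x k ^ n k)
    (g' := fun k => ((n k : ℂ) * x k ^ (n k - 1)) •
      ContinuousLinearMap.proj (R := ℂ) (φ := fun _ => ℂ) k)
    (fun k _ => by
      have h := (ContinuousLinearMap.proj (R := ℂ) (φ := fun _ : Fin m => ℂ) k).hasFDerivAt (x := x)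
      simpa using h.pow (n k))
  exact this

/-- Monomials are eigenvectors of the Euler operator; the factor `x k` also removes the truncated
exponent `n k - 1`. -/
theorem mul_monomialDeriv_single {m : ℕ} (n : Fin m → ℕ) (x : Fin m → ℂ) (k : Fin m) :
    x k * monomialDeriv n x (Pi.single k 1) = (n k : ℂ) * ∏ i, x i ^ n i := by
  have h : monomialDeriv n x (Pi.single k 1) =
      (∏ i ∈ Finset.univ.erase k, x i ^ n i) * ((n k : ℂ) * x k ^ (n k - 1)) := by
    rw [monomialDeriv, sum_apply, Finset.sum_eq_single k]
    · simp
    · intro b _ hb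
      simp [hb]
    · simp
  rw [h, ← Finset.mul_prod_erase _ (fun i => x i ^ n i) (Finset.mem_univ k)]
  rcases Nat.eq_zero_or_pos (n k) with h0 | h0
  · simp [h0]
  · rw [← mul_pow_sub_one h0.ne' (x k)]
    ring

theorem norm_monomialDeriv_le {m : ℕ} (n : Fin m → ℕ) {x : Fin m → ℂ} {R : Fin m → ℝ}
    (hR : ∀ k, 0 < R k) (hx : ∀ k, ‖x k‖ ≤ R k) :
    ‖monomialDeriv n x‖ ≤ ∑ k, (R k)⁻¹ * (n k * ∏ i, R i ^ n i) := by
  refine (norm_sum_le _ _).trans (Finset.sum_le_sum fun k _ => ?_)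
  have hproj : ‖ContinuousLinearMap.proj (R := ℂ) (φ := fun _ : Fin m => ℂ) k‖ ≤ 1 :=
    ContinuousLinearMap.opNorm_le_bound _ zero_le_one fun y => by
      simpa using norm_le_pi_norm y k
  rw [norm_smul, norm_smul, norm_prod, norm_mul, norm_pow, Complex.norm_natCast]
  simp only [norm_pow]
  have h1 : ∏ i ∈ Finset.univ.erase k, ‖x i‖ ^ n i ≤ ∏ i ∈ Finset.univ.erase k, R i ^ n i :=
    Finset.prod_le_prod (fun i _ => by positivity)
      fun i _ => pow_le_pow_left₀ (norm_nonneg _) (hx i) _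
  have h2 : ‖x k‖ ^ (n k - 1) ≤ R k ^ (n k - 1) := pow_le_pow_left₀ (norm_nonneg _) (hx k) _
  have h3 : 0 ≤ ∏ i ∈ Finset.univ.erase k, R i ^ n i :=
    Finset.prod_nonneg fun i _ => pow_nonneg (hR i).le _
  calc _ ≤ (∏ i ∈ Finset.univ.erase k, R i ^ n i) * ((n k * R k ^ (n k - 1)) * 1) := by
        have h4 : 0 ≤ R k ^ (n k - 1) := pow_nonneg (hR k).le _
        gcongr
    _ = _ := by
      rw [← Finset.mul_prod_erase _ (fun i => R i ^ n i) (Finset.mem_univ k)]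
      rcases Nat.eq_zero_or_pos (n k) with h0 | h0
      · simp [h0]
      · rw [← mul_pow_sub_one h0.ne' (R k)]
        have := (hR k).ne'
        field_simp

/-- Termwise differentiation on a polydisc: the derivatives of the terms are dominated by the series
with coefficients `n k * A n` at the radii. The derivative is recorded through the Euler operators,
which act diagonally on the coefficients. -/
theorem hasFDerivAt_powerSum {m : ℕ} {A : (Fin m → ℕ) → ℂ} (hA : ConvergesDA A) {x : Fin m → ℂ}
    (hx : x ∈ domainDA m) :
    DifferentiableAt ℂ (powerSum A) x ∧
      ∀ k, x k * pd k (powerSum A) x = powerSum (fun n => (n k : ℂ) * A n) x := by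
  obtain ⟨R, hR0, hxR, hR1⟩ := exists_radii hx
  have hRD := ofReal_mem_domainDA hR0 hR1
  set s : Set (Fin m → ℂ) := Set.univ.pi fun k => Metric.ball (0 : ℂ) (R k) with hs
  have hmem : ∀ y ∈ s, ∀ k, ‖y k‖ < R k := fun y hy k => by simpa using hy k (Set.mem_univ k)
  have hxs : x ∈ s := fun k _ => by simpa using hxR k
  have hu : Summable fun n : Fin m → ℕ => ‖A n‖ * ∑ k, (R k)⁻¹ * (n k * ∏ i, R i ^ n i) := by
    have : Summable fun n : Fin m → ℕ =>
        ∑ k, (R k)⁻¹ * ‖((n k : ℂ) * A n) * ∏ i, ((R i : ℂ)) ^ n i‖ :=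
      summable_sum fun k _ => ((hA.natCast_mul k) _ hRD).norm.mul_left _
    refine this.congr fun n => ?_
    rw [Finset.mul_sum]
    refine Finset.sum_congr rfl fun k _ => ?_
    simp only [norm_mul, norm_prod, norm_pow, Complex.norm_real, Complex.norm_natCast,
      Real.norm_of_nonneg (hR0 _).le]
    ring
  have hf : ∀ (n : Fin m → ℕ) (y : Fin m → ℂ), y ∈ s →
      HasFDerivAt (fun x : Fin m → ℂ => A n * ∏ k, x k ^ n k) (A n • monomialDeriv n y) y :=
    fun n y _ => (hasFDerivAt_monomial n y).const_mul (A n)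
  have hbound : ∀ (n : Fin m → ℕ) (y : Fin m → ℂ), y ∈ s → ‖A n • monomialDeriv n y‖ ≤
      ‖A n‖ * ∑ k, (R k)⁻¹ * (n k * ∏ i, R i ^ n i) := fun n y hy => by
    rw [norm_smul]
    gcongr
    exact norm_monomialDeriv_le n hR0 fun k => (hmem y hy k).le
  have hso : IsOpen s := isOpen_set_pi Set.finite_univ fun _ _ => Metric.isOpen_ball
  have hsc : IsPreconnected s :=
    (convex_pi fun k _ => convex_ball (0 : ℂ) (R k)).isPreconnected
  have key := hasFDerivAt_tsum_of_isPreconnected hu hso hsc hf hbound hxs (hA x hx) hxs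
  refine ⟨key.differentiableAt, fun k => ?_⟩
  have hsum : Summable fun n => A n • monomialDeriv n x :=
    Summable.of_norm_bounded hu fun n => hbound n x hxs
  have hfd : pd k (powerSum A) x = ∑' n, A n * monomialDeriv n x (Pi.single k 1) := by
    have : fderiv ℂ (powerSum A) x = ∑' n, A n • monomialDeriv n x := key.fderiv
    rw [pd, this]
    exact ((ContinuousLinearMap.apply ℂ ℂ (Pi.single k (1 : ℂ) : Fin m → ℂ)).map_tsum hsum)
  rw [hfd, ← tsum_mul_left, powerSum]
  refine tsum_congr fun n => ?_
  rw [mul_left_comm, mul_monomialDeriv_single]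
  ring

/-- `x ^ ρ` times a power series. -/
def twistedSum {m : ℕ} (ρ : Fin m → ℂ) (A : (Fin m → ℕ) → ℂ) (x : Fin m → ℂ) : ℂ :=
  (∏ k, x k ^ ρ k) * powerSum A x

theorem hasFDerivAt_cpowProd {m : ℕ} (ρ : Fin m → ℂ) {x : Fin m → ℂ}
    (hx : ∀ k, x k ∈ Complex.slitPlane) :
    DifferentiableAt ℂ (fun x : Fin m → ℂ => ∏ k, x k ^ ρ k) x ∧
      ∀ k, x k * pd k (fun x : Fin m → ℂ => ∏ k, x k ^ ρ k) x = ρ k * ∏ i, x i ^ ρ i := by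
  have h := HasFDerivAt.finsetProd (u := Finset.univ) (x := x)
    (g := fun k (x : Fin m → ℂ) => x k ^ ρ k)
    (g' := fun k => (ρ k * x k ^ (ρ k - 1)) •
      ContinuousLinearMap.proj (R := ℂ) (φ := fun _ => ℂ) k)
    (fun k _ => by
      have h := (ContinuousLinearMap.proj (R := ℂ) (φ := fun _ : Fin m => ℂ) k).hasFDerivAt (x := x)
      exact (Complex.hasStrictDerivAt_cpow_const (c := ρ k) (hx k)).hasDerivAt.comp_hasFDerivAt x h)
  refine ⟨h.differentiableAt, fun k => ?_⟩
  rw [pd, h.fderiv, sum_apply, Finset.sum_eq_single k]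
  · rw [← Finset.mul_prod_erase _ (fun i => x i ^ ρ i) (Finset.mem_univ k)]
    have hk : x k ≠ 0 := Complex.slitPlane_ne_zero (hx k)
    simp only [smul_apply, ContinuousLinearMap.proj_apply, Pi.single_eq_same,
      smul_eq_mul, mul_one]
    rw [Complex.cpow_sub _ _ hk, Complex.cpow_one]
    field_simp
  · intro b _ hb
    simp [hb]
  · simp

/-- By the product rule the Euler operator has the eigenvalue `n k + ρ k` on `x ^ ρ x ^ n`. -/
theorem twistedSum_theta {m : ℕ} (ρ : Fin m → ℂ) {A : (Fin m → ℕ) → ℂ} (hA : ConvergesDA A)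
    {x : Fin m → ℂ} (hx : x ∈ cutDomain m) :
    DifferentiableAt ℂ (twistedSum ρ A) x ∧
      ∀ k, x k * pd k (twistedSum ρ A) x = twistedSum ρ (fun n => ((n k : ℂ) + ρ k) * A n) x := by
  obtain ⟨d1, e1⟩ := hasFDerivAt_cpowProd ρ hx.2
  obtain ⟨d2, e2⟩ := hasFDerivAt_powerSum hA hx.1
  refine ⟨d1.mul d2, fun k => ?_⟩
  have h : pd k (twistedSum ρ A) x = (∏ k, x k ^ ρ k) * pd k (powerSum A) x +
      powerSum A x * pd k (fun x : Fin m → ℂ => ∏ k, x k ^ ρ k) x := by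
    have := (d1.hasFDerivAt.mul d2.hasFDerivAt).fderiv
    rw [pd, show twistedSum ρ A = (fun x : Fin m → ℂ => ∏ k, x k ^ ρ k) * powerSum A from rfl, this]
    simp [pd]
  have h3 : powerSum (fun n => ((n k : ℂ) + ρ k) * A n) x =
      powerSum (fun n => (n k : ℂ) * A n) x + ρ k * powerSum A x := by
    simp only [powerSum]
    rw [← tsum_mul_left, ← ((hA.natCast_mul k) x hx.1).tsum_add ((hA x hx.1).mul_left _)]
    exact tsum_congr fun n => by ring
  rw [h, mul_add, mul_left_comm, e2, mul_left_comm (x k), e1, twistedSum, h3]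
  ring

/-- This is `x_k x_i ∂_k ∂_i = θ_k θ_i - δ_{ki} θ_i` on eigenvectors. -/
theorem twistedSum_theta_theta {m : ℕ} (ρ : Fin m → ℂ) {A : (Fin m → ℕ) → ℂ} (hA : ConvergesDA A)
    {x : Fin m → ℂ} (hx : x ∈ cutDomain m) (i k : Fin m) :
    x k * (x i * pd k (pd i (twistedSum ρ A)) x) =
      twistedSum ρ (fun n => ((n k : ℂ) + ρ k - if k = i then 1 else 0) *
        (((n i : ℂ) + ρ i) * A n)) x := by
  have hne : ∀ y ∈ cutDomain m, y i ≠ 0 := fun y hy => Complex.slitPlane_ne_zero (hy.2 i)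
  have hB : ConvergesDA fun n => ((n i : ℂ) + ρ i) * A n := hA.affine_mul i (ρ i)
  obtain ⟨dB, eB⟩ := twistedSum_theta ρ hB hx
  -- Writing `∂_i` as `x_i⁻¹ θ_i` near `x` makes the second derivative a first derivative of `x_i⁻¹`
  -- times a twisted sum.
  have hev : pd i (twistedSum ρ A) =ᶠ[nhds x]
      fun y => (y i)⁻¹ * twistedSum ρ (fun n => ((n i : ℂ) + ρ i) * A n) y := by
    filter_upwards [(isOpen_cutDomain m).mem_nhds hx] with y hy
    rw [← (twistedSum_theta ρ hA hy).2 i, inv_mul_cancel_left₀ (hne y hy)]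
  have hproj := (ContinuousLinearMap.proj (R := ℂ) (φ := fun _ : Fin m => ℂ) i).hasFDerivAt (x := x)
  have hinv := (hasDerivAt_inv (hne x hx)).comp_hasFDerivAt x hproj
  have hd := hinv.mul dB.hasFDerivAt
  have hpd : pd k (pd i (twistedSum ρ A)) x =
      (x i)⁻¹ * pd k (twistedSum ρ (fun n => ((n i : ℂ) + ρ i) * A n)) x +
      twistedSum ρ (fun n => ((n i : ℂ) + ρ i) * A n) x *
        (-(x i ^ 2)⁻¹ * (if k = i then 1 else 0)) := by
    rw [pd, hev.fderiv_eq]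
    have : fderiv ℂ (fun y : Fin m → ℂ =>
        (y i)⁻¹ * twistedSum ρ (fun n => ((n i : ℂ) + ρ i) * A n) y) x = _ := hd.fderiv
    rw [this]
    simp [pd, Pi.single_apply, eq_comm]
  have hsum : twistedSum ρ (fun n => ((n k : ℂ) + ρ k - if k = i then 1 else 0) *
        (((n i : ℂ) + ρ i) * A n)) x =
      twistedSum ρ (fun n => ((n k : ℂ) + ρ k) * (((n i : ℂ) + ρ i) * A n)) x -
      (if k = i then 1 else 0) * twistedSum ρ (fun n => ((n i : ℂ) + ρ i) * A n) x := by
    simp only [twistedSum, powerSum]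
    rw [mul_left_comm, ← mul_sub]
    congr 1
    rw [← tsum_mul_left, ← ((hB.affine_mul k (ρ k)) x hx.1).tsum_sub ((hB x hx.1).mul_left _)]
    exact tsum_congr fun n => by ring
  rw [hpd, hsum, ← eB k]
  have := hne x hx
  by_cases hki : k = i
  · subst hki
    simp only [if_true]
    field_simp
    ring
  · simp only [hki, if_false]
    field_simp
    ring

/-- Multiplication by `x k` shifts the coefficients one step in the direction `k`; by `h0` the
coefficients `B` live on the image of this shift. -/
theorem mul_twistedSum_shift {m : ℕ} (ρ : Fin m → ℂ) {A B : (Fin m → ℕ) → ℂ} (k : Fin m)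
    (x : Fin m → ℂ)
    (h0 : ∀ n : Fin m → ℕ, n k = 0 → B n = 0)
    (h1 : ∀ n : Fin m → ℕ, B (Function.update n k (n k + 1)) = A n) :
    x k * twistedSum ρ A x = twistedSum ρ B x := by
  have hinj : Function.Injective fun n : Fin m → ℕ => Function.update n k (n k + 1) := by
    intro n n' h
    funext i
    have := congrFun h i
    by_cases hi : i = k
    · subst hi; simpa using this
    · simpa [hi] using this
  simp only [twistedSum, powerSum]
  rw [mul_left_comm, ← tsum_mul_left]
  congr 1
  rw [← hinj.tsum_eq (f := fun n => B n * ∏ k, x k ^ n k)]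
  · refine tsum_congr fun n => ?_
    rw [h1, ← Finset.mul_prod_erase _ _ (Finset.mem_univ k),
      ← Finset.mul_prod_erase _ (fun i => x i ^ Function.update n k (n k + 1) i)
        (Finset.mem_univ k), Finset.prod_congr rfl (s₁ := Finset.univ.erase k)
        (f := fun i => x i ^ Function.update n k (n k + 1) i) (g := fun i => x i ^ n i)
        fun i hi => by rw [Function.update_of_ne (Finset.ne_of_mem_erase hi)]]
    simp only [Function.update_self]
    ring
  · intro n hn
    have hk : n k ≠ 0 := fun h => hn (by simp [h0 n h])
    refine ⟨Function.update n k (n k - 1), ?_⟩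
    funext i
    by_cases hi : i = k
    · subst hi; simp; omega
    · simp [hi]

theorem hasSum_twistedSum {m : ℕ} (ρ : Fin m → ℂ) {A : (Fin m → ℕ) → ℂ} (hA : ConvergesDA A)
    {x : Fin m → ℂ} (hx : x ∈ domainDA m) :
    HasSum (fun n => A n * ((∏ k, x k ^ ρ k) * ∏ k, x k ^ n k)) (twistedSum ρ A x) :=
  hasSum_of_eq ((hA x hx).hasSum.mul_left (∏ k, x k ^ ρ k)) fun n => by ring

theorem twistedSum_eq_of_hasSum {m : ℕ} {ρ : Fin m → ℂ} {A : (Fin m → ℕ) → ℂ} {x : Fin m → ℂ} {s : ℂ}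
    (h : HasSum (fun n => A n * ((∏ k, x k ^ ρ k) * ∏ k, x k ^ n k)) s) :
    twistedSum ρ A x = s := by
  rw [← h.tsum_eq, twistedSum, powerSum, ← tsum_mul_left]
  exact tsum_congr fun n => by ring

/-- After multiplication by `x_k` the equation reads `θ_k (θ_k - 1 + c_k) f = x_k (∑ θ_i + a) (θ_k +
b_k) f`. Both sides are diagonal up to the shift by `x_k`, so the equation is a recurrence together
with the vanishing of the terms with `n k = 0`. -/
theorem isSolutionEA_twistedSum {m : ℕ} (a : ℂ) (b c ρ : Fin m → ℂ) {A : (Fin m → ℕ) → ℂ}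
    (hA : ConvergesDA A) (hρ : ∀ k, ρ k * (ρ k - 1 + c k) = 0)
    (hrec : ∀ k n, ((n k : ℂ) + 1 + ρ k) * ((n k : ℂ) + ρ k + c k) *
      A (Function.update n k (n k + 1)) =
      (∑ i, ((n i : ℂ) + ρ i) + a) * ((n k : ℂ) + ρ k + b k) * A n) :
    IsSolutionEA a b c (cutDomain m) (twistedSum ρ A) := by
  refine ⟨fun x hx => (twistedSum_theta ρ hA hx).1.differentiableWithinAt, fun k x hx => ?_⟩
  have hk : x k ≠ 0 := Complex.slitPlane_ne_zero (hx.2 k)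
  have hY : ∀ i, HasSum (fun n => ((n i : ℂ) + ρ i) * A n *
      ((∏ k, x k ^ ρ k) * ∏ k, x k ^ n k)) (x i * pd i (twistedSum ρ A) x) := fun i => by
    rw [(twistedSum_theta ρ hA hx).2 i]
    exact hasSum_twistedSum ρ (hA.affine_mul i (ρ i)) hx.1
  have hX : ∀ i, HasSum (fun n => ((n k : ℂ) + ρ k - if k = i then 1 else 0) *
      (((n i : ℂ) + ρ i) * A n) * ((∏ k, x k ^ ρ k) * ∏ k, x k ^ n k))
      (x k * (x i * pd k (pd i (twistedSum ρ A)) x)) := fun i => by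
    rw [twistedSum_theta_theta ρ hA hx]
    simp only [add_sub_assoc]
    exact hasSum_twistedSum ρ ((hA.affine_mul i (ρ i)).affine_mul k _) hx.1
  have hf := hasSum_twistedSum ρ hA hx.1
  set mon : (Fin m → ℕ) → ℂ := fun n => (∏ k, x k ^ ρ k) * ∏ k, x k ^ n k
  -- The part of the equation that carries a further factor `x_k`: its coefficients are those of `(∑
  -- θ_i + a) (θ_k + b_k) f`.
  have hC := twistedSum_eq_of_hasSum (A := fun n : Fin m → ℕ =>
      (∑ i, ((n i : ℂ) + ρ i) + a) * ((n k : ℂ) + ρ k + b k) * A n) <|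
    hasSum_of_eq (((((hX k).add (hasSum_sum fun i (_ : i ∈ Finset.univ.erase k) => hX i)).add
      ((hY k).mul_left (a + b k + 1))).add
      ((hasSum_sum fun i (_ : i ∈ Finset.univ.erase k) => hY i).mul_left (b k))).add
      (hf.mul_left (a * b k))) fun n => by
    have e1 : ∑ i ∈ Finset.univ.erase k, ((n k : ℂ) + ρ k - if k = i then 1 else 0) *
        (((n i : ℂ) + ρ i) * A n) * mon n =
        ((n k : ℂ) + ρ k) * A n * mon n * ∑ i ∈ Finset.univ.erase k, ((n i : ℂ) + ρ i) := by
      rw [Finset.mul_sum]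
      refine Finset.sum_congr rfl fun i hi => ?_
      rw [if_neg (Finset.ne_of_mem_erase hi).symm]
      ring
    have e2 : ∑ i ∈ Finset.univ.erase k, ((n i : ℂ) + ρ i) * A n * mon n =
        A n * mon n * ∑ i ∈ Finset.univ.erase k, ((n i : ℂ) + ρ i) := by
      rw [Finset.mul_sum]
      exact Finset.sum_congr rfl fun i _ => by ring
    rw [e1, e2, ← Finset.add_sum_erase _ _ (Finset.mem_univ k), if_pos rfl]
    change _ * mon n = _
    ring
  -- The other part, `θ_k (θ_k - 1 + c_k) f`.
  have hD := twistedSum_eq_of_hasSum (A := fun n : Fin m → ℕ =>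
      ((n k : ℂ) + ρ k) * ((n k : ℂ) + ρ k - 1 + c k) * A n) <|
    hasSum_of_eq ((hX k).add ((hY k).mul_left (c k))) fun n => by
    rw [if_pos rfl]
    change _ * mon n = _
    ring
  have hshift := mul_twistedSum_shift ρ (A := fun n : Fin m → ℕ =>
      (∑ i, ((n i : ℂ) + ρ i) + a) * ((n k : ℂ) + ρ k + b k) * A n)
    (B := fun n : Fin m → ℕ => ((n k : ℂ) + ρ k) * ((n k : ℂ) + ρ k - 1 + c k) * A n) k x
    -- At `n k = 0` the coefficient vanishes by the indicial equation; otherwise it is the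
    -- recurrence.
    (fun n hn => by simp [hn, hρ k]) (fun n => by
      rw [← hrec k n]
      simp only [Function.update_self]
      push_cast
      ring)
  rw [hC, hD] at hshift
  refine mul_left_cancel₀ hk ?_
  simp only [← Finset.mul_sum] at hshift
  linear_combination -hshift

/-- The coefficients of Lauricella's series. -/
def lauricellaCoeff {m : ℕ} (a : ℂ) (b c : Fin m → ℂ) (n : Fin m → ℕ) : ℂ :=
  poch a (∑ k, n k) * (∏ k, poch (b k) (n k)) /
    ((∏ k, poch (c k) (n k)) * ∏ k, ((n k).factorial : ℂ))

theorem lauricellaCoeff_update {m : ℕ} (a : ℂ) (b c : Fin m → ℂ) (hc : ∀ k (n : ℤ), c k ≠ n)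
    (k : Fin m) (n : Fin m → ℕ) :
    ((n k : ℂ) + 1) * (c k + n k) * lauricellaCoeff a b c (Function.update n k (n k + 1)) =
      (a + ∑ i, (n i : ℂ)) * (b k + n k) * lauricellaCoeff a b c n := by
  have hsum : ∑ i, Function.update n k (n k + 1) i = ∑ i, n i + 1 := by
    rw [← Finset.add_sum_erase _ _ (Finset.mem_univ k),
      ← Finset.add_sum_erase _ n (Finset.mem_univ k),
      Finset.sum_congr rfl (s₁ := Finset.univ.erase k) (g := n)
        fun i hi => by rw [Function.update_of_ne (Finset.ne_of_mem_erase hi)]]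
    simp only [Function.update_self]
    ring
  have hprod : ∀ f : Fin m → ℕ → ℂ, ∏ i, f i (Function.update n k (n k + 1) i) =
      f k (n k + 1) * ∏ i ∈ Finset.univ.erase k, f i (n i) := fun f => by
    rw [← Finset.mul_prod_erase _ _ (Finset.mem_univ k),
      Finset.prod_congr rfl (s₁ := Finset.univ.erase k) (g := fun i => f i (n i))
        fun i hi => by rw [Function.update_of_ne (Finset.ne_of_mem_erase hi)]]
    simp only [Function.update_self]
  have hprod' : ∀ f : Fin m → ℕ → ℂ, ∏ i, f i (n i) =
      f k (n k) * ∏ i ∈ Finset.univ.erase k, f i (n i) := fun f =>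
    (Finset.mul_prod_erase _ _ (Finset.mem_univ k)).symm
  have hcn : c k + n k ≠ 0 := fun h => hc k (-n k) (by
    push_cast; exact eq_neg_of_add_eq_zero_left h)
  have h1 : (n k : ℂ) + 1 ≠ 0 := by exact_mod_cast Nat.succ_ne_zero (n k)
  simp only [lauricellaCoeff]
  rw [hsum, hprod fun i => poch (b i), hprod fun i => poch (c i),
    hprod fun _ j => (j.factorial : ℂ), hprod' fun i => poch (b i), hprod' fun i => poch (c i),
    hprod' fun _ j => (j.factorial : ℂ), poch_succ, poch_succ, poch_succ, Nat.factorial_succ]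
  have h2 : ∏ i ∈ Finset.univ.erase k, poch (c i) (n i) ≠ 0 :=
    Finset.prod_ne_zero_iff.2 fun i _ => poch_ne_zero (hc i) _
  have h3 : ∏ i ∈ Finset.univ.erase k, ((n i).factorial : ℂ) ≠ 0 :=
    Finset.prod_ne_zero_iff.2 fun i _ => by exact_mod_cast Nat.factorial_ne_zero _
  have h4 := poch_ne_zero (hc k) (n k)
  have h5 : ((n k).factorial : ℂ) ≠ 0 := by exact_mod_cast Nat.factorial_ne_zero _
  push_cast
  field_simp

/-! ### The parameters of `f_I`, and `f_I` as a solution. -/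

section parameters

variable {m : ℕ} {a : ℂ} {b c : Fin m → ℂ} {I : Finset (Fin m)}

theorem bI_ne_intCast (hb : ∀ k (n : ℤ), b k ≠ n) (hcb : ∀ k (n : ℤ), c k - b k ≠ n) (k : Fin m)
    (n : ℤ) : bI b c I k ≠ n := by
  rw [bI]
  split_ifs with hk
  · intro h
    exact hcb k (1 - n) (by push_cast; rw [← h]; ring)
  · exact hb k n

theorem cI_ne_intCast (hc : ∀ k (n : ℤ), c k ≠ n) (k : Fin m) (n : ℤ) : cI c I k ≠ n := by
  rw [cI]
  split_ifs with hk
  · intro h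
    exact hc k (2 - n) (by push_cast; rw [← h]; ring)
  · exact hc k n

theorem summable_localSolution (hb : ∀ k (n : ℤ), b k ≠ n) (hc : ∀ k (n : ℤ), c k ≠ n)
    (hcb : ∀ k (n : ℤ), c k - b k ≠ n) {x : Fin m → ℂ} (hx : x ∈ domainDA m) :
    Summable (lauricellaTerm (aI a c I) (bI b c I) (cI c I) x) :=
  summable_lauricellaTerm _ _ _ (bI_ne_intCast hb hcb) (cI_ne_intCast hc) hx

/-- The set `I` selects for every `k` one of the two roots `1 - c k` and `0` of the indicial
equation. -/
theorem localSolution_eq_twistedSum : localSolution a b c I =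
    twistedSum (fun k => if k ∈ I then 1 - c k else 0)
      (lauricellaCoeff (aI a c I) (bI b c I) (cI c I)) := by
  funext x
  rw [localSolution, twistedSum]
  congr 1
  rw [← Finset.prod_subset (Finset.subset_univ I) (fun k _ hk => by simp [hk])]
  exact Finset.prod_congr rfl fun k hk => by rw [if_pos hk]

/-- Shifting the Euler operators by `ρ` changes `a`, `b`, `c` into `aI`, `bI`, `cI`, so the required
recurrence is that of Lauricella's coefficients with these parameters. -/
theorem isSolutionEA_localSolution (hb : ∀ k (n : ℤ), b k ≠ n) (hc : ∀ k (n : ℤ), c k ≠ n)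
    (hcb : ∀ k (n : ℤ), c k - b k ≠ n) :
    IsSolutionEA a b c (cutDomain m) (localSolution a b c I) := by
  rw [localSolution_eq_twistedSum]
  refine isSolutionEA_twistedSum a b c _ (fun x hx => summable_localSolution hb hc hcb hx)
    (fun k => by split_ifs <;> ring) fun k n => ?_
  have h := lauricellaCoeff_update (aI a c I) (bI b c I) (cI c I) (cI_ne_intCast hc) k n
  have hs : ∑ i, ((n i : ℂ) + if i ∈ I then 1 - c i else 0) + a =
      aI a c I + ∑ i, (n i : ℂ) := by
    rw [Finset.sum_add_distrib, Finset.sum_ite_mem, Finset.univ_inter, Finset.sum_sub_distrib, aI]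
    simp
    ring
  rw [hs]
  by_cases hk : k ∈ I
  · simp only [hk, if_true, bI, cI] at h ⊢
    linear_combination h
  · simp only [hk, if_false, bI, cI] at h ⊢
    linear_combination h

theorem gammaFactor_ne_zero (hb : ∀ k (n : ℤ), b k ≠ n) (hc : ∀ k (n : ℤ), c k ≠ n)
    (hcb : ∀ k (n : ℤ), c k - b k ≠ n) (ha : ∀ (K : Finset (Fin m)) (n : ℤ), a - ∑ p ∈ K, c p ≠ n) :
    gammaFactor a b c I ≠ 0 := by
  have key : ∀ z : ℂ, (∀ n : ℤ, z ≠ n) → Complex.Gamma z ≠ 0 := fun z hz =>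
    Complex.Gamma_ne_zero fun n => by simpa using hz (-n)
  refine mul_ne_zero (mul_ne_zero ?_ ?_) (div_ne_zero ?_ ?_)
  · exact Finset.prod_ne_zero_iff.2 fun p _ => key _ fun n h =>
      hc p (n + 1) (by push_cast; rw [← h]; ring)
  · exact Finset.prod_ne_zero_iff.2 fun q _ =>
      div_ne_zero (mul_ne_zero (key _ (hb q)) (key _ (hcb q))) (key _ (hc q))
  -- The two gamma factors involving `a` use the nonresonance condition for the empty set and for
  -- `I`.
  · exact key _ fun n h => ha ∅ (1 - n) (by push_cast; rw [← h]; simp)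
  · exact key _ fun n h => ha I (1 - I.card - n) (by push_cast; rw [← h]; ring)

theorem phaseFactor_ne_zero : phaseFactor b c I ≠ 0 := Complex.exp_ne_zero _

end parameters

/-! ### Geometry of the cells -/

theorem circ_zero (ρ : ℝ) : circ ρ 0 = ρ := by simp [circ]

theorem circ_one (ρ : ℝ) : circ ρ 1 = ρ := by simp [circ, Complex.exp_two_pi_mul_I]

theorem logCirc_zero (ρ : ℝ) : logCirc ρ 0 = (Real.log ρ : ℂ) := by simp [logCirc]

theorem logCirc_one (ρ : ℝ) : logCirc ρ 1 = logCirc ρ 0 + 2 * Real.pi * Complex.I := by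
  simp [logCirc]

theorem exp_logCirc {ρ : ℝ} (hρ : 0 < ρ) (θ : ℝ) : Complex.exp (logCirc ρ θ) = circ ρ θ := by
  rw [logCirc, Complex.exp_add, ← Complex.ofReal_exp, Real.exp_log hρ, circ]

theorem norm_circ {ρ : ℝ} (hρ : 0 < ρ) (θ : ℝ) : ‖circ ρ θ‖ = ρ := by
  rw [circ, norm_mul, Complex.norm_real, Real.norm_of_nonneg hρ.le,
    show 2 * (Real.pi : ℂ) * Complex.I * (θ : ℂ) = ((2 * Real.pi * θ : ℝ) : ℂ) * Complex.I by
      push_cast; ring, Complex.norm_exp_ofReal_mul_I, mul_one]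

theorem re_circ_le {ρ : ℝ} (hρ : 0 < ρ) (θ : ℝ) : (circ ρ θ).re ≤ ρ :=
  (Complex.re_le_norm _).trans (norm_circ hρ θ).le

/-- The conditions on the radii of the circles of a regularized cycle. -/
structure AdmissibleRadii {m : ℕ} (ε : ℝ) (εs : Fin m → ℝ) : Prop where
  pos_last : 0 < ε
  pos : ∀ k, 0 < εs k
  lt_quarter : ∀ k, εs k < 1 / 4
  sum_lt : ε < 1 - ∑ k, εs k

section cells

variable {m : ℕ} {I : Finset (Fin m)} {ε : ℝ} {εs : Fin m → ℝ} {J : Finset (Factor m)}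

theorem AdmissibleRadii.sum_I_lt (h : AdmissibleRadii ε εs) (I : Finset (Fin m)) :
    ε + ∑ p ∈ I, εs p < 1 := by
  have h1 : ∑ p ∈ I, εs p ≤ ∑ p, εs p :=
    Finset.sum_le_sum_of_subset_of_nonneg (Finset.subset_univ _) fun k _ _ => (h.pos k).le
  linarith [h.sum_lt]

theorem mem_free {p : Fin m} : p ∈ free I J ↔ p ∈ I ∧ atZero p ∉ J := Finset.mem_filter

theorem IsTop.eq {p q : Fin m} (hp : IsTop I J p) (hq : IsTop I J q) : p = q :=
  le_antisymm (hq.2 p hp.1) (hp.2 q hq.1)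

theorem IsTop.topCoord_eq {t : Fin m} (ht : IsTop I J t) (y : Fin m → ℝ) :
    topCoord I J y = y t := by
  classical
  rw [topCoord, Finset.sum_eq_single t]
  · intro b hb hbt
    exact absurd ((Finset.mem_filter.1 hb).2.eq ht) hbt
  · intro h
    exact absurd (Finset.mem_filter.2 ⟨Finset.mem_univ t, ht⟩) h

theorem exists_isTop (h : (free I J).Nonempty) : ∃ t, IsTop I J t :=
  ⟨(free I J).max' h, Finset.max'_mem _ h, fun p hp => Finset.le_max' _ p hp⟩

/-- Not all facets of a simplex meet, so `last ∈ J` leaves a free index, and the largest one can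
give up its coordinate to the angle of the last circle. -/
theorem IsFaceSet.exists_isTop (hJ : IsFaceSet I J) (h : last ∈ J) : ∃ t, IsTop I J t := by
  obtain ⟨-, -, h3⟩ := hJ
  have : ∃ p ∈ I, atZero p ∉ J := by
    by_contra hcon
    push Not at hcon
    exact h3 ⟨h, hcon⟩
  obtain ⟨p, hp, hpJ⟩ := this
  exact LauricellaFA.exists_isTop ⟨p, mem_free.2 ⟨hp, hpJ⟩⟩

theorem IsFaceSet.of_subset {J' : Finset (Factor m)} (hJ : IsFaceSet I J) (h : J' ⊆ J) :
    IsFaceSet I J' :=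
  ⟨fun p hp hm => hJ.1 p hp (h hm), fun q hq hm => hJ.2.1 q hq ⟨h hm.1, h hm.2⟩,
    fun hm => hJ.2.2 ⟨h hm.1, fun p hp => h (hm.2 p hp)⟩⟩

theorem stick_of_last_notMem (h : last ∉ J) (y : Fin m → ℝ) (p : Fin m) :
    stick I J y p = y p * ∏ p' ∈ (free I J).filter (· < p), (1 - y p') := by
  rw [stick, if_neg fun hm => h hm.1]

/-- Omitting the factor `y t` amounts to `y t = 1`, so the case `last ∈ J` is ordinary stick
breaking in which nothing is left over. -/
theorem stick_of_isTop {t : Fin m} (h : last ∈ J) (ht : IsTop I J t) (y : Fin m → ℝ) {p : Fin m}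
    (hp : p ∈ free I J) : stick I J y p = Function.update y t 1 p *
      ∏ p' ∈ (free I J).filter (· < p), (1 - Function.update y t 1 p') := by
  have hprod : ∏ p' ∈ (free I J).filter (· < p), (1 - Function.update y t 1 p') =
      ∏ p' ∈ (free I J).filter (· < p), (1 - y p') := by
    refine Finset.prod_congr rfl fun p' hp' => ?_
    rw [Function.update_of_ne]
    rintro rfl
    exact absurd (ht.2 p hp) (not_le.2 (Finset.mem_filter.1 hp').2)
  rw [stick, hprod]
  by_cases hpt : p = t
  · subst hpt
    rw [if_pos ⟨h, ht⟩, Function.update_self]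
  · rw [if_neg fun hm => hpt (hm.2.eq ht), Function.update_of_ne hpt]

theorem sum_stick_of_last_notMem (h : last ∉ J) (y : Fin m → ℝ) :
    ∑ p ∈ free I J, stick I J y p = 1 - ∏ p ∈ free I J, (1 - y p) := by
  rw [Finset.prod_one_sub_ordered, sub_sub_cancel]
  exact Finset.sum_congr rfl fun p _ => stick_of_last_notMem h y p

theorem sum_stick_of_isTop {t : Fin m} (h : last ∈ J) (ht : IsTop I J t) (y : Fin m → ℝ) :
    ∑ p ∈ free I J, stick I J y p = 1 := by
  have h0 := Finset.prod_one_sub_ordered (free I J) (Function.update y t 1)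
  rw [Finset.prod_eq_zero ht.1 (by simp)] at h0
  rw [Finset.sum_congr rfl fun p hp => stick_of_isTop h ht y hp]
  linarith

theorem stick_nonneg {y : Fin m → ℝ} (hy : y ∈ unitCube m) (p : Fin m) : 0 ≤ stick I J y p := by
  rw [stick]
  refine mul_nonneg ?_ (Finset.prod_nonneg fun p' _ => sub_nonneg.2 (hy.2 p'))
  split_ifs
  · exact zero_le_one
  · exact hy.1 p

theorem cellMap_of_atZero_mem {k : Fin m} (h : atZero k ∈ J) (y : Fin m → ℝ) :
    cellMap I ε εs J y k = circ (εs k) (y k) := by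
  simp [cellMap, h]

theorem cellMap_of_mem_free {p : Fin m} (h : p ∈ free I J) (y : Fin m → ℝ) :
    cellMap I ε εs J y p = (εs p : ℂ) + (stick I J y p : ℂ) * margin I ε εs J y := by
  rw [mem_free] at h
  simp [cellMap, h]

theorem cellMap_of_atOne_mem {q : Fin m} (hJ : IsFaceSet I J) (h : atOne q ∈ J) (y : Fin m → ℝ) :
    cellMap I ε εs J y q = 1 - circ (εs q) (y q) := by
  have hq : q ∉ I := fun hq => hJ.1 q hq h
  have h0 : atZero q ∉ J := fun h0 => hJ.2.1 q hq ⟨h0, h⟩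
  rw [cellMap, if_neg hq, if_neg h0, if_pos h]

theorem cellMap_of_notMem {q : Fin m} (hq : q ∉ I) (h0 : atZero q ∉ J) (h1 : atOne q ∉ J)
    (y : Fin m → ℝ) :
    cellMap I ε εs J y q = (εs q : ℂ) + (1 - 2 * (εs q : ℂ)) * (y q : ℂ) := by
  rw [cellMap, if_neg hq, if_neg h0, if_neg h1]

/-- The margin is by definition what remains of the total `1` after the radii have been corrected by
the circles; the last barycentric coordinate receives the part of it that the sticks leave. -/
theorem sum_cellMap (y : Fin m → ℝ) : ∑ p ∈ I, cellMap I ε εs J y p =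
    1 - (ε : ℂ) + (if last ∈ J then (ε : ℂ) - circ ε (topCoord I J y) else 0) +
      ((∑ p ∈ free I J, (stick I J y p : ℂ)) - 1) * margin I ε εs J y := by
  have h1 : ∑ p ∈ I, cellMap I ε εs J y p = ∑ p ∈ I, ((εs p : ℂ) -
      (if atZero p ∈ J then (εs p : ℂ) - circ (εs p) (y p) else 0)) +
      ∑ p ∈ free I J, (stick I J y p : ℂ) * margin I ε εs J y := by
    rw [free, Finset.sum_filter, ← Finset.sum_add_distrib]
    refine Finset.sum_congr rfl fun p hp => ?_
    by_cases h : atZero p ∈ J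
    · rw [cellMap_of_atZero_mem h, if_pos h, if_neg (not_not.2 h)]
      ring
    · rw [cellMap_of_mem_free (mem_free.2 ⟨hp, h⟩), if_neg h, if_pos h]
      ring
  rw [h1, ← Finset.sum_mul, sub_mul, one_mul, Finset.sum_sub_distrib]
  conv_rhs => rw [margin]
  conv_lhs => rw [margin]
  ring

theorem one_sub_sum_cellMap_of_last_mem (hJ : IsFaceSet I J) (h : last ∈ J) (y : Fin m → ℝ) :
    1 - ∑ p ∈ I, cellMap I ε εs J y p = circ ε (topCoord I J y) := by
  obtain ⟨t, ht⟩ := hJ.exists_isTop h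
  rw [sum_cellMap, if_pos h, ← Complex.ofReal_sum, sum_stick_of_isTop h ht]
  push_cast
  ring

theorem one_sub_sum_cellMap_of_last_notMem (h : last ∉ J) (y : Fin m → ℝ) :
    1 - ∑ p ∈ I, cellMap I ε εs J y p =
      ε + ((∏ p ∈ free I J, (1 - y p) : ℝ) : ℂ) * margin I ε εs J y := by
  rw [sum_cellMap, if_neg h, ← Complex.ofReal_sum, sum_stick_of_last_notMem h]
  push_cast
  ring

/-- Moving along a circle of radius `ρ` changes the margin by `ρ - circ ρ θ`, whose real part is
nonnegative; at the starting points the margin is positive because the radii add up to less than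
`1`. -/
theorem margin_re_pos (hε : AdmissibleRadii ε εs) (y : Fin m → ℝ) :
    0 < (margin I ε εs J y).re := by
  have h1 : 0 ≤ (∑ p ∈ I, if atZero p ∈ J then (εs p : ℂ) - circ (εs p) (y p) else 0).re := by
    rw [Complex.re_sum]
    refine Finset.sum_nonneg fun p _ => ?_
    split_ifs
    · simpa using re_circ_le (hε.pos p) (y p)
    · simp
  have h2 : 0 ≤ (if last ∈ J then (ε : ℂ) - circ ε (topCoord I J y) else 0).re := by
    split_ifs
    · simpa using re_circ_le hε.pos_last (topCoord I J y)
    · simp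
  have h3 := hε.sum_I_lt I
  rw [margin, Complex.add_re, Complex.add_re, Complex.sub_re, ← Complex.ofReal_sum,
    ← Complex.ofReal_add, Complex.ofReal_re, Complex.one_re]
  linarith

theorem le_re_cellMap_of_mem_free (hε : AdmissibleRadii ε εs) {y : Fin m → ℝ}
    (hy : y ∈ unitCube m) {p : Fin m} (hp : p ∈ free I J) :
    εs p ≤ (cellMap I ε εs J y p).re := by
  rw [cellMap_of_mem_free hp, Complex.add_re, Complex.re_ofReal_mul, Complex.ofReal_re]
  have := mul_nonneg (stick_nonneg (I := I) (J := J) hy p)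
    (margin_re_pos (I := I) (J := J) hε y).le
  linarith

theorem le_re_last (hε : AdmissibleRadii ε εs) {y : Fin m → ℝ} (hy : y ∈ unitCube m)
    (h : last ∉ J) : ε ≤ (1 - ∑ p ∈ I, cellMap I ε εs J y p).re := by
  rw [one_sub_sum_cellMap_of_last_notMem h, Complex.add_re, Complex.re_ofReal_mul,
    Complex.ofReal_re]
  have h1 : 0 ≤ ∏ p ∈ free I J, (1 - y p) :=
    Finset.prod_nonneg fun p' _ => sub_nonneg.2 (hy.2 p')
  have := mul_nonneg h1 (margin_re_pos (I := I) (J := J) hε y).le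
  linarith

/-- On the last circle this is its radius, elsewhere the real part is at least `ε`; it keeps the
denominators of the expansion in `x` away from `0`. -/
theorem le_norm_last (hε : AdmissibleRadii ε εs) (hJ : IsFaceSet I J) {y : Fin m → ℝ}
    (hy : y ∈ unitCube m) : ε ≤ ‖1 - ∑ p ∈ I, cellMap I ε εs J y p‖ := by
  by_cases h : last ∈ J
  · rw [one_sub_sum_cellMap_of_last_mem hJ h, norm_circ hε.pos_last]
  · exact (le_re_last hε hy h).trans (Complex.re_le_norm _)

theorem le_norm_cellMap (hε : AdmissibleRadii ε εs) {y : Fin m → ℝ} (hy : y ∈ unitCube m)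
    {p : Fin m} (hp : p ∈ I) : εs p ≤ ‖cellMap I ε εs J y p‖ := by
  by_cases h : atZero p ∈ J
  · rw [cellMap_of_atZero_mem h, norm_circ (hε.pos p)]
  · exact (le_re_cellMap_of_mem_free hε hy (mem_free.2 ⟨hp, h⟩)).trans (Complex.re_le_norm _)

/-- The circle about `1` forces the bound `1 + εs q`; this is the origin of the factors `1 + εs k`
in the smallness condition on `x`. -/
theorem norm_cellMap_le (hε : AdmissibleRadii ε εs) (hJ : IsFaceSet I J) {y : Fin m → ℝ}
    (hy : y ∈ unitCube m) {q : Fin m} (hq : q ∉ I) : ‖cellMap I ε εs J y q‖ ≤ 1 + εs q := by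
  have hpos := hε.pos q
  have hlt := hε.lt_quarter q
  by_cases h0 : atZero q ∈ J
  · rw [cellMap_of_atZero_mem h0, norm_circ hpos]
    linarith
  · by_cases h1 : atOne q ∈ J
    · rw [cellMap_of_atOne_mem hJ h1]
      refine (norm_sub_le _ _).trans ?_
      rw [norm_circ hpos, norm_one]
    · rw [cellMap_of_notMem hq h0 h1]
      have : (εs q : ℂ) + (1 - 2 * (εs q : ℂ)) * (y q : ℂ) =
          ((εs q + (1 - 2 * εs q) * y q : ℝ) : ℂ) := by push_cast; ring
      have h2 := hy.1 q
      have h3 := hy.2 q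
      simp only [Pi.zero_apply, Pi.one_apply] at h2 h3
      rw [this, Complex.norm_real, Real.norm_of_nonneg (by nlinarith)]
      nlinarith

theorem re_cellMap_pos_of_notMem (hε : AdmissibleRadii ε εs) (hJ : IsFaceSet I J)
    {y : Fin m → ℝ} (hy : y ∈ unitCube m) {q : Fin m} (hq : q ∉ I) (h0 : atZero q ∉ J) :
    0 < (cellMap I ε εs J y q).re := by
  have hpos := hε.pos q
  have hlt := hε.lt_quarter q
  by_cases h1 : atOne q ∈ J
  · rw [cellMap_of_atOne_mem hJ h1, Complex.sub_re, Complex.one_re]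
    linarith [re_circ_le hpos (y q)]
  · rw [cellMap_of_notMem hq h0 h1]
    have : (εs q : ℂ) + (1 - 2 * (εs q : ℂ)) * (y q : ℂ) =
        ((εs q + (1 - 2 * εs q) * y q : ℝ) : ℂ) := by push_cast; ring
    have h2 := hy.1 q
    simp only [Pi.zero_apply] at h2
    rw [this, Complex.ofReal_re]
    nlinarith

theorem re_one_sub_cellMap_pos_of_notMem (hε : AdmissibleRadii ε εs)
    {y : Fin m → ℝ} (hy : y ∈ unitCube m) {q : Fin m} (hq : q ∉ I) (h1 : atOne q ∉ J) :
    0 < (1 - cellMap I ε εs J y q).re := by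
  have hpos := hε.pos q
  have hlt := hε.lt_quarter q
  by_cases h0 : atZero q ∈ J
  · rw [cellMap_of_atZero_mem h0, Complex.sub_re, Complex.one_re]
    linarith [re_circ_le hpos (y q)]
  · rw [cellMap_of_notMem hq h0 h1]
    have : 1 - ((εs q : ℂ) + (1 - 2 * (εs q : ℂ)) * (y q : ℂ)) =
        ((1 - (εs q + (1 - 2 * εs q) * y q) : ℝ) : ℂ) := by push_cast; ring
    have h3 := hy.2 q
    simp only [Pi.one_apply] at h3
    rw [this, Complex.ofReal_re]
    nlinarith

theorem contDiff_circ_apply (ρ : ℝ) (k : Fin m) : ContDiff ℝ ∞ fun y : Fin m → ℝ => circ ρ (y k) := by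
  unfold circ
  have : ContDiff ℝ ∞ fun y : Fin m → ℝ => (y k : ℂ) :=
    Complex.ofRealCLM.contDiff.comp (contDiff_apply ℝ ℝ k)
  fun_prop

theorem contDiff_topCoord : ContDiff ℝ ∞ fun y : Fin m → ℝ => topCoord I J y := by
  unfold topCoord
  exact ContDiff.sum fun k _ => contDiff_apply ℝ ℝ k

theorem contDiff_margin : ContDiff ℝ ∞ fun y : Fin m → ℝ => margin I ε εs J y := by
  unfold margin
  refine (contDiff_const.add (ContDiff.sum fun p _ => ?_)).add ?_
  · split_ifs
    · exact contDiff_const.sub (contDiff_circ_apply _ p)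
    · exact contDiff_const
  · split_ifs
    · refine contDiff_const.sub ?_
      unfold circ
      have : ContDiff ℝ ∞ fun y : Fin m → ℝ => (topCoord I J y : ℂ) :=
        Complex.ofRealCLM.contDiff.comp contDiff_topCoord
      fun_prop
    · exact contDiff_const

theorem contDiff_stick (p : Fin m) : ContDiff ℝ ∞ fun y : Fin m → ℝ => stick I J y p := by
  unfold stick
  refine ContDiff.mul ?_ (contDiff_prod fun p' _ => contDiff_const.sub (contDiff_apply ℝ ℝ p'))
  split_ifs
  · exact contDiff_const
  · exact contDiff_apply ℝ ℝ p

theorem contDiff_cellMap : ContDiff ℝ ∞ (cellMap I ε εs J) := by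
  refine contDiff_pi.2 fun k => ?_
  have hk : ContDiff ℝ ∞ fun y : Fin m → ℝ => (y k : ℂ) :=
    Complex.ofRealCLM.contDiff.comp (contDiff_apply ℝ ℝ k)
  have hs : ContDiff ℝ ∞ fun y : Fin m → ℝ => (stick I J y k : ℂ) :=
    Complex.ofRealCLM.contDiff.comp (contDiff_stick k)
  have hm := contDiff_margin (I := I) (J := J) (ε := ε) (εs := εs)
  have hc := contDiff_circ_apply (εs k) k
  unfold cellMap
  split_ifs <;> fun_prop

theorem continuous_cellMap_apply (k : Fin m) : Continuous fun y => cellMap I ε εs J y k :=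
  (continuous_apply k).comp contDiff_cellMap.continuous

theorem continuous_logCirc (ρ : ℝ) : Continuous (logCirc ρ) := by
  unfold logCirc
  fun_prop

/-- The conditions on the variables `x`. -/
structure AdmissiblePoint {m : ℕ} (ε : ℝ) (εs x : Fin m → ℝ) : Prop where
  pos : ∀ k, 0 < x k
  lt : ∀ k, x k < εs k
  sum_lt : ∑ k, x k * (1 + εs k) < ε

variable {x : Fin m → ℝ}

theorem norm_div_cellMap_lt_one (hε : AdmissibleRadii ε εs) (hx : AdmissiblePoint ε εs x)
    {y : Fin m → ℝ} (hy : y ∈ unitCube m) {p : Fin m} (hp : p ∈ I) :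
    ‖(x p : ℂ) / cellMap I ε εs J y p‖ < 1 := by
  have h1 := le_norm_cellMap (J := J) hε hy hp
  rw [norm_div, Complex.norm_real, Real.norm_of_nonneg (hx.pos p).le,
    div_lt_one ((hε.pos p).trans_le h1)]
  exact (hx.lt p).trans_le h1

theorem sum_norm_div_last_le (hε : AdmissibleRadii ε εs) (hx : AdmissiblePoint ε εs x)
    (hJ : IsFaceSet I J) {y : Fin m → ℝ} (hy : y ∈ unitCube m) :
    ∑ q ∈ Iᶜ, ‖(x q : ℂ) * cellMap I ε εs J y q / (1 - ∑ p ∈ I, cellMap I ε εs J y p)‖ ≤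
      ∑ q ∈ Iᶜ, x q * (1 + εs q) / ε := by
  refine Finset.sum_le_sum fun q hq => ?_
  rw [norm_div, norm_mul, Complex.norm_real, Real.norm_of_nonneg (hx.pos q).le]
  have h1 := norm_cellMap_le hε hJ hy (Finset.mem_compl.1 hq)
  have h2 := le_norm_last hε hJ hy
  have h3 := hε.pos_last
  have h4 := (hx.pos q).le
  have h5 := hε.pos q
  gcongr

theorem sum_compl_div_lt_one (hε : AdmissibleRadii ε εs) (hx : AdmissiblePoint ε εs x) :
    ∑ q ∈ Iᶜ, x q * (1 + εs q) / ε < 1 := by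
  rw [← Finset.sum_div, div_lt_one hε.pos_last]
  refine lt_of_le_of_lt ?_ hx.sum_lt
  exact Finset.sum_le_sum_of_subset_of_nonneg (Finset.subset_univ _) fun k _ _ =>
    mul_nonneg (hx.pos k).le (by linarith [hε.pos k])

theorem norm_sum_div_last_lt_one (hε : AdmissibleRadii ε εs) (hx : AdmissiblePoint ε εs x)
    (hJ : IsFaceSet I J) {y : Fin m → ℝ} (hy : y ∈ unitCube m) :
    ‖(∑ q ∈ Iᶜ, (x q : ℂ) * cellMap I ε εs J y q) / (1 - ∑ p ∈ I, cellMap I ε εs J y p)‖ < 1 := by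
  rw [Finset.sum_div]
  exact (norm_sum_le _ _).trans_lt
    ((sum_norm_div_last_le hε hx hJ hy).trans_lt (sum_compl_div_lt_one hε hx))

theorem one_sub_mem_slitPlane {z : ℂ} (hz : ‖z‖ < 1) : 1 - z ∈ Complex.slitPlane := by
  refine Or.inl ?_
  rw [Complex.sub_re, Complex.one_re]
  linarith [Complex.re_le_norm z]

theorem exp_logZero (hε : AdmissibleRadii ε εs) (hJ : IsFaceSet I J) {y : Fin m → ℝ}
    (hy : y ∈ unitCube m) (k : Fin m) :
    Complex.exp (logZero I ε εs J k y) = cellMap I ε εs J y k := by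
  rw [logZero]
  split_ifs with h
  · rw [exp_logCirc (hε.pos k), cellMap_of_atZero_mem h]
  · refine Complex.exp_log fun h0 => ?_
    by_cases hk : k ∈ I
    · have := le_norm_cellMap (J := J) hε hy hk
      rw [h0, norm_zero] at this
      linarith [hε.pos k]
    · have := re_cellMap_pos_of_notMem hε hJ hy hk h
      rw [h0, Complex.zero_re] at this
      exact this.false

theorem exp_logOne_of_notMem (hε : AdmissibleRadii ε εs) (hJ : IsFaceSet I J) {y : Fin m → ℝ}
    (hy : y ∈ unitCube m) {k : Fin m} (hk : k ∉ I) :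
    Complex.exp (logOne I ε εs x J k y) = 1 - cellMap I ε εs J y k := by
  rw [logOne, if_neg hk]
  split_ifs with h
  · rw [exp_logCirc (hε.pos k), cellMap_of_atOne_mem hJ h]
    ring
  · refine Complex.exp_log fun h0 => ?_
    have := re_one_sub_cellMap_pos_of_notMem hε hy hk h
    rw [h0, Complex.zero_re] at this
    exact this.false

/-- The branch of `log (1 - ∑_{p ∈ I} s_p)` on a cell. -/
def logSimplex (I : Finset (Fin m)) (ε : ℝ) (εs : Fin m → ℝ) (J : Finset (Factor m))
    (y : Fin m → ℝ) : ℂ :=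
  if last ∈ J then logCirc ε (topCoord I J y)
    else Complex.log (1 - ∑ p ∈ I, cellMap I ε εs J y p)

theorem exp_logSimplex (hε : AdmissibleRadii ε εs) (hJ : IsFaceSet I J) {y : Fin m → ℝ}
    (hy : y ∈ unitCube m) :
    Complex.exp (logSimplex I ε εs J y) = 1 - ∑ p ∈ I, cellMap I ε εs J y p := by
  rw [logSimplex]
  split_ifs with h
  · rw [exp_logCirc hε.pos_last, one_sub_sum_cellMap_of_last_mem hJ h]
  · refine Complex.exp_log fun h0 => ?_
    have := le_re_last (I := I) hε hy h
    rw [h0, Complex.zero_re] at this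
    linarith [hε.pos_last]

theorem continuousOn_logZero (hε : AdmissibleRadii ε εs) (hJ : IsFaceSet I J) (k : Fin m) :
    ContinuousOn (logZero I ε εs J k) (unitCube m) := by
  unfold logZero
  split_ifs with h
  · exact ((continuous_logCirc _).comp (continuous_apply k)).continuousOn
  · refine ContinuousOn.clog (continuous_cellMap_apply k).continuousOn fun y hy => Or.inl ?_
    by_cases hk : k ∈ I
    · exact (hε.pos k).trans_le (le_re_cellMap_of_mem_free hε hy (mem_free.2 ⟨hk, h⟩))
    · exact re_cellMap_pos_of_notMem hε hJ hy hk h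

theorem continuousOn_logSimplex (hε : AdmissibleRadii ε εs) :
    ContinuousOn (logSimplex I ε εs J) (unitCube m) := by
  unfold logSimplex
  split_ifs with h
  · exact ((continuous_logCirc _).comp contDiff_topCoord.continuous).continuousOn
  · refine ContinuousOn.clog (continuous_const.sub (continuous_finsetSum _ fun p _ =>
      continuous_cellMap_apply p)).continuousOn fun y hy => Or.inl ?_
    exact hε.pos_last.trans_le (le_re_last hε hy h)

theorem continuousOn_logOne_of_notMem (hε : AdmissibleRadii ε εs) {k : Fin m} (hk : k ∉ I) :
    ContinuousOn (logOne I ε εs x J k) (unitCube m) := by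
  unfold logOne
  simp only [if_neg hk]
  split_ifs with h
  · exact ((continuous_logCirc _).comp (continuous_apply k)).continuousOn
  · exact ContinuousOn.clog (continuous_const.sub (continuous_cellMap_apply k)).continuousOn
      fun y hy => Or.inl (re_one_sub_cellMap_pos_of_notMem hε hy hk h)

/-- A facet function in `J` runs through a circle and has the explicit logarithm `logCirc`; every
other one has positive real part, so its principal logarithm is continuous. The factors that contain
`x` in `M_I` are such functions times `1 - z` with `|z| < 1`. -/
theorem isLoaded_cell (hε : AdmissibleRadii ε εs) (hx : AdmissiblePoint ε εs x)
    (hJ : IsFaceSet I J) : (cell I ε εs x J).IsLoaded (polyMI I x) := by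
  have hlog : ∀ f : Factor m, ContinuousOn ((cell I ε εs x J).logBranch f) (unitCube m) ∧
      ∀ y ∈ unitCube m, Complex.exp ((cell I ε εs x J).logBranch f y) =
        polyMI I x f ((cell I ε εs x J).map y) := by
    rintro (k | k | _)
    · exact ⟨continuousOn_logZero hε hJ k, fun y hy => exp_logZero hε hJ hy k⟩
    · by_cases hk : k ∈ I
      · have hne : ∀ y ∈ unitCube m, cellMap I ε εs J y k ≠ 0 := fun y hy => by
          rw [← exp_logZero hε hJ hy k]
          exact Complex.exp_ne_zero _
        refine ⟨?_, fun y hy => ?_⟩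
        · change ContinuousOn (fun y => logOne I ε εs x J k y) (unitCube m)
          unfold logOne
          simp only [if_pos hk]
          refine (continuousOn_logZero hε hJ k).add (ContinuousOn.clog (continuousOn_const.sub
            (continuousOn_const.div (continuous_cellMap_apply k).continuousOn hne)) fun y hy => ?_)
          exact one_sub_mem_slitPlane (norm_div_cellMap_lt_one hε hx hy hk)
        · change Complex.exp (logOne I ε εs x J k y) = if k ∈ I then cellMap I ε εs J y k - (x k : ℂ)
            else 1 - cellMap I ε εs J y k
          rw [if_pos hk, logOne, if_pos hk, Complex.exp_add, exp_logZero hε hJ hy,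
            Complex.exp_log (Complex.slitPlane_ne_zero (one_sub_mem_slitPlane
              (norm_div_cellMap_lt_one hε hx hy hk))), mul_sub, mul_one,
              mul_div_cancel₀ _ (hne y hy)]
      · refine ⟨continuousOn_logOne_of_notMem hε hk, fun y hy => ?_⟩
        change Complex.exp (logOne I ε εs x J k y) = if k ∈ I then cellMap I ε εs J y k - (x k : ℂ)
          else 1 - cellMap I ε εs J y k
        rw [if_neg hk, exp_logOne_of_notMem hε hJ hy hk]
    · have hne : ∀ y ∈ unitCube m, 1 - ∑ p ∈ I, cellMap I ε εs J y p ≠ 0 := fun y hy => by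
        rw [← exp_logSimplex hε hJ hy]
        exact Complex.exp_ne_zero _
      refine ⟨(continuousOn_logSimplex hε).add (ContinuousOn.clog (continuousOn_const.sub
        (ContinuousOn.div (continuous_finsetSum _ fun q _ => continuous_const.mul
          (continuous_cellMap_apply q)).continuousOn (continuous_const.sub
          (continuous_finsetSum _ fun q _ => continuous_cellMap_apply q)).continuousOn hne))
          fun y hy => ?_), fun y hy => ?_⟩
      · exact one_sub_mem_slitPlane (norm_sum_div_last_lt_one hε hx hJ hy)
      · change Complex.exp (logSimplex I ε εs J y + _) = 1 - ∑ p ∈ I, cellMap I ε εs J y p -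
          ∑ q ∈ Iᶜ, (x q : ℂ) * cellMap I ε εs J y q
        rw [Complex.exp_add, exp_logSimplex hε hJ hy, Complex.exp_log (Complex.slitPlane_ne_zero
          (one_sub_mem_slitPlane (norm_sum_div_last_lt_one hε hx hJ hy))), mul_sub, mul_one,
          mul_div_cancel₀ _ (hne y hy)]
  refine ⟨contDiff_cellMap.contDiffOn, fun y hy f => ?_, hlog⟩
  rw [← (hlog f).2 y hy]
  exact Complex.exp_ne_zero _

end cells

/-! ### Null chains -/

/-- Needed for faces of two cells in which the coordinates `p` and `t` have exchanged roles.
Deleting position `t` instead of `p` moves the entry at `t` to position `p`, which is a cyclic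
permutation of the positions in between; combined with the boundary signs it gives opposite
orientations. -/
theorem exists_perm_insertNth {k : ℕ} {p t : Fin (k + 1)} (h : p < t) :
    ∃ π : Equiv.Perm (Fin k), ((Equiv.Perm.sign π : ℤ) : ℂ) * (-1) ^ (t : ℕ) = -(-1) ^ (p : ℕ) ∧
      ∀ (y : Fin k → ℝ) (z w : ℝ) (g : Fin (k + 1)),
        t.insertNth (α := fun _ => ℝ) w (y ∘ π) g = if g = t then w else
          if g = p then p.insertNth (α := fun _ => ℝ) z y t else
            p.insertNth (α := fun _ => ℝ) z y g := by
  have hk : k ≠ 0 := by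
    rintro rfl
    have := t.2
    have : (p : ℕ) < t := h
    omega
  have : NeZero k := ⟨hk⟩
  have hpt : (p : ℕ) < t := h
  have ht := t.2
  let p' : Fin k := ⟨p, by omega⟩
  let t' : Fin k := ⟨(t : ℕ) - 1, by omega⟩
  have hle : p' ≤ t' := by
    change (p : ℕ) ≤ (t : ℕ) - 1
    omega
  refine ⟨(Fin.cycleIcc p' t').symm, ?_, ?_⟩
  · rw [Equiv.Perm.sign_symm, Fin.sign_cycleIcc_of_le hle]
    push_cast
    rw [← pow_add]
    -- The cycle on the positions `p, …, t - 1` has sign `(-1) ^ (t - 1 - p)`.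
    have e : (t' : ℕ) - (p' : ℕ) + (t : ℕ) = 2 * ((t : ℕ) - 1 - p) + (p + 1) := by
      change (t : ℕ) - 1 - (p : ℕ) + (t : ℕ) = _
      omega
    rw [e, pow_add, pow_mul]
    simp [pow_succ]
  · intro y z w g
    rcases Fin.eq_self_or_eq_succAbove t g with rfl | ⟨l, rfl⟩
    · simp
    · rw [Fin.insertNth_apply_succAbove, if_neg (Fin.succAbove_ne t l)]
      obtain ⟨l', rfl⟩ := (Fin.cycleIcc p' t').surjective l
      rw [Function.comp_apply, Equiv.symm_apply_apply]
      have hval : ∀ (i : Fin (k + 1)) (j : Fin k), ((i.succAbove j : Fin (k + 1)) : ℕ) =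
          if (j : ℕ) < i then (j : ℕ) else j + 1 := fun i j => by
        rw [Fin.succAbove]
        simp only [Fin.lt_def, Fin.val_castSucc]
        split_ifs <;> rfl
      have hl' := l'.2
      have hpv : (p' : ℕ) = p := rfl
      have htv : (t' : ℕ) = t - 1 := rfl
      by_cases h1 : l' < p'
      · have h1' : (l' : ℕ) < p := h1
        rw [Fin.cycleIcc_of_lt h1]
        have e : t.succAbove l' = p.succAbove l' := Fin.ext (by rw [hval, hval]; split_ifs <;> omega)
        rw [e, if_neg (Fin.succAbove_ne p l'), Fin.insertNth_apply_succAbove]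
      · by_cases h2 : t' < l'
        · have h2' : (t : ℕ) - 1 < l' := h2
          rw [Fin.cycleIcc_of_gt h2]
          have e : t.succAbove l' = p.succAbove l' :=
            Fin.ext (by rw [hval, hval]; split_ifs <;> omega)
          rw [e, if_neg (Fin.succAbove_ne p l'), Fin.insertNth_apply_succAbove]
        · by_cases h3 : l' = t'
          · subst h3
            rw [Fin.cycleIcc_of_last hle]
            have e1 : t.succAbove p' = p := Fin.ext (by rw [hval]; split_ifs <;> omega)
            have e2 : p.succAbove t' = t := Fin.ext (by rw [hval]; split_ifs <;> omega)
            rw [e1, if_pos rfl]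
            conv_rhs => rw [← e2]
            rw [Fin.insertNth_apply_succAbove]
          · have h4 : l' < t' := lt_of_le_of_ne (not_lt.1 h2) h3
            rw [Fin.cycleIcc_of_ge_of_lt (not_lt.1 h1) h4]
            have h4' : (l' : ℕ) < t - 1 := h4
            have h1' : ¬ (l' : ℕ) < p := h1
            have hv : ((l' + 1 : Fin k) : ℕ) = l' + 1 := Fin.val_add_one_of_lt' (by omega)
            have e : t.succAbove (l' + 1) = p.succAbove l' :=
              Fin.ext (by rw [hval, hval, hv]; split_ifs <;> omega)
            rw [e, if_neg (Fin.succAbove_ne p l'), Fin.insertNth_apply_succAbove]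

section null

variable {ι : Type} {m k : ℕ} {P : ι → (Fin m → ℂ) → ℂ}

theorem insertNth_mem_unitCube {y : Fin k → ℝ} (hy : y ∈ unitCube k) (i : Fin (k + 1)) {z : ℝ}
    (hz : z ∈ Set.Icc (0 : ℝ) 1) : i.insertNth (α := fun _ => ℝ) z y ∈ unitCube (k + 1) := by
  constructor <;> intro g <;> rcases Fin.eq_self_or_eq_succAbove i g with rfl | ⟨l, rfl⟩
  · simpa using hz.1
  · simpa using hy.1 l
  · simpa using hz.2
  · simpa using hy.2 l

theorem contDiff_insertNth (i : Fin (k + 1)) (z : ℝ) :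
    ContDiff ℝ ∞ fun y : Fin k → ℝ => i.insertNth (α := fun _ => ℝ) z y := by
  refine contDiff_pi.2 fun g => ?_
  rcases Fin.eq_self_or_eq_succAbove i g with rfl | ⟨l, rfl⟩
  · simpa using contDiff_const
  · simpa using contDiff_apply ℝ ℝ l

theorem LoadedCube.IsLoaded.face {A : LoadedCube ι m (k + 1)} (hA : A.IsLoaded P)
    (i : Fin (k + 1)) {z : ℝ} (hz : z ∈ Set.Icc (0 : ℝ) 1) : (A.face i z).IsLoaded P := by
  have hmaps : Set.MapsTo (fun y : Fin k → ℝ => i.insertNth (α := fun _ => ℝ) z y) (unitCube k)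
      (unitCube (k + 1)) := fun y hy => insertNth_mem_unitCube hy i hz
  refine ⟨hA.1.comp (contDiff_insertNth i z).contDiffOn hmaps, fun y hy => hA.2.1 _ (hmaps hy),
    fun f => ⟨(hA.2.2 f).1.comp (contDiff_insertNth i z).continuous.continuousOn hmaps,
      fun y hy => (hA.2.2 f).2 _ (hmaps hy)⟩⟩

variable [Fintype ι] {lam : ι → ℂ}

theorem mk_single_eq {A B : LoadedCube ι m k} (hA : A.IsLoaded P) (hB : B.IsLoaded P)
    (π : Equiv.Perm (Fin k)) (κ : ℂ)
    (h : ∀ y ∈ unitCube k, B.map y = A.map (y ∘ π) ∧ B.load lam y = κ * A.load lam (y ∘ π)) :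
    (nullChains P lam k).mkQ (Finsupp.single B 1) =
      (κ * ((Equiv.Perm.sign π : ℤ) : ℂ)) • (nullChains P lam k).mkQ (Finsupp.single A 1) := by
  rw [← map_smul, Finsupp.smul_single, smul_eq_mul, mul_one, ← sub_eq_zero, ← map_sub,
    Submodule.mkQ_apply, Submodule.Quotient.mk_eq_zero]
  exact Submodule.subset_span (Or.inl ⟨A, B, π, κ, hA, hB, h, rfl⟩)

theorem mk_single_eq_of_load {A B : LoadedCube ι m k} (hA : A.IsLoaded P) (hB : B.IsLoaded P)
    (κ : ℂ) (h : ∀ y ∈ unitCube k, B.map y = A.map y ∧ B.load lam y = κ * A.load lam y) :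
    (nullChains P lam k).mkQ (Finsupp.single B 1) =
      κ • (nullChains P lam k).mkQ (Finsupp.single A 1) := by
  have := mk_single_eq hA hB 1 κ h
  rwa [Equiv.Perm.sign_one, Units.val_one, Int.cast_one, mul_one] at this

theorem mk_single_eq_zero {A : LoadedCube ι m k} (hA : A.IsLoaded P) (i : Fin k)
    (h : ∀ y ∈ unitCube k, ∀ y' ∈ unitCube k, (∀ j, j ≠ i → y j = y' j) →
      A.map y = A.map y' ∧ A.load lam y = A.load lam y') :
    (nullChains P lam k).mkQ (Finsupp.single A 1) = 0 := by
  rw [Submodule.mkQ_apply, Submodule.Quotient.mk_eq_zero]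
  exact Submodule.subset_span (Or.inr ⟨A, i, hA, h, rfl⟩)

end null

/-! ### Coincidences between faces of cells -/

section coincidences

variable {m : ℕ} {I : Finset (Fin m)} {ε : ℝ} {εs x : Fin m → ℝ} {J J' : Finset (Factor m)}
  {y y' : Fin m → ℝ}

/-- The point of a cell is determined by the circle values (or radii) of the `s_p`, the sticks, the
value at the last facet, and the interval coordinates. All comparisons between different `J` are
made on these four data. -/
theorem cellMap_congr
    (hz : ∀ p ∈ I, (if atZero p ∈ J then circ (εs p) (y p) else (εs p : ℂ)) =
      if atZero p ∈ J' then circ (εs p) (y' p) else (εs p : ℂ))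
    (hτ : ∀ p ∈ I, (if atZero p ∈ J then 0 else stick I J y p) =
      if atZero p ∈ J' then 0 else stick I J' y' p)
    (hl : (if last ∈ J then circ ε (topCoord I J y) else (ε : ℂ)) =
      if last ∈ J' then circ ε (topCoord I J' y') else (ε : ℂ))
    (hq : ∀ q, q ∉ I → cellMap I ε εs J y q = cellMap I ε εs J' y' q) :
    cellMap I ε εs J y = cellMap I ε εs J' y' := by
  have hmargin : ∀ (J : Finset (Factor m)) (y : Fin m → ℝ), margin I ε εs J y =
      1 - (ε + ∑ p ∈ I, (εs p : ℂ)) +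
      ∑ p ∈ I, ((εs p : ℂ) - if atZero p ∈ J then circ (εs p) (y p) else (εs p : ℂ)) +
      (ε - if last ∈ J then circ ε (topCoord I J y) else (ε : ℂ)) := fun J y => by
    rw [margin]
    congr 2
    · refine Finset.sum_congr rfl fun p _ => ?_
      split_ifs <;> simp
    · split_ifs <;> simp
  have hm : margin I ε εs J y = margin I ε εs J' y' := by
    rw [hmargin J, hmargin J', hl]
    congr 2
    exact Finset.sum_congr rfl fun p hp => by rw [hz p hp]
  have hcell : ∀ (J : Finset (Factor m)) (y : Fin m → ℝ), ∀ p ∈ I, cellMap I ε εs J y p =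
      (if atZero p ∈ J then circ (εs p) (y p) else (εs p : ℂ)) +
      ((if atZero p ∈ J then 0 else stick I J y p : ℝ) : ℂ) * margin I ε εs J y :=
    fun J y p hp => by
      rw [cellMap, if_pos hp]
      split_ifs <;> simp
  funext p
  by_cases hp : p ∈ I
  · rw [hcell J y p hp, hcell J' y' p hp, hz p hp, hτ p hp, hm]
  · exact hq p hp

/-- Over the same point two loads differ by the exponents weighted with the winding numbers `δ₀`,
`δ₁`, `δl` of `s_k`, `1 - s_k` and `1 - ∑ s_p`. The factors `s_p - x_p` and `last` wind with `s_p`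
and `1 - ∑ s_p`, since the correcting principal logarithms depend on the point alone. -/
theorem load_cell_eq {a : ℂ} {b c : Fin m → ℂ} (δ₀ δ₁ : Fin m → ℂ) (δl : ℂ)
    (hmap : cellMap I ε εs J y = cellMap I ε εs J' y')
    (h0 : ∀ k, logZero I ε εs J k y = logZero I ε εs J' k y' + 2 * Real.pi * Complex.I * δ₀ k)
    (h1 : ∀ k, k ∉ I → logOne I ε εs x J k y =
      logOne I ε εs x J' k y' + 2 * Real.pi * Complex.I * δ₁ k)
    (hl : logSimplex I ε εs J y = logSimplex I ε εs J' y' + 2 * Real.pi * Complex.I * δl) :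
    (cell I ε εs x J).load (exponents a b c) y =
      Complex.exp (2 * Real.pi * Complex.I * (∑ k, (b k * δ₀ k +
        (c k - b k - 1) * if k ∈ I then δ₀ k else δ₁ k) - a * δl)) *
      (cell I ε εs x J').load (exponents a b c) y' := by
  have h1' : ∀ k, logOne I ε εs x J k y = logOne I ε εs x J' k y' +
      2 * Real.pi * Complex.I * if k ∈ I then δ₀ k else δ₁ k := fun k => by
    by_cases hk : k ∈ I
    · rw [if_pos hk, logOne, logOne, if_pos hk, if_pos hk, h0, hmap]
      ring
    · rw [if_neg hk, h1 k hk]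
  have hl' : logLast I ε εs x J y = logLast I ε εs x J' y' + 2 * Real.pi * Complex.I * δl := by
    change logSimplex I ε εs J y + _ = logSimplex I ε εs J' y' + _ + _
    rw [hl, hmap]
    ring
  rw [LoadedCube.load, LoadedCube.load, ← Complex.exp_add]
  congr 1
  simp only [Fintype.sum_sum_type, exponents, cell, Sum.elim_inl, Sum.elim_inr, h0, h1', hl',
    Finset.univ_unique, Finset.sum_singleton, mul_add, Finset.sum_add_distrib, mul_sub,
    Finset.mul_sum]
  simp only [mul_left_comm (2 * (Real.pi : ℂ) * Complex.I)]
  ring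

theorem load_cell_congr {a : ℂ} {b c : Fin m → ℂ}
    (hmap : cellMap I ε εs J y = cellMap I ε εs J' y')
    (h0 : ∀ k, logZero I ε εs J k y = logZero I ε εs J' k y')
    (h1 : ∀ k, k ∉ I → logOne I ε εs x J k y = logOne I ε εs x J' k y')
    (hl : logSimplex I ε εs J y = logSimplex I ε εs J' y') :
    (cell I ε εs x J).load (exponents a b c) y =
      (cell I ε εs x J').load (exponents a b c) y' := by
  have := load_cell_eq (a := a) (b := b) (c := c) (x := x) (fun _ => 0) (fun _ => 0) 0 hmap
    (by simpa using h0) (by simpa using h1) (by simpa using hl)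
  simpa using this

/-- At its starting point `y k = 0` the logarithm along the circle is the real one; hence a tube and
the cell that it is attached to carry the same branch. -/
theorem logZero_eq_log {k : Fin m} (hk : 0 < εs k) (h : atZero k ∈ J → y k = 0) :
    logZero I ε εs J k y = Complex.log (cellMap I ε εs J y k) := by
  rw [logZero]
  split_ifs with hm
  · rw [cellMap_of_atZero_mem hm, h hm, logCirc_zero, circ_zero, Complex.ofReal_log hk.le]
  · rfl

theorem logOne_eq_log {k : Fin m} (hJ : IsFaceSet I J) (hI : k ∉ I) (hk : 0 < εs k)
    (h : atOne k ∈ J → y k = 0) :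
    logOne I ε εs x J k y = Complex.log (1 - cellMap I ε εs J y k) := by
  rw [logOne, if_neg hI]
  split_ifs with hm
  · rw [cellMap_of_atOne_mem hJ hm, h hm, logCirc_zero, circ_zero, Complex.ofReal_log hk.le,
      sub_sub_cancel]
  · rfl

theorem logSimplex_eq_log (hJ : IsFaceSet I J) (hε : 0 < ε) (h : last ∈ J → topCoord I J y = 0) :
    logSimplex I ε εs J y = Complex.log (1 - ∑ p ∈ I, cellMap I ε εs J y p) := by
  rw [logSimplex]
  split_ifs with hm
  · rw [one_sub_sum_cellMap_of_last_mem hJ hm, h hm, logCirc_zero, circ_zero,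
      Complex.ofReal_log hε.le]
  · rfl

theorem logZero_congr {k : Fin m} (hmap : cellMap I ε εs J y = cellMap I ε εs J' y')
    (h : atZero k ∈ J ↔ atZero k ∈ J') (hy : atZero k ∈ J → y k = y' k) :
    logZero I ε εs J k y = logZero I ε εs J' k y' := by
  rw [logZero, logZero, hmap]
  by_cases hm : atZero k ∈ J
  · rw [if_pos hm, if_pos (h.1 hm), hy hm]
  · rw [if_neg hm, if_neg fun hm' => hm (h.2 hm')]

theorem logOne_congr {k : Fin m} (hI : k ∉ I) (hmap : cellMap I ε εs J y = cellMap I ε εs J' y')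
    (h : atOne k ∈ J ↔ atOne k ∈ J') (hy : atOne k ∈ J → y k = y' k) :
    logOne I ε εs x J k y = logOne I ε εs x J' k y' := by
  rw [logOne, logOne, if_neg hI, if_neg hI, hmap]
  by_cases hm : atOne k ∈ J
  · rw [if_pos hm, if_pos (h.1 hm), hy hm]
  · rw [if_neg hm, if_neg fun hm' => hm (h.2 hm')]

theorem logSimplex_congr (hmap : cellMap I ε εs J y = cellMap I ε εs J' y')
    (h : last ∈ J ↔ last ∈ J') (hy : last ∈ J → topCoord I J y = topCoord I J' y') :
    logSimplex I ε εs J y = logSimplex I ε εs J' y' := by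
  rw [logSimplex, logSimplex, hmap]
  by_cases hm : last ∈ J
  · rw [if_pos hm, if_pos (h.1 hm), hy hm]
  · rw [if_neg hm, if_neg fun hm' => hm (h.2 hm')]

theorem cellMap_congr_apply {k : Fin m} (hI : k ∉ I) (h0 : atZero k ∈ J ↔ atZero k ∈ J')
    (h1 : atOne k ∈ J ↔ atOne k ∈ J') (hy : y k = y' k) :
    cellMap I ε εs J y k = cellMap I ε εs J' y' k := by
  simp only [cellMap, hI, if_false, h0, h1, hy]

open Classical in
theorem stick_congr {p : Fin m} (hf : free I J = free I J')
    (hp : (if last ∈ J ∧ IsTop I J p then 1 else y p) =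
      if last ∈ J' ∧ IsTop I J' p then 1 else y' p)
    (hy : ∀ p' ∈ free I J, p' < p → y p' = y' p') : stick I J y p = stick I J' y' p := by
  rw [stick, stick, hp, ← hf]
  congr 1
  refine Finset.prod_congr rfl fun p' hp' => ?_
  rw [hy p' (Finset.mem_filter.1 hp').1 (Finset.mem_filter.1 hp').2]

theorem topCoord_congr (h : ∀ t, IsTop I J t → y t = y' t) :
    topCoord I J y = topCoord I J y' := by
  classical
  rw [topCoord, topCoord]
  exact Finset.sum_congr rfl fun t ht => h t (Finset.mem_filter.1 ht).2

/-- The coordinate `i` is the angle of a circle of the cell. -/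
def IsCircleCoord (I : Finset (Fin m)) (J : Finset (Factor m)) (i : Fin m) : Prop :=
  atZero i ∈ J ∨ atOne i ∈ J ∨ (last ∈ J ∧ IsTop I J i)

/-- The circles close up, and an angle enters the parametrization only through `circ`: for the top
index, `stick` omits the coordinate, and no later stick contains it. -/
theorem cellMap_circle (hJ : IsFaceSet I J) {i : Fin m} (hi : IsCircleCoord I J i)
    (h : ∀ k, k ≠ i → y k = y' k) (hy : y i = 1) (hy' : y' i = 0) :
    cellMap I ε εs J y = cellMap I ε εs J y' := by
  have hcirc : ∀ ρ k, circ ρ (y k) = circ ρ (y' k) := fun ρ k => by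
    by_cases hk : k = i
    · rw [hk, hy, hy', circ_one, circ_zero]
    · rw [h k hk]
  have hfree : i ∈ free I J → last ∈ J ∧ IsTop I J i := fun hf => by
    rcases hi with hi | hi | hi
    · exact absurd hi (mem_free.1 hf).2
    · exact absurd hi (hJ.1 i (mem_free.1 hf).1)
    · exact hi
  refine cellMap_congr (fun p _ => by rw [hcirc]) (fun p hp => ?_) ?_ fun q hq => ?_
  · by_cases hpJ : atZero p ∈ J
    · rw [if_pos hpJ, if_pos hpJ]
    · rw [if_neg hpJ, if_neg hpJ]
      refine stick_congr rfl ?_ fun p' hp' hlt => h p' ?_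
      · by_cases hpi : p = i
        · subst hpi
          rw [if_pos (hfree (mem_free.2 ⟨hp, hpJ⟩)), if_pos (hfree (mem_free.2 ⟨hp, hpJ⟩))]
        · rw [h p hpi]
      · rintro rfl
        exact absurd ((hfree hp').2.2 p (mem_free.2 ⟨hp, hpJ⟩)) (not_le.2 hlt)
  · by_cases hl : last ∈ J
    · obtain ⟨t, ht⟩ := hJ.exists_isTop hl
      rw [if_pos hl, if_pos hl, ht.topCoord_eq, ht.topCoord_eq, hcirc]
    · rw [if_neg hl, if_neg hl]
  · simp only [cellMap, hq, if_false, hcirc]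
    by_cases h0 : atZero q ∈ J
    · rw [if_pos h0, if_pos h0]
    · by_cases h1 : atOne q ∈ J
      · rw [if_neg h0, if_neg h0, if_pos h1, if_pos h1]
      · rw [h q]
        rintro rfl
        rcases hi with hi | hi | hi
        exacts [h0 hi, h1 hi, hq (mem_free.1 hi.2.1).1]

theorem free_insert_atZero (i : Fin m) : free I (insert (atZero i) J) = (free I J).erase i := by
  ext p
  simp only [mem_free, Finset.mem_insert, Finset.mem_erase, Sum.inl.injEq]
  tauto

theorem free_insert_atOne (i : Fin m) : free I (insert (atOne i) J) = free I J := by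
  ext p
  simp [mem_free, Finset.mem_insert]

theorem free_insert_last : free I (insert last J) = free I J := by
  ext p
  simp [mem_free, Finset.mem_insert]

theorem isTop_congr {p : Fin m} (h : free I J = free I J') : IsTop I J p ↔ IsTop I J' p := by
  rw [IsTop, IsTop, h]

theorem topCoord_insert (h : free I J = free I J') (y : Fin m → ℝ) :
    topCoord I J y = topCoord I J' y := by
  classical
  rw [topCoord, topCoord]
  simp only [isTop_congr h]

end coincidences

/-! ### The faces of the cells modulo null chains -/

section loads

variable {m : ℕ} {a : ℂ} {b c : Fin m → ℂ} {I : Finset (Fin m)} {ε : ℝ} {εs x : Fin m → ℝ}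
  {J : Finset (Factor m)} {y y' : Fin m → ℝ}

theorem expTwoPiI_add (z w : ℂ) : expTwoPiI (z + w) = expTwoPiI z * expTwoPiI w := by
  rw [expTwoPiI, mul_add, Complex.exp_add, expTwoPiI, expTwoPiI]

theorem expTwoPiI_intCast (n : ℤ) : expTwoPiI n = 1 := by
  rw [expTwoPiI, mul_comm, Complex.exp_int_mul_two_pi_mul_I]

theorem expTwoPiI_sub_one (z : ℂ) : expTwoPiI (z - 1) = expTwoPiI z := by
  have := expTwoPiI_intCast (-1)
  push_cast at this
  rw [sub_eq_add_neg, expTwoPiI_add, this, mul_one]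

theorem expTwoPiI_neg (z : ℂ) : expTwoPiI (-z) = (expTwoPiI z)⁻¹ := by
  rw [expTwoPiI, mul_neg, Complex.exp_neg, expTwoPiI]

theorem expTwoPiI_ne_one {z : ℂ} (hz : ∀ n : ℤ, z ≠ n) : expTwoPiI z ≠ 1 := by
  intro h
  obtain ⟨n, hn⟩ := Complex.exp_eq_one_iff.1 h
  refine hz n (mul_left_cancel₀ Complex.two_pi_I_ne_zero (hn.trans (mul_comm _ _)))

theorem stick_congr_of_free {J' : Finset (Factor m)} (hf : free I J = free I J')
    (hl : last ∈ J ↔ last ∈ J') (hy : ∀ k ∈ I, y k = y' k) {p : Fin m} (hp : p ∈ I) :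
    stick I J y p = stick I J' y' p := by
  classical
  refine stick_congr hf ?_ fun p' hp' _ => hy p' (mem_free.1 hp').1
  by_cases h : last ∈ J ∧ IsTop I J p
  · rw [if_pos h, if_pos ⟨hl.1 h.1, (isTop_congr hf).1 h.2⟩]
  · rw [if_neg h, if_neg fun h' => h ⟨hl.2 h'.1, (isTop_congr hf).2 h'.2⟩, hy p hp]

/-- For `i ∈ I` both `s_i` and `s_i - x_i` wind once, with total exponent `c_i - 1`; for `i ∉ I`
only `s_i` does, with exponent `b_i`. This explains the two cases of `dCoeff`. -/
theorem load_circle_atZero (hJ : IsFaceSet I J) {i : Fin m} (hi : atZero i ∈ J)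
    (h : ∀ k, k ≠ i → y k = y' k) (hy : y i = 1) (hy' : y' i = 0) :
    (cell I ε εs x J).load (exponents a b c) y =
      (dCoeff I a b c (atZero i) + 1) * (cell I ε εs x J).load (exponents a b c) y' := by
  have hmap : cellMap I ε εs J y = cellMap I ε εs J y' :=
    cellMap_circle hJ (Or.inl hi) h hy hy'
  rw [load_cell_eq (J' := J) (y' := y') (Pi.single i 1) (fun _ => 0) 0 hmap]
  · congr 1
    rw [Finset.sum_eq_single i]
    · by_cases hI : i ∈ I
      · simp only [Pi.single_eq_same, dCoeff, hI, if_true, Sum.elim_inl]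
        rw [sub_add_cancel, ← expTwoPiI_sub_one, expTwoPiI]
        congr 1
        ring
      · simp [hI, dCoeff, expTwoPiI]
    · intro k _ hk
      simp [hk]
    · simp
  · intro k
    by_cases hk : k = i
    · subst hk
      rw [logZero, logZero, if_pos hi, if_pos hi, hy, hy', logCirc_one, Pi.single_eq_same, mul_one]
    · rw [Pi.single_eq_of_ne hk, mul_zero, add_zero]
      exact logZero_congr hmap Iff.rfl fun _ => h k hk
  · intro k hkI
    rw [mul_zero, add_zero]
    refine logOne_congr hkI hmap Iff.rfl fun hk => h k ?_
    rintro rfl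
    exact hJ.2.1 k hkI ⟨hi, hk⟩
  · rw [mul_zero, add_zero]
    refine logSimplex_congr hmap Iff.rfl fun _ => topCoord_congr fun t ht => h t ?_
    rintro rfl
    exact (mem_free.1 ht.1).2 hi

theorem load_circle_atOne (hJ : IsFaceSet I J) {i : Fin m} (hi : atOne i ∈ J)
    (h : ∀ k, k ≠ i → y k = y' k) (hy : y i = 1) (hy' : y' i = 0) :
    (cell I ε εs x J).load (exponents a b c) y =
      (dCoeff I a b c (atOne i) + 1) * (cell I ε εs x J).load (exponents a b c) y' := by
  have hmap : cellMap I ε εs J y = cellMap I ε εs J y' :=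
    cellMap_circle hJ (Or.inr (Or.inl hi)) h hy hy'
  have hI : i ∉ I := fun hI => hJ.1 i hI hi
  rw [load_cell_eq (J' := J) (y' := y') (fun _ => 0) (Pi.single i 1) 0 hmap]
  · congr 1
    rw [Finset.sum_eq_single i]
    · simp only [Pi.single_eq_same, dCoeff, hI, if_false, Sum.elim_inl, Sum.elim_inr]
      rw [sub_add_cancel, ← expTwoPiI_neg, ← expTwoPiI_add, ← expTwoPiI_sub_one, expTwoPiI]
      congr 1
      ring
    · intro k _ hk
      simp [hk]
    · simp
  · intro k
    rw [mul_zero, add_zero]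
    refine logZero_congr hmap Iff.rfl fun hk => h k ?_
    rintro rfl
    exact hJ.2.1 k hI ⟨hk, hi⟩
  · intro k hkI
    by_cases hk : k = i
    · subst hk
      rw [logOne, logOne, if_neg hkI, if_neg hkI, if_pos hi, if_pos hi, hy, hy', logCirc_one,
        Pi.single_eq_same, mul_one]
    · rw [Pi.single_eq_of_ne hk, mul_zero, add_zero]
      exact logOne_congr hkI hmap Iff.rfl fun _ => h k hk
  · rw [mul_zero, add_zero]
    refine logSimplex_congr hmap Iff.rfl fun _ => topCoord_congr fun t ht => h t ?_
    rintro rfl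
    exact hI (mem_free.1 ht.1).1

/-- Around the last circle the factor with exponent `-a` winds once, and none of the others do. -/
theorem load_circle_last (hJ : IsFaceSet I J) {i : Fin m} (hl : last ∈ J) (hi : IsTop I J i)
    (h : ∀ k, k ≠ i → y k = y' k) (hy : y i = 1) (hy' : y' i = 0) :
    (cell I ε εs x J).load (exponents a b c) y =
      (dCoeff I a b c last + 1) * (cell I ε εs x J).load (exponents a b c) y' := by
  have hmap : cellMap I ε εs J y = cellMap I ε εs J y' :=
    cellMap_circle hJ (Or.inr (Or.inr ⟨hl, hi⟩)) h hy hy'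
  have hI := mem_free.1 hi.1
  rw [load_cell_eq (J' := J) (y' := y') (fun _ => 0) (fun _ => 0) 1 hmap]
  · congr 1
    simp only [dCoeff, Sum.elim_inr, sub_add_cancel, ← expTwoPiI_neg]
    rw [expTwoPiI]
    simp
  · intro k
    rw [mul_zero, add_zero]
    refine logZero_congr hmap Iff.rfl fun hk => h k ?_
    rintro rfl
    exact hI.2 hk
  · intro k hkI
    rw [mul_zero, add_zero]
    refine logOne_congr hkI hmap Iff.rfl fun hk => h k ?_
    rintro rfl
    exact hkI hI.1
  · rw [logSimplex, logSimplex, if_pos hl, if_pos hl, hi.topCoord_eq, hi.topCoord_eq, hy, hy',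
      logCirc_one, mul_one]

/-- The tube about `s_q = 0` starts at `s_q = εs q`, which is the face `y q = 0` of the cell. -/
theorem cell_insert_atZero_compl (hε : AdmissibleRadii ε εs) {q : Fin m} (hq : q ∉ I)
    (h0 : atZero q ∉ J)
    (hJ' : IsFaceSet I (insert (atZero q) J)) (hy : y q = 0) :
    cellMap I ε εs J y = cellMap I ε εs (insert (atZero q) J) y ∧
    (cell I ε εs x J).load (exponents a b c) y =
      (cell I ε εs x (insert (atZero q) J)).load (exponents a b c) y := by
  have h1 : atOne q ∉ J := fun h1 =>
    hJ'.2.1 q hq ⟨Finset.mem_insert_self _ _, Finset.mem_insert_of_mem h1⟩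
  have hfree : free I J = free I (insert (atZero q) J) := by
    rw [free_insert_atZero, Finset.erase_eq_of_notMem fun h => hq (mem_free.1 h).1]
  have hne : ∀ k, k ≠ q → (atZero k ∈ J ↔ atZero k ∈ insert (atZero q) J) := fun k hk => by
    simp [hk]
  have hmap : cellMap I ε εs J y = cellMap I ε εs (insert (atZero q) J) y := by
    refine cellMap_congr (fun p hp => ?_) (fun p hp => ?_) ?_ fun k hk => ?_
    · simp only [hne p (ne_of_mem_of_not_mem hp hq)]
    · simp only [hne p (ne_of_mem_of_not_mem hp hq)]
      rw [stick_congr_of_free hfree (by simp) (fun _ _ => rfl) hp]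
    · rw [topCoord_insert hfree]
      simp
    · by_cases hkq : k = q
      · subst hkq
        rw [cellMap_of_notMem hk h0 h1, cellMap_of_atZero_mem (Finset.mem_insert_self _ _), hy,
          circ_zero]
        simp
      · exact cellMap_congr_apply hk (hne k hkq) (by simp) rfl
  refine ⟨hmap, load_cell_congr hmap (fun k => ?_) (fun k hk => ?_) ?_⟩
  · by_cases hkq : k = q
    · subst hkq
      rw [logZero_eq_log (hε.pos k) fun _ => hy, logZero_eq_log (hε.pos k) fun _ => hy, hmap]
    · exact logZero_congr hmap (hne k hkq) fun _ => rfl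
  · exact logOne_congr hk hmap (by simp) fun _ => rfl
  · exact logSimplex_congr hmap (by simp) fun _ => topCoord_insert hfree y

/-- The tube about `s_q = 1` starts at `s_q = 1 - εs q`: the face `y q = 1` of the cell is the face
`y q = 0` of the tube. -/
theorem cell_insert_atOne_compl (hε : AdmissibleRadii ε εs) (hJ : IsFaceSet I J)
    {q : Fin m} (hq : q ∉ I) (h1 : atOne q ∉ J)
    (hJ' : IsFaceSet I (insert (atOne q) J)) (hy : y q = 1) (hy' : y' q = 0)
    (h : ∀ k, k ≠ q → y k = y' k) :
    cellMap I ε εs J y = cellMap I ε εs (insert (atOne q) J) y' ∧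
    (cell I ε εs x J).load (exponents a b c) y =
      (cell I ε εs x (insert (atOne q) J)).load (exponents a b c) y' := by
  have h0 : atZero q ∉ J := fun h0 =>
    hJ'.2.1 q hq ⟨Finset.mem_insert_of_mem h0, Finset.mem_insert_self _ _⟩
  have hfree : free I J = free I (insert (atOne q) J) := (free_insert_atOne q).symm
  have hne : ∀ k, k ≠ q → (atOne k ∈ J ↔ atOne k ∈ insert (atOne q) J) := fun k hk => by
    simp [hk]
  have hI : ∀ p ∈ I, y p = y' p := fun p hp => h p (ne_of_mem_of_not_mem hp hq)
  have hf : ∀ p ∈ free I J, y p = y' p := fun p hp => hI p (mem_free.1 hp).1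
  have htc : topCoord I J y = topCoord I (insert (atOne q) J) y' := by
    rw [← topCoord_insert hfree]
    exact topCoord_congr fun t ht => hf t ht.1
  have hmap : cellMap I ε εs J y = cellMap I ε εs (insert (atOne q) J) y' := by
    refine cellMap_congr (fun p hp => ?_) (fun p hp => ?_) ?_ fun k hk => ?_
    · simp [hI p hp]
    · rw [stick_congr_of_free hfree (by simp) hI hp]
      simp
    · rw [htc]
      simp
    · by_cases hkq : k = q
      · subst hkq
        rw [cellMap_of_notMem hk h0 h1, cellMap_of_atOne_mem hJ' (Finset.mem_insert_self _ _), hy,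
          hy', circ_zero]
        push_cast
        ring
      · exact cellMap_congr_apply hk (by simp) (hne k hkq) (h k hkq)
  refine ⟨hmap, load_cell_congr hmap (fun k => ?_) (fun k hk => ?_) ?_⟩
  · by_cases hkq : k = q
    · subst hkq
      rw [logZero_eq_log (hε.pos k) fun h => absurd h h0,
        logZero_eq_log (hε.pos k) fun _ => hy', hmap]
    · exact logZero_congr hmap (by simp) fun _ => h k hkq
  · by_cases hkq : k = q
    · subst hkq
      rw [logOne_eq_log hJ hk (hε.pos k) fun h => absurd h h1,
        logOne_eq_log hJ' hk (hε.pos k) fun _ => hy', hmap]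
    · exact logOne_congr hk hmap (hne k hkq) fun _ => h k hkq
  · exact logSimplex_congr hmap (by simp) fun _ => htc

/-- At `y i = 0` the stick of `i` has length `0` and its factor `1 - y i` is `1`, so dropping `i`
from the free indices changes no other stick. The top index is excluded because its coordinate may
be an angle. -/
theorem cell_insert_atZero_free (hε : AdmissibleRadii ε εs) (hJ : IsFaceSet I J)
    {i : Fin m} (hi : i ∈ free I J)
    (hit : ¬ (last ∈ J ∧ IsTop I J i)) (hy : y i = 0) :
    cellMap I ε εs J y = cellMap I ε εs (insert (atZero i) J) y ∧
    (cell I ε εs x J).load (exponents a b c) y =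
      (cell I ε εs x (insert (atZero i) J)).load (exponents a b c) y := by
  have hiI := mem_free.1 hi
  have hne : ∀ k, k ≠ i → (atZero k ∈ J ↔ atZero k ∈ insert (atZero i) J) := fun k hk => by
    simp [hk]
  have hfree : free I (insert (atZero i) J) = (free I J).erase i := free_insert_atZero i
  have htop : last ∈ J → ∀ p, (IsTop I J p ↔ IsTop I (insert (atZero i) J) p) := fun hl p => by
    obtain ⟨t, ht⟩ := hJ.exists_isTop hl
    have hti : t ≠ i := fun h => hit ⟨hl, h ▸ ht⟩
    have ht' : IsTop I (insert (atZero i) J) t := by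
      rw [IsTop, hfree]
      exact ⟨Finset.mem_erase.2 ⟨hti, ht.1⟩, fun p hp => ht.2 p (Finset.mem_of_mem_erase hp)⟩
    exact ⟨fun hp => hp.eq ht ▸ ht', fun hp => hp.eq ht' ▸ ht⟩
  have htc : last ∈ J → topCoord I J y = topCoord I (insert (atZero i) J) y := fun hl => by
    obtain ⟨t, ht⟩ := hJ.exists_isTop hl
    rw [ht.topCoord_eq, ((htop hl t).1 ht).topCoord_eq]
  have hmap : cellMap I ε εs J y = cellMap I ε εs (insert (atZero i) J) y := by
    refine cellMap_congr (fun p hp => ?_) (fun p hp => ?_) ?_ fun k hk => ?_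
    · by_cases hpi : p = i
      · subst hpi
        rw [if_neg hiI.2, if_pos (Finset.mem_insert_self _ _), hy, circ_zero]
      · simp only [hne p hpi]
    · by_cases hpi : p = i
      · subst hpi
        rw [if_neg hiI.2, if_pos (Finset.mem_insert_self _ _), stick, if_neg hit, hy, zero_mul]
      · simp only [hne p hpi]
        congr 1
        rw [stick, stick]
        congr 1
        · by_cases hl : last ∈ J
          · by_cases hp' : IsTop I J p
            · rw [if_pos ⟨hl, hp'⟩, if_pos ⟨Finset.mem_insert_of_mem hl, (htop hl p).1 hp'⟩]
            · rw [if_neg fun h => hp' h.2, if_neg fun h => hp' ((htop hl p).2 h.2)]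
          · rw [if_neg fun h => hl h.1, if_neg fun h => hl (by simpa using h.1)]
        · rw [hfree, Finset.filter_erase]
          by_cases him : i ∈ (free I J).filter (· < p)
          · rw [← Finset.mul_prod_erase _ _ him, hy, sub_zero, one_mul]
          · rw [Finset.erase_eq_of_notMem him]
    · by_cases hl : last ∈ J
      · simp [hl, htc hl]
      · simp [hl]
    · have hki : k ≠ i := fun h => hk (h ▸ hiI.1)
      exact cellMap_congr_apply hk (hne k hki) (by simp) rfl
  refine ⟨hmap, load_cell_congr hmap (fun k => ?_) (fun k hk => ?_) ?_⟩
  · by_cases hki : k = i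
    · subst hki
      rw [logZero_eq_log (hε.pos k) fun _ => hy, logZero_eq_log (hε.pos k) fun _ => hy, hmap]
    · exact logZero_congr hmap (hne k hki) fun _ => rfl
  · exact logOne_congr hk hmap (by simp) fun _ => rfl
  · exact logSimplex_congr hmap (by simp) htc

/-- At `y t = 1` the sticks use up the whole margin; the last coordinate is then `ε`, the starting
point of its circle, whose angle takes over the coordinate `t`. -/
theorem cell_insert_last (hε : AdmissibleRadii ε εs) (hJ : IsFaceSet I J)
    (hJ' : IsFaceSet I (insert last J)) (hl : last ∉ J)
    {t : Fin m} (ht : IsTop I J t) (hy : y t = 1) (hy' : y' t = 0) (h : ∀ k, k ≠ t → y k = y' k) :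
    cellMap I ε εs J y = cellMap I ε εs (insert last J) y' ∧
    (cell I ε εs x J).load (exponents a b c) y =
      (cell I ε εs x (insert last J)).load (exponents a b c) y' := by
  have hfree : free I J = free I (insert last J) := free_insert_last.symm
  have ht' : IsTop I (insert last J) t := (isTop_congr hfree).1 ht
  have htI := mem_free.1 ht.1
  have hmap : cellMap I ε εs J y = cellMap I ε εs (insert last J) y' := by
    refine cellMap_congr (fun p hp => ?_) (fun p hp => ?_) ?_ fun k hk => ?_
    · by_cases hpt : p = t
      · subst hpt
        simp [htI.2]
      · simp [h p hpt]
    · have : stick I J y p = stick I (insert last J) y' p ∨ atZero p ∈ J := by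
        by_cases hpJ : atZero p ∈ J
        · exact Or.inr hpJ
        refine Or.inl (stick_congr hfree ?_ fun p' hp' hlt => h p' ?_)
        · rw [if_neg fun h => hl h.1]
          by_cases hpt : p = t
          · subst hpt
            rw [if_pos ⟨Finset.mem_insert_self _ _, ht'⟩, hy]
          · rw [if_neg fun h => hpt (h.2.eq ht'), h p hpt]
        · rintro rfl
          exact absurd (ht.2 p (mem_free.2 ⟨hp, hpJ⟩)) (not_le.2 hlt)
      rcases this with h1 | h1
      · rw [h1]
        simp
      · simp [h1]
    · rw [if_neg hl, if_pos (Finset.mem_insert_self _ _), ht'.topCoord_eq, hy', circ_zero]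
    · exact cellMap_congr_apply hk (by simp) (by simp)
        (h k fun hkt => hk (hkt ▸ htI.1))
  refine ⟨hmap, load_cell_congr hmap (fun k => ?_) (fun k hk => ?_) ?_⟩
  · refine logZero_congr hmap (by simp) fun hk => h k ?_
    rintro rfl
    exact htI.2 hk
  · refine logOne_congr hk hmap (by simp) fun _ => h k ?_
    rintro rfl
    exact hk htI.1
  · rw [logSimplex_eq_log hJ hε.pos_last fun h => absurd h hl, logSimplex_eq_log hJ' hε.pos_last
      fun _ => by rw [ht'.topCoord_eq, hy'], hmap]

/-- When `last ∈ J`, the coordinate of the top index `t` is an angle, so the facet `s_t = εs t` is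
reached elsewhere: at `y p = 1` for the next largest free `p`, whose stick then takes everything. In
the tube around that facet `p` is the top index and carries the angle of the last circle, whence `y'
p = y t`. -/
theorem cell_insert_atZero_top (hε : AdmissibleRadii ε εs) (hl : last ∈ J)
    {t p : Fin m} (ht : IsTop I J t) (hp : IsTop I (insert (atZero t) J) p) (hyp : y p = 1)
    (hy't : y' t = 0) (hy'p : y' p = y t) (h : ∀ k, k ≠ t → k ≠ p → y k = y' k) :
    cellMap I ε εs J y = cellMap I ε εs (insert (atZero t) J) y' ∧
    (cell I ε εs x J).load (exponents a b c) y =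
      (cell I ε εs x (insert (atZero t) J)).load (exponents a b c) y' := by
  have htI := mem_free.1 ht.1
  have hfree : free I (insert (atZero t) J) = (free I J).erase t := free_insert_atZero t
  have hpf : p ∈ (free I J).erase t := hfree ▸ hp.1
  have hpt : p ≠ t := (Finset.mem_erase.1 hpf).1
  have hpI := mem_free.1 (Finset.mem_erase.1 hpf).2
  have hplt : p < t := lt_of_le_of_ne (ht.2 p (Finset.mem_erase.1 hpf).2) hpt
  have hmax : ∀ g ∈ free I J, g ≠ t → g ≤ p := fun g hg hgt =>
    hp.2 g (hfree ▸ Finset.mem_erase.2 ⟨hgt, hg⟩)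
  have hne : ∀ k, k ≠ t → (atZero k ∈ J ↔ atZero k ∈ insert (atZero t) J) := fun k hk => by
    simp [hk]
  have hmap : cellMap I ε εs J y = cellMap I ε εs (insert (atZero t) J) y' := by
    refine cellMap_congr (fun g hg => ?_) (fun g hg => ?_) ?_ fun k hk => ?_
    · by_cases hgt : g = t
      · subst hgt
        rw [if_neg htI.2, if_pos (Finset.mem_insert_self _ _), hy't, circ_zero]
      · simp only [← hne g hgt]
        by_cases hgp : g = p
        · subst hgp
          rw [if_neg hpI.2, if_neg hpI.2]
        · rw [h g hgt hgp]
    · by_cases hgt : g = t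
      · subst hgt
        rw [if_neg htI.2, if_pos (Finset.mem_insert_self _ _), stick,
          Finset.prod_eq_zero (Finset.mem_filter.2 ⟨(Finset.mem_erase.1 hpf).2, hplt⟩)
            (by rw [hyp, sub_self]), mul_zero]
      · simp only [← hne g hgt]
        by_cases hgJ : atZero g ∈ J
        · simp [hgJ]
        have hgp := hmax g (mem_free.2 ⟨hg, hgJ⟩) hgt
        rw [if_neg hgJ, if_neg hgJ, stick, stick, if_neg fun h => hgt (h.2.eq ht)]
        congr 1
        · by_cases hgp' : g = p
          · subst hgp'
            rw [if_pos ⟨Finset.mem_insert_of_mem hl, hp⟩, hyp]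
          · rw [if_neg fun h => hgp' (h.2.eq hp), h g hgt hgp']
        · rw [hfree, Finset.filter_erase, Finset.erase_eq_of_notMem (a := t)
            (s := (free I J).filter (· < g))
            fun hm => absurd (Finset.mem_filter.1 hm).2 (not_lt.2 (hgp.trans hplt.le))]
          refine Finset.prod_congr rfl fun g' hg' => ?_
          have hlt := (Finset.mem_filter.1 hg').2
          rw [h g' (hlt.trans (hgp.trans_lt hplt)).ne (hlt.trans_le hgp).ne]
    · rw [if_pos hl, if_pos (Finset.mem_insert_of_mem hl), ht.topCoord_eq, hp.topCoord_eq, hy'p]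
    · exact cellMap_congr_apply hk (hne k fun hkt => hk (hkt ▸ htI.1)) (by simp)
        (h k (fun hkt => hk (hkt ▸ htI.1)) fun hkp => hk (hkp ▸ hpI.1))
  refine ⟨hmap, load_cell_congr hmap (fun k => ?_) (fun k hk => ?_) ?_⟩
  · by_cases hkt : k = t
    · subst hkt
      rw [logZero_eq_log (hε.pos k) fun h => absurd h htI.2, logZero_eq_log (hε.pos k) fun _ => hy't,
        hmap]
    · refine logZero_congr hmap (hne k hkt) fun hk => h k hkt ?_
      rintro rfl
      exact hpI.2 hk
  · exact logOne_congr hk hmap (by simp) fun _ =>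
      h k (fun hkt => hk (hkt ▸ htI.1)) fun hkp => hk (hkp ▸ hpI.1)
  · exact logSimplex_congr hmap (by simp) fun _ => by
      rw [ht.topCoord_eq, hp.topCoord_eq, hy'p]

/-- Once `y p = 1`, all later sticks are `0`, so the coordinate `g` has no effect. -/
theorem cell_degenerate {p g : Fin m} (hp : p ∈ free I J) (hg : g ∈ free I J) (hpg : p < g)
    (hgt : ¬ (last ∈ J ∧ IsTop I J g)) (hy : y p = 1)
    (h : ∀ k, k ≠ g → y k = y' k) :
    cellMap I ε εs J y = cellMap I ε εs J y' ∧
    (cell I ε εs x J).load (exponents a b c) y =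
      (cell I ε εs x J).load (exponents a b c) y' := by
  have hgI := mem_free.1 hg
  have hy' : y' p = 1 := by rw [← h p hpg.ne, hy]
  have htc : last ∈ J → topCoord I J y = topCoord I J y' := fun hl =>
    topCoord_congr fun t ht => h t fun htg => hgt ⟨hl, htg ▸ ht⟩
  have hmap : cellMap I ε εs J y = cellMap I ε εs J y' := by
    refine cellMap_congr (fun k hk => ?_) (fun k hk => ?_) ?_ fun k hk => ?_
    · by_cases hkg : k = g
      · subst hkg
        rw [if_neg hgI.2, if_neg hgI.2]
      · rw [h k hkg]
    · by_cases hkJ : atZero k ∈ J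
      · rw [if_pos hkJ, if_pos hkJ]
      rw [if_neg hkJ, if_neg hkJ]
      by_cases hpk : p < k
      · rw [stick, stick, Finset.prod_eq_zero (Finset.mem_filter.2 ⟨hp, hpk⟩)
          (by rw [hy, sub_self]), Finset.prod_eq_zero (Finset.mem_filter.2 ⟨hp, hpk⟩)
          (by rw [hy', sub_self]), mul_zero, mul_zero]
      · have hkg : k < g := (not_lt.1 hpk).trans_lt hpg
        exact stick_congr rfl (by rw [h k hkg.ne]) fun k' _ hlt => h k' (hlt.trans hkg).ne
    · by_cases hl : last ∈ J
      · simp [hl, htc hl]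
      · simp [hl]
    · exact cellMap_congr_apply hk Iff.rfl Iff.rfl (h k fun hkg => hk (hkg ▸ hgI.1))
  refine ⟨hmap, load_cell_congr hmap (fun k => ?_) (fun k hk => ?_) ?_⟩
  · refine logZero_congr hmap Iff.rfl fun hk => h k ?_
    rintro rfl
    exact hgI.2 hk
  · refine logOne_congr hk hmap Iff.rfl fun _ => h k fun hkg => hk (hkg ▸ hgI.1)
  · exact logSimplex_congr hmap Iff.rfl htc

end loads

theorem isCircleCoord_of_atZero {m : ℕ} {I : Finset (Fin m)} {J : Finset (Factor m)} {i : Fin m}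
    (h : atZero i ∈ J) : IsCircleCoord I J i := Or.inl h

theorem isCircleCoord_of_atOne {m : ℕ} {I : Finset (Fin m)} {J : Finset (Factor m)} {i : Fin m}
    (h : atOne i ∈ J) : IsCircleCoord I J i := Or.inr (Or.inl h)

theorem isCircleCoord_of_last {m : ℕ} {I : Finset (Fin m)} {J : Finset (Factor m)} {i : Fin m}
    (h : last ∈ J ∧ IsTop I J i) : IsCircleCoord I J i := Or.inr (Or.inr h)

/-! ### The regularized chain is a twisted cycle -/

section cycle

variable {k : ℕ} {a : ℂ} {b c : Fin (k + 1) → ℂ} {I : Finset (Fin (k + 1))} {ε : ℝ}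
  {εs x : Fin (k + 1) → ℝ} {J J' : Finset (Factor (k + 1))}

/-- The class of a face of a cell modulo null chains. -/
def faceClass (a : ℂ) (b c : Fin (k + 1) → ℂ) (I : Finset (Fin (k + 1))) (ε : ℝ)
    (εs x : Fin (k + 1) → ℝ) (J : Finset (Factor (k + 1))) (i : Fin (k + 1)) (z : ℝ) :
    (LoadedCube (Factor (k + 1)) (k + 1) k →₀ ℂ) ⧸
      nullChains (polyMI I x) (exponents a b c) k :=
  (nullChains (polyMI I x) (exponents a b c) k).mkQ (Finsupp.single ((cell I ε εs x J).face i z) 1)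

theorem zero_mem_Icc : (0 : ℝ) ∈ Set.Icc (0 : ℝ) 1 := ⟨le_rfl, zero_le_one⟩

theorem one_mem_Icc : (1 : ℝ) ∈ Set.Icc (0 : ℝ) 1 := ⟨zero_le_one, le_rfl⟩

theorem insertNth_congr {i : Fin (k + 1)} {z z' : ℝ} (u : Fin k → ℝ) (j : Fin (k + 1))
    (hj : j ≠ i) : i.insertNth (α := fun _ => ℝ) z u j = i.insertNth (α := fun _ => ℝ) z' u j := by
  obtain ⟨l, rfl⟩ := Fin.exists_succAbove_eq hj
  simp

variable (a b c) in
theorem faceClass_eq_smul (hε : AdmissibleRadii ε εs) (hx : AdmissiblePoint ε εs x)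
    (hJ : IsFaceSet I J) (hJ' : IsFaceSet I J') {i : Fin (k + 1)} {z z' : ℝ}
    (hz : z ∈ Set.Icc (0 : ℝ) 1) (hz' : z' ∈ Set.Icc (0 : ℝ) 1) (κ : ℂ)
    (h : ∀ u : Fin k → ℝ, cellMap I ε εs J (i.insertNth (α := fun _ => ℝ) z u) =
        cellMap I ε εs J' (i.insertNth (α := fun _ => ℝ) z' u) ∧
      (cell I ε εs x J).load (exponents a b c) (i.insertNth (α := fun _ => ℝ) z u) =
        κ * (cell I ε εs x J').load (exponents a b c) (i.insertNth (α := fun _ => ℝ) z' u)) :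
    faceClass a b c I ε εs x J i z = κ • faceClass a b c I ε εs x J' i z' :=
  mk_single_eq_of_load ((isLoaded_cell hε hx hJ').face i hz') ((isLoaded_cell hε hx hJ).face i hz) κ
    fun u _ => h u

variable (a b c) in
theorem faceClass_eq (hε : AdmissibleRadii ε εs) (hx : AdmissiblePoint ε εs x)
    (hJ : IsFaceSet I J) (hJ' : IsFaceSet I J') {i : Fin (k + 1)} {z z' : ℝ}
    (hz : z ∈ Set.Icc (0 : ℝ) 1) (hz' : z' ∈ Set.Icc (0 : ℝ) 1)
    (h : ∀ u : Fin k → ℝ, cellMap I ε εs J (i.insertNth (α := fun _ => ℝ) z u) =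
        cellMap I ε εs J' (i.insertNth (α := fun _ => ℝ) z' u) ∧
      (cell I ε εs x J).load (exponents a b c) (i.insertNth (α := fun _ => ℝ) z u) =
        (cell I ε εs x J').load (exponents a b c) (i.insertNth (α := fun _ => ℝ) z' u)) :
    faceClass a b c I ε εs x J i z = faceClass a b c I ε εs x J' i z' := by
  rw [faceClass_eq_smul a b c hε hx hJ hJ' hz hz' 1 fun u => by simpa using h u, one_smul]

theorem faceClass_circle (hε : AdmissibleRadii ε εs) (hx : AdmissiblePoint ε εs x)
    (hJ : IsFaceSet I J) {i : Fin (k + 1)} {j : Factor (k + 1)}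
    (hij : (j = atZero i ∧ atZero i ∈ J) ∨ (j = atOne i ∧ atOne i ∈ J) ∨
      (j = last ∧ last ∈ J ∧ IsTop I J i)) :
    faceClass a b c I ε εs x J i 1 = (dCoeff I a b c j + 1) • faceClass a b c I ε εs x J i 0 := by
  have hcoord : IsCircleCoord I J i := by
    rcases hij with h | h | h
    exacts [Or.inl h.2, Or.inr (Or.inl h.2), Or.inr (Or.inr h.2)]
  refine faceClass_eq_smul a b c hε hx hJ hJ one_mem_Icc zero_mem_Icc _ fun u => ?_
  have h1 := fun j hj => insertNth_congr (i := i) (z := 1) (z' := 0) u j hj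
  have h2 := Fin.insertNth_apply_same (α := fun _ => ℝ) i 1 u
  have h3 := Fin.insertNth_apply_same (α := fun _ => ℝ) i 0 u
  refine ⟨cellMap_circle hJ hcoord h1 h2 h3, ?_⟩
  rcases hij with ⟨rfl, h⟩ | ⟨rfl, h⟩ | ⟨rfl, h⟩
  · exact load_circle_atZero hJ h h1 h2 h3
  · exact load_circle_atOne hJ h h1 h2 h3
  · exact load_circle_last hJ h.1 h.2 h1 h2 h3

theorem faceClass_degenerate (hε : AdmissibleRadii ε εs) (hx : AdmissiblePoint ε εs x)
    (hJ : IsFaceSet I J) {p g : Fin (k + 1)} (hp : p ∈ free I J) (hg : g ∈ free I J) (hpg : p < g)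
    (hgt : ¬ (last ∈ J ∧ IsTop I J g)) : faceClass a b c I ε εs x J p 1 = 0 := by
  obtain ⟨l, hl⟩ := Fin.exists_succAbove_eq (x := g) (y := p) hpg.ne'
  refine mk_single_eq_zero ((isLoaded_cell hε hx hJ).face p one_mem_Icc) l fun u _ u' _ huu' => ?_
  refine cell_degenerate hp hg hpg hgt (Fin.insertNth_apply_same (α := fun _ => ℝ) p 1 u)
    fun j hj => ?_
  rcases Fin.eq_self_or_eq_succAbove p j with rfl | ⟨l', rfl⟩
  · rw [Fin.insertNth_apply_same, Fin.insertNth_apply_same]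
  · rw [Fin.insertNth_apply_succAbove, Fin.insertNth_apply_succAbove]
    refine huu' l' ?_
    rintro rfl
    exact hj hl

/-- The two faces coincide after a cyclic permutation of coordinates, whose sign makes their
boundary contributions opposite. -/
theorem faceClass_top (hε : AdmissibleRadii ε εs) (hx : AdmissiblePoint ε εs x)
    (hJ : IsFaceSet I J) (hl : last ∈ J) {t p : Fin (k + 1)} (ht : IsTop I J t)
    (hp : IsTop I (insert (atZero t) J) p) (hJ' : IsFaceSet I (insert (atZero t) J)) :
    ((-1 : ℂ) ^ (p : ℕ)) • faceClass a b c I ε εs x J p 1 +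
      ((-1 : ℂ) ^ (t : ℕ)) • faceClass a b c I ε εs x (insert (atZero t) J) t 0 = 0 := by
  have hpf : p ∈ (free I J).erase t := free_insert_atZero (I := I) (J := J) t ▸ hp.1
  have hpt : p ≠ t := (Finset.mem_erase.1 hpf).1
  have hplt : p < t := lt_of_le_of_ne (ht.2 p (Finset.mem_erase.1 hpf).2) hpt
  obtain ⟨π, hsign, hπ⟩ := exists_perm_insertNth hplt
  have key : faceClass a b c I ε εs x J p 1 =
      ((1 : ℂ) * ((Equiv.Perm.sign π : ℤ) : ℂ)) •
        faceClass a b c I ε εs x (insert (atZero t) J) t 0 := by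
    refine mk_single_eq ((isLoaded_cell hε hx hJ').face t zero_mem_Icc)
      ((isLoaded_cell hε hx hJ).face p one_mem_Icc) π 1 fun u _ => ?_
    rw [one_mul]
    refine cell_insert_atZero_top hε hl ht hp
      (Fin.insertNth_apply_same (α := fun _ => ℝ) p 1 u)
      (Fin.insertNth_apply_same (α := fun _ => ℝ) t 0 _) ?_ fun j hjt hjp => ?_
    · rw [hπ u 1 0, if_neg hpt, if_pos rfl]
    · rw [hπ u 1 0, if_neg hjt, if_neg hjp]
  -- The sign is its own inverse, so the relation between `p` and `t` can be solved in either
  -- direction.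
  have hs : ((Equiv.Perm.sign π : ℤ) : ℂ) * (-1) ^ (p : ℕ) = -(-1) ^ (t : ℕ) := by
    have h1 : ((Equiv.Perm.sign π : ℤ) : ℂ) * ((Equiv.Perm.sign π : ℤ) : ℂ) = 1 := by
      rw [← Int.cast_mul, ← Units.val_mul, Int.units_mul_self, Units.val_one, Int.cast_one]
    have h2 : (-1 : ℂ) ^ (p : ℕ) = -(((Equiv.Perm.sign π : ℤ) : ℂ) * (-1) ^ (t : ℕ)) := by
      rw [hsign, neg_neg]
    rw [h2, mul_neg, ← mul_assoc, h1, one_mul]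
  rw [key, smul_smul, one_mul, mul_comm, hs, neg_smul, neg_add_cancel]

/-- The coefficient of a cell in the regularized cycle. -/
def cellCoeff {m : ℕ} (I : Finset (Fin m)) (a : ℂ) (b c : Fin m → ℂ) (J : Finset (Factor m)) : ℂ :=
  ∏ j ∈ J, facetSign j / dCoeff I a b c j

theorem dCoeff_ne_zero {m : ℕ} {a : ℂ} {b c : Fin m → ℂ} {I : Finset (Fin m)}
    (hb : ∀ k (n : ℤ), b k ≠ n) (hc : ∀ k (n : ℤ), c k ≠ n)
    (hcb : ∀ k (n : ℤ), c k - b k ≠ n) (ha : ∀ n : ℤ, a ≠ n) (j : Factor m) :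
    dCoeff I a b c j ≠ 0 := by
  rcases j with k | k | _
  · simp only [dCoeff, Sum.elim_inl]
    split_ifs
    · exact sub_ne_zero.2 (expTwoPiI_ne_one (hc k))
    · exact sub_ne_zero.2 (expTwoPiI_ne_one (hb k))
  · simp only [dCoeff, Sum.elim_inl, Sum.elim_inr]
    rw [← expTwoPiI_neg, ← expTwoPiI_add, ← sub_eq_add_neg]
    exact sub_ne_zero.2 (expTwoPiI_ne_one (hcb k))
  · simp only [dCoeff, Sum.elim_inr]
    rw [← expTwoPiI_neg]
    refine sub_ne_zero.2 (expTwoPiI_ne_one fun n h => ha (-n) ?_)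
    rw [Int.cast_neg, ← h, neg_neg]

/-- The monodromy defect of a circle cancels one denominator and leads back to the cell without that
circle. -/
theorem cellCoeff_mul_dCoeff {m : ℕ} {a : ℂ} {b c : Fin m → ℂ} {I : Finset (Fin m)}
    {J : Finset (Factor m)} {j : Factor m} (hj : j ∈ J) (hd : dCoeff I a b c j ≠ 0) :
    cellCoeff I a b c J * dCoeff I a b c j = facetSign j * cellCoeff I a b c (J.erase j) := by
  rw [cellCoeff, ← Finset.mul_prod_erase _ _ hj, cellCoeff]
  field_simp

open Classical in
-- Used to collect the starting faces of tubes at the cell they are attached to, that is, to sort by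
-- `J.erase j` instead of `J`.
theorem sum_faceSet_erase {m : ℕ} {I : Finset (Fin m)} {V : Type*} [AddCommMonoid V]
    (j : Factor m) (Φ : Finset (Factor m) → Finset (Factor m) → V) :
    ∑ J with IsFaceSet I J, (if j ∈ J then Φ (J.erase j) J else 0) =
      ∑ J with IsFaceSet I J,
        if j ∉ J ∧ IsFaceSet I (insert j J) then Φ J (insert j J) else 0 := by
  rw [← Finset.sum_filter, ← Finset.sum_filter]
  refine Finset.sum_nbij' (fun J => J.erase j) (fun J => insert j J) ?_ ?_ ?_ ?_ ?_
  · intro J hJ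
    simp only [Finset.mem_filter, Finset.mem_univ, true_and] at hJ ⊢
    refine ⟨hJ.1.of_subset (Finset.erase_subset _ _), Finset.notMem_erase _ _, ?_⟩
    rw [Finset.insert_erase hJ.2]
    exact hJ.1
  · intro J hJ
    simp only [Finset.mem_filter, Finset.mem_univ, true_and] at hJ ⊢
    exact ⟨hJ.2.2, Finset.mem_insert_self _ _⟩
  · intro J hJ
    exact Finset.insert_erase (Finset.mem_filter.1 hJ).2
  · intro J hJ
    exact Finset.erase_insert (Finset.mem_filter.1 hJ).2.1
  · intro J hJ
    rw [Finset.insert_erase (Finset.mem_filter.1 hJ).2]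

open Classical in
/-- The contributions of the faces of a cell and of the adjacent tubes cancel. -/
theorem sum_faces_eq_zero (hε : AdmissibleRadii ε εs) (hx : AdmissiblePoint ε εs x)
    (hJ : IsFaceSet I J) :
    ∑ i : Fin (k + 1), ((-1 : ℂ) ^ (i : ℕ)) •
      ((if IsCircleCoord I J i then 0 else
          faceClass a b c I ε εs x J i 1 - faceClass a b c I ε εs x J i 0) +
        (if atZero i ∉ J ∧ IsFaceSet I (insert (atZero i) J) then
          faceClass a b c I ε εs x (insert (atZero i) J) i 0 else 0) -
        (if atOne i ∉ J ∧ IsFaceSet I (insert (atOne i) J) then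
          faceClass a b c I ε εs x (insert (atOne i) J) i 0 else 0) -
        (if last ∉ J ∧ IsFaceSet I (insert last J) then
          (if IsTop I J i then faceClass a b c I ε εs x (insert last J) i 0 else 0) else 0)) = 0 := by
  -- An interval coordinate: its faces at the two ends cancel against the tubes around `0` and `1`.
  -- A face at `0` enters a boundary with a minus sign and one at `1` with a plus sign, so the two
  -- tubes need opposite signs.
  have hcompl : ∀ i, i ∉ I → ((if IsCircleCoord I J i then 0 else
          faceClass a b c I ε εs x J i 1 - faceClass a b c I ε εs x J i 0) +
        (if atZero i ∉ J ∧ IsFaceSet I (insert (atZero i) J) then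
          faceClass a b c I ε εs x (insert (atZero i) J) i 0 else 0) -
        (if atOne i ∉ J ∧ IsFaceSet I (insert (atOne i) J) then
          faceClass a b c I ε εs x (insert (atOne i) J) i 0 else 0) -
        (if last ∉ J ∧ IsFaceSet I (insert last J) then
          (if IsTop I J i then faceClass a b c I ε εs x (insert last J) i 0 else 0) else 0)) = 0 := by
    intro i hi
    have htop : ¬ IsTop I J i := fun h => hi (mem_free.1 h.1).1
    rw [if_neg htop, ite_self, sub_zero]
    by_cases h0 : atZero i ∈ J
    · rw [if_pos (isCircleCoord_of_atZero h0), if_neg fun h => h.1 h0, if_neg, zero_add, sub_zero]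
      exact fun h => h.2.2.1 i hi ⟨Finset.mem_insert_of_mem h0, Finset.mem_insert_self _ _⟩
    · by_cases h1 : atOne i ∈ J
      · rw [if_pos (isCircleCoord_of_atOne h1), if_neg, if_neg fun h => h.1 h1, zero_add, sub_zero]
        exact fun h => h.2.2.1 i hi ⟨Finset.mem_insert_self _ _, Finset.mem_insert_of_mem h1⟩
      · have hJ0 : IsFaceSet I (insert (atZero i) J) := by
          refine ⟨fun p hp h => hJ.1 p hp (by simpa using h), fun q hq h => ?_,
            fun h => hJ.2.2 ⟨by simpa using h.1, fun p hp => ?_⟩⟩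
          · by_cases hqi : q = i
            · subst hqi
              exact h1 (by simpa using h.2)
            · exact hJ.2.1 q hq ⟨by simpa [hqi] using h.1, by simpa using h.2⟩
          · have hpi : p ≠ i := ne_of_mem_of_not_mem hp hi
            simpa [hpi] using h.2 p hp
        have hJ1 : IsFaceSet I (insert (atOne i) J) := by
          refine ⟨fun p hp h => hJ.1 p hp ?_, fun q hq h => ?_,
            fun h => hJ.2.2 ⟨by simpa using h.1, fun p hp => by simpa using h.2 p hp⟩⟩
          · have hpi : p ≠ i := ne_of_mem_of_not_mem hp hi
            simpa [hpi] using h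
          · by_cases hqi : q = i
            · subst hqi
              exact h0 (by simpa using h.1)
            · exact hJ.2.1 q hq ⟨by simpa using h.1, by simpa [hqi] using h.2⟩
        have hnc : ¬ IsCircleCoord I J i := by
          rintro (h | h | h)
          exacts [h0 h, h1 h, htop h.2]
        rw [if_neg hnc, if_pos ⟨h0, hJ0⟩, if_pos ⟨h1, hJ1⟩,
          faceClass_eq a b c hε hx hJ hJ1 one_mem_Icc zero_mem_Icc fun u =>
            cell_insert_atOne_compl hε hJ hi h1 hJ1 (Fin.insertNth_apply_same (α := fun _ => ℝ) i 1 u)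
              (Fin.insertNth_apply_same (α := fun _ => ℝ) i 0 u) fun j hj => insertNth_congr u j hj,
          faceClass_eq a b c hε hx hJ hJ0 zero_mem_Icc zero_mem_Icc fun u =>
            cell_insert_atZero_compl hε hi h0 hJ0
              (Fin.insertNth_apply_same (α := fun _ => ℝ) i 0 u)]
        abel
  have hone : ∀ i ∈ I, ¬ (atOne i ∉ J ∧ IsFaceSet I (insert (atOne i) J)) := fun i hi h =>
    h.2.1 i hi (Finset.mem_insert_self _ _)
  have hcirc0 : ∀ i ∈ I, i ∉ free I J → atZero i ∈ J := fun i hi h => by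
    by_contra h'
    exact h (mem_free.2 ⟨hi, h'⟩)
  -- Adding `atZero i` could only produce all facets of the simplex, which is prevented by a second
  -- free index whenever `last ∈ J`.
  have hins : ∀ i ∈ free I J, (last ∈ J → ∃ p ∈ free I J, p ≠ i) →
      IsFaceSet I (insert (atZero i) J) := fun i hi hex => by
    have hiI := mem_free.1 hi
    refine ⟨fun p hp h => hJ.1 p hp (by simpa using h), fun q hq h => hJ.2.1 q hq ?_, fun h => ?_⟩
    · have hqi : q ≠ i := fun h' => hq (h' ▸ hiI.1)
      exact ⟨by simpa [hqi] using h.1, by simpa using h.2⟩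
    · obtain ⟨p, hp, hpi⟩ := hex (by simpa using h.1)
      have := h.2 p (mem_free.1 hp).1
      exact (mem_free.1 hp).2 (by simpa [hpi] using this)
  have hzero : ∀ i ∈ free I J, ¬ (last ∈ J ∧ IsTop I J i) → IsFaceSet I (insert (atZero i) J) →
      faceClass a b c I ε εs x J i 0 = faceClass a b c I ε εs x (insert (atZero i) J) i 0 :=
    fun i hi hit hJi => faceClass_eq a b c hε hx hJ hJi zero_mem_Icc zero_mem_Icc fun u =>
      cell_insert_atZero_free hε hJ hi hit (Fin.insertNth_apply_same (α := fun _ => ℝ) i 0 u)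
  have hnc : ∀ i ∈ free I J, ¬ (last ∈ J ∧ IsTop I J i) → ¬ IsCircleCoord I J i := by
    rintro i hi hit (h | h | h)
    exacts [(mem_free.1 hi).2 h, hJ.1 i (mem_free.1 hi).1 h, hit h]
  by_cases hl : last ∈ J
  · obtain ⟨t, ht⟩ := hJ.exists_isTop hl
    -- With `last ∈ J`, faces at `0` cancel the tubes of the free indices other than `t`; there
    -- remain the faces at `1` of these indices and the tube around `s_t = 0`.
    have hterm : ∀ i : Fin (k + 1), ((-1 : ℂ) ^ (i : ℕ)) •
      ((if IsCircleCoord I J i then 0 else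
          faceClass a b c I ε εs x J i 1 - faceClass a b c I ε εs x J i 0) +
        (if atZero i ∉ J ∧ IsFaceSet I (insert (atZero i) J) then
          faceClass a b c I ε εs x (insert (atZero i) J) i 0 else 0) -
        (if atOne i ∉ J ∧ IsFaceSet I (insert (atOne i) J) then
          faceClass a b c I ε εs x (insert (atOne i) J) i 0 else 0) -
        (if last ∉ J ∧ IsFaceSet I (insert last J) then
          (if IsTop I J i then faceClass a b c I ε εs x (insert last J) i 0 else 0) else 0)) =
      (if i ∈ (free I J).erase t then
        ((-1 : ℂ) ^ (i : ℕ)) • faceClass a b c I ε εs x J i 1 else 0) +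
      (if i = t then (if IsFaceSet I (insert (atZero t) J) then
        ((-1 : ℂ) ^ (t : ℕ)) • faceClass a b c I ε εs x (insert (atZero t) J) t 0 else 0)
        else 0) := by
      intro i
      by_cases hi : i ∈ I
      · rw [if_neg (hone i hi), if_neg fun h : last ∉ J ∧ _ => h.1 hl, sub_zero, sub_zero]
        by_cases hif : i ∈ free I J
        · by_cases hit : i = t
          · subst hit
            rw [if_pos (isCircleCoord_of_last ⟨hl, ht⟩), if_neg (Finset.notMem_erase _ _), if_pos rfl,
              zero_add, zero_add]
            by_cases hJi : IsFaceSet I (insert (atZero i) J)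
            · rw [if_pos ⟨(mem_free.1 hif).2, hJi⟩, if_pos hJi]
            · rw [if_neg fun h => hJi h.2, if_neg hJi, smul_zero]
          · have hit' : ¬ (last ∈ J ∧ IsTop I J i) := fun h => hit (h.2.eq ht)
            have hJi := hins i hif fun _ => ⟨t, ht.1, fun h => hit h.symm⟩
            rw [if_neg (hnc i hif hit'), if_pos ⟨(mem_free.1 hif).2, hJi⟩,
              if_pos (Finset.mem_erase.2 ⟨hit, hif⟩), if_neg hit, hzero i hif hit' hJi,
              sub_add_cancel, add_zero]
        · have h0 := hcirc0 i hi hif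
          rw [if_pos (isCircleCoord_of_atZero h0), if_neg fun h => h.1 h0,
            if_neg fun h => hif (Finset.mem_of_mem_erase h), if_neg fun h : i = t => hif (h ▸ ht.1),
            add_zero, smul_zero]
      · rw [hcompl i hi, smul_zero, if_neg fun h => hi (mem_free.1 (Finset.mem_of_mem_erase h)).1,
          if_neg fun h : i = t => hi (h ▸ (mem_free.1 ht.1).1), add_zero]
    rw [Finset.sum_congr rfl fun i _ => hterm i, Finset.sum_add_distrib, Finset.sum_ite_mem,
      Finset.univ_inter, Finset.sum_ite_eq' _ t, if_pos (Finset.mem_univ t)]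
    -- Among the faces at `1` only that of the second largest free index `p` is not degenerate, and
    -- it cancels the tube of `t`.
    by_cases hne : ((free I J).erase t).Nonempty
    · have hne' : (free I (insert (atZero t) J)).Nonempty := by rwa [free_insert_atZero]
      obtain ⟨p, hp⟩ := exists_isTop hne'
      have hpf : p ∈ (free I J).erase t := free_insert_atZero (I := I) (J := J) t ▸ hp.1
      have hJt := hins t ht.1 fun _ => ⟨p, Finset.mem_of_mem_erase hpf, (Finset.mem_erase.1 hpf).1⟩
      rw [if_pos hJt, Finset.sum_eq_single p, faceClass_top hε hx hJ hl ht hp hJt]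
      · intro i hi hip
        have hlt : i < p := lt_of_le_of_ne (hp.2 i (by rwa [free_insert_atZero])) hip
        rw [faceClass_degenerate hε hx hJ (Finset.mem_of_mem_erase hi) (Finset.mem_of_mem_erase hpf)
          hlt fun h => (Finset.mem_erase.1 hpf).1 (h.2.eq ht), smul_zero]
      · intro h
        exact absurd hpf h
    -- If `t` is the only free index, its tube would meet all facets of the simplex and does not
    -- occur.
    · rw [Finset.not_nonempty_iff_eq_empty.1 hne, Finset.sum_empty, if_neg, zero_add]
      intro hJt
      obtain ⟨p, hp⟩ := hJt.exists_isTop (Finset.mem_insert_of_mem hl)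
      exact hne ⟨p, free_insert_atZero (I := I) (J := J) t ▸ hp.1⟩
  -- Without `last` every coordinate cancels separately: a face at `1` is degenerate unless `i` is
  -- the top index, and then it is the start of the last circle.
  · refine Finset.sum_eq_zero fun i _ => ?_
    by_cases hi : i ∈ I
    · have hit' : ¬ (last ∈ J ∧ IsTop I J i) := fun h => hl h.1
      rw [if_neg (hone i hi), sub_zero]
      by_cases hif : i ∈ free I J
      · have hJi := hins i hif fun h => absurd h hl
        have hJl : IsFaceSet I (insert last J) := by
          refine ⟨fun p hp h => hJ.1 p hp (by simpa using h), fun q hq h => hJ.2.1 q hq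
            ⟨by simpa using h.1, by simpa using h.2⟩, fun h => ?_⟩
          have := h.2 i hi
          exact (mem_free.1 hif).2 (by simpa using this)
        rw [if_neg (hnc i hif hit'), if_pos ⟨(mem_free.1 hif).2, hJi⟩, if_pos ⟨hl, hJl⟩,
          hzero i hif hit' hJi, sub_add_cancel]
        by_cases hit : IsTop I J i
        · rw [if_pos hit, faceClass_eq a b c hε hx hJ hJl one_mem_Icc zero_mem_Icc fun u =>
            cell_insert_last hε hJ hJl hl hit (Fin.insertNth_apply_same (α := fun _ => ℝ) i 1 u)
              (Fin.insertNth_apply_same (α := fun _ => ℝ) i 0 u) fun j hj => insertNth_congr u j hj,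
            sub_self, smul_zero]
        · obtain ⟨t, ht⟩ := exists_isTop ⟨i, hif⟩
          have hlt : i < t := lt_of_le_of_ne (ht.2 i hif) fun h => hit (h ▸ ht)
          rw [if_neg hit, sub_zero, faceClass_degenerate hε hx hJ hif ht.1 hlt fun h => hl h.1,
            smul_zero]
      · have h0 := hcirc0 i hi hif
        rw [if_pos (isCircleCoord_of_atZero h0), if_neg fun h => h.1 h0, if_neg fun h : IsTop I J i => hif h.1,
          ite_self, add_zero, sub_zero, smul_zero]
    · rw [hcompl i hi, smul_zero]

open Classical in
-- In a circle direction the end face is `d_j + 1` times the starting face; the difference `d_j`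
-- lowers the coefficient of `J` to `facetSign j` times that of `J.erase j`. A coordinate is the
-- angle of at most one circle, so at most one of the last three terms is present.
theorem cellCoeff_smul_faces (hε : AdmissibleRadii ε εs) (hx : AdmissiblePoint ε εs x)
    (hd : ∀ j, dCoeff I a b c j ≠ 0) (hJ : IsFaceSet I J) (i : Fin (k + 1)) :
    cellCoeff I a b c J •
        (faceClass a b c I ε εs x J i 1 - faceClass a b c I ε εs x J i 0) =
      cellCoeff I a b c J • (if IsCircleCoord I J i then 0 else
          faceClass a b c I ε εs x J i 1 - faceClass a b c I ε εs x J i 0) +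
        (if atZero i ∈ J then cellCoeff I a b c (J.erase (atZero i)) •
          faceClass a b c I ε εs x J i 0 else 0) -
        (if atOne i ∈ J then cellCoeff I a b c (J.erase (atOne i)) •
          faceClass a b c I ε εs x J i 0 else 0) -
        (if last ∈ J then cellCoeff I a b c (J.erase last) • (if IsTop I (J.erase last) i then
          faceClass a b c I ε εs x J i 0 else 0) else 0) := by
  have hfree : last ∈ J → (IsTop I (J.erase last) i ↔ IsTop I J i) := fun hl => by
    refine isTop_congr ?_
    conv_rhs => rw [← Finset.insert_erase hl, free_insert_last]
  have hcirc : ∀ j : Factor (k + 1), j ∈ J → ((j = atZero i ∧ atZero i ∈ J) ∨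
      (j = atOne i ∧ atOne i ∈ J) ∨ (j = last ∧ last ∈ J ∧ IsTop I J i)) →
      cellCoeff I a b c J • (faceClass a b c I ε εs x J i 1 - faceClass a b c I ε εs x J i 0) =
      (facetSign j * cellCoeff I a b c (J.erase j)) • faceClass a b c I ε εs x J i 0 :=
    fun j hj h => by
      rw [faceClass_circle hε hx hJ h, add_smul, one_smul, add_sub_cancel_right, smul_smul,
        cellCoeff_mul_dCoeff hj (hd j)]
  by_cases h0 : atZero i ∈ J
  · have h1 : atOne i ∉ J := fun h1 => by
      by_cases hi : i ∈ I
      exacts [hJ.1 i hi h1, hJ.2.1 i hi ⟨h0, h1⟩]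
    have ht : ¬ IsTop I J i := fun h => (mem_free.1 h.1).2 h0
    have hl : (if last ∈ J then cellCoeff I a b c (J.erase last) •
        (if IsTop I (J.erase last) i then faceClass a b c I ε εs x J i 0 else 0) else 0) = 0 := by
      split_ifs with hl htop
      · exact absurd ((hfree hl).1 htop) ht
      · rw [smul_zero]
      · rfl
    rw [hl, if_pos (isCircleCoord_of_atZero h0), if_pos h0, if_neg h1,
      hcirc _ h0 (Or.inl ⟨rfl, h0⟩)]
    simp [facetSign]
  · by_cases h1 : atOne i ∈ J
    · have ht : ¬ IsTop I J i := fun h => hJ.1 i (mem_free.1 h.1).1 h1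
      have hl : (if last ∈ J then cellCoeff I a b c (J.erase last) •
          (if IsTop I (J.erase last) i then faceClass a b c I ε εs x J i 0 else 0) else 0) = 0 := by
        split_ifs with hl htop
        · exact absurd ((hfree hl).1 htop) ht
        · rw [smul_zero]
        · rfl
      rw [hl, if_pos (isCircleCoord_of_atOne h1), if_neg h0, if_pos h1,
        hcirc _ h1 (Or.inr (Or.inl ⟨rfl, h1⟩))]
      simp [facetSign]
    · rw [if_neg h0, if_neg h1]
      by_cases hl : last ∈ J ∧ IsTop I J i
      · rw [if_pos (isCircleCoord_of_last hl), if_pos hl.1,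
          if_pos ((hfree hl.1).2 hl.2), hcirc _ hl.1 (Or.inr (Or.inr ⟨rfl, hl⟩))]
        simp [facetSign]
      · have hnc : ¬ IsCircleCoord I J i := by
          rintro (h | h | h)
          exacts [h0 h, h1 h, hl h]
        have hl : (if last ∈ J then cellCoeff I a b c (J.erase last) •
            (if IsTop I (J.erase last) i then faceClass a b c I ε εs x J i 0 else 0) else 0)
            = 0 := by
          split_ifs with hl' htop
          · exact absurd ⟨hl', (hfree hl').1 htop⟩ hl
          · rw [smul_zero]
          · rfl
        rw [hl, if_neg hnc]
        simp

theorem mkQ_boundary_single (A : LoadedCube (Factor (k + 1)) (k + 1) (k + 1)) (z : ℂ) :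
    (nullChains (polyMI I x) (exponents a b c) k).mkQ (boundary (Finsupp.single A z)) =
      ∑ i : Fin (k + 1), ((-1 : ℂ) ^ (i : ℕ)) • z •
        ((nullChains (polyMI I x) (exponents a b c) k).mkQ (Finsupp.single (A.face i 1) 1) -
          (nullChains (polyMI I x) (exponents a b c) k).mkQ (Finsupp.single (A.face i 0) 1)) := by
  rw [boundary, Finsupp.lsum_single, LinearMap.toSpanSingleton_apply, map_smul, map_sum,
    Finset.smul_sum]
  refine Finset.sum_congr rfl fun i _ => ?_
  rw [map_smul, map_sub, smul_comm]

/-- Once the starting faces of the tubes are booked at the cells that they start from, the terms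
with the coefficient of a fixed `J` cancel among themselves. -/
theorem boundary_tildeDelta_mem (hε : AdmissibleRadii ε εs) (hx : AdmissiblePoint ε εs x)
    (hd : ∀ j, dCoeff I a b c j ≠ 0) :
    boundary (tildeDelta a b c I ε εs x) ∈ nullChains (polyMI I x) (exponents a b c) k := by
  classical
  rw [← Submodule.Quotient.mk_eq_zero, ← Submodule.mkQ_apply, tildeDelta, map_sum, map_sum]
  simp only [mkQ_boundary_single]
  rw [Finset.sum_comm]
  have key : ∀ i : Fin (k + 1), ∑ J with IsFaceSet I J, ((-1 : ℂ) ^ (i : ℕ)) •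
      cellCoeff I a b c J •
        (faceClass a b c I ε εs x J i 1 - faceClass a b c I ε εs x J i 0) =
      ∑ J with IsFaceSet I J, cellCoeff I a b c J • ((-1 : ℂ) ^ (i : ℕ)) •
      ((if IsCircleCoord I J i then 0 else
          faceClass a b c I ε εs x J i 1 - faceClass a b c I ε εs x J i 0) +
        (if atZero i ∉ J ∧ IsFaceSet I (insert (atZero i) J) then
          faceClass a b c I ε εs x (insert (atZero i) J) i 0 else 0) -
        (if atOne i ∉ J ∧ IsFaceSet I (insert (atOne i) J) then
          faceClass a b c I ε εs x (insert (atOne i) J) i 0 else 0) -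
        (if last ∉ J ∧ IsFaceSet I (insert last J) then
          (if IsTop I J i then faceClass a b c I ε εs x (insert last J) i 0 else 0) else 0)) := by
    intro i
    rw [← Finset.smul_sum, Finset.sum_congr rfl fun J hJ =>
      cellCoeff_smul_faces hε hx hd (Finset.mem_filter.1 hJ).2 i, Finset.sum_sub_distrib,
      Finset.sum_sub_distrib, Finset.sum_add_distrib,
      sum_faceSet_erase (atZero i) fun J' J => cellCoeff I a b c J' •
        faceClass a b c I ε εs x J i 0,
      sum_faceSet_erase (atOne i) fun J' J => cellCoeff I a b c J' •
        faceClass a b c I ε εs x J i 0,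
      sum_faceSet_erase last fun J' J => cellCoeff I a b c J' •
        (if IsTop I J' i then faceClass a b c I ε εs x J i 0 else 0),
      ← Finset.sum_add_distrib, ← Finset.sum_sub_distrib, ← Finset.sum_sub_distrib,
      Finset.smul_sum]
    refine Finset.sum_congr rfl fun J _ => ?_
    rw [smul_comm (cellCoeff I a b c J)]
    congr 1
    rw [smul_sub, smul_sub, smul_add]
    congr 1
    · congr 1
      · congr 1
        split_ifs <;> simp
      · split_ifs <;> simp
    · split_ifs <;> simp
  refine (Finset.sum_congr rfl fun i _ => key i).trans ?_
  rw [Finset.sum_comm]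
  refine Finset.sum_eq_zero fun J hJ => ?_
  rw [← Finset.smul_sum, sum_faces_eq_zero hε hx (Finset.mem_filter.1 hJ).2, smul_zero]

end cycle

section cycles

variable {m : ℕ} {a : ℂ} {b c : Fin m → ℂ} {I : Finset (Fin m)} {ε : ℝ} {εs x : Fin m → ℝ}

theorem tildeDelta_mem_twistedChains (hε : AdmissibleRadii ε εs) (hx : AdmissiblePoint ε εs x) :
    tildeDelta a b c I ε εs x ∈ twistedChains (polyMI I x) m := by
  classical
  rw [tildeDelta]
  exact Submodule.sum_mem _ fun J hJ => Finsupp.single_mem_supported ℂ _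
    (isLoaded_cell hε hx (Finset.mem_filter.1 hJ).2)

theorem isTwistedCycle_tildeDelta (hε : AdmissibleRadii ε εs) (hx : AdmissiblePoint ε εs x)
    (hd : ∀ j, dCoeff I a b c j ≠ 0) :
    IsTwistedCycle (polyMI I x) (exponents a b c) m (tildeDelta a b c I ε εs x) := by
  cases m with
  | zero => exact tildeDelta_mem_twistedChains hε hx
  | succ k => exact ⟨tildeDelta_mem_twistedChains hε hx, boundary_tildeDelta_mem hε hx hd⟩

end cycles

/-! ### Pushforward of twisted chains -/

section pushforward

variable {ι : Type} {m k : ℕ} {P P' : ι → (Fin m → ℂ) → ℂ} {Φ : (Fin m → ℂ) → Fin m → ℂ}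
  {κ : ι → ℂ} {A : LoadedCube ι m k}

theorem LoadedCube.IsLoaded.push (hA : A.IsLoaded P') (hΦ : ContDiff ℝ ∞ Φ)
    (h : ∀ f s, P f (Φ s) = Complex.exp (κ f) * P' f s) : (A.push Φ κ).IsLoaded P := by
  refine ⟨hΦ.comp_contDiffOn hA.1, fun y hy f => ?_, fun f => ⟨(hA.2.2 f).1.add continuousOn_const,
    fun y hy => ?_⟩⟩
  · rw [LoadedCube.push, h]
    exact mul_ne_zero (Complex.exp_ne_zero _) (hA.2.1 y hy f)
  · change Complex.exp (A.logBranch f y + κ f) = P f (Φ (A.map y))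
    rw [Complex.exp_add, (hA.2.2 f).2 y hy, h, mul_comm]

/-- The pushforward rescales every load by the same constant, so it respects the relations between
loaded cubes. -/
theorem LoadedCube.load_push [Fintype ι] (lam : ι → ℂ) (y : Fin k → ℝ) :
    (A.push Φ κ).load lam y = Complex.exp (∑ f, lam f * κ f) * A.load lam y := by
  rw [LoadedCube.load, LoadedCube.load, ← Complex.exp_add, ← Finset.sum_add_distrib]
  congr 1
  refine Finset.sum_congr rfl fun f _ => ?_
  change lam f * (A.logBranch f y + κ f) = _
  ring

theorem pushforward_eq (Δ : LoadedCube ι m k →₀ ℂ) :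
    pushforward Φ κ Δ = Finsupp.lmapDomain ℂ ℂ (LoadedCube.push Φ κ) Δ := rfl

theorem pushforward_mem_twistedChains (hΦ : ContDiff ℝ ∞ Φ)
    (h : ∀ f s, P f (Φ s) = Complex.exp (κ f) * P' f s) {Δ : LoadedCube ι m k →₀ ℂ}
    (hΔ : Δ ∈ twistedChains P' k) : pushforward Φ κ Δ ∈ twistedChains P k := by
  classical
  refine (Finsupp.mem_supported ℂ _).2 fun B hB => ?_
  obtain ⟨A, hA, rfl⟩ := Finset.mem_image.1 (Finsupp.mapDomain_support hB)
  exact ((Finsupp.mem_supported ℂ _).1 hΔ hA).push hΦ h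

theorem boundary_pushforward (Δ : LoadedCube ι m (k + 1) →₀ ℂ) :
    boundary (pushforward Φ κ Δ) = pushforward Φ κ (boundary Δ) := by
  suffices boundary ∘ₗ Finsupp.lmapDomain ℂ ℂ (LoadedCube.push (k := k + 1) Φ κ) =
      Finsupp.lmapDomain ℂ ℂ (LoadedCube.push Φ κ) ∘ₗ boundary from LinearMap.congr_fun this Δ
  refine Finsupp.lhom_ext fun A z => ?_
  simp only [LinearMap.comp_apply, Finsupp.lmapDomain_apply, Finsupp.mapDomain_single, boundary,
    Finsupp.lsum_single, LinearMap.toSpanSingleton_apply, Finsupp.mapDomain_smul]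
  congr 1
  rw [← Finsupp.lmapDomain_apply ℂ ℂ, map_sum]
  refine Finset.sum_congr rfl fun i _ => ?_
  rw [map_smul, map_sub, Finsupp.lmapDomain_apply, Finsupp.lmapDomain_apply,
    Finsupp.mapDomain_single, Finsupp.mapDomain_single]
  rfl

theorem pushforward_mem_nullChains [Fintype ι] {lam : ι → ℂ} (hΦ : ContDiff ℝ ∞ Φ)
    (h : ∀ f s, P f (Φ s) = Complex.exp (κ f) * P' f s) {w : LoadedCube ι m k →₀ ℂ}
    (hw : w ∈ nullChains P' lam k) : pushforward Φ κ w ∈ nullChains P lam k := by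
  suffices nullChains P' lam k ≤
      (nullChains P lam k).comap (Finsupp.lmapDomain ℂ ℂ (LoadedCube.push Φ κ)) from this hw
  refine Submodule.span_le.2 ?_
  rintro w (⟨A, B, π, μ, hA, hB, hAB, rfl⟩ | ⟨A, i, hA, hAA, rfl⟩)
  · refine Submodule.subset_span (Or.inl ⟨A.push Φ κ, B.push Φ κ, π, μ, hA.push hΦ h, hB.push hΦ h,
      fun y hy => ⟨congrArg Φ (hAB y hy).1, ?_⟩, ?_⟩)
    · rw [LoadedCube.load_push, LoadedCube.load_push, (hAB y hy).2]
      ring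
    · rw [map_sub, Finsupp.lmapDomain_apply, Finsupp.lmapDomain_apply, Finsupp.mapDomain_single,
        Finsupp.mapDomain_single]
  · refine Submodule.subset_span (Or.inr ⟨A.push Φ κ, i, hA.push hΦ h,
      fun y hy y' hy' hyy => ⟨congrArg Φ (hAA y hy y' hy' hyy).1, ?_⟩, ?_⟩)
    · rw [LoadedCube.load_push, LoadedCube.load_push, (hAA y hy y' hy' hyy).2]
    · rw [Finsupp.lmapDomain_apply, Finsupp.mapDomain_single]

theorem IsTwistedCycle.pushforward [Fintype ι] {lam : ι → ℂ} (hΦ : ContDiff ℝ ∞ Φ)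
    (h : ∀ f s, P f (Φ s) = Complex.exp (κ f) * P' f s) {Δ : LoadedCube ι m k →₀ ℂ}
    (hΔ : IsTwistedCycle P' lam k Δ) : IsTwistedCycle P lam k (pushforward Φ κ Δ) := by
  cases k with
  | zero => exact pushforward_mem_twistedChains hΦ h hΔ
  | succ k =>
    refine ⟨pushforward_mem_twistedChains hΦ h hΔ.1, ?_⟩
    rw [boundary_pushforward]
    exact pushforward_mem_nullChains hΦ h hΔ.2

end pushforward

/-! ### The map `ι_I` and the integral over `Δ_I`. -/

section iota

variable {m : ℕ} {a : ℂ} {b c : Fin m → ℂ} {I : Finset (Fin m)} {ε : ℝ} {εs x : Fin m → ℝ}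
  {J : Finset (Factor m)}

/-- The linear map `iotaMap`. -/
def iotaCLM (I : Finset (Fin m)) (x : Fin m → ℝ) : (Fin m → ℂ) →L[ℝ] Fin m → ℂ :=
  ContinuousLinearMap.pi fun k => (if k ∈ I then ((x k : ℂ))⁻¹ else 1) •
    ContinuousLinearMap.proj (R := ℝ) (φ := fun _ => ℂ) k

theorem iotaCLM_apply (s : Fin m → ℂ) (k : Fin m) :
    iotaCLM I x s k = (if k ∈ I then ((x k : ℂ))⁻¹ else 1) * s k := rfl

theorem iotaMap_eq : iotaMap I x = iotaCLM I x := by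
  funext s k
  rw [iotaCLM_apply, iotaMap]
  split_ifs
  · rw [div_eq_inv_mul]
  · rw [one_mul]

theorem polyM_iotaMap (hx : ∀ k, 0 < x k) (f : Factor m) (s : Fin m → ℂ) :
    polyM x f (iotaMap I x s) = Complex.exp (iotaLog I x f) * polyMI I x f s := by
  have hne : ∀ k, (x k : ℂ) ≠ 0 := fun k => Complex.ofReal_ne_zero.2 (hx k).ne'
  have hexp : ∀ k, Complex.exp (-(Real.log (x k) : ℂ)) = (x k : ℂ)⁻¹ := fun k => by
    rw [Complex.exp_neg, ← Complex.ofReal_exp, Real.exp_log (hx k)]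
  rcases f with k | k | ⟨⟩
  · change iotaMap I x s k = Complex.exp (if k ∈ I then _ else _) * s k
    rw [iotaMap]
    split_ifs
    · rw [hexp, div_eq_inv_mul]
    · rw [Complex.exp_zero, one_mul]
  · change 1 - iotaMap I x s k = Complex.exp (if k ∈ I then _ else _) *
      (if k ∈ I then s k - (x k : ℂ) else 1 - s k)
    rw [iotaMap]
    split_ifs
    -- The summand `-πi` of the logarithm is the sign in `1 - s_k / x_k = -(s_k - x_k) / x_k`.
    · rw [Complex.exp_sub, hexp, Complex.exp_pi_mul_I]
      field_simp [hne k]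
      ring
    · rw [Complex.exp_zero, one_mul]
  · change 1 - ∑ k, (x k : ℂ) * iotaMap I x s k = Complex.exp 0 *
      (1 - ∑ p ∈ I, s p - ∑ q ∈ Iᶜ, (x q : ℂ) * s q)
    rw [Complex.exp_zero, one_mul, ← Finset.sum_add_sum_compl I, sub_sub]
    congr 2
    · refine Finset.sum_congr rfl fun k hk => ?_
      rw [iotaMap, if_pos hk, mul_div_cancel₀ _ (hne k)]
    · refine Finset.sum_congr rfl fun k hk => ?_
      rw [iotaMap, if_neg (Finset.mem_compl.1 hk)]

theorem isTwistedCycle_Delta (hε : AdmissibleRadii ε εs) (hx : AdmissiblePoint ε εs x)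
    (hd : ∀ j, dCoeff I a b c j ≠ 0) :
    IsTwistedCycle (polyM x) (exponents a b c) m (Delta a b c I ε εs x) :=
  (isTwistedCycle_tildeDelta hε hx hd).pushforward
    (iotaMap_eq (I := I) (x := x) ▸ (iotaCLM I x).contDiff) (polyM_iotaMap hx.pos)

theorem uniqueDiffOn_unitCube (k : ℕ) : UniqueDiffOn ℝ (unitCube k) := by
  rw [unitCube, ← Set.pi_univ_Icc]
  exact UniqueDiffOn.univ_pi fun _ => uniqueDiffOn_Icc zero_lt_one

/-- For `p ∈ I` the logarithms `-log x_p` and `-log x_p - πi` are weighted by `b_p` and `c_p - b_p -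
1`; they add up to `(1 - c_p) log x_p + πi (b_p - c_p + 1)`. -/
theorem exp_sum_exponents_mul_iotaLog (hx : ∀ k, 0 < x k) :
    Complex.exp (∑ f, exponents a b c f * iotaLog I x f) =
      phaseFactor b c I * ∏ p ∈ I, (x p : ℂ) ^ (1 - c p) := by
  have h : ∀ p ∈ I, (x p : ℂ) ^ (1 - c p) = Complex.exp ((Real.log (x p) : ℂ) * (1 - c p)) := by
    intro p _
    rw [Complex.cpow_def_of_ne_zero (Complex.ofReal_ne_zero.2 (hx p).ne'), Complex.ofReal_log (hx p).le]
  rw [phaseFactor, Finset.prod_congr rfl h, ← Complex.exp_sum, ← Complex.exp_add]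
  congr 1
  rw [Fintype.sum_sum_type, Fintype.sum_sum_type]
  simp only [exponents, iotaLog, Sum.elim_inl, Sum.elim_inr, Finset.univ_unique, Finset.sum_const,
    mul_zero, smul_zero, add_zero, mul_ite, Finset.sum_ite_mem, Finset.univ_inter]
  rw [Finset.card_eq_sum_ones, Nat.cast_sum, ← Finset.sum_sub_distrib, ← Finset.sum_add_distrib,
    ← Finset.sum_add_distrib, Finset.mul_sum, ← Finset.sum_add_distrib]
  refine Finset.sum_congr rfl fun p _ => ?_
  push_cast
  ring

/-- The form `φ` is invariant under rescaling of the coordinates, so only the constant factor of the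
load remains. -/
theorem integral_push_cell (hε : AdmissibleRadii ε εs) (hx : AdmissiblePoint ε εs x)
    (hJ : IsFaceSet I J) :
    ((cell I ε εs x J).push (iotaMap I x) (iotaLog I x)).integral (exponents a b c) phiCoeff =
      (phaseFactor b c I * ∏ p ∈ I, (x p : ℂ) ^ (1 - c p)) *
        (cell I ε εs x J).integral (exponents a b c) phiCoeff := by
  rw [LoadedCube.integral, LoadedCube.integral, ← MeasureTheory.integral_const_mul]
  refine MeasureTheory.setIntegral_congr_fun measurableSet_Icc fun y hy => ?_
  set A := cell I ε εs x J
  have hdiff : DifferentiableWithinAt ℝ A.map (unitCube m) y :=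
    ((isLoaded_cell hε hx hJ).1.differentiableOn (by simp)) y hy
  have hfd : ∀ i j, fderivWithin ℝ (A.push (iotaMap I x) (iotaLog I x)).map (unitCube m) y
      (Pi.single j 1) i = (if i ∈ I then ((x i : ℂ))⁻¹ else 1) *
        fderivWithin ℝ A.map (unitCube m) y (Pi.single j 1) i := by
    intro i j
    have : (A.push (iotaMap I x) (iotaLog I x)).map = iotaCLM I x ∘ A.map := by
      rw [← iotaMap_eq]; rfl
    rw [this, ((iotaCLM I x).hasFDerivAt.comp_hasFDerivWithinAt y
      hdiff.hasFDerivWithinAt).fderivWithin (uniqueDiffOn_unitCube m y hy)]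
    rfl
  simp only [hfd]
  rw [LoadedCube.load_push, exp_sum_exponents_mul_iotaLog hx.pos]
  have hdet := Matrix.det_mul_column (fun i => if i ∈ I then ((x i : ℂ))⁻¹ else 1)
    (Matrix.of fun i j : Fin m => fderivWithin ℝ A.map (unitCube m) y (Pi.single j 1) i)
  simp only [Matrix.of_apply] at hdet
  rw [hdet]
  -- The Jacobian `∏ x_p⁻¹` of the linear map against the change of `1 / (t_1 ⋯ t_m)`.
  have hphi : phiCoeff ((A.push (iotaMap I x) (iotaLog I x)).map y) *
      (∏ i, if i ∈ I then ((x i : ℂ))⁻¹ else 1) = phiCoeff (A.map y) := by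
    have : (A.push (iotaMap I x) (iotaLog I x)).map y = iotaCLM I x (A.map y) := by
      rw [← iotaMap_eq]; rfl
    rw [this, phiCoeff, phiCoeff]
    simp only [iotaCLM_apply]
    rw [Finset.prod_mul_distrib, mul_inv, mul_right_comm, inv_mul_cancel₀, one_mul]
    refine Finset.prod_ne_zero_iff.2 fun i _ => ?_
    split_ifs
    · exact inv_ne_zero (Complex.ofReal_ne_zero.2 (hx.pos i).ne')
    · exact one_ne_zero
  rw [← hphi]
  ring

theorem twistedIntegral_single_sum {ι κ : Type} [Fintype ι] (lam : ι → ℂ)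
    (h : (Fin m → ℂ) → ℂ) (s : Finset κ) (A : κ → LoadedCube ι m m) (z : κ → ℂ) :
    twistedIntegral lam h (∑ j ∈ s, Finsupp.single (A j) (z j)) =
      ∑ j ∈ s, z j * (A j).integral lam h := by
  rw [twistedIntegral, ← Finsupp.sum_finsetSum_index (fun _ => zero_mul _)
    (fun _ _ _ => add_mul _ _ _)]
  exact Finset.sum_congr rfl fun j _ => Finsupp.sum_single_index (zero_mul _)

open Classical in
theorem FInt_eq_sum : FInt a b c I ε εs x = ∑ J with IsFaceSet I J, cellCoeff I a b c J *
    (cell I ε εs x J).integral (exponents a b c) phiCoeff :=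
  twistedIntegral_single_sum _ _ _ _ _

theorem twistedIntegral_Delta (hε : AdmissibleRadii ε εs) (hx : AdmissiblePoint ε εs x) :
    twistedIntegral (exponents a b c) phiCoeff (Delta a b c I ε εs x) =
      phaseFactor b c I * (∏ p ∈ I, (x p : ℂ) ^ (1 - c p)) * FInt a b c I ε εs x := by
  classical
  rw [Delta, tildeDelta, pushforward_eq, map_sum]
  simp only [Finsupp.lmapDomain_apply, Finsupp.mapDomain_single]
  rw [twistedIntegral_single_sum, FInt_eq_sum, Finset.mul_sum]
  refine Finset.sum_congr rfl fun J hJ => ?_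
  rw [integral_push_cell hε hx (Finset.mem_filter.1 hJ).2, cellCoeff]
  ring

end iota

/-! ### Regularized circles and segments -/

section oneDim

open MeasureTheory

/-- Because `R > 1`, the Taylor series converges absolutely at `1`, which dominates it uniformly on
the closed unit disc and permits termwise integration. -/
theorem hasSum_integral_comp_of_differentiableOn {g : ℂ → ℂ} {R : ℝ} (hR : 1 < R)
    (hg : DifferentiableOn ℂ g (Metric.ball 0 R)) {w φ : ℝ → ℂ}
    (hw : ContinuousOn w (Set.Icc 0 1)) (hφ : ContinuousOn φ (Set.Icc 0 1))
    (h : ∀ t ∈ Set.Icc (0 : ℝ) 1, ‖φ t‖ ≤ 1) :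
    HasSum (fun n : ℕ => ((n.factorial : ℂ)⁻¹ * iteratedDeriv n g 0) *
      ∫ t in Set.Icc (0 : ℝ) 1, w t * φ t ^ n) (∫ t in Set.Icc (0 : ℝ) 1, w t * g (φ t)) := by
  have hsum : ∀ z : ℂ, ‖z‖ ≤ 1 →
      HasSum (fun n : ℕ => ((n.factorial : ℂ)⁻¹ * iteratedDeriv n g 0) * z ^ n) (g z) := by
    intro z hz
    refine hasSum_of_eq (Complex.hasSum_taylorSeries_on_ball hg (z := z)
      (by simpa using hz.trans_lt hR)) fun n => ?_
    rw [sub_zero, smul_eq_mul, smul_eq_mul]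
    ring
  have hs := (hsum 1 (by simp)).summable.norm
  simp only [one_pow, mul_one] at hs
  obtain ⟨W, hW⟩ := isCompact_Icc.exists_bound_of_continuousOn hw
  have key := hasSum_integral_of_dominated_convergence (μ := volume.restrict (Set.Icc (0 : ℝ) 1))
    (F := fun (n : ℕ) t => ((n.factorial : ℂ)⁻¹ * iteratedDeriv n g 0) * (w t * φ t ^ n))
    (f := fun t => w t * g (φ t))
    (fun n _ => ‖((n.factorial : ℂ)⁻¹ * iteratedDeriv n g 0)‖ * W)
    (fun n => ((continuousOn_const.mul (hw.mul (hφ.pow n))).aestronglyMeasurable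
      measurableSet_Icc)) (fun n => ?_) ?_ ?_ ?_
  · refine hasSum_of_eq key fun n => ?_
    rw [integral_const_mul]
  · refine (ae_restrict_iff' measurableSet_Icc).2 (Filter.Eventually.of_forall fun t ht => ?_)
    rw [norm_mul]
    refine mul_le_mul_of_nonneg_left ?_ (norm_nonneg _)
    rw [norm_mul, norm_pow]
    exact (mul_le_of_le_one_right (norm_nonneg _)
      (pow_le_one₀ (norm_nonneg _) (h t ht))).trans (hW t ht)
  · exact Filter.Eventually.of_forall fun t => hs.mul_right W
  · exact integrable_const _
  · refine (ae_restrict_iff' measurableSet_Icc).2 (Filter.Eventually.of_forall fun t ht => ?_)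
    refine hasSum_of_eq ((hsum (φ t) (h t ht)).mul_left (w t)) fun n => by ring

/-- The weight of a regularized circle. -/
def circleWeight (ν : ℂ) (t : ℝ) : ℂ :=
  2 * Real.pi * Complex.I * expTwoPiI (ν * t) / (expTwoPiI ν - 1)

theorem continuous_expTwoPiI : Continuous expTwoPiI := by
  unfold expTwoPiI
  fun_prop

theorem continuous_circleWeight (ν : ℂ) : Continuous (circleWeight ν) := by
  unfold circleWeight
  exact (continuous_const.mul (continuous_expTwoPiI.comp (by fun_prop))).div_const _

theorem continuous_expTwoPiI_ofReal : Continuous fun t : ℝ => expTwoPiI t :=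
  continuous_expTwoPiI.comp Complex.continuous_ofReal

theorem norm_expTwoPiI_ofReal (t : ℝ) : ‖expTwoPiI t‖ = 1 := by
  rw [expTwoPiI, show 2 * (Real.pi : ℂ) * Complex.I * t = ((2 * Real.pi * t : ℝ) : ℂ) * Complex.I by
    push_cast; ring, Complex.norm_exp_ofReal_mul_I]

theorem continuous_ofReal_cpow {ν : ℂ} (hν : 1 < ν.re) : Continuous fun t : ℝ => (t : ℂ) ^ (ν - 1) :=
  Complex.continuous_ofReal_cpow_const (by simpa using hν)

/-- Over a full turn `e^{2πi(ν + n)t}` has the integral `(e^{2πiν} - 1) / (2πi (ν + n))`; the weight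
is normalized to leave `(ν + n)⁻¹`, the moment of the radius. -/
theorem integral_circleWeight_mul_pow {ν : ℂ} (hν : 1 < ν.re) (h1 : expTwoPiI ν ≠ 1) (n : ℕ) :
    ∫ t in Set.Icc (0 : ℝ) 1, circleWeight ν t * expTwoPiI t ^ n = (ν + n)⁻¹ := by
  have hne : ν + n ≠ 0 := fun h => by
    have := congrArg Complex.re h
    simp only [Complex.add_re, Complex.natCast_re, Complex.zero_re] at this
    have : (0 : ℝ) ≤ n := n.cast_nonneg
    linarith
  have hpi : (2 * Real.pi * Complex.I : ℂ) ≠ 0 := Complex.two_pi_I_ne_zero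
  have h2 := sub_ne_zero.2 h1
  have hfun : ∀ t : ℝ, circleWeight ν t * expTwoPiI t ^ n =
      (2 * Real.pi * Complex.I / (expTwoPiI ν - 1)) *
        Complex.exp ((2 * Real.pi * Complex.I * (ν + n)) * t) := by
    intro t
    rw [circleWeight, expTwoPiI, expTwoPiI, expTwoPiI, ← Complex.exp_nat_mul,
      show (2 * Real.pi * Complex.I * (ν + n)) * (t : ℂ) = 2 * Real.pi * Complex.I * (ν * t) +
        n * (2 * Real.pi * Complex.I * t) by ring, Complex.exp_add]
    ring
  simp only [hfun]
  rw [integral_const_mul, integral_Icc_eq_integral_Ioc, ← intervalIntegral.integral_of_le zero_le_one,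
    integral_exp_mul_complex (mul_ne_zero hpi hne), Complex.ofReal_one, Complex.ofReal_zero, mul_one,
    mul_zero, Complex.exp_zero]
  have : Complex.exp (2 * Real.pi * Complex.I * (ν + n)) = expTwoPiI ν := by
    change expTwoPiI (ν + n) = _
    have := expTwoPiI_intCast n
    rw [Int.cast_natCast] at this
    rw [expTwoPiI_add, this, mul_one]
  rw [this]
  field_simp

theorem integral_cpow_mul_pow {ν : ℂ} (hν : 1 < ν.re) (n : ℕ) :
    ∫ t in Set.Icc (0 : ℝ) 1, (t : ℂ) ^ (ν - 1) * (t : ℂ) ^ n = (ν + n)⁻¹ := by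
  have hne : ν + n ≠ 0 := fun h => by
    have := congrArg Complex.re h
    simp only [Complex.add_re, Complex.natCast_re, Complex.zero_re] at this
    have : (0 : ℝ) ≤ n := n.cast_nonneg
    linarith
  rw [integral_Icc_eq_integral_Ioc, setIntegral_congr_fun (g := fun t : ℝ => (t : ℂ) ^ (ν - 1 + n))
    measurableSet_Ioc fun t ht => ?_, ← intervalIntegral.integral_of_le zero_le_one, integral_cpow,
    show ν - 1 + n + 1 = ν + n by ring, Complex.ofReal_one, Complex.ofReal_zero, Complex.one_cpow,
    Complex.zero_cpow hne, sub_zero, one_div]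
  · left
    simp only [Complex.add_re, Complex.sub_re, Complex.one_re, Complex.natCast_re]
    have : (0 : ℝ) ≤ n := n.cast_nonneg
    linarith
  · change (t : ℂ) ^ (ν - 1) * (t : ℂ) ^ n = (t : ℂ) ^ (ν - 1 + n)
    rw [Complex.cpow_add _ _ (Complex.ofReal_ne_zero.2 ht.1.ne'), Complex.cpow_natCast]

/-- The integral over a regularized circle is the integral over its radius. -/
theorem integral_circleWeight {ν : ℂ} (hν : 1 < ν.re) (h1 : expTwoPiI ν ≠ 1) {g : ℂ → ℂ} {R : ℝ}
    (hR : 1 < R) (hg : DifferentiableOn ℂ g (Metric.ball 0 R)) :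
    ∫ t in Set.Icc (0 : ℝ) 1, circleWeight ν t * g (expTwoPiI t) =
      ∫ t in Set.Icc (0 : ℝ) 1, (t : ℂ) ^ (ν - 1) * g t := by
  have hc := hasSum_integral_comp_of_differentiableOn hR hg (continuous_circleWeight ν).continuousOn
    continuous_expTwoPiI_ofReal.continuousOn fun t _ => (norm_expTwoPiI_ofReal t).le
  have hs := hasSum_integral_comp_of_differentiableOn hR hg (w := fun t : ℝ => (t : ℂ) ^ (ν - 1))
    (continuous_ofReal_cpow hν).continuousOn Complex.continuous_ofReal.continuousOn
    fun t ht => by rw [Complex.norm_real, Real.norm_of_nonneg ht.1]; exact ht.2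
  -- The circle and the radius give the same series, since their moments agree.
  refine hc.unique (hasSum_of_eq hs fun n => ?_)
  rw [integral_circleWeight_mul_pow hν h1, integral_cpow_mul_pow hν]

end oneDim

/-! ### Products of regularized circles. -/

section multiDim

open MeasureTheory

theorem measurableSet_unitCube (m : ℕ) : MeasurableSet (unitCube m) := measurableSet_Icc

theorem isCompact_unitCube (m : ℕ) : IsCompact (unitCube m) := isCompact_Icc

theorem mem_unitCube {m : ℕ} {y : Fin m → ℝ} : y ∈ unitCube m ↔ ∀ k, y k ∈ Set.Icc (0 : ℝ) 1 :=
  ⟨fun h k => ⟨h.1 k, h.2 k⟩, fun h => ⟨fun k => (h k).1, fun k => (h k).2⟩⟩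

theorem integral_unitCube_insertNth {n : ℕ} (k : Fin (n + 1)) {F : (Fin (n + 1) → ℝ) → ℂ}
    (hF : IntegrableOn F (unitCube (n + 1))) :
    ∫ y in unitCube (n + 1), F y =
      ∫ y in unitCube n, ∫ t in Set.Icc (0 : ℝ) 1, F (k.insertNth t y) := by
  have hvp := (volume_preserving_piFinSuccAbove (fun _ : Fin (n + 1) => ℝ) k).symm
  have hpre : (MeasurableEquiv.piFinSuccAbove (fun _ : Fin (n + 1) => ℝ) k).symm ⁻¹'
      unitCube (n + 1) = Set.Icc (0 : ℝ) 1 ×ˢ unitCube n := by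
    ext ⟨t, y⟩
    simp only [Set.mem_preimage, Set.mem_prod, mem_unitCube]
    change (∀ i, k.insertNth (α := fun _ => ℝ) t y i ∈ _) ↔ _
    rw [Fin.forall_iff_succAbove k]
    simp
  have hemb := (MeasurableEquiv.piFinSuccAbove (fun _ : Fin (n + 1) => ℝ) k).symm.measurableEmbedding
  rw [← hvp.setIntegral_preimage_emb hemb, hpre]
  have hint : IntegrableOn (fun q : ℝ × (Fin n → ℝ) => F (k.insertNth q.1 q.2))
      (Set.Icc (0 : ℝ) 1 ×ˢ unitCube n) (volume.prod volume) := by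
    have := (hvp.integrableOn_comp_preimage hemb).2 hF
    rw [hpre] at this
    exact this
  change ∫ q in Set.Icc (0 : ℝ) 1 ×ˢ unitCube n, F (k.insertNth q.1 q.2) ∂(volume.prod volume) = _
  rw [← setIntegral_prod_swap, setIntegral_prod]
  · rfl
  · exact hint.swap

/-- Fubini: integrals over the cube agree if they agree in one coordinate with the others frozen. -/
theorem integral_unitCube_congr_update {m : ℕ} (k : Fin m) {F F' : (Fin m → ℝ) → ℂ}
    (hF : IntegrableOn F (unitCube m)) (hF' : IntegrableOn F' (unitCube m))
    (h : ∀ y ∈ unitCube m, ∫ t in Set.Icc (0 : ℝ) 1, F (Function.update y k t) =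
      ∫ t in Set.Icc (0 : ℝ) 1, F' (Function.update y k t)) :
    ∫ y in unitCube m, F y = ∫ y in unitCube m, F' y := by
  cases m with
  | zero => exact k.elim0
  | succ n =>
    rw [integral_unitCube_insertNth k hF, integral_unitCube_insertNth k hF']
    refine setIntegral_congr_fun (measurableSet_unitCube n) fun y hy => ?_
    have := h (k.insertNth 0 y) (insertNth_mem_unitCube hy k ⟨le_rfl, zero_le_one⟩)
    simpa only [Fin.update_insertNth] using this

/-- The weight of the coordinate `k`, which is an angle if `k ∈ S`. -/
def mixedWeight {m : ℕ} (C S : Finset (Fin m)) (ν : Fin m → ℂ) (k : Fin m) (t : ℝ) : ℂ :=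
  if k ∈ S then circleWeight (ν k) t else if k ∈ C then (t : ℂ) ^ (ν k - 1) else 1

/-- The coordinate `k`, which is an angle if `k ∈ S`. -/
def mixedCoord {m : ℕ} (S : Finset (Fin m)) (k : Fin m) (t : ℝ) : ℂ :=
  if k ∈ S then expTwoPiI t else t

/-- The polydisc of radius `R` in the coordinates `k ∈ C`, times real unit intervals. -/
def mixedDomain {m : ℕ} (C : Finset (Fin m)) (R : ℝ) : Set (Fin m → ℂ) :=
  {z | ∀ k, if k ∈ C then ‖z k‖ < R else ∃ t ∈ Set.Icc (0 : ℝ) 1, z k = t}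

variable {m : ℕ} {C S : Finset (Fin m)} {ν : Fin m → ℂ} {R : ℝ}

theorem continuous_mixedWeight (hν : ∀ k ∈ C, 1 < (ν k).re) (k : Fin m) :
    Continuous (mixedWeight C S ν k) := by
  unfold mixedWeight
  split_ifs with h1 h2
  · exact continuous_circleWeight _
  · exact continuous_ofReal_cpow (hν k h2)
  · exact continuous_const

theorem continuous_mixedCoord (k : Fin m) : Continuous (mixedCoord S k) := by
  unfold mixedCoord
  split_ifs
  · exact continuous_expTwoPiI_ofReal
  · exact Complex.continuous_ofReal

theorem mixedCoord_mem_mixedDomain (hR : 1 < R) (hS : S ⊆ C) {y : Fin m → ℝ}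
    (hy : y ∈ unitCube m) : (fun k => mixedCoord S k (y k)) ∈ mixedDomain C R := by
  intro k
  have hyk := mem_unitCube.1 hy k
  split_ifs with h
  · change ‖mixedCoord S k (y k)‖ < R
    rw [mixedCoord]
    split_ifs
    · rw [norm_expTwoPiI_ofReal]; exact hR
    · rw [Complex.norm_real, Real.norm_of_nonneg hyk.1]
      exact hyk.2.trans_lt hR
  · exact ⟨y k, hyk, if_neg fun hk => h (hS hk)⟩

theorem integrableOn_mixed (hR : 1 < R) (hS : S ⊆ C) (hν : ∀ k ∈ C, 1 < (ν k).re)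
    {g : (Fin m → ℂ) → ℂ} (hg : ∀ z ∈ mixedDomain C R, DifferentiableAt ℂ g z) :
    IntegrableOn (fun y => (∏ k, mixedWeight C S ν k (y k)) * g fun k => mixedCoord S k (y k))
      (unitCube m) := by
  refine ContinuousOn.integrableOn_compact (isCompact_unitCube m) (ContinuousOn.mul ?_ ?_)
  · exact (continuous_finsetProd _ fun k _ =>
      (continuous_mixedWeight hν k).comp (continuous_apply k)).continuousOn
  · intro y hy
    refine ContinuousAt.continuousWithinAt (ContinuousAt.comp (f := fun (y : Fin m → ℝ) k =>
      mixedCoord S k (y k)) (hg _ (mixedCoord_mem_mixedDomain hR hS hy)).continuousAt ?_)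
    exact (continuous_pi fun k => (continuous_mixedCoord k).comp (continuous_apply k)).continuousAt

/-- Replaces one circle by its radius. With the other coordinates fixed on circles or real
intervals, `g` is holomorphic in the coordinate `i` on a disc of radius `R > 1`. -/
theorem integral_mixed_insert (hR : 1 < R) {i : Fin m} (hi : i ∉ S) (hS : insert i S ⊆ C)
    (hν : ∀ k ∈ C, 1 < (ν k).re) (hν' : ∀ k ∈ C, expTwoPiI (ν k) ≠ 1)
    {g : (Fin m → ℂ) → ℂ} (hg : ∀ z ∈ mixedDomain C R, DifferentiableAt ℂ g z) :
    ∫ y in unitCube m, (∏ k, mixedWeight C (insert i S) ν k (y k)) *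
        g (fun k => mixedCoord (insert i S) k (y k)) =
      ∫ y in unitCube m, (∏ k, mixedWeight C S ν k (y k)) *
        g (fun k => mixedCoord S k (y k)) := by
  have hiC : i ∈ C := hS (Finset.mem_insert_self _ _)
  have hSC : S ⊆ C := (Finset.subset_insert _ _).trans hS
  refine integral_unitCube_congr_update i (integrableOn_mixed hR hS hν hg)
    (integrableOn_mixed hR hSC hν hg) fun y hy => ?_
  set P := ∏ k ∈ Finset.univ.erase i, mixedWeight C S ν k (y k) with hP
  set z : Fin m → ℂ := fun k => mixedCoord S k (y k) with hz
  -- Isolates the coordinate `i`; everything else is the same for `S` and for `insert i S`.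
  have hsplit : ∀ (S' : Finset (Fin m)), (∀ k, k ≠ i → (k ∈ S' ↔ k ∈ S)) → ∀ t : ℝ,
      (∏ k, mixedWeight C S' ν k (Function.update y i t k)) *
        g (fun k => mixedCoord S' k (Function.update y i t k)) =
      P * (mixedWeight C S' ν i t * g (Function.update z i (mixedCoord S' i t))) := by
    intro S' hS' t
    rw [← Finset.mul_prod_erase _ _ (Finset.mem_univ i), Function.update_self,
      Finset.prod_congr rfl (g := fun k => mixedWeight C S ν k (y k)) fun k hk => ?_]
    · have : (fun k => mixedCoord S' k (Function.update y i t k)) =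
          Function.update z i (mixedCoord S' i t) := by
        funext k
        by_cases hk : k = i
        · subst hk
          rw [Function.update_self, Function.update_self]
        · rw [Function.update_of_ne hk, Function.update_of_ne hk]
          simp only [hz, mixedCoord, hS' k hk]
      rw [this]
      ring
    · have hk' := Finset.ne_of_mem_erase hk
      rw [Function.update_of_ne hk', mixedWeight, mixedWeight]
      simp only [hS' k hk']
  simp only [hsplit (insert i S) fun k hk => by simp [hk], hsplit S fun k _ => Iff.rfl]
  rw [integral_const_mul, integral_const_mul]
  congr 1
  have h1 : ∀ t, mixedWeight C (insert i S) ν i t = circleWeight (ν i) t := fun t =>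
    if_pos (Finset.mem_insert_self _ _)
  have h2 : ∀ t, mixedWeight C S ν i t = (t : ℂ) ^ (ν i - 1) := fun t => by
    rw [mixedWeight, if_neg hi, if_pos hiC]
  have h3 : ∀ t, mixedCoord (insert i S) i t = expTwoPiI t := fun t =>
    if_pos (Finset.mem_insert_self _ _)
  have h4 : ∀ t, mixedCoord S i t = t := fun t => if_neg hi
  simp only [h1, h2, h3, h4]
  refine integral_circleWeight (g := fun w => g (Function.update z i w)) (hν i hiC) (hν' i hiC) hR
    fun w hw => ?_
  refine DifferentiableAt.differentiableWithinAt ?_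
  refine DifferentiableAt.comp (f := fun w => Function.update z i w) w (hg _ fun k => ?_)
    (hasFDerivAt_update z w).differentiableAt
  have hzk := mixedCoord_mem_mixedDomain hR hSC hy k
  by_cases hk : k = i
  · subst hk
    rw [if_pos hiC, Function.update_self]
    simpa using hw
  · rw [Function.update_of_ne hk]
    exact hzk

/-- The integral over a product of regularized circles is the integral over the product of their
radii. -/
theorem integral_circles_eq_segments (hR : 1 < R)
    (hν : ∀ k ∈ C, 1 < (ν k).re) (hν' : ∀ k ∈ C, expTwoPiI (ν k) ≠ 1)
    {g : (Fin m → ℂ) → ℂ} (hg : ∀ z ∈ mixedDomain C R, DifferentiableAt ℂ g z) :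
    ∫ y in unitCube m, (∏ k ∈ C, circleWeight (ν k) (y k)) * g (fun k => mixedCoord C k (y k)) =
      ∫ y in unitCube m, (∏ k ∈ C, (y k : ℂ) ^ (ν k - 1)) * g (fun k => (y k : ℂ)) := by
  have key : ∀ S : Finset (Fin m), S ⊆ C →
      ∫ y in unitCube m, (∏ k, mixedWeight C S ν k (y k)) * g (fun k => mixedCoord S k (y k)) =
      ∫ y in unitCube m, (∏ k, mixedWeight C ∅ ν k (y k)) * g (fun k => mixedCoord ∅ k (y k)) := by
    intro S
    induction S using Finset.induction_on with
    | empty => exact fun _ => rfl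
    | insert i S hi ih =>
      intro hS
      rw [integral_mixed_insert hR hi hS hν hν' hg, ih ((Finset.subset_insert _ _).trans hS)]
  have h := key C subset_rfl
  have h1 : ∀ y : Fin m → ℝ, ∏ k, mixedWeight C C ν k (y k) = ∏ k ∈ C, circleWeight (ν k) (y k) := by
    intro y
    rw [← Finset.prod_subset (Finset.subset_univ C) fun k _ hk => by
      rw [mixedWeight, if_neg hk, if_neg hk]]
    exact Finset.prod_congr rfl fun k hk => if_pos hk
  have h2 : ∀ y : Fin m → ℝ, ∏ k, mixedWeight C ∅ ν k (y k) = ∏ k ∈ C, (y k : ℂ) ^ (ν k - 1) := by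
    intro y
    rw [← Finset.prod_subset (Finset.subset_univ C) fun k _ hk => by
      rw [mixedWeight, if_neg (Finset.notMem_empty k), if_neg hk]]
    exact Finset.prod_congr rfl fun k hk => by
      rw [mixedWeight, if_neg (Finset.notMem_empty k), if_pos hk]
  simp only [h1, h2] at h
  exact h

end multiDim

/-! ### Jacobian determinants -/

section jacobian

variable {m : ℕ}

/-- A matrix that is triangular with respect to an injective rank function. -/
theorem det_of_rank_triangular {R : Type*} [CommRing R] {M : Matrix (Fin m) (Fin m) R}
    {rank : Fin m → ℕ} (hr : Function.Injective rank) (h : ∀ i j, rank i < rank j → M i j = 0) :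
    M.det = ∏ i, M i i := by
  rw [Matrix.det_apply', Finset.sum_eq_single 1]
  · simp
  · intro σ _ hσ
    -- If a permutation never lowers the rank, equality holds everywhere, because both sides have
    -- the same sum; injectivity then makes it the identity.
    suffices ∃ i, rank (σ i) < rank i by
      obtain ⟨i, hi⟩ := this
      exact mul_eq_zero_of_right _ (Finset.prod_eq_zero (Finset.mem_univ i) (h _ _ hi))
    by_contra! hcon
    have heq := (Finset.sum_eq_sum_iff_of_le fun i (_ : i ∈ Finset.univ) => hcon i).1
      (Equiv.sum_comp σ rank).symm
    exact hσ (Equiv.ext fun i => (hr (heq i (Finset.mem_univ i))).symm)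
  · exact fun h => (h (Finset.mem_univ _)).elim

variable {𝕜 : Type*} [NontriviallyNormedField 𝕜]

/-- The Jacobian matrix. -/
def jacobian (f : (Fin m → 𝕜) → Fin m → 𝕜) (z : Fin m → 𝕜) : Matrix (Fin m) (Fin m) 𝕜 :=
  Matrix.of fun i j => fderiv 𝕜 f z (Pi.single j 1) i

theorem jacobian_eq_toMatrix' (f : (Fin m → 𝕜) → Fin m → 𝕜) (z : Fin m → 𝕜) :
    jacobian f z = LinearMap.toMatrix' (fderiv 𝕜 f z : (Fin m → 𝕜) →ₗ[𝕜] Fin m → 𝕜) := by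
  ext i j
  rw [LinearMap.toMatrix'_apply]
  rfl

theorem det_fderiv_eq (f : (Fin m → 𝕜) → Fin m → 𝕜) (z : Fin m → 𝕜) :
    (fderiv 𝕜 f z).det = (jacobian f z).det := by
  rw [jacobian_eq_toMatrix', LinearMap.det_toMatrix']

theorem det_jacobian_comp {f g : (Fin m → 𝕜) → Fin m → 𝕜} {z : Fin m → 𝕜}
    (hf : DifferentiableAt 𝕜 f (g z)) (hg : DifferentiableAt 𝕜 g z) :
    (jacobian (f ∘ g) z).det = (jacobian f (g z)).det * (jacobian g z).det := by
  rw [← det_fderiv_eq, ← det_fderiv_eq, ← det_fderiv_eq, fderiv_comp z hf hg]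
  exact LinearMap.det_comp _ _

/-- A column entry of the Jacobian matrix of a map that is affine in a coordinate. -/
theorem jacobian_apply_of_affine {f : (Fin m → 𝕜) → Fin m → 𝕜} {z : Fin m → 𝕜}
    (hf : DifferentiableAt 𝕜 f z) {i j : Fin m} {w : 𝕜}
    (h : ∀ t, f (Function.update z j (z j + t)) i = f z i + t * w) : jacobian f z i j = w := by
  have h1 : HasFDerivAt (fun z => f z i) _ z := hasFDerivAt_pi'.1 hf.hasFDerivAt i
  have h2 := h1.hasLineDerivAt (Pi.single j 1)
  have h3 : HasDerivAt (fun t : 𝕜 => f z i + t * w) w 0 := by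
    simpa using ((hasDerivAt_id (0 : 𝕜)).mul_const w).const_add (f z i)
  refine HasDerivAt.unique h2 (h3.congr_of_eventuallyEq (Filter.Eventually.of_forall fun t => ?_))
  refine Eq.trans ?_ (h t)
  change f _ i = f _ i
  congr 1
  funext k
  by_cases hk : k = j
  · subst hk
    simp
  · simp [hk]

end jacobian

/-! ### Iterated conical parametrizations of a simplex -/

section stickMap

variable {m : ℕ} {I F : Finset (Fin m)}

section ring

variable {𝕜 : Type*} [CommRing 𝕜] {A B : Fin m → 𝕜} {u : 𝕜} {z : Fin m → 𝕜}

/-- The size of the simplex left by the coordinates outside `F`. -/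
def stickMargin (I F : Finset (Fin m)) (A B : Fin m → 𝕜) (u : 𝕜) (z : Fin m → 𝕜) : 𝕜 :=
  1 - ∑ k ∈ I, A k - u - ∑ k ∈ I \ F, B k * z k

/-- Affine coordinates outside `F`, and stick breaking coordinates of the remaining simplex
in `F`. -/
def stickMap (I F : Finset (Fin m)) (A B : Fin m → 𝕜) (u : 𝕜) (z : Fin m → 𝕜) (k : Fin m) : 𝕜 :=
  if k ∈ F then A k + z k * (∏ p ∈ F with p < k, (1 - z p)) * stickMargin I F A B u z
  else A k + B k * z k

theorem stickMap_of_mem {k : Fin m} (hk : k ∈ F) : stickMap I F A B u z k =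
    A k + z k * (∏ p ∈ F with p < k, (1 - z p)) * stickMargin I F A B u z := if_pos hk

theorem stickMap_of_notMem {k : Fin m} (hk : k ∉ F) : stickMap I F A B u z k = A k + B k * z k :=
  if_neg hk

theorem one_sub_sum_stickMap (hF : F ⊆ I) : 1 - ∑ k ∈ I, stickMap I F A B u z k =
    u + (∏ p ∈ F, (1 - z p)) * stickMargin I F A B u z := by
  have h1 : ∑ k ∈ F, stickMap I F A B u z k = ∑ k ∈ F, A k +
      (∑ k ∈ F, z k * ∏ p ∈ F with p < k, (1 - z p)) * stickMargin I F A B u z := by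
    rw [Finset.sum_mul, ← Finset.sum_add_distrib]
    exact Finset.sum_congr rfl fun k hk => stickMap_of_mem hk
  have h2 : ∑ k ∈ I \ F, stickMap I F A B u z k = ∑ k ∈ I \ F, A k + ∑ k ∈ I \ F, B k * z k := by
    rw [← Finset.sum_add_distrib]
    exact Finset.sum_congr rfl fun k hk => stickMap_of_notMem (Finset.mem_sdiff.1 hk).2
  rw [Finset.prod_one_sub_ordered, ← Finset.sum_sdiff hF, h1, h2, sub_mul, one_mul]
  have h3 := Finset.sum_sdiff hF (f := A)
  have h4 : stickMargin I F A B u z = 1 - ∑ k ∈ I, A k - u - ∑ k ∈ I \ F, B k * z k := rfl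
  rw [← h3] at h4
  linear_combination -h4

/-- The part of the simplex left by the coordinates `p < k` in `F`. -/
theorem prod_mul_stickMargin (k : Fin m) :
    (∏ p ∈ F with p < k, (1 - z p)) * stickMargin I F A B u z =
      stickMargin I F A B u z - ∑ p ∈ F with p < k, (stickMap I F A B u z p - A p) := by
  rw [Finset.prod_one_sub_ordered, sub_mul, one_mul, Finset.sum_mul]
  congr 1
  refine Finset.sum_congr rfl fun p hp => ?_
  have hp' := Finset.mem_filter.1 hp
  rw [stickMap_of_mem hp'.1, add_sub_cancel_left, Finset.filter_filter]
  congr 3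
  ext q
  simp only [Finset.mem_filter]
  constructor
  · exact fun h => ⟨h.1, h.2.2⟩
  · exact fun h => ⟨h.1, h.2.trans hp'.2, h.2⟩

/-- The margin can be read off from the image point, which is what makes the parametrization
invertible. -/
theorem stickMargin_eq (hF : F ⊆ I) : stickMargin I F A B u z =
    (1 - ∑ k ∈ I, stickMap I F A B u z k - u) + ∑ k ∈ F, (stickMap I F A B u z k - A k) := by
  have h2 : ∑ k ∈ I \ F, stickMap I F A B u z k = ∑ k ∈ I \ F, A k + ∑ k ∈ I \ F, B k * z k := by
    rw [← Finset.sum_add_distrib]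
    exact Finset.sum_congr rfl fun k hk => stickMap_of_notMem (Finset.mem_sdiff.1 hk).2
  rw [stickMargin, ← Finset.sum_sdiff hF (f := A),
    ← Finset.sum_sdiff hF (f := stickMap I F A B u z), h2, Finset.sum_sub_distrib]
  ring

/-- Affine coordinates first, then the coordinates in `F` in their order. -/
def stickRank (F : Finset (Fin m)) (k : Fin m) : ℕ := if k ∈ F then m + k else k

theorem stickRank_injective : Function.Injective (stickRank F) := by
  intro i j h
  unfold stickRank at h
  have := i.isLt
  have := j.isLt
  split_ifs at h <;> exact Fin.ext (by omega)

theorem stickMargin_update {j : Fin m} (hj : j ∈ F) (t : 𝕜) :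
    stickMargin I F A B u (Function.update z j t) = stickMargin I F A B u z := by
  rw [stickMargin, stickMargin]
  congr 1
  refine Finset.sum_congr rfl fun k hk => ?_
  rw [Function.update_of_ne]
  rintro rfl
  exact (Finset.mem_sdiff.1 hk).2 hj

theorem prod_filter_lt_update {i j : Fin m} (h : ¬ (j ∈ F ∧ j < i)) (t : 𝕜) :
    ∏ p ∈ F with p < i, (1 - Function.update z j t p) = ∏ p ∈ F with p < i, (1 - z p) := by
  refine Finset.prod_congr rfl fun p hp => ?_
  rw [Function.update_of_ne]
  rintro rfl
  exact h (Finset.mem_filter.1 hp)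

/-- Affine coordinates depend on themselves only, and a stick depends on affine coordinates, itself
and earlier sticks. So the Jacobian matrix is triangular for `stickRank`. -/
theorem stickMap_update_of_rank_lt {i j : Fin m} (h : stickRank F i < stickRank F j) (t : 𝕜) :
    stickMap I F A B u (Function.update z j t) i = stickMap I F A B u z i := by
  have hij : i ≠ j := by
    rintro rfl
    exact lt_irrefl _ h
  have := i.isLt
  have := j.isLt
  by_cases hi : i ∈ F
  · have hj : j ∈ F ∧ i < j := by
      unfold stickRank at h
      rw [if_pos hi] at h
      split_ifs at h with hj
      · exact ⟨hj, by omega⟩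
      · omega
    rw [stickMap_of_mem hi, stickMap_of_mem hi, Function.update_of_ne hij, stickMargin_update hj.1,
      prod_filter_lt_update fun hc => absurd hj.2 (not_lt.2 hc.2.le)]
  · rw [stickMap_of_notMem hi, stickMap_of_notMem hi, Function.update_of_ne hij]

end ring

section field

variable {𝕜 : Type*} [NontriviallyNormedField 𝕜] {A B : Fin m → 𝕜} {u : 𝕜} {z : Fin m → 𝕜}

theorem differentiable_stickMap : Differentiable 𝕜 (stickMap I F A B u) := by
  refine differentiable_pi.2 fun k => ?_
  unfold stickMap stickMargin
  split_ifs <;> fun_prop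

theorem det_jacobian_stickMap : (jacobian (stickMap I F A B u) z).det =
    ∏ k, if k ∈ F then (∏ p ∈ F with p < k, (1 - z p)) * stickMargin I F A B u z else B k := by
  rw [det_of_rank_triangular (stickRank_injective (F := F))]
  · refine Finset.prod_congr rfl fun i _ => ?_
    refine jacobian_apply_of_affine differentiable_stickMap.differentiableAt fun t => ?_
    by_cases hi : i ∈ F
    · rw [stickMap_of_mem hi, stickMap_of_mem hi, Function.update_self, stickMargin_update hi,
        prod_filter_lt_update fun hc => lt_irrefl _ hc.2, if_pos hi]
      ring
    · rw [stickMap_of_notMem hi, stickMap_of_notMem hi, Function.update_self, if_neg hi]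
      ring
  · intro i j hij
    refine jacobian_apply_of_affine differentiable_stickMap.differentiableAt fun t => ?_
    rw [stickMap_update_of_rank_lt hij, mul_zero, add_zero]

end field

section real

variable {A B : Fin m → ℝ} {u : ℝ} {z : Fin m → ℝ}

/-- The open unit cube. -/
def openCube (m : ℕ) : Set (Fin m → ℝ) := Set.univ.pi fun _ => Set.Ioo 0 1

theorem mem_openCube : z ∈ openCube m ↔ ∀ k, z k ∈ Set.Ioo (0 : ℝ) 1 := Set.mem_univ_pi

theorem prod_filter_pos (hz : z ∈ openCube m) (s : Finset (Fin m)) : 0 < ∏ p ∈ s, (1 - z p) :=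
  Finset.prod_pos fun p _ => sub_pos.2 (mem_openCube.1 hz p).2

/-- The image determines the margin and, by `prod_mul_stickMargin`, what is left before every stick;
both are positive, so each coordinate is obtained by division. -/
theorem injOn_stickMap (hF : F ⊆ I) (hB : ∀ k ∉ F, B k ≠ 0)
    (hpos : ∀ z ∈ openCube m, 0 < stickMargin I F A B u z) :
    Set.InjOn (stickMap I F A B u) (openCube m) := by
  intro z hz z' hz' h
  funext k
  by_cases hk : k ∈ F
  · have h1 := (prod_mul_stickMargin (I := I) (F := F) (A := A) (B := B) (u := u) (z := z) k)
    have h2 := (prod_mul_stickMargin (I := I) (F := F) (A := A) (B := B) (u := u) (z := z') k)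
    have hm : stickMargin I F A B u z = stickMargin I F A B u z' := by
      rw [stickMargin_eq hF, stickMargin_eq hF, h]
    rw [h, hm, ← h2] at h1
    have h3 := congrFun h k
    rw [stickMap_of_mem hk, stickMap_of_mem hk, mul_assoc, mul_assoc, hm, h1] at h3
    exact mul_right_cancel₀ (mul_pos (prod_filter_pos hz' _) (hpos z' hz')).ne' (add_left_cancel h3)
  · have h3 := congrFun h k
    rw [stickMap_of_notMem hk, stickMap_of_notMem hk] at h3
    exact mul_left_cancel₀ (hB k hk) (add_left_cancel h3)

theorem image_stickMap (hF : F ⊆ I) (hB : ∀ k ∉ F, B k ≠ 0)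
    (hpos : ∀ z ∈ openCube m, 0 < stickMargin I F A B u z) :
    stickMap I F A B u '' openCube m = {w | (∀ k ∉ F, (w k - A k) / B k ∈ Set.Ioo (0 : ℝ) 1) ∧
      (∀ k ∈ F, A k < w k) ∧ u < 1 - ∑ k ∈ I, w k} := by
  refine Set.Subset.antisymm ?_ ?_
  · rintro _ ⟨z, hz, rfl⟩
    refine ⟨fun k hk => ?_, fun k hk => ?_, ?_⟩
    · rw [stickMap_of_notMem hk, add_sub_cancel_left, mul_div_cancel_left₀ _ (hB k hk)]
      exact mem_openCube.1 hz k
    · rw [stickMap_of_mem hk]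
      exact lt_add_of_pos_right _ (mul_pos (mul_pos (mem_openCube.1 hz k).1 (prod_filter_pos hz _))
        (hpos z hz))
    · rw [one_sub_sum_stickMap hF]
      exact lt_add_of_pos_right _ (mul_pos (prod_filter_pos hz _) (hpos z hz))
  · rintro w ⟨h1, h2, h3⟩
    -- The margin of the preimage, by `stickMargin_eq`; `ρ k` below is the part of it that the
    -- sticks before `k` leave, and `z` is the proportion each stick takes.
    set N : ℝ := (1 - ∑ k ∈ I, w k - u) + ∑ k ∈ F, (w k - A k) with hN
    set ρ : Fin m → ℝ := fun k => N - ∑ p ∈ F with p < k, (w p - A p) with hρ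
    have hle : ∀ k, ∀ s ⊆ F, k ∈ F → k ∉ s → w k - A k < N - ∑ p ∈ s, (w p - A p) := by
      intro k s hs hkF hks
      have : ∑ p ∈ insert k s, (w p - A p) ≤ ∑ k ∈ F, (w k - A k) :=
        Finset.sum_le_sum_of_subset_of_nonneg (Finset.insert_subset hkF hs)
          fun p hp _ => (sub_pos.2 (h2 p hp)).le
      rw [Finset.sum_insert hks] at this
      linarith
    have hρk : ∀ k ∈ F, w k - A k < ρ k := fun k hk =>
      hle k _ (Finset.filter_subset _ _) hk (by simp)
    have hρpos : ∀ k ∈ F, 0 < ρ k := fun k hk => (sub_pos.2 (h2 k hk)).trans (hρk k hk)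
    have hNpos : 0 < N := add_pos_of_pos_of_nonneg (by linarith)
      (Finset.sum_nonneg fun p hp => (sub_pos.2 (h2 p hp)).le)
    set z : Fin m → ℝ := fun k => if k ∈ F then (w k - A k) / ρ k else (w k - A k) / B k with hz
    have hzc : z ∈ openCube m := by
      refine mem_openCube.2 fun k => ?_
      rw [hz]
      by_cases hk : k ∈ F
      · simp only [if_pos hk]
        exact ⟨div_pos (sub_pos.2 (h2 k hk)) (hρpos k hk), (div_lt_one (hρpos k hk)).2 (hρk k hk)⟩
      · simp only [if_neg hk]
        exact h1 k hk
    have hmargin : stickMargin I F A B u z = N := by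
      have : ∑ k ∈ I \ F, B k * z k = ∑ k ∈ I \ F, (w k - A k) := by
        refine Finset.sum_congr rfl fun k hk => ?_
        have hk' := (Finset.mem_sdiff.1 hk).2
        simp only [hz, if_neg hk']
        exact mul_div_cancel₀ _ (hB k hk')
      rw [stickMargin, this, hN, ← Finset.sum_sdiff hF (f := A), ← Finset.sum_sdiff hF (f := w),
        Finset.sum_sub_distrib, Finset.sum_sub_distrib]
      ring
    -- Stick breaking in reverse, by induction on `k`: the lengths of the earlier sticks are `w p -
    -- A p`.
    have hprod : ∀ k, (∏ p ∈ F with p < k, (1 - z p)) = ρ k / N := by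
      intro k
      induction k using WellFoundedLT.induction with
      | _ k ih =>
        rw [Finset.prod_one_sub_ordered, hρ, sub_div, div_self hNpos.ne', Finset.sum_div]
        congr 1
        refine Finset.sum_congr rfl fun p hp => ?_
        have hp' := Finset.mem_filter.1 hp
        have : (F.filter (· < k)).filter (· < p) = F.filter (· < p) := by
          ext q
          simp only [Finset.mem_filter]
          exact ⟨fun h => ⟨h.1.1, h.2⟩, fun h => ⟨⟨h.1, h.2.trans hp'.2⟩, h.2⟩⟩
        rw [this, ih p hp'.2]
        simp only [hz, if_pos hp'.1]
        have := (hρpos p hp'.1).ne'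
        field_simp
    refine ⟨z, hzc, funext fun k => ?_⟩
    by_cases hk : k ∈ F
    · rw [stickMap_of_mem hk, hmargin, mul_assoc, hprod k, div_mul_cancel₀ _ hNpos.ne']
      simp only [hz, if_pos hk]
      rw [div_mul_cancel₀ _ (hρpos k hk).ne']
      ring
    · rw [stickMap_of_notMem hk]
      simp only [hz, if_neg hk]
      rw [mul_div_cancel₀ _ (hB k hk)]
      ring

end real

end stickMap

/-! ### The cells as images of polydiscs -/

section cellParam

variable {m : ℕ} {I : Finset (Fin m)} {ε : ℝ} {εs : Fin m → ℝ} {J : Finset (Factor m)}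

open Classical in
/-- The coordinates of a cell that are angles. -/
def circleSet (I : Finset (Fin m)) (J : Finset (Factor m)) : Finset (Fin m) :=
  Finset.univ.filter (IsCircleCoord I J)

/-- The stick breaking coordinates of a cell. -/
def stickSet (I : Finset (Fin m)) (J : Finset (Factor m)) : Finset (Fin m) := I \ circleSet I J

theorem mem_circleSet {k : Fin m} : k ∈ circleSet I J ↔ IsCircleCoord I J k := by
  simp [circleSet]

theorem mem_stickSet {k : Fin m} : k ∈ stickSet I J ↔ k ∈ I ∧ ¬ IsCircleCoord I J k := by
  rw [stickSet, Finset.mem_sdiff, mem_circleSet]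

theorem stickSet_subset : stickSet I J ⊆ I := Finset.sdiff_subset

theorem notMem_circleSet_of_mem_stickSet {k : Fin m} (h : k ∈ stickSet I J) : k ∉ circleSet I J :=
  fun hc => (mem_stickSet.1 h).2 (mem_circleSet.1 hc)

theorem mem_stickSet_iff_free (hJ : IsFaceSet I J) {k : Fin m} :
    k ∈ stickSet I J ↔ k ∈ free I J ∧ ¬ (last ∈ J ∧ IsTop I J k) := by
  rw [mem_stickSet, mem_free]
  constructor
  · rintro ⟨h1, h2⟩
    exact ⟨⟨h1, fun h => h2 (isCircleCoord_of_atZero h)⟩, fun h => h2 (isCircleCoord_of_last h)⟩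
  · rintro ⟨⟨h1, h2⟩, h3⟩
    refine ⟨h1, ?_⟩
    rintro (h | h | h)
    · exact h2 h
    · exact hJ.1 k h1 h
    · exact h3 h

/-- The radius of the circle around a facet. -/
def facetRadius (ε : ℝ) (εs : Fin m → ℝ) : Factor m → ℝ := Sum.elim εs (Sum.elim εs fun _ => ε)

/-- The facet whose circle has the coordinate `k`. -/
def facetLabel (J : Finset (Factor m)) (k : Fin m) : Factor m :=
  if atZero k ∈ J then atZero k else if atOne k ∈ J then atOne k else last

open Classical in
/-- The constant terms of the affine coordinates of a cell. -/
def cellBase (I : Finset (Fin m)) (εs : Fin m → ℝ) (J : Finset (Factor m)) (k : Fin m) : ℝ :=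
  if IsCircleCoord I J k then (if atOne k ∈ J then 1 else 0) else εs k

open Classical in
/-- The slopes of the affine coordinates of a cell. -/
def cellSlope (I : Finset (Fin m)) (ε : ℝ) (εs : Fin m → ℝ) (J : Finset (Factor m)) (k : Fin m) : ℝ :=
  if atZero k ∈ J then εs k else if atOne k ∈ J then -εs k
    else if last ∈ J ∧ IsTop I J k then ε else 1 - 2 * εs k

/-- The distance from the facet that closes the stick breaking coordinates. -/
def cellClose (I : Finset (Fin m)) (ε : ℝ) (εs : Fin m → ℝ) (J : Finset (Factor m)) : ℝ :=
  if last ∈ J then topCoord I J εs else ε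

section ring

variable {𝕜 : Type*} [CommRing 𝕜]

open Classical in
/-- If `last ∈ J`, the coordinate `1 - ∑ s_p` is used in place of the top coordinate. -/
def simplexMap (I : Finset (Fin m)) (J : Finset (Factor m)) (w : Fin m → 𝕜) (k : Fin m) : 𝕜 :=
  if last ∈ J ∧ IsTop I J k then 1 - ∑ p ∈ I, w p else w k

theorem simplexMap_of_last_notMem (h : last ∉ J) (w : Fin m → 𝕜) : simplexMap I J w = w :=
  funext fun _ => if_neg fun hc => h hc.1

theorem simplexMap_of_isTop (h : last ∈ J) {t : Fin m} (ht : IsTop I J t) (w : Fin m → 𝕜) :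
    simplexMap I J w = Function.update w t (1 - ∑ p ∈ I, w p) := by
  funext k
  rw [simplexMap]
  by_cases hk : k = t
  · subst hk
    rw [if_pos ⟨h, ht⟩, Function.update_self]
  · rw [if_neg fun hc => hk (hc.2.eq ht), Function.update_of_ne hk]

theorem IsTop.mem {t : Fin m} (ht : IsTop I J t) : t ∈ I := (mem_free.1 ht.1).1

theorem one_sub_sum_simplexMap (h : last ∈ J) {t : Fin m} (ht : IsTop I J t) (w : Fin m → 𝕜) :
    1 - ∑ p ∈ I, simplexMap I J w p = w t := by
  rw [simplexMap_of_isTop h ht, Finset.sum_update_of_mem ht.mem, ← Finset.erase_eq,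
    ← Finset.add_sum_erase I w ht.mem]
  ring

/-- Exchanging the top coordinate and the last barycentric coordinate is an involution. -/
theorem simplexMap_simplexMap (hJ : IsFaceSet I J) (w : Fin m → 𝕜) :
    simplexMap I J (simplexMap I J w) = w := by
  by_cases h : last ∈ J
  · obtain ⟨t, ht⟩ := hJ.exists_isTop h
    rw [simplexMap_of_isTop h ht (simplexMap I J w), one_sub_sum_simplexMap h ht,
      simplexMap_of_isTop h ht, Function.update_idem, Function.update_eq_self]
  · rw [simplexMap_of_last_notMem h, simplexMap_of_last_notMem h]

end ring

/-- The sign of the orientation change in `simplexMap`. -/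
def simplexSign (𝕜 : Type*) [Ring 𝕜] (J : Finset (Factor m)) : 𝕜 := if last ∈ J then -1 else 1

section field

variable {𝕜 : Type*} [NontriviallyNormedField 𝕜]

theorem differentiable_simplexMap : Differentiable 𝕜 (simplexMap (𝕜 := 𝕜) I J) := by
  refine differentiable_pi.2 fun k => ?_
  unfold simplexMap
  split_ifs <;> fun_prop

theorem det_jacobian_simplexMap (hJ : IsFaceSet I J) (w : Fin m → 𝕜) :
    (jacobian (simplexMap I J) w).det = simplexSign 𝕜 J := by
  classical
  by_cases h : last ∈ J
  · obtain ⟨t, ht⟩ := hJ.exists_isTop h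
    -- Only the row of `t` differs from the identity matrix, and its diagonal entry is `-1`; giving
    -- `t` the highest rank makes the matrix triangular.
    have hinj : Function.Injective fun k : Fin m => if k = t then m else (k : ℕ) := by
      intro i j hij
      have := i.isLt
      have := j.isLt
      dsimp only at hij
      split_ifs at hij with h1 h2 h2
      · rw [h1, h2]
      · omega
      · omega
      · exact Fin.ext hij
    rw [det_of_rank_triangular hinj, Finset.prod_eq_single t]
    · rw [simplexSign, if_pos h]
      refine jacobian_apply_of_affine differentiable_simplexMap.differentiableAt fun s => ?_
      rw [simplexMap_of_isTop h ht, simplexMap_of_isTop h ht, Function.update_self,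
        Function.update_self, Finset.sum_update_of_mem ht.mem, ← Finset.erase_eq,
        ← Finset.add_sum_erase I w ht.mem]
      ring
    · intro k _ hk
      refine jacobian_apply_of_affine differentiable_simplexMap.differentiableAt fun s => ?_
      rw [simplexMap_of_isTop h ht, simplexMap_of_isTop h ht, Function.update_of_ne hk,
        Function.update_of_ne hk, Function.update_self, mul_one]
    · exact fun h => (h (Finset.mem_univ _)).elim
    · intro i j hij
      have hi : i ≠ t := by
        rintro rfl
        simp only [if_true] at hij
        have := j.isLt
        split_ifs at hij <;> omega
      have hne : i ≠ j := by
        rintro rfl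
        exact lt_irrefl _ hij
      refine jacobian_apply_of_affine differentiable_simplexMap.differentiableAt fun s => ?_
      rw [simplexMap_of_isTop h ht, simplexMap_of_isTop h ht, Function.update_of_ne hi,
        Function.update_of_ne hi, Function.update_of_ne hne, mul_zero, add_zero]
  · have hid : simplexMap (𝕜 := 𝕜) I J = id := funext fun w => simplexMap_of_last_notMem h w
    rw [hid, det_of_rank_triangular (rank := fun k : Fin m => (k : ℕ)) Fin.val_injective,
      simplexSign, if_neg h, Finset.prod_eq_one]
    · intro k _
      refine jacobian_apply_of_affine differentiable_id.differentiableAt fun s => ?_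
      simp
    · intro i j hij
      have hne : i ≠ j := by
        rintro rfl
        exact lt_irrefl _ hij
      refine jacobian_apply_of_affine differentiable_id.differentiableAt fun s => ?_
      simp [Function.update_of_ne hne]

end field

/-- The real chart of a region of the simplex times intervals. -/
def cellReal (I : Finset (Fin m)) (ε : ℝ) (εs : Fin m → ℝ) (J : Finset (Factor m)) :
    (Fin m → ℝ) → Fin m → ℝ :=
  simplexMap I J ∘ stickMap I (stickSet I J) (cellBase I εs J) (cellSlope I ε εs J)
    (cellClose I ε εs J)

/-- The complexification of `cellReal`. -/
def cellComplex (I : Finset (Fin m)) (ε : ℝ) (εs : Fin m → ℝ) (J : Finset (Factor m)) :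
    (Fin m → ℂ) → Fin m → ℂ :=
  simplexMap I J ∘ stickMap I (stickSet I J) (fun k => (cellBase I εs J k : ℂ))
    (fun k => (cellSlope I ε εs J k : ℂ)) (cellClose I ε εs J : ℂ)

/-- The size of the simplex in the chart of a cell. -/
def cellMargin (I : Finset (Fin m)) (ε : ℝ) (εs : Fin m → ℝ) (J : Finset (Factor m)) :
    (Fin m → ℂ) → ℂ :=
  stickMargin I (stickSet I J) (fun k => (cellBase I εs J k : ℂ))
    (fun k => (cellSlope I ε εs J k : ℂ)) (cellClose I ε εs J : ℂ)

theorem cellComplex_ofReal (z : Fin m → ℝ) (k : Fin m) :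
    cellComplex I ε εs J (fun i => (z i : ℂ)) k = cellReal I ε εs J z k := by
  have h : ∀ k, stickMap I (stickSet I J) (fun k => (cellBase I εs J k : ℂ))
      (fun k => (cellSlope I ε εs J k : ℂ)) (cellClose I ε εs J : ℂ) (fun i => (z i : ℂ)) k =
      (stickMap I (stickSet I J) (cellBase I εs J) (cellSlope I ε εs J)
        (cellClose I ε εs J) z k : ℝ) := by
    intro k
    unfold stickMap stickMargin
    split_ifs <;> push_cast <;> rfl
  rw [cellComplex, cellReal, Function.comp_apply, Function.comp_apply, simplexMap, simplexMap]
  split_ifs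
  · simp only [h]
    push_cast
    rfl
  · exact h k

theorem circ_eq (ρ θ : ℝ) : circ ρ θ = ρ * expTwoPiI θ := rfl

/-- The coordinates of the polydisc. -/
def cellCoord (I : Finset (Fin m)) (J : Finset (Factor m)) (y : Fin m → ℝ) (k : Fin m) : ℂ :=
  mixedCoord (circleSet I J) k (y k)

theorem cellCoord_of_circle {k : Fin m} (h : IsCircleCoord I J k) (y : Fin m → ℝ) :
    cellCoord I J y k = expTwoPiI (y k) := if_pos (mem_circleSet.2 h)

theorem cellCoord_of_not_circle {k : Fin m} (h : ¬ IsCircleCoord I J k) (y : Fin m → ℝ) :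
    cellCoord I J y k = y k := if_neg fun hc => h (mem_circleSet.1 hc)

theorem isCircleCoord_iff_of_mem (hJ : IsFaceSet I J) {k : Fin m} (hk : k ∈ I) :
    IsCircleCoord I J k ↔ atZero k ∈ J ∨ (last ∈ J ∧ IsTop I J k) := by
  constructor
  · rintro (h | h | h)
    · exact Or.inl h
    · exact (hJ.1 k hk h).elim
    · exact Or.inr h
  · rintro (h | h)
    · exact isCircleCoord_of_atZero h
    · exact isCircleCoord_of_last h

/-- For `last ∈ J` the chart has the last coordinate in the place of the top one, so `ε` and `εs t`
exchange roles between slope and closing distance; the total is the same. -/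
theorem cellMargin_cellCoord (hJ : IsFaceSet I J) (y : Fin m → ℝ) :
    cellMargin I ε εs J (cellCoord I J y) = margin I ε εs J y := by
  classical
  have hsd : ∑ k ∈ I \ stickSet I J, (cellSlope I ε εs J k : ℂ) * cellCoord I J y k =
      ∑ k ∈ I, if IsCircleCoord I J k then (cellSlope I ε εs J k : ℂ) * expTwoPiI (y k) else 0 := by
    rw [← Finset.sum_filter]
    refine Finset.sum_congr ?_ fun k hk => ?_
    · ext k
      simp only [Finset.mem_sdiff, mem_stickSet, Finset.mem_filter]
      by_cases h : IsCircleCoord I J k <;> simp [h]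
    · rw [cellCoord_of_circle (Finset.mem_filter.1 hk).2]
  rw [cellMargin, stickMargin, hsd, margin]
  have hterm : ∀ k ∈ I, (cellBase I εs J k : ℂ) +
      (if IsCircleCoord I J k then (cellSlope I ε εs J k : ℂ) * expTwoPiI (y k) else 0) =
      (εs k : ℂ) - (if atZero k ∈ J then (εs k : ℂ) - circ (εs k) (y k) else 0) -
        (if last ∈ J ∧ IsTop I J k then (εs k : ℂ) - circ ε (y k) else 0) := by
    intro k hk
    have h1 : atOne k ∉ J := hJ.1 k hk
    by_cases h0 : atZero k ∈ J
    · have ht : ¬ (last ∈ J ∧ IsTop I J k) := fun h => (mem_free.1 h.2.1).2 h0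
      simp [cellBase, cellSlope, isCircleCoord_of_atZero h0, h0, h1, if_neg ht, circ_eq]
    · by_cases ht : last ∈ J ∧ IsTop I J k
      · simp [cellBase, cellSlope, isCircleCoord_of_last ht, h0, h1, if_pos ht, circ_eq]
      · have hc : ¬ IsCircleCoord I J k := by
          rw [isCircleCoord_iff_of_mem hJ hk]
          tauto
        simp [cellBase, hc, h0, if_neg ht]
  have hsum := Finset.sum_congr rfl hterm
  rw [Finset.sum_add_distrib, Finset.sum_sub_distrib, Finset.sum_sub_distrib] at hsum
  by_cases hl : last ∈ J
  · obtain ⟨t, ht⟩ := hJ.exists_isTop hl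
    have hst : ∑ k ∈ I, (if last ∈ J ∧ IsTop I J k then (εs k : ℂ) - circ ε (y k) else 0) =
        (εs t : ℂ) - circ ε (y t) := by
      rw [Finset.sum_eq_single t]
      · rw [if_pos ⟨hl, ht⟩]
      · exact fun k _ hk => if_neg fun hc => hk (hc.2.eq ht)
      · exact fun h => (h ht.mem).elim
    rw [hst] at hsum
    rw [if_pos hl, cellClose, if_pos hl, ht.topCoord_eq, ht.topCoord_eq]
    linear_combination -hsum
  · have hst : ∑ k ∈ I, (if last ∈ J ∧ IsTop I J k then (εs k : ℂ) - circ ε (y k) else 0) = 0 :=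
      Finset.sum_eq_zero fun k _ => if_neg fun hc => hl hc.1
    rw [hst] at hsum
    rw [if_neg hl, cellClose, if_neg hl]
    linear_combination -hsum

theorem prod_filter_lt_cellCoord (hJ : IsFaceSet I J) (y : Fin m → ℝ) {k : Fin m}
    (hk : k ∈ free I J) :
    ∏ p ∈ stickSet I J with p < k, (1 - cellCoord I J y p) =
      ((∏ p ∈ (free I J).filter (· < k), (1 - y p) : ℝ) : ℂ) := by
  rw [Complex.ofReal_prod]
  refine Finset.prod_congr ?_ fun p hp => ?_
  · ext p
    simp only [Finset.mem_filter, mem_stickSet_iff_free hJ]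
    refine ⟨fun h => ⟨h.1.1, h.2⟩, fun h => ⟨⟨h.1, fun hc => ?_⟩, h.2⟩⟩
    exact absurd (hc.2.2 k hk) (not_le.2 h.2)
  · have hp' := ((mem_stickSet_iff_free hJ).2 ?_ : p ∈ stickSet I J)
    · rw [cellCoord_of_not_circle (mem_stickSet.1 hp').2]
      push_cast
      rfl
    · rw [Finset.mem_filter] at hp
      exact ⟨hp.1, fun hc => absurd (hc.2.2 k hk) (not_le.2 hp.2)⟩

/-- The link between cells and regions: `cellComplex` is one polynomial map, which gives the cell
when the circle coordinates run over unit circles and, by `cellComplex_ofReal`, a real region when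
they run over `[0, 1]`. -/
theorem cellMap_eq (hJ : IsFaceSet I J) (y : Fin m → ℝ) :
    cellMap I ε εs J y = cellComplex I ε εs J (cellCoord I J y) := by
  classical
  funext k
  rw [cellComplex, Function.comp_apply]
  by_cases ht : last ∈ J ∧ IsTop I J k
  -- All stick coordinates lie below the top index, so the product that closes the simplex is the
  -- product in its stick.
  · have hset : stickSet I J = (stickSet I J).filter (· < k) := by
      rw [Finset.filter_true_of_mem]
      intro p hp
      rw [mem_stickSet_iff_free hJ] at hp
      refine lt_of_le_of_ne (ht.2.2 p hp.1) ?_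
      rintro rfl
      exact hp.2 ht
    rw [simplexMap, if_pos ht, one_sub_sum_stickMap stickSet_subset]
    change _ = _ + _ * cellMargin I ε εs J _
    rw [cellMargin_cellCoord hJ, Finset.prod_congr hset fun _ _ => rfl,
      prod_filter_lt_cellCoord hJ y ht.2.1, cellMap_of_mem_free ht.2.1, stick, if_pos ht, one_mul,
      cellClose, if_pos ht.1, ht.2.topCoord_eq]
  · rw [simplexMap, if_neg ht]
    by_cases hF : k ∈ stickSet I J
    · have hfree := ((mem_stickSet_iff_free hJ).1 hF).1
      have hc := (mem_stickSet.1 hF).2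
      rw [stickMap_of_mem hF, prod_filter_lt_cellCoord hJ y hfree, cellCoord_of_not_circle hc]
      change _ = _ + _ * cellMargin I ε εs J _
      rw [cellMargin_cellCoord hJ, cellMap_of_mem_free hfree, stick, if_neg ht, cellBase, if_neg hc]
      push_cast
      rfl
    · rw [stickMap_of_notMem hF]
      by_cases h0 : atZero k ∈ J
      · have h1 : atOne k ∉ J := fun h1 => by
          by_cases hk : k ∈ I
          · exact hJ.1 k hk h1
          · exact hJ.2.1 k hk ⟨h0, h1⟩
        rw [cellMap_of_atZero_mem h0, cellCoord_of_circle (isCircleCoord_of_atZero h0), circ_eq,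
          cellBase, if_pos (isCircleCoord_of_atZero h0), if_neg h1, cellSlope, if_pos h0,
          Complex.ofReal_zero, zero_add]
      · by_cases h1 : atOne k ∈ J
        · rw [cellMap_of_atOne_mem hJ h1, cellCoord_of_circle (isCircleCoord_of_atOne h1), circ_eq,
            cellBase, if_pos (isCircleCoord_of_atOne h1), if_pos h1, cellSlope, if_neg h0, if_pos h1]
          push_cast
          ring
        · have hc : ¬ IsCircleCoord I J k := by
            rintro (h | h | h)
            · exact h0 h
            · exact h1 h
            · exact ht h
          have hk : k ∉ I := fun hk => hF (mem_stickSet.2 ⟨hk, hc⟩)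
          rw [cellMap_of_notMem hk h0 h1, cellCoord_of_not_circle hc, cellBase, if_neg hc, cellSlope,
            if_neg h0, if_neg h1, if_neg ht]
          push_cast
          rfl

/-! ### The Jacobian determinants of the cells -/

/-- The Jacobian determinant of `cellComplex`. -/
def cellJac (I : Finset (Fin m)) (ε : ℝ) (εs : Fin m → ℝ) (J : Finset (Factor m))
    (z : Fin m → ℂ) : ℂ :=
  simplexSign ℂ J * ∏ k, if k ∈ stickSet I J then
    (∏ p ∈ stickSet I J with p < k, (1 - z p)) * cellMargin I ε εs J z else (cellSlope I ε εs J k : ℂ)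

theorem differentiable_cellComplex : Differentiable ℂ (cellComplex I ε εs J) :=
  differentiable_simplexMap.comp differentiable_stickMap

theorem differentiable_cellReal : Differentiable ℝ (cellReal I ε εs J) :=
  differentiable_simplexMap.comp differentiable_stickMap

theorem det_jacobian_cellComplex (hJ : IsFaceSet I J) (z : Fin m → ℂ) :
    (jacobian (cellComplex I ε εs J) z).det = cellJac I ε εs J z := by
  rw [cellComplex, det_jacobian_comp differentiable_simplexMap.differentiableAt
    differentiable_stickMap.differentiableAt, det_jacobian_simplexMap hJ, det_jacobian_stickMap]
  rfl

theorem det_jacobian_cellReal (hJ : IsFaceSet I J) (z : Fin m → ℝ) :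
    (jacobian (cellReal I ε εs J) z).det = simplexSign ℝ J * ∏ k, if k ∈ stickSet I J then
      (∏ p ∈ stickSet I J with p < k, (1 - z p)) * stickMargin I (stickSet I J) (cellBase I εs J)
        (cellSlope I ε εs J) (cellClose I ε εs J) z else cellSlope I ε εs J k := by
  rw [cellReal, det_jacobian_comp differentiable_simplexMap.differentiableAt
    differentiable_stickMap.differentiableAt, det_jacobian_simplexMap hJ, det_jacobian_stickMap]

theorem cellJac_ofReal (hJ : IsFaceSet I J) (z : Fin m → ℝ) :
    cellJac I ε εs J (fun k => (z k : ℂ)) = (jacobian (cellReal I ε εs J) z).det := by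
  have hm : cellMargin I ε εs J (fun k => (z k : ℂ)) = (stickMargin I (stickSet I J)
      (cellBase I εs J) (cellSlope I ε εs J) (cellClose I ε εs J) z : ℝ) := by
    rw [cellMargin, stickMargin, stickMargin]
    push_cast
    rfl
  rw [det_jacobian_cellReal hJ, cellJac, hm, Complex.ofReal_mul, Complex.ofReal_prod]
  congr 1
  · rw [simplexSign, simplexSign]
    split_ifs <;> simp
  · refine Finset.prod_congr rfl fun k _ => ?_
    split_ifs
    · push_cast
      rfl
    · rfl

theorem differentiable_cellMargin : Differentiable ℂ (cellMargin I ε εs J) := by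
  unfold cellMargin stickMargin
  fun_prop

theorem differentiable_cellJac : Differentiable ℂ (cellJac I ε εs J) := by
  unfold cellJac
  refine Differentiable.const_mul ?_ _
  have h : ∀ k, Differentiable ℂ fun z : Fin m → ℂ =>
      if k ∈ stickSet I J then (∏ p ∈ stickSet I J with p < k, (1 - z p)) * cellMargin I ε εs J z
        else (cellSlope I ε εs J k : ℂ) := by
    intro k
    have := differentiable_cellMargin (I := I) (ε := ε) (εs := εs) (J := J)
    split_ifs <;> fun_prop
  exact fun z => (HasFDerivAt.finsetProd fun k _ => (h k z).hasFDerivAt).differentiableAt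

theorem hasDerivAt_expTwoPiI_ofReal (t : ℝ) :
    HasDerivAt (fun t : ℝ => expTwoPiI t) (2 * Real.pi * Complex.I * expTwoPiI t) t := by
  have h1 : HasDerivAt (fun t : ℝ => 2 * Real.pi * Complex.I * (t : ℂ)) (2 * Real.pi * Complex.I) t := by
    simpa using (hasDerivAt_id t).ofReal_comp.const_mul (2 * Real.pi * Complex.I : ℂ)
  have h2 := h1.cexp
  rw [mul_comm (Complex.exp _)] at h2
  exact h2

open Classical in
-- Chain rule through `cellMap_eq`: an angle contributes `2πi e^{2πiθ}` to its column, and a real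
-- coordinate contributes `1`.
theorem det_fderivWithin_cellMap (hJ : IsFaceSet I J) {y : Fin m → ℝ} (hy : y ∈ unitCube m) :
    Matrix.det (Matrix.of fun i j : Fin m =>
      fderivWithin ℝ (cellMap I ε εs J) (unitCube m) y (Pi.single j 1) i) =
      (∏ k ∈ circleSet I J, 2 * Real.pi * Complex.I * expTwoPiI (y k)) *
        cellJac I ε εs J (cellCoord I J y) := by
  set v : Fin m → ℂ := fun k =>
    if k ∈ circleSet I J then 2 * Real.pi * Complex.I * expTwoPiI (y k) else 1 with hv
  have hcoord : ∀ k, HasDerivAt (fun t : ℝ => mixedCoord (circleSet I J) k t) (v k) (y k) := by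
    intro k
    by_cases hk : k ∈ circleSet I J
    · simp only [mixedCoord, if_pos hk, hv]
      exact hasDerivAt_expTwoPiI_ofReal (y k)
    · simp only [mixedCoord, if_neg hk, hv]
      simpa using (hasDerivAt_id (y k)).ofReal_comp
  have hc : HasFDerivAt (cellCoord I J) (ContinuousLinearMap.pi fun k =>
      (ContinuousLinearMap.toSpanSingleton ℝ (v k)).comp
        (ContinuousLinearMap.proj (R := ℝ) (φ := fun _ : Fin m => ℝ) k)) y :=
    hasFDerivAt_pi.2 fun k => (hcoord k).hasFDerivAt.comp y (hasFDerivAt_apply k y)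
  have hT := (differentiable_cellComplex (I := I) (ε := ε) (εs := εs) (J := J)
    (cellCoord I J y)).hasFDerivAt.restrictScalars ℝ
  have hcomp := (hT.comp y hc).hasFDerivWithinAt (s := unitCube m)
  have hfun : cellComplex I ε εs J ∘ cellCoord I J = cellMap I ε εs J :=
    funext fun y => (cellMap_eq hJ y).symm
  rw [hfun] at hcomp
  rw [hcomp.fderivWithin (uniqueDiffOn_unitCube m y hy), ← det_jacobian_cellComplex hJ]
  have hentry : ∀ i j, ((fderiv ℂ (cellComplex I ε εs J) (cellCoord I J y)).restrictScalars ℝ ∘SL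
      ContinuousLinearMap.pi fun k => (ContinuousLinearMap.toSpanSingleton ℝ (v k)).comp
        (ContinuousLinearMap.proj (R := ℝ) (φ := fun _ : Fin m => ℝ) k)) (Pi.single j 1) i =
      v j * jacobian (cellComplex I ε εs J) (cellCoord I J y) i j := by
    intro i j
    have : (ContinuousLinearMap.pi fun k => (ContinuousLinearMap.toSpanSingleton ℝ (v k)).comp
        (ContinuousLinearMap.proj (R := ℝ) (φ := fun _ : Fin m => ℝ) k)) (Pi.single j (1 : ℝ)) =
        v j • (Pi.single j (1 : ℂ) : Fin m → ℂ) := by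
      funext k
      by_cases hk : k = j
      · subst hk
        simp
      · simp [hk]
    refine (congrFun (congrArg (fderiv ℂ (cellComplex I ε εs J) (cellCoord I J y)) this) i).trans ?_
    rw [map_smul]
    rfl
  simp only [hentry]
  rw [Matrix.det_mul_row]
  congr 1
  rw [hv, Finset.prod_ite_mem, Finset.univ_inter]

end cellParam

/-! ### The facet functions on a cell -/

section facets

variable {m : ℕ} {I : Finset (Fin m)} {ε : ℝ} {εs : Fin m → ℝ} {J : Finset (Factor m)}

/-- The labels of the facets of the product of a simplex and intervals. -/
def facets (I : Finset (Fin m)) : Finset (Factor m) :=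
  Finset.univ.filter fun v => ∀ p ∈ I, v ≠ atOne p

theorem mem_facets {v : Factor m} : v ∈ facets I ↔ ∀ p ∈ I, v ≠ atOne p := by simp [facets]

theorem atZero_mem_facets (k : Fin m) : atZero k ∈ facets I := by simp [mem_facets]

theorem last_mem_facets : last ∈ facets I := by simp [mem_facets]

theorem atOne_mem_facets {k : Fin m} : atOne k ∈ facets I ↔ k ∉ I := by
  rw [mem_facets]
  refine ⟨fun h hk => h k hk rfl, fun h p hp hc => h ?_⟩
  rw [Sum.inr.injEq, Sum.inl.injEq] at hc
  exact hc ▸ hp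

theorem IsFaceSet.subset_facets (hJ : IsFaceSet I J) : J ⊆ facets I := fun _ hv =>
  mem_facets.2 fun p hp h => hJ.1 p hp (h ▸ hv)

theorem IsFaceSet.atOne_notMem (hJ : IsFaceSet I J) {k : Fin m} (h : atZero k ∈ J) :
    atOne k ∉ J := fun h1 => by
  by_cases hk : k ∈ I
  · exact hJ.1 k hk h1
  · exact hJ.2.1 k hk ⟨h, h1⟩

theorem IsFaceSet.notMem_of_atOne (hJ : IsFaceSet I J) {k : Fin m} (h : atOne k ∈ J) : k ∉ I :=
  fun hk => hJ.1 k hk h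

theorem IsFaceSet.atOne_notMem_of_isTop (hJ : IsFaceSet I J) {k : Fin m} (h : IsTop I J k) :
    atOne k ∉ J := hJ.1 k h.mem

theorem IsTop.atZero_notMem {k : Fin m} (h : IsTop I J k) : atZero k ∉ J := (mem_free.1 h.1).2

/-- The functions that define the facets. -/
def facetVal {𝕜 : Type*} [Ring 𝕜] (I : Finset (Fin m)) (s : Fin m → 𝕜) : Factor m → 𝕜 :=
  Sum.elim s (Sum.elim (fun k => 1 - s k) fun _ => 1 - ∑ p ∈ I, s p)

/-- The continuous logarithms of the facet functions along a cell. -/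
def logFacet (I : Finset (Fin m)) (ε : ℝ) (εs : Fin m → ℝ) (J : Finset (Factor m)) :
    Factor m → (Fin m → ℝ) → ℂ :=
  Sum.elim (logZero I ε εs J) (Sum.elim (logOne I ε εs 0 J) fun _ => logSimplex I ε εs J)

theorem facetLabel_of_atZero {k : Fin m} (h : atZero k ∈ J) : facetLabel J k = atZero k := if_pos h

theorem facetLabel_of_atOne (hJ : IsFaceSet I J) {k : Fin m} (h : atOne k ∈ J) :
    facetLabel J k = atOne k := by
  rw [facetLabel, if_neg fun h0 => hJ.atOne_notMem h0 h, if_pos h]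

theorem facetLabel_of_isTop (hJ : IsFaceSet I J) {k : Fin m} (h : IsTop I J k) :
    facetLabel J k = last := by
  rw [facetLabel, if_neg h.atZero_notMem, if_neg (hJ.atOne_notMem_of_isTop h)]

/-- Together with injectivity this is a bijection between the angles of a cell and the facets in
`J`; products over `J` become products over coordinates. -/
theorem image_facetLabel (hJ : IsFaceSet I J) : (circleSet I J).image (facetLabel J) = J := by
  ext v
  rw [Finset.mem_image]
  constructor
  · rintro ⟨k, hk, rfl⟩
    rcases mem_circleSet.1 hk with h | h | h
    · rwa [facetLabel_of_atZero h]
    · rwa [facetLabel_of_atOne hJ h]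
    · rw [facetLabel_of_isTop hJ h.2]
      exact h.1
  · intro hv
    rcases v with k | k | ⟨⟩
    · exact ⟨k, mem_circleSet.2 (isCircleCoord_of_atZero hv), facetLabel_of_atZero hv⟩
    · exact ⟨k, mem_circleSet.2 (isCircleCoord_of_atOne hv), facetLabel_of_atOne hJ hv⟩
    · obtain ⟨t, ht⟩ := hJ.exists_isTop hv
      exact ⟨t, mem_circleSet.2 (isCircleCoord_of_last ⟨hv, ht⟩), facetLabel_of_isTop hJ ht⟩

theorem injOn_facetLabel (hJ : IsFaceSet I J) : Set.InjOn (facetLabel J) (circleSet I J) := by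
  intro k hk k' hk' h
  rcases mem_circleSet.1 hk with h0 | h0 | h0 <;> rcases mem_circleSet.1 hk' with h0' | h0' | h0'
  · rw [facetLabel_of_atZero h0, facetLabel_of_atZero h0'] at h
    exact Sum.inl_injective h
  · simp [facetLabel_of_atZero h0, facetLabel_of_atOne hJ h0'] at h
  · simp [facetLabel_of_atZero h0, facetLabel_of_isTop hJ h0'.2] at h
  · simp [facetLabel_of_atOne hJ h0, facetLabel_of_atZero h0'] at h
  · rw [facetLabel_of_atOne hJ h0, facetLabel_of_atOne hJ h0'] at h
    exact Sum.inl_injective (Sum.inr_injective h)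
  · simp [facetLabel_of_atOne hJ h0, facetLabel_of_isTop hJ h0'.2] at h
  · simp [facetLabel_of_isTop hJ h0.2, facetLabel_of_atZero h0'] at h
  · simp [facetLabel_of_isTop hJ h0.2, facetLabel_of_atOne hJ h0'] at h
  · exact h0.2.eq h0'.2

theorem prod_faceSet {R : Type*} [CommMonoid R] (hJ : IsFaceSet I J) (f : Factor m → R) :
    ∏ j ∈ J, f j = ∏ k ∈ circleSet I J, f (facetLabel J k) := by
  conv_lhs => rw [← image_facetLabel hJ]
  exact Finset.prod_image (injOn_facetLabel hJ)

theorem sum_faceSet {R : Type*} [AddCommMonoid R] (hJ : IsFaceSet I J) (f : Factor m → R) :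
    ∑ j ∈ J, f j = ∑ k ∈ circleSet I J, f (facetLabel J k) := by
  conv_lhs => rw [← image_facetLabel hJ]
  exact Finset.sum_image (injOn_facetLabel hJ)

theorem logFacet_facetLabel (hJ : IsFaceSet I J) {k : Fin m} (hk : k ∈ circleSet I J)
    (y : Fin m → ℝ) : logFacet I ε εs J (facetLabel J k) y =
      logCirc (facetRadius ε εs (facetLabel J k)) (y k) := by
  rcases mem_circleSet.1 hk with h | h | h
  · rw [facetLabel_of_atZero h]
    exact if_pos h
  · rw [facetLabel_of_atOne hJ h]
    change logOne I ε εs 0 J k y = _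
    rw [logOne, if_neg (hJ.notMem_of_atOne h), if_pos h]
    rfl
  · rw [facetLabel_of_isTop hJ h.2]
    change logSimplex I ε εs J y = _
    rw [logSimplex, if_pos h.1, h.2.topCoord_eq]
    rfl

theorem logFacet_of_notMem {v : Factor m} (hv : v ∈ facets I \ J) (y : Fin m → ℝ) :
    logFacet I ε εs J v y = Complex.log (facetVal I (cellMap I ε εs J y) v) := by
  obtain ⟨hf, hJ⟩ := Finset.mem_sdiff.1 hv
  rcases v with k | k | ⟨⟩
  · exact if_neg hJ
  · change logOne I ε εs 0 J k y = _
    rw [logOne, if_neg (atOne_mem_facets.1 hf), if_neg hJ]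
    rfl
  · exact if_neg hJ

theorem AdmissibleRadii.facetRadius_pos (hε : AdmissibleRadii ε εs) (v : Factor m) :
    0 < facetRadius ε εs v := by
  rcases v with k | k | ⟨⟩
  · exact hε.pos k
  · exact hε.pos k
  · exact hε.pos_last

/-! ### Positivity on the polydisc -/

/-- With the circle coordinates at their starting point `1`, all distances from the facets of the
simplex are the radii; in the chart they are distributed over offsets, slopes and closing distance.
-/
theorem sum_cellBase_add (hJ : IsFaceSet I J) : ∑ k ∈ I, cellBase I εs J k + cellClose I ε εs J +
    ∑ k ∈ I \ stickSet I J, cellSlope I ε εs J k = ε + ∑ k ∈ I, εs k := by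
  classical
  have hsd : ∑ k ∈ I \ stickSet I J, cellSlope I ε εs J k =
      ∑ k ∈ I, if IsCircleCoord I J k then cellSlope I ε εs J k else 0 := by
    rw [← Finset.sum_filter]
    refine Finset.sum_congr ?_ fun k hk => rfl
    ext k
    simp only [Finset.mem_sdiff, mem_stickSet, Finset.mem_filter]
    by_cases h : IsCircleCoord I J k <;> simp [h]
  have hterm : ∀ k ∈ I, cellBase I εs J k + (if IsCircleCoord I J k then cellSlope I ε εs J k else 0) =
      εs k + (if last ∈ J ∧ IsTop I J k then ε - εs k else 0) := by
    intro k hk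
    have h1 : atOne k ∉ J := hJ.1 k hk
    by_cases h0 : atZero k ∈ J
    · have ht : ¬ (last ∈ J ∧ IsTop I J k) := fun h => h.2.atZero_notMem h0
      simp [cellBase, cellSlope, isCircleCoord_of_atZero h0, h0, h1, if_neg ht]
    · by_cases ht : last ∈ J ∧ IsTop I J k
      · simp [cellBase, cellSlope, isCircleCoord_of_last ht, h0, h1, if_pos ht]
      · have hc : ¬ IsCircleCoord I J k := by
          rw [isCircleCoord_iff_of_mem hJ hk]
          tauto
        simp [cellBase, hc, if_neg ht]
  have hsum := Finset.sum_congr rfl hterm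
  rw [Finset.sum_add_distrib, Finset.sum_add_distrib, ← hsd] at hsum
  by_cases hl : last ∈ J
  · obtain ⟨t, ht⟩ := hJ.exists_isTop hl
    have hst : ∑ k ∈ I, (if last ∈ J ∧ IsTop I J k then ε - εs k else 0) = ε - εs t := by
      rw [Finset.sum_eq_single t]
      · rw [if_pos ⟨hl, ht⟩]
      · exact fun k _ hk => if_neg fun hc => hk (hc.2.eq ht)
      · exact fun h => (h ht.mem).elim
    rw [hst] at hsum
    rw [cellClose, if_pos hl, ht.topCoord_eq]
    linear_combination hsum
  · have hst : ∑ k ∈ I, (if last ∈ J ∧ IsTop I J k then ε - εs k else 0) = 0 :=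
      Finset.sum_eq_zero fun k _ => if_neg fun hc => hl hc.1
    rw [hst] at hsum
    rw [cellClose, if_neg hl]
    linear_combination hsum

theorem cellSlope_pos (hε : AdmissibleRadii ε εs) {k : Fin m} (h : atOne k ∉ J) :
    0 < cellSlope I ε εs J k := by
  have h1 := hε.pos k
  have h2 := hε.lt_quarter k
  have h3 := hε.pos_last
  rw [cellSlope]
  split_ifs
  · exact h1
  · exact h3
  · linarith

theorem cellBase_nonneg (hε : AdmissibleRadii ε εs) (k : Fin m) : 0 ≤ cellBase I εs J k := by
  rw [cellBase]
  split_ifs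
  · exact zero_le_one
  · exact le_rfl
  · exact (hε.pos k).le

theorem cellClose_pos (hε : AdmissibleRadii ε εs) (hJ : IsFaceSet I J) : 0 < cellClose I ε εs J := by
  rw [cellClose]
  split_ifs with h
  · obtain ⟨t, ht⟩ := hJ.exists_isTop h
    rw [ht.topCoord_eq]
    exact hε.pos t
  · exact hε.pos_last

/-- Enlarging the circles multiplies the slopes by at most `R`; the remaining distances are
nonnegative, so they are also bounded by their `R`-fold. -/
theorem le_re_cellMargin (hε : AdmissibleRadii ε εs) (hJ : IsFaceSet I J) {R : ℝ} (hR : 1 ≤ R)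
    {z : Fin m → ℂ} (hz : ∀ k ∈ circleSet I J, ‖z k‖ ≤ R) :
    1 - R * (ε + ∑ k ∈ I, εs k) ≤ (cellMargin I ε εs J z).re := by
  have hle : (∑ k ∈ I \ stickSet I J, (cellSlope I ε εs J k : ℂ) * z k).re ≤
      ∑ k ∈ I \ stickSet I J, cellSlope I ε εs J k * R := by
    rw [Complex.re_sum]
    refine Finset.sum_le_sum fun k hk => ?_
    obtain ⟨hkI, hkF⟩ := Finset.mem_sdiff.1 hk
    rw [Complex.re_ofReal_mul]
    refine mul_le_mul_of_nonneg_left ((Complex.re_le_norm _).trans (hz k ?_))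
      (cellSlope_pos hε (hJ.1 k hkI)).le
    by_contra hc
    exact hkF (mem_stickSet.2 ⟨hkI, fun h => hc (mem_circleSet.2 h)⟩)
  have hsum := sum_cellBase_add (ε := ε) (εs := εs) hJ
  have h0 : 0 ≤ ∑ k ∈ I, cellBase I εs J k := Finset.sum_nonneg fun k _ => cellBase_nonneg hε k
  have h1 := cellClose_pos hε hJ
  rw [← Finset.sum_mul] at hle
  rw [cellMargin, stickMargin, Complex.sub_re, Complex.sub_re, Complex.sub_re, Complex.one_re,
    Complex.ofReal_re, ← Complex.ofReal_sum, Complex.ofReal_re]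
  rw [← hsum]
  nlinarith

/-- In the chart the facet functions in `J` are pure multiples of single coordinates, so their
powers separate as one-dimensional weights and the rest stays holomorphic in these coordinates. -/
theorem cellComplex_of_circle (hJ : IsFaceSet I J) {k : Fin m} (hk : k ∈ circleSet I J)
    (z : Fin m → ℂ) : facetVal I (cellComplex I ε εs J z) (facetLabel J k) =
      facetRadius ε εs (facetLabel J k) * z k := by
  have hnF : k ∉ stickSet I J := fun h => notMem_circleSet_of_mem_stickSet h hk
  have hc := mem_circleSet.1 hk
  by_cases ht : last ∈ J ∧ IsTop I J k
  · have h0 := ht.2.atZero_notMem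
    have h1 := hJ.atOne_notMem_of_isTop ht.2
    rw [facetLabel_of_isTop hJ ht.2]
    change 1 - ∑ p ∈ I, simplexMap I J _ p = _
    rw [one_sub_sum_simplexMap ht.1 ht.2, stickMap_of_notMem hnF, cellBase, if_pos hc, if_neg h1,
      cellSlope, if_neg h0, if_neg h1, if_pos ht, Complex.ofReal_zero, zero_add]
    rfl
  · have hval : cellComplex I ε εs J z k = cellBase I εs J k + cellSlope I ε εs J k * z k := by
      rw [cellComplex, Function.comp_apply, simplexMap, if_neg ht, stickMap_of_notMem hnF]
    rcases hc with h | h | h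
    · rw [facetLabel_of_atZero h]
      change cellComplex I ε εs J z k = _
      rw [hval, cellBase, if_pos (isCircleCoord_of_atZero h), if_neg (hJ.atOne_notMem h), cellSlope,
        if_pos h, Complex.ofReal_zero, zero_add]
      rfl
    · rw [facetLabel_of_atOne hJ h]
      change 1 - cellComplex I ε εs J z k = _
      rw [hval, cellBase, if_pos (isCircleCoord_of_atOne h), if_pos h, cellSlope,
        if_neg fun h0 => hJ.atOne_notMem h0 h, if_pos h]
      change _ = (εs k : ℂ) * z k
      push_cast
      ring
    · exact (ht h).elim

theorem facetVal_cellReal_of_circle (hJ : IsFaceSet I J) {k : Fin m} (hk : k ∈ circleSet I J)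
    (z : Fin m → ℝ) : facetVal I (cellReal I ε εs J z) (facetLabel J k) =
      facetRadius ε εs (facetLabel J k) * z k := by
  have h := cellComplex_of_circle (ε := ε) (εs := εs) hJ hk fun i => (z i : ℂ)
  rw [funext (cellComplex_ofReal z)] at h
  have h2 : facetVal I (fun k => (cellReal I ε εs J z k : ℂ)) (facetLabel J k) =
      (facetVal I (cellReal I ε εs J z) (facetLabel J k) : ℝ) := by
    rcases facetLabel J k with k | k | ⟨⟩
    · rfl
    · change 1 - _ = ((1 - _ : ℝ) : ℂ)
      push_cast
      rfl
    · change 1 - _ = ((1 - _ : ℝ) : ℂ)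
      push_cast
      rfl
  rw [h2] at h
  exact_mod_cast h

theorem mixedDomain_norm_le {C : Finset (Fin m)} {R : ℝ} {z : Fin m → ℂ}
    (hz : z ∈ mixedDomain C R) {k : Fin m} (hk : k ∈ C) : ‖z k‖ < R := by
  have := hz k
  rwa [if_pos hk] at this

theorem mixedDomain_real {C : Finset (Fin m)} {R : ℝ} {z : Fin m → ℂ}
    (hz : z ∈ mixedDomain C R) {k : Fin m} (hk : k ∉ C) : ∃ t ∈ Set.Icc (0 : ℝ) 1, z k = t := by
  have := hz k
  rwa [if_neg hk] at this

theorem exists_prod_eq_ofReal {R : ℝ} {z : Fin m → ℂ} (hz : z ∈ mixedDomain (circleSet I J) R)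
    (s : Finset (Fin m)) (hs : s ⊆ stickSet I J) :
    ∃ t : ℝ, 0 ≤ t ∧ ∏ p ∈ s, (1 - z p) = t := by
  induction s using Finset.induction_on with
  | empty => exact ⟨1, zero_le_one, by simp⟩
  | insert i s hi ih =>
    obtain ⟨t, ht, h⟩ := ih ((Finset.subset_insert _ _).trans hs)
    obtain ⟨r, hr, h'⟩ := mixedDomain_real hz
      (notMem_circleSet_of_mem_stickSet (hs (Finset.mem_insert_self _ _)))
    refine ⟨(1 - r) * t, mul_nonneg (sub_nonneg.2 hr.2) ht, ?_⟩
    rw [Finset.prod_insert hi, h, h']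
    push_cast
    rfl

/-- Makes the principal logarithms holomorphic on a polydisc slightly larger than the unit one. The
bound `R ≤ 2` with radii below `1 / 4` keeps a disc about one end of an interval away from the other
end; the bound on the sum keeps the real part of the margin nonnegative. -/
theorem re_facetVal_cellComplex_pos (hε : AdmissibleRadii ε εs) (hJ : IsFaceSet I J) {R : ℝ}
    (hR : 1 ≤ R) (hR2 : R ≤ 2) (hR' : R * (ε + ∑ k ∈ I, εs k) ≤ 1) {z : Fin m → ℂ}
    (hz : z ∈ mixedDomain (circleSet I J) R) {v : Factor m} (hv : v ∈ facets I \ J) :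
    0 < (facetVal I (cellComplex I ε εs J z) v).re := by
  obtain ⟨hvf, hvJ⟩ := Finset.mem_sdiff.1 hv
  have hN : 0 ≤ (cellMargin I ε εs J z).re := (sub_nonneg.2 hR').trans
    (le_re_cellMargin hε hJ hR fun k hk => (mixedDomain_norm_le hz hk).le)
  -- The coordinate that closes the sticks: the last one if `last ∉ J`, the top one if `last ∈ J`.
  -- The product of the real factors `1 - z p` is nonnegative.
  have hclose : ∀ w : ℂ, w = (cellClose I ε εs J : ℂ) +
      (∏ p ∈ stickSet I J, (1 - z p)) * cellMargin I ε εs J z → 0 < w.re := by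
    rintro w rfl
    obtain ⟨t, ht, h⟩ := exists_prod_eq_ofReal hz _ (subset_refl _)
    rw [h, Complex.add_re, Complex.ofReal_re, Complex.re_ofReal_mul]
    exact add_pos_of_pos_of_nonneg (cellClose_pos hε hJ) (mul_nonneg ht hN)
  have hcompl : ∀ k, k ∉ I → (atZero k ∉ J → 0 < (cellComplex I ε εs J z k).re) ∧
      (atOne k ∉ J → 0 < (1 - cellComplex I ε εs J z k).re) := by
    intro k hk
    have hpos := hε.pos k
    have hlt := hε.lt_quarter k
    have hsmall : k ∈ circleSet I J → (z k).re < 2 ∧ -2 < (z k).re := fun hc => by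
      have := (Complex.abs_re_le_norm (z k)).trans (mixedDomain_norm_le hz hc).le
      have h := mixedDomain_norm_le hz hc
      have h2 := abs_le.1 (Complex.abs_re_le_norm (z k))
      exact ⟨by linarith [h2.2], by linarith [h2.1]⟩
    have hval : cellComplex I ε εs J z k = cellBase I εs J k + cellSlope I ε εs J k * z k := by
      rw [cellComplex, Function.comp_apply, simplexMap, if_neg fun h => hk h.2.mem,
        stickMap_of_notMem fun h => hk (mem_stickSet.1 h).1]
    have hre : (cellComplex I ε εs J z k).re = cellBase I εs J k + cellSlope I ε εs J k * (z k).re := by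
      rw [hval, Complex.add_re, Complex.ofReal_re, Complex.re_ofReal_mul]
    rw [Complex.sub_re, Complex.one_re, hre]
    by_cases h0 : atZero k ∈ J
    · have h1 := hJ.atOne_notMem h0
      have hc := isCircleCoord_of_atZero (I := I) h0
      have := hsmall (mem_circleSet.2 hc)
      rw [cellBase, if_pos hc, if_neg h1, cellSlope, if_pos h0]
      exact ⟨fun h => (h h0).elim, fun _ => by nlinarith⟩
    · by_cases h1 : atOne k ∈ J
      · have hc := isCircleCoord_of_atOne (I := I) h1
        have := hsmall (mem_circleSet.2 hc)
        rw [cellBase, if_pos hc, if_pos h1, cellSlope, if_neg h0, if_pos h1]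
        exact ⟨fun _ => by nlinarith, fun h => (h h1).elim⟩
      · have hc : ¬ IsCircleCoord I J k := by
          rintro (h | h | h)
          · exact h0 h
          · exact h1 h
          · exact hk h.2.mem
        obtain ⟨t, ht, h⟩ := mixedDomain_real hz fun h => hc (mem_circleSet.1 h)
        rw [cellBase, if_neg hc, cellSlope, if_neg h0, if_neg h1, if_neg fun h => hk h.2.mem, h,
          Complex.ofReal_re]
        exact ⟨fun _ => by nlinarith [ht.1], fun _ => by nlinarith [ht.2]⟩
  rcases v with k | k | ⟨⟩
  · change 0 < (cellComplex I ε εs J z k).re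
    by_cases hk : k ∈ I
    · by_cases ht : last ∈ J ∧ IsTop I J k
      · refine hclose _ ?_
        rw [cellComplex, Function.comp_apply, simplexMap, if_pos ht,
          one_sub_sum_stickMap stickSet_subset]
        rfl
      · have hc : ¬ IsCircleCoord I J k := by
          rw [isCircleCoord_iff_of_mem hJ hk]
          tauto
        have hF := mem_stickSet.2 ⟨hk, hc⟩
        obtain ⟨t, ht', h⟩ := exists_prod_eq_ofReal hz _ (Finset.filter_subset (· < k) (stickSet I J))
        obtain ⟨r, hr, h'⟩ := mixedDomain_real hz fun h => hc (mem_circleSet.1 h)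
        rw [cellComplex, Function.comp_apply, simplexMap, if_neg ht, stickMap_of_mem hF, h, h',
          cellBase, if_neg hc, ← Complex.ofReal_mul, Complex.add_re, Complex.ofReal_re,
          Complex.re_ofReal_mul]
        exact add_pos_of_pos_of_nonneg (hε.pos k) (mul_nonneg (mul_nonneg hr.1 ht') hN)
    · exact (hcompl k hk).1 hvJ
  · exact (hcompl k (atOne_mem_facets.1 hvf)).2 hvJ
  · refine hclose _ ?_
    change 1 - ∑ p ∈ I, cellComplex I ε εs J z p = _
    rw [cellComplex, Function.comp_apply, simplexMap_of_last_notMem hvJ,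
      one_sub_sum_stickMap stickSet_subset]
    rfl

theorem differentiable_facetVal (v : Factor m) :
    Differentiable ℂ fun s : Fin m → ℂ => facetVal I s v := by
  rcases v with k | k | ⟨⟩
  · change Differentiable ℂ fun s : Fin m → ℂ => s k
    fun_prop
  · change Differentiable ℂ fun s : Fin m → ℂ => 1 - s k
    fun_prop
  · change Differentiable ℂ fun s : Fin m → ℂ => 1 - ∑ p ∈ I, s p
    fun_prop

/-- The product of the powers of the facet functions not in `J`, times the Jacobian, on the
polydisc. -/
def cellFun (I : Finset (Fin m)) (ε : ℝ) (εs : Fin m → ℝ) (J : Finset (Factor m))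
    (e : Factor m → ℂ) (z : Fin m → ℂ) : ℂ :=
  Complex.exp (∑ v ∈ facets I \ J, e v * Complex.log (facetVal I (cellComplex I ε εs J z) v)) *
    cellJac I ε εs J z

theorem differentiableAt_cellFun (hε : AdmissibleRadii ε εs) (hJ : IsFaceSet I J) {R : ℝ}
    (hR : 1 ≤ R) (hR2 : R ≤ 2) (hR' : R * (ε + ∑ k ∈ I, εs k) ≤ 1) (e : Factor m → ℂ)
    {z : Fin m → ℂ} (hz : z ∈ mixedDomain (circleSet I J) R) :
    DifferentiableAt ℂ (cellFun I ε εs J e) z := by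
  refine DifferentiableAt.mul (DifferentiableAt.cexp (DifferentiableAt.fun_sum fun v hv => ?_))
    (differentiable_cellJac z)
  have h : DifferentiableAt ℂ (fun z => facetVal I (cellComplex I ε εs J z) v) z :=
    (differentiable_facetVal (I := I) v).differentiableAt.comp z (differentiable_cellComplex z)
  exact (h.clog (Or.inl (re_facetVal_cellComplex_pos hε hJ hR hR2 hR' hz hv))).const_mul _

theorem exists_radius (hε : AdmissibleRadii ε εs) (I : Finset (Fin m)) :
    ∃ R : ℝ, 1 < R ∧ R ≤ 2 ∧ R * (ε + ∑ k ∈ I, εs k) ≤ 1 := by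
  have h1 := hε.sum_I_lt I
  have h0 : 0 < ε + ∑ k ∈ I, εs k :=
    add_pos_of_pos_of_nonneg hε.pos_last (Finset.sum_nonneg fun k _ => (hε.pos k).le)
  refine ⟨min 2 (ε + ∑ k ∈ I, εs k)⁻¹, lt_min one_lt_two ((one_lt_inv₀ h0).2 h1), min_le_left _ _, ?_⟩
  exact (mul_le_mul_of_nonneg_right (min_le_right _ _) h0.le).trans (inv_mul_cancel₀ h0.ne').le

end facets

/-! ### The integral over a cell as an integral over a region -/

section regions

open MeasureTheory

variable {m : ℕ} {I : Finset (Fin m)} {ε : ℝ} {εs : Fin m → ℝ} {J : Finset (Factor m)}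

/-- The region near the facets in `J` and away from the other facets. -/
def facetRegion (I : Finset (Fin m)) (ε : ℝ) (εs : Fin m → ℝ) (J : Finset (Factor m)) :
    Set (Fin m → ℝ) :=
  {s | ∀ v ∈ facets I, if v ∈ J then 0 < facetVal I s v ∧ facetVal I s v < facetRadius ε εs v
    else facetRadius ε εs v < facetVal I s v}

theorem div_mem_Ioo_iff {a r : ℝ} (hr : 0 < r) : a / r ∈ Set.Ioo (0 : ℝ) 1 ↔ 0 < a ∧ a < r := by
  rw [Set.mem_Ioo, div_pos_iff_of_pos_right hr, div_lt_one hr]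

theorem cellSlope_ne_zero (hε : AdmissibleRadii ε εs) (k : Fin m) :
    cellSlope I ε εs J k ≠ 0 := by
  have h1 := hε.pos k
  have h2 := hε.lt_quarter k
  have h3 := hε.pos_last
  rw [cellSlope]
  split_ifs
  · exact h1.ne'
  · exact (neg_neg_of_pos h1).ne
  · exact h3.ne'
  · exact ne_of_gt (by linarith)

theorem stickMargin_cell_pos (hε : AdmissibleRadii ε εs) (hJ : IsFaceSet I J) {z : Fin m → ℝ}
    (hz : z ∈ openCube m) : 0 < stickMargin I (stickSet I J) (cellBase I εs J)
      (cellSlope I ε εs J) (cellClose I ε εs J) z := by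
  have h := le_re_cellMargin hε hJ le_rfl (z := fun k => (z k : ℂ)) fun k _ => by
    rw [Complex.norm_real, Real.norm_of_nonneg (mem_openCube.1 hz k).1.le]
    exact (mem_openCube.1 hz k).2.le
  have hm : cellMargin I ε εs J (fun k => (z k : ℂ)) = (stickMargin I (stickSet I J)
      (cellBase I εs J) (cellSlope I ε εs J) (cellClose I ε εs J) z : ℝ) := by
    rw [cellMargin, stickMargin, stickMargin]
    push_cast
    rfl
  rw [hm, Complex.ofReal_re] at h
  have := hε.sum_I_lt I
  linarith

theorem injOn_cellReal (hε : AdmissibleRadii ε εs) (hJ : IsFaceSet I J) :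
    Set.InjOn (cellReal I ε εs J) (openCube m) := by
  have h1 := injOn_stickMap (stickSet_subset (I := I) (J := J))
    (fun k _ => cellSlope_ne_zero hε k) fun z hz => stickMargin_cell_pos hε hJ hz
  intro z hz z' hz' h
  refine h1 hz hz' ?_
  have := congrArg (simplexMap I J) h
  rwa [cellReal, Function.comp_apply, Function.comp_apply, simplexMap_simplexMap hJ,
    simplexMap_simplexMap hJ] at this

/-- After `simplexMap` is undone, the three conditions of `image_stickMap` are the inequalities of
the region, facet by facet. -/
theorem image_cellReal (hε : AdmissibleRadii ε εs) (hJ : IsFaceSet I J) :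
    cellReal I ε εs J '' openCube m = facetRegion I ε εs J := by
  have himg := image_stickMap (stickSet_subset (I := I) (J := J))
    (fun k _ => cellSlope_ne_zero hε k) fun z hz => stickMargin_cell_pos hε hJ hz
  ext s
  have hmem : s ∈ cellReal I ε εs J '' openCube m ↔ simplexMap I J s ∈
      stickMap I (stickSet I J) (cellBase I εs J) (cellSlope I ε εs J) (cellClose I ε εs J) ''
        openCube m := by
    rw [cellReal, Set.image_comp]
    constructor
    · rintro ⟨w, hw, rfl⟩
      rwa [simplexMap_simplexMap hJ]
    · exact fun h => ⟨_, h, simplexMap_simplexMap hJ s⟩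
  rw [hmem, himg]
  set w := simplexMap I J s with hw
  have hne : ∀ k, ¬ (last ∈ J ∧ IsTop I J k) → w k = s k := fun k h => if_neg h
  have htop : ∀ k, last ∈ J ∧ IsTop I J k → w k = 1 - ∑ p ∈ I, s p := fun k h => if_pos h
  have htop' : ∀ k, last ∈ J ∧ IsTop I J k → 1 - ∑ p ∈ I, w p = s k := fun k h =>
    one_sub_sum_simplexMap h.1 h.2 s
  have hlast : last ∉ J → w = s := fun h => simplexMap_of_last_notMem h s
  -- the conditions on the affine coordinates
  have c0 : ∀ k, atZero k ∈ J → ((w k - cellBase I εs J k) / cellSlope I ε εs J k ∈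
      Set.Ioo (0 : ℝ) 1 ↔ 0 < s k ∧ s k < εs k) := fun k h => by
    rw [cellBase, if_pos (isCircleCoord_of_atZero h), if_neg (hJ.atOne_notMem h), cellSlope, if_pos h,
      sub_zero, hne k fun hc => hc.2.atZero_notMem h, div_mem_Ioo_iff (hε.pos k)]
  have c1 : ∀ k, atOne k ∈ J → ((w k - cellBase I εs J k) / cellSlope I ε εs J k ∈
      Set.Ioo (0 : ℝ) 1 ↔ 0 < 1 - s k ∧ 1 - s k < εs k) := fun k h => by
    rw [cellBase, if_pos (isCircleCoord_of_atOne h), if_pos h, cellSlope,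
      if_neg fun h0 => hJ.atOne_notMem h0 h, if_pos h, hne k fun hc => hJ.atOne_notMem_of_isTop hc.2 h,
      div_neg, ← neg_div, neg_sub, div_mem_Ioo_iff (hε.pos k)]
  have cl : ∀ k, last ∈ J ∧ IsTop I J k → ((w k - cellBase I εs J k) / cellSlope I ε εs J k ∈
      Set.Ioo (0 : ℝ) 1 ↔ 0 < 1 - ∑ p ∈ I, s p ∧ 1 - ∑ p ∈ I, s p < ε) := fun k h => by
    rw [cellBase, if_pos (isCircleCoord_of_last h), if_neg (hJ.atOne_notMem_of_isTop h.2), cellSlope,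
      if_neg h.2.atZero_notMem, if_neg (hJ.atOne_notMem_of_isTop h.2), if_pos h, sub_zero, htop k h,
      div_mem_Ioo_iff hε.pos_last]
  have cn : ∀ k, ¬ IsCircleCoord I J k → ((w k - cellBase I εs J k) / cellSlope I ε εs J k ∈
      Set.Ioo (0 : ℝ) 1 ↔ εs k < s k ∧ εs k < 1 - s k) := fun k h => by
    have h2 := hε.lt_quarter k
    have ht : ¬ (last ∈ J ∧ IsTop I J k) := fun hc => h (isCircleCoord_of_last hc)
    rw [cellBase, if_neg h, cellSlope, if_neg fun h0 => h (isCircleCoord_of_atZero h0),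
      if_neg fun h0 => h (isCircleCoord_of_atOne h0), if_neg ht, hne k ht,
      div_mem_Ioo_iff (by linarith)]
    constructor <;> rintro ⟨h3, h4⟩ <;> constructor <;> linarith
  constructor
  · rintro ⟨h1, h2, h3⟩ v hv
    rcases v with k | k | ⟨⟩
    · change if atZero k ∈ J then 0 < s k ∧ s k < εs k else εs k < s k
      split_ifs with h0
      · exact (c0 k h0).1 (h1 k fun hF => (mem_stickSet.1 hF).2 (isCircleCoord_of_atZero h0))
      · by_cases ht : last ∈ J ∧ IsTop I J k
        · rwa [htop' k ht, cellClose, if_pos ht.1, ht.2.topCoord_eq] at h3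
        · by_cases hF : k ∈ stickSet I J
          · have := h2 k hF
            rwa [hne k ht, cellBase, if_neg (mem_stickSet.1 hF).2] at this
          -- Points close to the end `1` of an interval are automatically far from `0`, as the radii
          -- are below `1 / 4`.
          · by_cases h1J : atOne k ∈ J
            · have := ((c1 k h1J).1 (h1 k hF)).2
              have := hε.lt_quarter k
              linarith
            · refine ((cn k ?_).1 (h1 k hF)).1
              rintro (h | h | h)
              · exact h0 h
              · exact h1J h
              · exact ht h
    · have hk := atOne_mem_facets.1 hv
      have hF : k ∉ stickSet I J := fun h => hk (mem_stickSet.1 h).1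
      change if atOne k ∈ J then 0 < 1 - s k ∧ 1 - s k < εs k else εs k < 1 - s k
      split_ifs with h1J
      · exact (c1 k h1J).1 (h1 k hF)
      · by_cases h0 : atZero k ∈ J
        · have := ((c0 k h0).1 (h1 k hF)).2
          have := hε.lt_quarter k
          linarith
        · refine ((cn k ?_).1 (h1 k hF)).2
          rintro (h | h | h)
          · exact h0 h
          · exact h1J h
          · exact hk h.2.mem
    · change if last ∈ J then 0 < 1 - ∑ p ∈ I, s p ∧ 1 - ∑ p ∈ I, s p < ε
        else ε < 1 - ∑ p ∈ I, s p
      split_ifs with hl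
      · obtain ⟨t, ht⟩ := hJ.exists_isTop hl
        exact (cl t ⟨hl, ht⟩).1
          (h1 t fun hF => (mem_stickSet.1 hF).2 (isCircleCoord_of_last ⟨hl, ht⟩))
      · rwa [hlast hl, cellClose, if_neg hl] at h3
  · intro h
    have r0 : ∀ k, if atZero k ∈ J then 0 < s k ∧ s k < εs k else εs k < s k := fun k =>
      h (atZero k) (atZero_mem_facets k)
    have r1 : ∀ k, k ∉ I → if atOne k ∈ J then 0 < 1 - s k ∧ 1 - s k < εs k else εs k < 1 - s k :=
      fun k hk => h (atOne k) (atOne_mem_facets.2 hk)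
    have rl : if last ∈ J then 0 < 1 - ∑ p ∈ I, s p ∧ 1 - ∑ p ∈ I, s p < ε
        else ε < 1 - ∑ p ∈ I, s p := h last last_mem_facets
    refine ⟨fun k hF => ?_, fun k hF => ?_, ?_⟩
    · by_cases hc : IsCircleCoord I J k
      · rcases hc with hc | hc | hc
        · refine (c0 k hc).2 ?_
          have := r0 k
          rwa [if_pos hc] at this
        · refine (c1 k hc).2 ?_
          have := r1 k (hJ.notMem_of_atOne hc)
          rwa [if_pos hc] at this
        · refine (cl k hc).2 ?_
          rwa [if_pos hc.1] at rl
      · have hk : k ∉ I := fun hk => hF (mem_stickSet.2 ⟨hk, hc⟩)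
        have h0 := r0 k
        have h1 := r1 k hk
        rw [if_neg fun h0 => hc (isCircleCoord_of_atZero h0)] at h0
        rw [if_neg fun h0 => hc (isCircleCoord_of_atOne h0)] at h1
        exact (cn k hc).2 ⟨h0, h1⟩
    · have hc := (mem_stickSet.1 hF).2
      have h0 := r0 k
      rw [if_neg fun h0 => hc (isCircleCoord_of_atZero h0)] at h0
      rwa [hne k fun h => hc (isCircleCoord_of_last h), cellBase, if_neg hc]
    · rw [cellClose]
      split_ifs with hl
      · obtain ⟨t, ht⟩ := hJ.exists_isTop hl
        have h0 := r0 t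
        rw [if_neg ht.atZero_notMem] at h0
        rwa [htop' t ⟨hl, ht⟩, ht.topCoord_eq]
      · rw [if_neg hl] at rl
        rwa [hlast hl]

theorem prod_facetSign (J : Finset (Factor m)) : ∏ j ∈ J, facetSign j =
    (∏ k : Fin m, if atOne k ∈ J then (-1 : ℂ) else 1) * simplexSign ℂ J := by
  have h : ∏ j ∈ J, facetSign j = ∏ j : Factor m, if j ∈ J then facetSign j else 1 := by
    rw [Finset.prod_ite_mem, Finset.univ_inter]
  rw [h, Fintype.prod_sum_type, Fintype.prod_sum_type]
  simp [facetSign, simplexSign]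

/-- The orientation signs of the cycle are the signs of these Jacobians: every `atOne k ∈ J` has the
negative slope `-εs k`, and `last ∈ J` brings in the exchange `simplexMap`. -/
theorem abs_det_cellReal (hε : AdmissibleRadii ε εs) (hJ : IsFaceSet I J) {z : Fin m → ℝ}
    (hz : z ∈ openCube m) : ((|(jacobian (cellReal I ε εs J) z).det| : ℝ) : ℂ) =
      (∏ j ∈ J, facetSign j) * cellJac I ε εs J fun k => (z k : ℂ) := by
  rw [cellJac_ofReal hJ, det_jacobian_cellReal hJ, prod_facetSign]
  have hs : |simplexSign ℝ J| = simplexSign ℝ J * simplexSign ℝ J := by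
    rw [simplexSign]
    split_ifs <;> simp
  have hs' : simplexSign ℂ J = (simplexSign ℝ J : ℝ) := by
    rw [simplexSign, simplexSign]
    split_ifs <;> simp
  rw [abs_mul, hs, Finset.abs_prod, hs']
  have : ∀ k : Fin m, |if k ∈ stickSet I J then (∏ p ∈ stickSet I J with p < k, (1 - z p)) *
      stickMargin I (stickSet I J) (cellBase I εs J) (cellSlope I ε εs J) (cellClose I ε εs J) z
        else cellSlope I ε εs J k| = (if atOne k ∈ J then (-1 : ℝ) else 1) *
      if k ∈ stickSet I J then (∏ p ∈ stickSet I J with p < k, (1 - z p)) *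
      stickMargin I (stickSet I J) (cellBase I εs J) (cellSlope I ε εs J) (cellClose I ε εs J) z
        else cellSlope I ε εs J k := by
    intro k
    by_cases hF : k ∈ stickSet I J
    · rw [if_pos hF, if_neg fun h => hJ.notMem_of_atOne h (mem_stickSet.1 hF).1, one_mul, abs_of_pos]
      exact mul_pos (prod_filter_pos hz _) (stickMargin_cell_pos hε hJ hz)
    · rw [if_neg hF]
      split_ifs with h1
      · rw [cellSlope, if_neg fun h0 => hJ.atOne_notMem h0 h1, if_pos h1, abs_neg,
          abs_of_pos (hε.pos k)]
        ring
      · rw [one_mul, abs_of_pos (cellSlope_pos hε h1)]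
  rw [Finset.prod_congr rfl fun k _ => this k, Finset.prod_mul_distrib]
  have h1 : (∏ k : Fin m, if atOne k ∈ J then (-1 : ℂ) else 1) =
      ((∏ k : Fin m, if atOne k ∈ J then (-1 : ℝ) else 1 : ℝ) : ℂ) := by
    rw [Complex.ofReal_prod]
    refine Finset.prod_congr rfl fun k _ => ?_
    split_ifs <;> simp
  rw [h1]
  push_cast
  ring

/-- The integral of `∏ w_v ^ e_v` over a cell, with the continued branch. -/
def cellIntegral (I : Finset (Fin m)) (ε : ℝ) (εs : Fin m → ℝ) (J : Finset (Factor m))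
    (e : Factor m → ℂ) : ℂ :=
  ∫ y in unitCube m, Complex.exp (∑ v ∈ facets I, e v * logFacet I ε εs J v y) *
    Matrix.det (Matrix.of fun i j : Fin m =>
      fderivWithin ℝ (cellMap I ε εs J) (unitCube m) y (Pi.single j 1) i)

/-- The coefficient of a cell. -/
def cellWeight (J : Finset (Factor m)) (e : Factor m → ℂ) : ℂ :=
  ∏ j ∈ J, facetSign j / (expTwoPiI (e j) - 1)

/-- The product of the powers of the facet functions. -/
def facetProd (I : Finset (Fin m)) (e : Factor m → ℂ) (s : Fin m → ℝ) : ℂ :=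
  ∏ v ∈ facets I, ((facetVal I s v : ℝ) : ℂ) ^ e v

theorem exp_sum_logFacet (hJ : IsFaceSet I J) (e : Factor m → ℂ) (y : Fin m → ℝ) :
    Complex.exp (∑ v ∈ facets I, e v * logFacet I ε εs J v y) * cellJac I ε εs J (cellCoord I J y) =
      (∏ k ∈ circleSet I J, Complex.exp (e (facetLabel J k) *
        logCirc (facetRadius ε εs (facetLabel J k)) (y k))) *
        cellFun I ε εs J e (cellCoord I J y) := by
  rw [← Finset.sum_sdiff hJ.subset_facets, Complex.exp_add, cellFun, sum_faceSet hJ,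
    Complex.exp_sum (circleSet I J), Finset.sum_congr rfl fun v hv => by
      rw [logFacet_of_notMem hv, cellMap_eq hJ], Finset.prod_congr rfl fun k hk => by
      rw [logFacet_facetLabel hJ hk]]
  ring

/-- Each angle contributes `w ^ e`, the factor `e^{2πiθ}` of the differential and the coefficient `1
/ d`. Together these form `circleWeight (e + 1)` up to a power of the radius, the other factor of
the radius being a slope inside `cellJac`. -/
theorem cellWeight_mul_cellIntegral_eq_circles (hJ : IsFaceSet I J) (e : Factor m → ℂ) :
    cellWeight J e * cellIntegral I ε εs J e =
      (∏ k ∈ circleSet I J, facetSign (facetLabel J k) *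
        Complex.exp (e (facetLabel J k) * Real.log (facetRadius ε εs (facetLabel J k)))) *
      ∫ y in unitCube m, (∏ k ∈ circleSet I J, circleWeight (e (facetLabel J k) + 1) (y k)) *
        cellFun I ε εs J e fun k => mixedCoord (circleSet I J) k (y k) := by
  rw [cellWeight, cellIntegral, ← integral_const_mul, ← integral_const_mul, prod_faceSet hJ]
  refine setIntegral_congr_fun (measurableSet_unitCube m) fun y hy => ?_
  have hterm : ∀ k : Fin m, facetSign (facetLabel J k) / (expTwoPiI (e (facetLabel J k)) - 1) *
      Complex.exp (e (facetLabel J k) * logCirc (facetRadius ε εs (facetLabel J k)) (y k)) *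
      (2 * Real.pi * Complex.I * expTwoPiI (y k)) =
      facetSign (facetLabel J k) *
        Complex.exp (e (facetLabel J k) * Real.log (facetRadius ε εs (facetLabel J k))) *
      circleWeight (e (facetLabel J k) + 1) (y k) := by
    intro k
    -- The differential raises the exponent by one, which the denominator does not see.
    have h1 : expTwoPiI (e (facetLabel J k) + 1) = expTwoPiI (e (facetLabel J k)) := by
      have := expTwoPiI_sub_one (e (facetLabel J k) + 1)
      rw [add_sub_cancel_right] at this
      exact this.symm
    rw [circleWeight, h1, logCirc, mul_add, Complex.exp_add, add_mul, one_mul, expTwoPiI_add,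
      show Complex.exp (e (facetLabel J k) * (2 * Real.pi * Complex.I * (y k : ℂ))) =
        expTwoPiI (e (facetLabel J k) * y k) by rw [expTwoPiI]; ring_nf]
    ring
  have hprod := Finset.prod_congr (rfl : circleSet I J = circleSet I J) fun k _ => hterm k
  simp only [Finset.prod_mul_distrib] at hprod
  simp only [det_fderivWithin_cellMap hJ hy]
  change _ * (_ * _) = _ * (_ * cellFun I ε εs J e (cellCoord I J y))
  rw [Finset.prod_mul_distrib (f := fun k => facetSign (facetLabel J k))]
  have hx := exp_sum_logFacet (ε := ε) (εs := εs) hJ e y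
  simp only [Finset.prod_mul_distrib]
  linear_combination (∏ k ∈ circleSet I J, facetSign (facetLabel J k) /
    (expTwoPiI (e (facetLabel J k)) - 1)) * ((∏ k ∈ circleSet I J, (2 : ℂ)) * (∏ k ∈ circleSet I J, (Real.pi : ℂ)) *
    (∏ k ∈ circleSet I J, Complex.I) * ∏ k ∈ circleSet I J, expTwoPiI (y k)) * hx +
    cellFun I ε εs J e (cellCoord I J y) * hprod

theorem openCube_ae_eq (m : ℕ) : openCube m =ᵐ[volume] unitCube m := by
  rw [openCube, unitCube]
  exact Measure.univ_pi_Ioo_ae_eq_Icc (μ := fun _ => volume) (f := 0) (g := 1)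

theorem cpow_eq_exp_log {x : ℝ} (hx : 0 < x) (e : ℂ) :
    (x : ℂ) ^ e = Complex.exp (e * Complex.log x) := by
  rw [Complex.cpow_def_of_ne_zero (Complex.ofReal_ne_zero.2 hx.ne'), mul_comm]

theorem facetVal_ofReal (s : Fin m → ℝ) (v : Factor m) :
    facetVal I (fun k => (s k : ℂ)) v = (facetVal I s v : ℝ) := by
  rcases v with k | k | ⟨⟩
  · rfl
  · change 1 - _ = ((1 - _ : ℝ) : ℂ)
    push_cast
    rfl
  · change 1 - _ = ((1 - _ : ℝ) : ℂ)
    push_cast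
    rfl

theorem facetVal_pos_of_mem_facetRegion (hε : AdmissibleRadii ε εs) {s : Fin m → ℝ}
    (hs : s ∈ facetRegion I ε εs J) {v : Factor m} (hv : v ∈ facets I) : 0 < facetVal I s v := by
  have := hs v hv
  split_ifs at this
  · exact this.1
  · exact (hε.facetRadius_pos v).trans this

/-- The real counterpart of the circle computation, with the same constants and the same holomorphic
factor `cellFun`; so only the one-dimensional weights differ. -/
theorem facetProd_cellReal (hε : AdmissibleRadii ε εs) (hJ : IsFaceSet I J) (e : Factor m → ℂ)
    {z : Fin m → ℝ} (hz : z ∈ openCube m) :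
    ((|(jacobian (cellReal I ε εs J) z).det| : ℝ) : ℂ) * facetProd I e (cellReal I ε εs J z) =
      (∏ k ∈ circleSet I J, facetSign (facetLabel J k) *
        Complex.exp (e (facetLabel J k) * Real.log (facetRadius ε εs (facetLabel J k)))) *
      ((∏ k ∈ circleSet I J, (z k : ℂ) ^ (e (facetLabel J k) + 1 - 1)) *
        cellFun I ε εs J e fun k => (z k : ℂ)) := by
  have hreg : cellReal I ε εs J z ∈ facetRegion I ε εs J := by
    rw [← image_cellReal hε hJ]
    exact ⟨z, hz, rfl⟩
  rw [abs_det_cellReal hε hJ hz, facetProd, ← Finset.prod_sdiff hJ.subset_facets,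
    prod_faceSet hJ, prod_faceSet hJ, cellFun, Complex.exp_sum]
  have h1 : ∀ v ∈ facets I \ J, ((facetVal I (cellReal I ε εs J z) v : ℝ) : ℂ) ^ e v =
      Complex.exp (e v * Complex.log (facetVal I (cellComplex I ε εs J fun k => (z k : ℂ)) v)) := by
    intro v hv
    rw [cpow_eq_exp_log (facetVal_pos_of_mem_facetRegion hε hreg (Finset.mem_sdiff.1 hv).1),
      funext (cellComplex_ofReal z), facetVal_ofReal]
  have h2 : ∀ k ∈ circleSet I J,
      ((facetVal I (cellReal I ε εs J z) (facetLabel J k) : ℝ) : ℂ) ^ e (facetLabel J k) =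
      Complex.exp (e (facetLabel J k) * Real.log (facetRadius ε εs (facetLabel J k))) *
        (z k : ℂ) ^ (e (facetLabel J k) + 1 - 1) := by
    intro k hk
    have hr := hε.facetRadius_pos (facetLabel J k)
    rw [facetVal_cellReal_of_circle hJ hk, Complex.ofReal_mul,
      Complex.mul_cpow_ofReal_nonneg hr.le (mem_openCube.1 hz k).1.le, add_sub_cancel_right,
      cpow_eq_exp_log hr, Complex.ofReal_log hr.le]
  rw [Finset.prod_congr rfl h1, Finset.prod_congr rfl h2]
  simp only [Finset.prod_mul_distrib]
  ring

theorem measurableSet_openCube (m : ℕ) : MeasurableSet (openCube m) :=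
  MeasurableSet.univ_pi fun _ => measurableSet_Ioo

/-- A weighted cell contributes the integral over its region. -/
theorem cellWeight_mul_cellIntegral (hε : AdmissibleRadii ε εs) (hJ : IsFaceSet I J)
    {e : Factor m → ℂ} (he : ∀ v ∈ facets I, 0 < (e v).re)
    (he' : ∀ v ∈ facets I, expTwoPiI (e v) ≠ 1) :
    cellWeight J e * cellIntegral I ε εs J e = ∫ s in facetRegion I ε εs J, facetProd I e s := by
  obtain ⟨R, hR, hR2, hR'⟩ := exists_radius hε I
  have hlab : ∀ k ∈ circleSet I J, facetLabel J k ∈ facets I := fun k hk =>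
    hJ.subset_facets ((image_facetLabel hJ).subset (Finset.mem_image_of_mem _ hk))
  rw [cellWeight_mul_cellIntegral_eq_circles hJ, integral_circles_eq_segments hR
    (fun k hk => by simpa using he _ (hlab k hk)) (fun k hk => ?_)
    (fun z hz => differentiableAt_cellFun hε hJ hR.le hR2 hR' e hz), ← image_cellReal hε hJ,
    integral_image_eq_integral_abs_det_fderiv_smul volume (measurableSet_openCube m)
      (fun z _ => (differentiable_cellReal z).hasFDerivAt.hasFDerivWithinAt) (injOn_cellReal hε hJ),
    ← setIntegral_congr_set (openCube_ae_eq m), ← integral_const_mul]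
  · refine setIntegral_congr_fun (measurableSet_openCube m) fun z hz => ?_
    change _ = |(fderiv ℝ (cellReal I ε εs J) z).det| • _
    rw [det_fderiv_eq, Complex.real_smul, facetProd_cellReal hε hJ e hz]
  · have := expTwoPiI_sub_one (e (facetLabel J k) + 1)
    rw [add_sub_cancel_right] at this
    rw [← this]
    exact he' _ (hlab k hk)

end regions

/-! ### The decomposition into regions -/

section decomposition

open MeasureTheory

variable {m : ℕ} {I : Finset (Fin m)} {ε : ℝ} {εs : Fin m → ℝ} {J : Finset (Factor m)}

/-- The product of an open simplex and open intervals. -/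
def simplexCube (I : Finset (Fin m)) : Set (Fin m → ℝ) := {s | ∀ v ∈ facets I, 0 < facetVal I s v}

theorem continuous_facetVal (v : Factor m) : Continuous fun s : Fin m → ℝ => facetVal I s v := by
  rcases v with k | k | ⟨⟩
  · change Continuous fun s : Fin m → ℝ => s k
    fun_prop
  · change Continuous fun s : Fin m → ℝ => 1 - s k
    fun_prop
  · change Continuous fun s : Fin m → ℝ => 1 - ∑ p ∈ I, s p
    fun_prop

theorem measurableSet_facetRegion : MeasurableSet (facetRegion I ε εs J) := by
  have : facetRegion I ε εs J = ⋂ v ∈ facets I, {s | if v ∈ J then 0 < facetVal I s v ∧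
      facetVal I s v < facetRadius ε εs v else facetRadius ε εs v < facetVal I s v} := by
    ext s
    simp [facetRegion]
  rw [this]
  refine Finset.measurableSet_biInter _ fun v _ => ?_
  have hc := continuous_facetVal (I := I) v
  by_cases h : v ∈ J
  · simp only [if_pos h]
    exact (measurableSet_lt measurable_const hc.measurable).inter
      (measurableSet_lt hc.measurable measurable_const)
  · simp only [if_neg h]
    exact measurableSet_lt measurable_const hc.measurable

theorem facetRegion_subset (hε : AdmissibleRadii ε εs) : facetRegion I ε εs J ⊆ simplexCube I :=
  fun _ hs _ hv => facetVal_pos_of_mem_facetRegion hε hs hv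

theorem simplexCube_subset : simplexCube I ⊆ unitCube m := by
  intro s hs
  have h0 : ∀ k, 0 < s k := fun k => hs (atZero k) (atZero_mem_facets k)
  have hl : 0 < 1 - ∑ p ∈ I, s p := hs last last_mem_facets
  refine mem_unitCube.2 fun k => ⟨(h0 k).le, ?_⟩
  by_cases hk : k ∈ I
  · have := Finset.single_le_sum (f := s) (fun p _ => (h0 p).le) hk
    linarith
  · have : 0 < 1 - s k := hs (atOne k) (atOne_mem_facets.2 hk)
    linarith

theorem continuous_facetProd {e : Factor m → ℂ} (he : ∀ v ∈ facets I, 0 < (e v).re) :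
    Continuous (facetProd I e) :=
  continuous_finsetProd _ fun v hv =>
    (Complex.continuous_ofReal_cpow_const (he v hv)).comp (continuous_facetVal v)

theorem integrableOn_facetProd {e : Factor m → ℂ} (he : ∀ v ∈ facets I, 0 < (e v).re) :
    IntegrableOn (facetProd I e) (simplexCube I) :=
  ((continuous_facetProd he).continuousOn.integrableOn_compact (isCompact_unitCube m)).mono_set
    simplexCube_subset

/-- Nonempty `I` makes this level set lie in a proper affine subspace; the unit vector at `p`
witnesses properness. -/
theorem volume_sum_eq {p : Fin m} (hp : p ∈ I) (c : ℝ) :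
    volume {s : Fin m → ℝ | ∑ k ∈ I, s k = c} = 0 := by
  set L : (Fin m → ℝ) →ₗ[ℝ] ℝ := ∑ k ∈ I, LinearMap.proj k with hL
  have hLs : ∀ s, L s = ∑ k ∈ I, s k := fun s => by simp [hL]
  rcases Set.eq_empty_or_nonempty {s : Fin m → ℝ | ∑ k ∈ I, s k = c} with h | ⟨s0, hs0⟩
  · rw [h, measure_empty]
  · have hne : AffineSubspace.mk' s0 (LinearMap.ker L) ≠ ⊤ := by
      intro h
      have := congrArg AffineSubspace.direction h
      rw [AffineSubspace.direction_mk', AffineSubspace.direction_top] at this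
      have h1 : (Pi.single p 1 : Fin m → ℝ) ∈ LinearMap.ker L := this ▸ Submodule.mem_top
      rw [LinearMap.mem_ker, hLs, Finset.sum_eq_single p] at h1
      · simp at h1
      · intro k _ hk
        simp [hk]
      · exact fun h => (h hp).elim
    refine measure_mono_null (fun s hs => ?_) (Measure.addHaar_affineSubspace volume _ hne)
    rw [SetLike.mem_coe, AffineSubspace.mem_mk', vsub_eq_sub, LinearMap.mem_ker, map_sub, hLs, hLs,
      hs, hs0, sub_self]

theorem volume_facetVal_eq (hε : AdmissibleRadii ε εs) (v : Factor m) :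
    volume {s : Fin m → ℝ | facetVal I s v = facetRadius ε εs v} = 0 := by
  rcases v with k | k | ⟨⟩
  · exact Measure.pi_hyperplane (fun _ : Fin m => (volume : Measure ℝ)) k (εs k)
  · have : {s : Fin m → ℝ | facetVal I s (atOne k) = facetRadius ε εs (atOne k)} =
        {s | s k = 1 - εs k} := by
      ext s
      change 1 - s k = εs k ↔ s k = 1 - εs k
      constructor <;> intro h <;> linarith
    rw [this]
    exact Measure.pi_hyperplane (fun _ : Fin m => (volume : Measure ℝ)) k (1 - εs k)
  · have : {s : Fin m → ℝ | facetVal I s last = facetRadius ε εs last} =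
        {s | ∑ p ∈ I, s p = 1 - ε} := by
      ext s
      change 1 - ∑ p ∈ I, s p = ε ↔ ∑ p ∈ I, s p = 1 - ε
      constructor <;> intro h <;> linarith
    change volume {s : Fin m → ℝ | facetVal I s last = facetRadius ε εs last} = 0
    rw [this]
    -- For empty `I` the last facet function is constantly `1`, which exceeds `ε`.
    rcases I.eq_empty_or_nonempty with rfl | ⟨p, hp⟩
    · have hlt := hε.sum_I_lt ∅
      rw [Finset.sum_empty, add_zero] at hlt
      have : {s : Fin m → ℝ | ∑ p ∈ (∅ : Finset (Fin m)), s p = 1 - ε} = ∅ := by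
        ext s
        simp only [Finset.sum_empty, Set.mem_ofPred_eq, Set.mem_empty_iff_false, iff_false]
        intro h
        linarith
      rw [this, measure_empty]
    · exact volume_sum_eq hp _

open Classical in
-- Off a null set, a point lies in the region of the set `J` of facets to which it is closer than
-- the radius. This `J` is a face set because opposite ends of an interval, or all facets of the
-- simplex, cannot be close at once for admissible radii.
theorem iUnion_facetRegion_ae_eq (hε : AdmissibleRadii ε εs) :
    (⋃ J ∈ Finset.univ.filter (IsFaceSet I), facetRegion I ε εs J) =ᵐ[volume] simplexCube I := by
  refine (Filter.eventuallyLE_antisymm_iff).2 ⟨Filter.Eventually.of_forall ?_, ?_⟩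
  · exact Set.iUnion₂_subset fun J _ => facetRegion_subset hε
  · have hall : ∀ᵐ s : Fin m → ℝ, ∀ v ∈ facets I, facetVal I s v ≠ facetRadius ε εs v :=
      (Finset.eventually_all _).2 fun v _ => by
        rw [ae_iff]
        simpa using volume_facetVal_eq hε v
    filter_upwards [hall] with s hs hmem
    have hmem' : s ∈ simplexCube I := hmem
    have h0 : ∀ k, 0 < s k := fun k => hmem' (atZero k) (atZero_mem_facets k)
    set J : Finset (Factor m) := (facets I).filter fun v => facetVal I s v < facetRadius ε εs v
      with hJ
    refine Set.mem_iUnion₂.2 ⟨J, Finset.mem_filter.2 ⟨Finset.mem_univ _, ?_, ?_, ?_⟩, ?_⟩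
    · intro p hp h
      exact atOne_mem_facets.1 (Finset.mem_filter.1 h).1 hp
    · rintro q - ⟨hq0, hq1⟩
      have h1 : s q < εs q := (Finset.mem_filter.1 hq0).2
      have h2 : 1 - s q < εs q := (Finset.mem_filter.1 hq1).2
      have := hε.lt_quarter q
      linarith
    · rintro ⟨hl, hp⟩
      have h1 : 1 - ∑ p ∈ I, s p < ε := (Finset.mem_filter.1 hl).2
      have h2 : ∑ p ∈ I, s p ≤ ∑ p ∈ I, εs p := Finset.sum_le_sum fun p hpI =>
        (show s p < εs p from (Finset.mem_filter.1 (hp p hpI)).2).le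
      have := hε.sum_I_lt I
      linarith
    · intro v hv
      split_ifs with h
      · exact ⟨hmem' v hv, (Finset.mem_filter.1 h).2⟩
      · exact lt_of_le_of_ne (not_lt.1 fun hlt => h (Finset.mem_filter.2 ⟨hv, hlt⟩))
          (hs v hv).symm

theorem disjoint_facetRegion {J J' : Finset (Factor m)} (hJ : IsFaceSet I J) (hJ' : IsFaceSet I J')
    (hne : J ≠ J') : Disjoint (facetRegion I ε εs J) (facetRegion I ε εs J') := by
  refine Set.disjoint_left.2 fun s hs hs' => hne ?_
  have key : ∀ {K K' : Finset (Factor m)}, IsFaceSet I K → s ∈ facetRegion I ε εs K →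
      s ∈ facetRegion I ε εs K' → K ⊆ K' := by
    intro K K' hK h h' v hv
    by_contra hc
    have h1 := h v (hK.subset_facets hv)
    have h2 := h' v (hK.subset_facets hv)
    rw [if_pos hv] at h1
    rw [if_neg hc] at h2
    exact lt_asymm h1.2 h2
  exact Finset.Subset.antisymm (key hJ hs hs') (key hJ' hs' hs)

open Classical in
theorem sum_integral_facetRegion (hε : AdmissibleRadii ε εs) {e : Factor m → ℂ}
    (he : ∀ v ∈ facets I, 0 < (e v).re) :
    ∑ J with IsFaceSet I J, ∫ s in facetRegion I ε εs J, facetProd I e s =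
      ∫ s in simplexCube I, facetProd I e s := by
  rw [← setIntegral_congr_set (iUnion_facetRegion_ae_eq hε), integral_biUnion_finset]
  · exact fun J _ => measurableSet_facetRegion
  · intro J hJ J' hJ' hne
    exact disjoint_facetRegion (Finset.mem_filter.1 hJ).2 (Finset.mem_filter.1 hJ').2 hne
  · exact fun J _ => (integrableOn_facetProd he).mono_set (facetRegion_subset hε)

end decomposition

/-! ### Dirichlet's integral -/

section dirichlet

open MeasureTheory

variable {m : ℕ} {I : Finset (Fin m)}

/-- The value of the regularized integral. -/
def dirichletValue (I : Finset (Fin m)) (e : Factor m → ℂ) : ℂ :=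
  (∏ p ∈ I, Complex.Gamma (e (atZero p) + 1)) * Complex.Gamma (e last + 1) *
    (Complex.Gamma (∑ p ∈ I, (e (atZero p) + 1) + (e last + 1)))⁻¹ *
    ∏ q ∈ Iᶜ, Complex.Gamma (e (atZero q) + 1) * Complex.Gamma (e (atOne q) + 1) *
      (Complex.Gamma ((e (atZero q) + 1) + (e (atOne q) + 1)))⁻¹

theorem betaIntegral_eq_Gamma {u v : ℂ} (hu : 0 < u.re) (hv : 0 < v.re) :
    Complex.betaIntegral u v = Complex.Gamma u * Complex.Gamma v * (Complex.Gamma (u + v))⁻¹ := by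
  rw [Complex.Gamma_mul_Gamma_eq_betaIntegral hu hv, mul_right_comm, mul_inv_cancel₀, one_mul]
  exact Complex.Gamma_ne_zero_of_re_pos (by rw [Complex.add_re]; exact add_pos hu hv)

/-- Written in gamma functions the product telescopes: the denominator of one index is the numerator
of the preceding one. -/
theorem prod_betaIntegral (s : Finset (Fin m)) (α : Fin m → ℂ) (β : ℂ)
    (hα : ∀ p ∈ s, 0 < (α p).re) (hβ : 0 < β.re) :
    ∏ p ∈ s, Complex.betaIntegral (α p) (∑ k ∈ s with p < k, α k + β) =
      (∏ p ∈ s, Complex.Gamma (α p)) * Complex.Gamma β * (Complex.Gamma (∑ p ∈ s, α p + β))⁻¹ := by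
  have hre : ∀ t ⊆ s, 0 < (∑ p ∈ t, α p + β).re := fun t ht => by
    rw [Complex.add_re, Complex.re_sum]
    exact add_pos_of_nonneg_of_pos (Finset.sum_nonneg fun p hp => (hα p (ht hp)).le) hβ
  induction s using Finset.induction_on_min with
  | empty => simp [mul_inv_cancel₀ (Complex.Gamma_ne_zero_of_re_pos hβ)]
  | insert a s ha ih =>
    have has : a ∉ s := fun h => lt_irrefl _ (ha a h)
    have h1 : (insert a s).filter (a < ·) = s := by
      ext k
      simp only [Finset.mem_filter, Finset.mem_insert]
      constructor
      · rintro ⟨rfl | h, h2⟩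
        · exact (lt_irrefl _ h2).elim
        · exact h
      · exact fun h => ⟨Or.inr h, ha k h⟩
    have h2 : ∀ p ∈ s, (insert a s).filter (p < ·) = s.filter (p < ·) := by
      intro p hp
      ext k
      simp only [Finset.mem_filter, Finset.mem_insert]
      constructor
      · rintro ⟨rfl | h, h2⟩
        · exact (lt_asymm h2 (ha p hp)).elim
        · exact ⟨h, h2⟩
      · exact fun h => ⟨Or.inr h.1, h.2⟩
    rw [Finset.prod_insert has, Finset.prod_insert has, Finset.sum_insert has, h1,
      Finset.prod_congr rfl fun p hp => by rw [h2 p hp],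
      ih (fun p hp => hα p (Finset.mem_insert_of_mem hp))
        (fun t ht => hre t (ht.trans (Finset.subset_insert _ _))),
      betaIntegral_eq_Gamma (hα a (Finset.mem_insert_self _ _)) (hre s (Finset.subset_insert _ _)),
      ← add_assoc]
    have := Complex.Gamma_ne_zero_of_re_pos (hre s (Finset.subset_insert _ _))
    field_simp

theorem cpow_finset_prod (s : Finset (Fin m)) {f : Fin m → ℝ} (hf : ∀ k, 0 < f k) (e : ℂ) :
    ((∏ k ∈ s, f k : ℝ) : ℂ) ^ e = ∏ k ∈ s, (f k : ℂ) ^ e := by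
  induction s using Finset.induction_on with
  | empty => simp
  | insert i s hi ih =>
    rw [Finset.prod_insert hi, Finset.prod_insert hi, Complex.ofReal_mul,
      Complex.mul_cpow_ofReal_nonneg (hf i).le (Finset.prod_nonneg fun k _ => (hf k).le), ih]

theorem cpow_finset_sum (s : Finset (Fin m)) {x : ℂ} (hx : x ≠ 0) (e : Fin m → ℂ) :
    x ^ (∑ k ∈ s, e k) = ∏ k ∈ s, x ^ e k := by
  induction s using Finset.induction_on with
  | empty => simp
  | insert i s hi ih => rw [Finset.sum_insert hi, Finset.prod_insert hi, Complex.cpow_add _ _ hx, ih]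

theorem image_stickMap_simplexCube :
    stickMap I I (fun _ => (0 : ℝ)) (fun _ => 1) 0 '' openCube m = simplexCube I := by
  rw [image_stickMap subset_rfl (fun _ _ => one_ne_zero) fun z _ => by simp [stickMargin]]
  ext s
  constructor
  · rintro ⟨h1, h2, h3⟩ v hv
    rcases v with k | k | ⟨⟩
    · change 0 < s k
      by_cases hk : k ∈ I
      · exact h2 k hk
      · simpa using (h1 k hk).1
    · change 0 < 1 - s k
      have := (h1 k (atOne_mem_facets.1 hv)).2
      rw [sub_zero, div_one] at this
      linarith
    · exact h3
  · intro h
    refine ⟨fun k hk => ?_, fun k _ => h (atZero k) (atZero_mem_facets k), h last last_mem_facets⟩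
    have h0 : 0 < s k := h (atZero k) (atZero_mem_facets k)
    have h1 : 0 < 1 - s k := h (atOne k) (atOne_mem_facets.2 hk)
    rw [sub_zero, div_one]
    exact ⟨h0, by linarith⟩

theorem facetProd_eq (e : Factor m → ℂ) (s : Fin m → ℝ) : facetProd I e s =
    (∏ p ∈ I, (s p : ℂ) ^ e (atZero p)) * ((1 - ∑ p ∈ I, s p : ℝ) : ℂ) ^ e last *
      ∏ q ∈ Iᶜ, (s q : ℂ) ^ e (atZero q) * ((1 - s q : ℝ) : ℂ) ^ e (atOne q) := by
  have h : facets I = Finset.univ.filter fun v : Factor m => v ∈ facets I := by simp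
  rw [facetProd, h, Finset.prod_filter, Fintype.prod_sum_type, Fintype.prod_sum_type]
  simp only [atZero_mem_facets, atOne_mem_facets, if_true, Finset.univ_unique,
    Finset.prod_singleton]
  rw [Finset.prod_mul_distrib (s := Iᶜ), ← Finset.prod_mul_prod_compl I]
  have h1 : (∏ k : Fin m, if k ∉ I then ((facetVal I s (atOne k) : ℝ) : ℂ) ^ e (atOne k) else 1) =
      ∏ q ∈ Iᶜ, ((1 - s q : ℝ) : ℂ) ^ e (atOne q) := by
    rw [← Finset.prod_filter]
    refine Finset.prod_congr ?_ fun k _ => rfl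
    ext k
    simp
  rw [h1, if_pos (show (Sum.inr (Sum.inr default) : Factor m) ∈ facets I from last_mem_facets)]
  change (∏ p ∈ I, (s p : ℂ) ^ e (atZero p)) * (∏ p ∈ Iᶜ, (s p : ℂ) ^ e (atZero p)) *
    (_ * ((1 - ∑ p ∈ I, s p : ℝ) : ℂ) ^ e last) = _
  ring

/-- The exponent of `1 - z_p` in the stick breaking coordinates. -/
def tailExponent (I : Finset (Fin m)) (e : Factor m → ℂ) (k : Fin m) : ℂ :=
  if k ∈ I then ∑ p ∈ I with k < p, (e (atZero p) + 1) + e last else e (atOne k)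

/-- The integrand becomes a product of functions of single coordinates: `1 - z_p` occurs in every
later stick, with exponent `e + 1` once the Jacobian is included, and in the last coordinate. -/
theorem det_mul_facetProd_stickMap (e : Factor m → ℂ) {z : Fin m → ℝ} (hz : z ∈ openCube m) :
    ((|(jacobian (stickMap I I (fun _ => (0 : ℝ)) (fun _ => 1) 0) z).det| : ℝ) : ℂ) *
      facetProd I e (stickMap I I (fun _ => (0 : ℝ)) (fun _ => 1) 0 z) =
      ∏ k, (z k : ℂ) ^ e (atZero k) * (1 - (z k : ℂ)) ^ tailExponent I e k := by
  have hz1 : ∀ k, 0 < z k := fun k => (mem_openCube.1 hz k).1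
  have hz2 : ∀ k, 0 < 1 - z k := fun k => sub_pos.2 (mem_openCube.1 hz k).2
  have hz3 : ∀ k, (1 - (z k : ℂ)) ≠ 0 := fun k => by
    have := Complex.ofReal_ne_zero.2 (hz2 k).ne'
    push_cast at this
    exact this
  have hmargin : stickMargin I I (fun _ => (0 : ℝ)) (fun _ => 1) 0 z = 1 := by simp [stickMargin]
  have hdet : |(jacobian (stickMap I I (fun _ => (0 : ℝ)) (fun _ => 1) 0) z).det| =
      ∏ k ∈ I, ∏ p ∈ I with p < k, (1 - z p) := by
    rw [det_jacobian_stickMap, hmargin]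
    simp only [mul_one]
    rw [Finset.prod_ite_mem, Finset.univ_inter, abs_of_pos]
    exact Finset.prod_pos fun k _ => prod_filter_pos hz _
  rw [hdet, facetProd_eq]
  have hp : ∀ p ∈ I, ((stickMap I I (fun _ => (0 : ℝ)) (fun _ => 1) 0 z p : ℝ) : ℂ) ^ e (atZero p) =
      (z p : ℂ) ^ e (atZero p) * ∏ p' ∈ I with p' < p, (1 - (z p' : ℂ)) ^ e (atZero p) := by
    intro p hp
    rw [stickMap_of_mem hp, hmargin, mul_one, zero_add, Complex.ofReal_mul,
      Complex.mul_cpow_ofReal_nonneg (hz1 p).le (prod_filter_pos hz _).le, cpow_finset_prod _ hz2]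
    push_cast
    rfl
  have hl : 1 - ∑ p ∈ I, stickMap I I (fun _ => (0 : ℝ)) (fun _ => 1) 0 z p = ∏ p ∈ I, (1 - z p) := by
    rw [one_sub_sum_stickMap subset_rfl, hmargin, mul_one, zero_add]
  have hq : ∀ q ∈ Iᶜ, stickMap I I (fun _ => (0 : ℝ)) (fun _ => 1) 0 z q = z q := by
    intro q hq
    rw [stickMap_of_notMem (Finset.mem_compl.1 hq), one_mul, zero_add]
  have hq' : ∏ q ∈ Iᶜ, ((stickMap I I (fun _ => (0 : ℝ)) (fun _ => 1) 0 z q : ℝ) : ℂ) ^ e (atZero q) *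
      ((1 - stickMap I I (fun _ => (0 : ℝ)) (fun _ => 1) 0 z q : ℝ) : ℂ) ^ e (atOne q) =
      ∏ q ∈ Iᶜ, (z q : ℂ) ^ e (atZero q) * ((1 - z q : ℝ) : ℂ) ^ e (atOne q) :=
    Finset.prod_congr rfl fun q h => by rw [hq q h]
  rw [hl, Finset.prod_congr rfl hp, cpow_finset_prod _ hz2, hq', ← Finset.prod_mul_prod_compl I (fun k => (z k : ℂ) ^ e (atZero k) * _)]
  -- Collects the factors by `p` instead of by `k`.
  have hswap : ∏ k ∈ I, ∏ p ∈ I with p < k, (1 - (z p : ℂ)) ^ (e (atZero k) + 1) =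
      ∏ p ∈ I, (1 - (z p : ℂ)) ^ ∑ k ∈ I with p < k, (e (atZero k) + 1) := by
    rw [Finset.prod_congr rfl fun p _ => cpow_finset_sum _ (hz3 p) _]
    exact Finset.prod_comm' fun x y => by
      simp only [Finset.mem_filter]
      tauto
  have h1 : ∀ k ∈ I, (z k : ℂ) ^ e (atZero k) * (1 - (z k : ℂ)) ^ tailExponent I e k =
      (z k : ℂ) ^ e (atZero k) * ((1 - (z k : ℂ)) ^ (∑ p ∈ I with k < p, (e (atZero p) + 1)) *
        (1 - (z k : ℂ)) ^ e last) := fun k hk => by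
    rw [tailExponent, if_pos hk, Complex.cpow_add _ _ (hz3 k)]
  have h2 : ∀ k ∈ Iᶜ, (z k : ℂ) ^ e (atZero k) * (1 - (z k : ℂ)) ^ tailExponent I e k =
      (z k : ℂ) ^ e (atZero k) * ((1 - z k : ℝ) : ℂ) ^ e (atOne k) := fun k hk => by
    rw [tailExponent, if_neg (Finset.mem_compl.1 hk)]
    push_cast
    rfl
  have h3 : ∀ k ∈ I, ∏ p ∈ I with p < k, (1 - (z p : ℂ)) ^ (e (atZero k) + 1) =
      (∏ p ∈ I with p < k, (1 - (z p : ℂ)) ^ e (atZero k)) * ∏ p ∈ I with p < k, (1 - (z p : ℂ)) :=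
    fun k _ => by
      rw [← Finset.prod_mul_distrib]
      refine Finset.prod_congr rfl fun p _ => ?_
      rw [Complex.cpow_add _ _ (hz3 p), Complex.cpow_one]
  rw [Finset.prod_congr rfl h1, Finset.prod_congr rfl h2]
  rw [Finset.prod_congr rfl h3] at hswap
  simp only [Finset.prod_mul_distrib] at hswap ⊢
  rw [← hswap]
  push_cast
  ring

theorem integral_simplexCube_facetProd {e : Factor m → ℂ} (he : ∀ v ∈ facets I, 0 < (e v).re) :
    ∫ s in simplexCube I, facetProd I e s = dirichletValue I e := by
  rw [← image_stickMap_simplexCube, integral_image_eq_integral_abs_det_fderiv_smul volume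
    (measurableSet_openCube m)
    (fun z _ => (differentiable_stickMap z).hasFDerivAt.hasFDerivWithinAt)
    (injOn_stickMap subset_rfl (fun _ _ => one_ne_zero) fun z _ => by simp [stickMargin]),
    setIntegral_congr_fun (g := fun z : Fin m → ℝ => ∏ k, (fun k (t : ℝ) => (t : ℂ) ^ e (atZero k) *
      (1 - (t : ℂ)) ^ tailExponent I e k) k (z k)) (measurableSet_openCube m) fun z hz => ?_]
  · rw [openCube, volume_pi, Measure.restrict_pi_pi,
      integral_fintype_prod_eq_prod (𝕜 := ℂ) (fun (k : Fin m) (t : ℝ) =>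
        (t : ℂ) ^ e (atZero k) * (1 - (t : ℂ)) ^ tailExponent I e k)]
    have hbeta : ∀ k, ∫ t in Set.Ioo (0 : ℝ) 1, (t : ℂ) ^ e (atZero k) *
        (1 - (t : ℂ)) ^ tailExponent I e k =
        Complex.betaIntegral (e (atZero k) + 1) (tailExponent I e k + 1) := by
      intro k
      rw [Complex.betaIntegral, intervalIntegral.integral_of_le zero_le_one,
        integral_Ioc_eq_integral_Ioo, add_sub_cancel_right, add_sub_cancel_right]
    simp only [hbeta]
    rw [← Finset.prod_mul_prod_compl I, dirichletValue]
    have hpos : ∀ v ∈ facets I, 0 < (e v + 1).re := fun v hv => by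
      have := he v hv
      simp only [Complex.add_re, Complex.one_re]
      linarith
    congr 1
    · rw [← prod_betaIntegral I (fun p => e (atZero p) + 1) (e last + 1)
        (fun p _ => hpos _ (atZero_mem_facets p)) (hpos _ last_mem_facets)]
      refine Finset.prod_congr rfl fun k hk => ?_
      rw [tailExponent, if_pos hk, add_assoc]
    · refine Finset.prod_congr rfl fun k hk => ?_
      have hk' := Finset.mem_compl.1 hk
      rw [tailExponent, if_neg hk', betaIntegral_eq_Gamma (hpos _ (atZero_mem_facets k))
        (hpos _ (atOne_mem_facets.2 hk'))]
  · change |(fderiv ℝ _ z).det| • _ = _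
    rw [det_fderiv_eq, Complex.real_smul]
    exact det_mul_facetProd_stickMap e hz

end dirichlet

/-! ### Analytic continuation in the exponents -/

section continuation

open MeasureTheory

variable {m : ℕ} {I : Finset (Fin m)} {ε : ℝ} {εs : Fin m → ℝ} {J : Finset (Factor m)}

/-- The cells are compact and avoid the zeros of the facet functions, so their integrals are entire
in the exponents; differentiation under the integral is dominated by the maximum over a compact
product. -/
theorem differentiable_integral_exp {A L D : (Fin m → ℝ) → ℂ}
    (hA : ContinuousOn A (unitCube m)) (hL : ContinuousOn L (unitCube m))
    (hD : ContinuousOn D (unitCube m)) :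
    Differentiable ℂ fun ζ : ℂ => ∫ y in unitCube m, Complex.exp (A y + ζ * L y) * D y := by
  intro ζ₀
  have hF : ∀ ζ : ℂ, ContinuousOn (fun y => Complex.exp (A y + ζ * L y) * D y) (unitCube m) :=
    fun ζ => ((hA.add (continuousOn_const.mul hL)).cexp).mul hD
  have hF' : ∀ ζ : ℂ, ContinuousOn (fun y => Complex.exp (A y + ζ * L y) * L y * D y) (unitCube m) :=
    fun ζ => (((hA.add (continuousOn_const.mul hL)).cexp).mul hL).mul hD
  have hjoint : ContinuousOn (fun q : ℂ × (Fin m → ℝ) => Complex.exp (A q.2 + q.1 * L q.2) * L q.2 * D q.2)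
      (Metric.closedBall ζ₀ 1 ×ˢ unitCube m) := by
    have hsnd : Set.MapsTo (fun q : ℂ × (Fin m → ℝ) => q.2) (Metric.closedBall ζ₀ 1 ×ˢ unitCube m)
        (unitCube m) := fun q hq => hq.2
    have hA' := hA.comp continuousOn_snd hsnd
    have hL' := hL.comp continuousOn_snd hsnd
    have hD' := hD.comp continuousOn_snd hsnd
    exact (((hA'.add (continuousOn_fst.mul hL')).cexp).mul hL').mul hD'
  obtain ⟨C, hC⟩ := ((isCompact_closedBall ζ₀ 1).prod (isCompact_unitCube m)).exists_bound_of_continuousOn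
    hjoint
  refine (hasDerivAt_integral_of_dominated_loc_of_deriv_le (μ := volume.restrict (unitCube m))
    (F := fun ζ y => Complex.exp (A y + ζ * L y) * D y)
    (F' := fun ζ y => Complex.exp (A y + ζ * L y) * L y * D y) (bound := fun _ => C)
    (Metric.ball_mem_nhds ζ₀ one_pos)
    (Filter.Eventually.of_forall fun ζ => (hF ζ).aestronglyMeasurable (measurableSet_unitCube m))
    ((hF ζ₀).integrableOn_compact (isCompact_unitCube m))
    ((hF' ζ₀).aestronglyMeasurable (measurableSet_unitCube m)) ?_ ?_ ?_).2.differentiableAt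
  · refine (ae_restrict_iff' (measurableSet_unitCube m)).2 (Filter.Eventually.of_forall
      fun y hy ζ hζ => hC (ζ, y) ⟨Metric.ball_subset_closedBall hζ, hy⟩)
  · exact (continuousOn_const.integrableOn_compact (isCompact_unitCube m))
  · refine Filter.Eventually.of_forall fun y ζ _ => HasDerivAt.mul_const ?_ _
    have h : HasDerivAt (fun ζ => A y + ζ * L y) (L y) ζ := by
      simpa using ((hasDerivAt_id ζ).mul_const (L y)).const_add (A y)
    exact h.cexp

theorem continuousOn_logFacet (hε : AdmissibleRadii ε εs) (hJ : IsFaceSet I J) {v : Factor m}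
    (hv : v ∈ facets I) : ContinuousOn (logFacet I ε εs J v) (unitCube m) := by
  rcases v with k | k | ⟨⟩
  · exact continuousOn_logZero hε hJ k
  · exact continuousOn_logOne_of_notMem hε (atOne_mem_facets.1 hv)
  · exact continuousOn_logSimplex hε

theorem continuous_cellCoord : Continuous (cellCoord I J) :=
  continuous_pi fun k => (continuous_mixedCoord k).comp (continuous_apply k)

/-- The Jacobian determinant of a cell. -/
def cellDet (I : Finset (Fin m)) (ε : ℝ) (εs : Fin m → ℝ) (J : Finset (Factor m))
    (y : Fin m → ℝ) : ℂ :=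
  Matrix.det (Matrix.of fun i j : Fin m =>
    fderivWithin ℝ (cellMap I ε εs J) (unitCube m) y (Pi.single j 1) i)

theorem continuousOn_cellDet (hJ : IsFaceSet I J) :
    ContinuousOn (cellDet I ε εs J) (unitCube m) := by
  refine ContinuousOn.congr (f := fun y =>
    (∏ k ∈ circleSet I J, 2 * Real.pi * Complex.I * expTwoPiI (y k)) *
      cellJac I ε εs J (cellCoord I J y)) ?_ fun y hy => det_fderivWithin_cellMap hJ hy
  refine Continuous.continuousOn (Continuous.mul (continuous_finsetProd _ fun k _ => ?_) ?_)
  · exact continuous_const.mul (continuous_expTwoPiI_ofReal.comp (continuous_apply k))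
  · exact differentiable_cellJac.continuous.comp continuous_cellCoord

theorem differentiable_cellIntegral (hε : AdmissibleRadii ε εs) (hJ : IsFaceSet I J)
    (e : Factor m → ℂ) :
    Differentiable ℂ fun ζ : ℂ => cellIntegral I ε εs J fun v => e v + ζ := by
  have h := differentiable_integral_exp
    (A := fun y => ∑ v ∈ facets I, e v * logFacet I ε εs J v y)
    (L := fun y => ∑ v ∈ facets I, logFacet I ε εs J v y) (D := cellDet I ε εs J)
    (continuousOn_finsetSum _ fun v hv => continuousOn_const.mul (continuousOn_logFacet hε hJ hv))
    (continuousOn_finsetSum _ fun v hv => continuousOn_logFacet hε hJ hv)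
    (continuousOn_cellDet hJ)
  convert h using 1
  funext ζ
  refine setIntegral_congr_fun (measurableSet_unitCube m) fun y _ => ?_
  change Complex.exp _ * cellDet I ε εs J y = _
  simp only [add_mul, Finset.sum_add_distrib, Finset.mul_sum]

open Classical in
/-- The integral of `∏ w_v ^ e_v` over the regularized cycle. -/
def regularizedIntegral (I : Finset (Fin m)) (ε : ℝ) (εs : Fin m → ℝ) (e : Factor m → ℂ) : ℂ :=
  ∑ J with IsFaceSet I J, cellWeight J e * cellIntegral I ε εs J e

open Classical in
theorem regularizedIntegral_of_re_pos (hε : AdmissibleRadii ε εs) {e : Factor m → ℂ}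
    (he : ∀ v ∈ facets I, 0 < (e v).re) (he' : ∀ v ∈ facets I, ∀ n : ℤ, e v ≠ n) :
    regularizedIntegral I ε εs e = dirichletValue I e := by
  rw [regularizedIntegral, ← integral_simplexCube_facetProd he, ← sum_integral_facetRegion hε he]
  exact Finset.sum_congr rfl fun J hJ => cellWeight_mul_cellIntegral hε (Finset.mem_filter.1 hJ).2 he
    fun v hv => expTwoPiI_ne_one (he' v hv)

/-- The shifts for which no exponent is an integer. -/
def regularShifts (I : Finset (Fin m)) (e : Factor m → ℂ) : Set ℂ :=
  {ζ | ∀ v ∈ facets I, ∀ n : ℤ, e v + ζ ≠ n}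

theorem isOpen_regularShifts (e : Factor m → ℂ) : IsOpen (regularShifts I e) := by
  have : regularShifts I e = ⋂ v ∈ facets I, {ζ | expTwoPiI (e v + ζ) ≠ 1} := by
    ext ζ
    simp only [Set.mem_iInter]
    refine forall₂_congr fun v _ => ⟨fun h => expTwoPiI_ne_one h, ?_⟩
    rintro h n rfl_h
    exact h (by rw [rfl_h, expTwoPiI_intCast])
  rw [this]
  exact isOpen_biInter_finset fun v _ =>
    isOpen_ne_fun (continuous_expTwoPiI.comp (continuous_const.add continuous_id)) continuous_const

theorem countable_compl_regularShifts (e : Factor m → ℂ) : (regularShifts I e)ᶜ.Countable := by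
  have : (regularShifts I e)ᶜ ⊆ ⋃ v : Factor m, Set.range fun n : ℤ => (n : ℂ) - e v := by
    intro ζ hζ
    have hζ' : ¬ ∀ v ∈ facets I, ∀ n : ℤ, e v + ζ ≠ n := hζ
    push Not at hζ'
    obtain ⟨v, -, n, h⟩ := hζ'
    exact Set.mem_iUnion.2 ⟨v, n, by simp only [← h, add_sub_cancel_left]⟩
  exact (Set.countable_iUnion fun v => Set.countable_range _).mono this

/-- Removing a countable set from a real vector space of dimension at least two leaves it path
connected; therefore one common shift of all exponents suffices for the continuation. -/
theorem isPreconnected_regularShifts (e : Factor m → ℂ) : IsPreconnected (regularShifts I e) := by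
  have h := (countable_compl_regularShifts (I := I) e).isPathConnected_compl_of_one_lt_rank
    (by rw [Complex.rank_real_complex]; exact Nat.one_lt_ofNat)
  rw [compl_compl] at h
  exact h.isConnected.isPreconnected

open Classical in
theorem differentiableOn_regularizedIntegral (hε : AdmissibleRadii ε εs) (e : Factor m → ℂ) :
    DifferentiableOn ℂ (fun ζ => regularizedIntegral I ε εs fun v => e v + ζ)
      (regularShifts I e) := by
  intro ζ hζ
  refine DifferentiableAt.differentiableWithinAt ?_
  unfold regularizedIntegral
  refine DifferentiableAt.fun_sum fun J hJ => ?_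
  have hJ' := (Finset.mem_filter.1 hJ).2
  refine DifferentiableAt.mul ?_ (differentiable_cellIntegral hε hJ' e ζ)
  unfold cellWeight
  refine DifferentiableAt.fun_finsetProd fun j hj => DifferentiableAt.div
    (differentiableAt_const _) ?_ (sub_ne_zero.2 (expTwoPiI_ne_one (hζ j (hJ'.subset_facets hj))))
  unfold expTwoPiI
  fun_prop

/-- Since `1 / Γ` is entire, only the numerators `Γ(e v + ζ + 1)` restrict `ζ`, and their poles need
an integral exponent. -/
theorem differentiableOn_dirichletValue (e : Factor m → ℂ) :
    DifferentiableOn ℂ (fun ζ => dirichletValue I fun v => e v + ζ) (regularShifts I e) := by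
  intro ζ hζ
  refine DifferentiableAt.differentiableWithinAt ?_
  have hG : ∀ v ∈ facets I, DifferentiableAt ℂ (fun ζ => Complex.Gamma (e v + ζ + 1)) ζ := by
    intro v hv
    refine DifferentiableAt.comp (f := fun ζ => e v + ζ + 1) ζ
      (Complex.differentiableAt_Gamma _ fun n h => hζ v hv (-(n : ℤ) - 1) ?_) (by fun_prop)
    push_cast
    linear_combination h
  have hI : ∀ f : ℂ → ℂ, Differentiable ℂ f → DifferentiableAt ℂ (fun ζ => (Complex.Gamma (f ζ))⁻¹) ζ :=
    fun f hf => (Complex.differentiable_one_div_Gamma.comp hf) ζ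
  unfold dirichletValue
  refine DifferentiableAt.mul (DifferentiableAt.mul (DifferentiableAt.mul
    (DifferentiableAt.fun_finsetProd fun p _ => hG _ (atZero_mem_facets p)) (hG _ last_mem_facets))
    (hI _ (by fun_prop))) (DifferentiableAt.fun_finsetProd fun q hq => ?_)
  exact ((hG _ (atZero_mem_facets q)).mul (hG _ (atOne_mem_facets.2 (Finset.mem_compl.1 hq)))).mul
    (hI _ (by fun_prop))

/-- The value of the integral over the regularized cycle, for all non-integral exponents. -/
theorem regularizedIntegral_eq (hε : AdmissibleRadii ε εs) {e : Factor m → ℂ}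
    (he : ∀ v ∈ facets I, ∀ n : ℤ, e v ≠ n) :
    regularizedIntegral I ε εs e = dirichletValue I e := by
  -- Shifts of real part larger than `K` make all exponents positive, so both sides agree there away
  -- from the excluded points.
  set K : ℝ := ∑ v, |(e v).re| with hK
  have hpos : ∀ ζ : ℂ, K < ζ.re → ∀ v, 0 < (e v + ζ).re := by
    intro ζ hζ v
    have h1 : |(e v).re| ≤ K :=
      Finset.single_le_sum (f := fun v => |(e v).re|) (fun v _ => abs_nonneg _) (Finset.mem_univ v)
    have h2 := neg_abs_le (e v).re
    rw [Complex.add_re]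
    linarith
  have hopen : IsOpen {ζ : ℂ | K < ζ.re} := isOpen_lt continuous_const Complex.continuous_re
  have hdense : Dense (regularShifts I e) := by
    have := (countable_compl_regularShifts (I := I) e).dense_compl ℝ
    rwa [compl_compl] at this
  obtain ⟨ζ₀, hζ₀, hζ₀'⟩ := hdense.inter_open_nonempty _ hopen
    ⟨((K + 1 : ℝ) : ℂ), by simp⟩
  have hnear : (fun ζ => regularizedIntegral I ε εs fun v => e v + ζ) =ᶠ[nhds ζ₀]
      fun ζ => dirichletValue I fun v => e v + ζ := by
    filter_upwards [hopen.mem_nhds hζ₀, (isOpen_regularShifts e).mem_nhds hζ₀'] with ζ h1 h2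
    exact regularizedIntegral_of_re_pos hε (fun v _ => hpos ζ h1 v) h2
  have h0 : (0 : ℂ) ∈ regularShifts I e := fun v hv n => by
    rw [add_zero]
    exact he v hv n
  have := ((differentiableOn_regularizedIntegral hε e).analyticOnNhd
    (isOpen_regularShifts e)).eqOn_of_preconnected_of_eventuallyEq
    ((differentiableOn_dirichletValue e).analyticOnNhd (isOpen_regularShifts e))
    (isPreconnected_regularShifts e) hζ₀' hnear h0
  simpa only [add_zero] using this

end continuation

/-! ### Expansion of the integrand in powers of `x` -/

section expansion

variable {m : ℕ} {I : Finset (Fin m)}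

/-- The factorial of the total degree in the multinomial coefficient cancels the denominator of the
binomial series. -/
theorem hasSum_multinomial_binomial {ι : Type*} [Fintype ι] [DecidableEq ι] (A : ℂ) {z : ι → ℂ}
    (hz : ∑ k, ‖z k‖ < 1) :
    HasSum (fun n : ι → ℕ => poch A (∑ k, n k) / (∏ k, ((n k).factorial : ℂ)) * ∏ k, z k ^ n k)
      (Complex.exp (-A * Complex.log (1 - ∑ k, z k))) := by
  have hs : Summable fun N : ℕ => ‖poch A N / (N.factorial : ℂ)‖ * (∑ k, ‖z k‖) ^ N := by
    have h0 : 0 ≤ ∑ k, ‖z k‖ := Finset.sum_nonneg fun k _ => norm_nonneg _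
    have h := (hasSum_binomial A (z := ((∑ k, ‖z k‖ : ℝ) : ℂ))
      (by rwa [Complex.norm_real, Real.norm_of_nonneg h0])).summable.norm
    refine h.congr fun N => ?_
    rw [norm_mul, norm_pow, Complex.norm_real, Real.norm_of_nonneg h0]
  have h := hasSum_multinomial (fun N => poch A N / (N.factorial : ℂ)) z hs
  rw [(hasSum_binomial A ((norm_sum_le _ _).trans_lt hz)).tsum_eq] at h
  refine hasSum_of_eq h fun n => ?_
  have h1 : (∏ k, ((n k).factorial : ℂ)) * (Nat.multinomial Finset.univ n : ℂ) =
      ((∑ k, n k).factorial : ℂ) := by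
    exact_mod_cast Nat.multinomial_spec (s := Finset.univ) (f := n)
  have h2 : (∏ k, ((n k).factorial : ℂ)) ≠ 0 :=
    Finset.prod_ne_zero_iff.2 fun k _ => Nat.cast_ne_zero.2 (Nat.factorial_ne_zero _)
  have h3 : ((∑ k, n k).factorial : ℂ) ≠ 0 := Nat.cast_ne_zero.2 (Nat.factorial_ne_zero _)
  rw [div_mul_eq_mul_div, div_mul_eq_mul_div, div_eq_div_iff h2 h3, ← h1]
  ring

/-- The Taylor coefficients of `∏_{p ∈ I} (1 - z_p) ^ (-B_p) · (1 - ∑_{q ∉ I} z_q) ^ (-A)`. -/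
def mixedCoeff (I : Finset (Fin m)) (A : ℂ) (B : Fin m → ℂ) (n : Fin m → ℕ) : ℂ :=
  (∏ p ∈ I, poch (B p) (n p) / ((n p).factorial : ℂ)) *
    (poch A (∑ q ∈ Iᶜ, n q) / ∏ q ∈ Iᶜ, ((n q).factorial : ℂ))

theorem hasSum_mul_prod {ι κ : Type*} {f : ι → ℂ} {g : κ → ℂ} {s t : ℂ} (hf : HasSum f s)
    (hg : HasSum g t) : HasSum (fun x : ι × κ => f x.1 * g x.2) (s * t) :=
  hf.mul hg (summable_mul_of_summable_norm hf.summable.norm hg.summable.norm)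

theorem hasSum_mixedCoeff (A : ℂ) (B : Fin m → ℂ) {z : Fin m → ℂ} (h1 : ∀ p ∈ I, ‖z p‖ < 1)
    (h2 : ∑ q ∈ Iᶜ, ‖z q‖ < 1) :
    HasSum (fun n : Fin m → ℕ => mixedCoeff I A B n * ∏ k, z k ^ n k)
      ((∏ p ∈ I, Complex.exp (-B p * Complex.log (1 - z p))) *
        Complex.exp (-A * Complex.log (1 - ∑ q ∈ Iᶜ, z q))) := by
  have hi : ∀ k, k ∈ I ↔ k ∈ I := fun k => Iff.rfl
  have hc : ∀ k, k ∈ Iᶜ ↔ ¬ k ∈ I := fun k => Finset.mem_compl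
  have hI : HasSum (fun n : {k // k ∈ I} → ℕ => ∏ k : {k // k ∈ I},
      (poch (B k) (n k) / ((n k).factorial : ℂ) * z k ^ n k)) _ :=
    hasSum_prod_pi (fun (k : {k // k ∈ I}) n => poch (B k) n / (n.factorial : ℂ) * z k ^ n) _
      fun k => hasSum_binomial (B k) (h1 k k.2)
  rw [Finset.sum_subtype _ hc] at h2
  have hQ := hasSum_multinomial_binomial A (z := fun k : {k // k ∉ I} => z k) h2
  have h := hasSum_mul_prod hI hQ
  -- Multi-indices split into their parts on `I` and on its complement, on which the two expansions
  -- are independent.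
  have h' := (Equiv.piEquivPiSubtypeProd (fun k => k ∈ I) fun _ => ℕ).hasSum_iff.2 h
  rw [Finset.prod_subtype _ hi, Finset.sum_subtype _ hc]
  refine hasSum_of_eq h' fun n => ?_
  have e : mixedCoeff I A B n * ∏ k, z k ^ n k =
      (∏ p ∈ I, (poch (B p) (n p) / ((n p).factorial : ℂ) * z p ^ n p)) *
      (poch A (∑ q ∈ Iᶜ, n q) / (∏ q ∈ Iᶜ, ((n q).factorial : ℂ)) * ∏ q ∈ Iᶜ, z q ^ n q) := by
    rw [mixedCoeff, ← Finset.prod_mul_prod_compl I, Finset.prod_mul_distrib]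
    ring
  rw [e, Finset.prod_subtype _ hi, Finset.sum_subtype _ hc, Finset.prod_subtype _ hc,
    Finset.prod_subtype _ hc]
  rfl

end expansion

/-! ### The integrand and its expansion at a point of a cell. -/

section pointwise

variable {m : ℕ} {a : ℂ} {b c : Fin m → ℂ} {I : Finset (Fin m)} {ε : ℝ} {εs x : Fin m → ℝ}
  {J : Finset (Factor m)}

theorem sum_facets {M : Type*} [AddCommMonoid M] (f : Factor m → M) : ∑ v ∈ facets I, f v =
    ∑ k, f (atZero k) + (∑ q ∈ Iᶜ, f (atOne q) + f last) := by
  have h : facets I = Finset.univ.disjSum (Iᶜ.disjSum Finset.univ) := by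
    ext v
    rcases v with k | k | ⟨⟩
    · simp [atZero_mem_facets]
    · simp [atOne_mem_facets]
    · simpa using last_mem_facets
  rw [h, Finset.sum_disjSum, Finset.sum_disjSum, Fintype.sum_unique fun u : Unit => _]

/-- The exponents of the facet functions in the `n`-th term of the expansion of the integrand. -/
def shiftedExponents (a : ℂ) (b c : Fin m → ℂ) (I : Finset (Fin m)) (n : Fin m → ℕ) :
    Factor m → ℂ :=
  Sum.elim (fun k => if k ∈ I then c k - 2 - n k else b k - 1 + n k)
    (Sum.elim (fun k => c k - b k - 1) fun _ => -a - ∑ q ∈ Iᶜ, (n q : ℂ))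

/-- The variables of the expansion of the integrand. -/
def expansionVar (I : Finset (Fin m)) (x : Fin m → ℝ) (s : Fin m → ℂ) (k : Fin m) : ℂ :=
  if k ∈ I then (x k : ℂ) / s k else (x k : ℂ) * s k / (1 - ∑ p ∈ I, s p)

/-- Splitting off `s_p` from `s_p - x_p` and `1 - ∑ s_p` from the last factor isolates the
dependence on `x`. With the `-1` from `φ`, the exponent of `s_p` is `b_p + (c_p - b_p - 1) - 1 = c_p
- 2`, and that of `1 - x_p / s_p` is `c_p - b_p - 1`, the negative of `bI` at `p`. -/
theorem load_mul_phiCoeff (hε : AdmissibleRadii ε εs) (hJ : IsFaceSet I J) {y : Fin m → ℝ}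
    (hy : y ∈ unitCube m) :
    (cell I ε εs x J).load (exponents a b c) y * phiCoeff (cellMap I ε εs J y) =
      Complex.exp (∑ v ∈ facets I, shiftedExponents a b c I 0 v * logFacet I ε εs J v y) *
        ((∏ p ∈ I, Complex.exp (-bI b c I p *
            Complex.log (1 - expansionVar I x (cellMap I ε εs J y) p))) *
          Complex.exp (-a * Complex.log (1 - ∑ q ∈ Iᶜ, expansionVar I x (cellMap I ε εs J y) q))) := by
  have hphi : phiCoeff (cellMap I ε εs J y) = Complex.exp (-∑ k, logZero I ε εs J k y) := by
    rw [phiCoeff, Complex.exp_neg, Complex.exp_sum]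
    exact congrArg _ (Finset.prod_congr rfl fun k _ => (exp_logZero hε hJ hy k).symm)
  have hX : ∑ q ∈ Iᶜ, expansionVar I x (cellMap I ε εs J y) q =
      (∑ q ∈ Iᶜ, (x q : ℂ) * cellMap I ε εs J y q) / (1 - ∑ p ∈ I, cellMap I ε εs J y p) := by
    rw [Finset.sum_div]
    exact Finset.sum_congr rfl fun q hq => by rw [expansionVar, if_neg (Finset.mem_compl.1 hq)]
  have hone : ∀ k, k ∈ I → logOne I ε εs x J k y = logZero I ε εs J k y +
      Complex.log (1 - expansionVar I x (cellMap I ε εs J y) k) := fun k hk => by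
    rw [logOne, if_pos hk, expansionVar, if_pos hk]
  -- Off `I` the factor is `1 - s_k`, which does not involve `x`; this justifies the value `0` in
  -- `logFacet`.
  have hone' : ∀ k, k ∈ Iᶜ → logOne I ε εs x J k y = logOne I ε εs 0 J k y := fun k hk => by
    rw [logOne, logOne, if_neg (Finset.mem_compl.1 hk), if_neg (Finset.mem_compl.1 hk)]
  rw [hphi, hX, LoadedCube.load, ← Complex.exp_add, ← Complex.exp_sum, ← Complex.exp_add,
    ← Complex.exp_add]
  congr 1
  rw [sum_facets, Fintype.sum_sum_type, Fintype.sum_sum_type, Fintype.sum_unique fun u : Unit => _]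
  change ∑ k, b k * logZero I ε εs J k y + (∑ k, (c k - b k - 1) * logOne I ε εs x J k y +
    -a * (logSimplex I ε εs J y + _)) + -∑ k, logZero I ε εs J k y =
    ∑ k, (if k ∈ I then c k - 2 - ((0 : ℕ) : ℂ) else b k - 1 + ((0 : ℕ) : ℂ)) * logZero I ε εs J k y +
      (∑ q ∈ Iᶜ, (c q - b q - 1) * logOne I ε εs 0 J q y + (-a - ∑ q ∈ Iᶜ, ((0 : ℕ) : ℂ)) *
        logSimplex I ε εs J y) + _
  rw [← Finset.sum_add_sum_compl I fun k => b k * logZero I ε εs J k y,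
    ← Finset.sum_add_sum_compl I fun k => logZero I ε εs J k y,
    ← Finset.sum_add_sum_compl I fun k => (c k - b k - 1) * logOne I ε εs x J k y,
    ← Finset.sum_add_sum_compl I fun k => (if k ∈ I then c k - 2 - ((0 : ℕ) : ℂ) else
      b k - 1 + ((0 : ℕ) : ℂ)) * logZero I ε εs J k y,
    Finset.sum_congr (s₁ := Iᶜ) rfl fun k hk => congrArg ((c k - b k - 1) * ·) (hone' k hk)]
  have e1 : ∑ k ∈ I, (c k - b k - 1) * logOne I ε εs x J k y + ∑ k ∈ I, b k * logZero I ε εs J k y -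
      ∑ k ∈ I, logZero I ε εs J k y =
      ∑ k ∈ I, (if k ∈ I then c k - 2 - ((0 : ℕ) : ℂ) else b k - 1 + ((0 : ℕ) : ℂ)) *
        logZero I ε εs J k y +
      ∑ k ∈ I, -bI b c I k * Complex.log (1 - expansionVar I x (cellMap I ε εs J y) k) := by
    rw [← Finset.sum_add_distrib, ← Finset.sum_sub_distrib, ← Finset.sum_add_distrib]
    refine Finset.sum_congr rfl fun k hk => ?_
    rw [hone k hk, if_pos hk, bI, if_pos hk]
    push_cast
    ring
  have e2 : ∑ k ∈ Iᶜ, b k * logZero I ε εs J k y - ∑ k ∈ Iᶜ, logZero I ε εs J k y =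
      ∑ k ∈ Iᶜ, (if k ∈ I then c k - 2 - ((0 : ℕ) : ℂ) else b k - 1 + ((0 : ℕ) : ℂ)) *
        logZero I ε εs J k y := by
    rw [← Finset.sum_sub_distrib]
    refine Finset.sum_congr rfl fun k hk => ?_
    rw [if_neg (Finset.mem_compl.1 hk)]
    push_cast
    ring
  rw [Nat.cast_zero] at *
  rw [Finset.sum_const_zero (s := Iᶜ)]
  linear_combination e1 + e2

/-- A monomial in the expansion variables lowers the exponent of `s_p` by `n_p`, raises that of
`s_q` by `n_q` and lowers that of `1 - ∑ s_p` by `∑ n_q`. -/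
theorem exp_mul_prod_expansionVar (hε : AdmissibleRadii ε εs) (hJ : IsFaceSet I J) {y : Fin m → ℝ}
    (hy : y ∈ unitCube m) (n : Fin m → ℕ) :
    Complex.exp (∑ v ∈ facets I, shiftedExponents a b c I 0 v * logFacet I ε εs J v y) *
        ∏ k, expansionVar I x (cellMap I ε εs J y) k ^ n k =
      (∏ k, (x k : ℂ) ^ n k) *
        Complex.exp (∑ v ∈ facets I, shiftedExponents a b c I n v * logFacet I ε εs J v y) := by
  have hv : ∀ k, expansionVar I x (cellMap I ε εs J y) k ^ n k = (x k : ℂ) ^ n k *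
      Complex.exp (if k ∈ I then -(n k : ℂ) * logZero I ε εs J k y else
        (n k : ℂ) * logZero I ε εs J k y - n k * logSimplex I ε εs J y) := by
    intro k
    rw [expansionVar, ← exp_logZero hε hJ hy k, ← exp_logSimplex hε hJ hy]
    split_ifs with hk
    · rw [div_eq_mul_inv, ← Complex.exp_neg, mul_pow, ← Complex.exp_nat_mul]
      ring_nf
    · rw [mul_div_assoc, ← Complex.exp_sub, mul_pow, ← Complex.exp_nat_mul]
      ring_nf
  rw [Finset.prod_congr rfl fun k _ => hv k, Finset.prod_mul_distrib, ← Complex.exp_sum, mul_left_comm,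
    ← Complex.exp_add]
  congr 2
  rw [sum_facets, sum_facets]
  change ∑ k, (if k ∈ I then c k - 2 - ((0 : ℕ) : ℂ) else b k - 1 + ((0 : ℕ) : ℂ)) *
      logZero I ε εs J k y + (∑ q ∈ Iᶜ, (c q - b q - 1) * logOne I ε εs 0 J q y +
        (-a - ∑ q ∈ Iᶜ, ((0 : ℕ) : ℂ)) * logSimplex I ε εs J y) + _ =
    ∑ k, (if k ∈ I then c k - 2 - (n k : ℂ) else b k - 1 + (n k : ℂ)) *
      logZero I ε εs J k y + (∑ q ∈ Iᶜ, (c q - b q - 1) * logOne I ε εs 0 J q y +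
        (-a - ∑ q ∈ Iᶜ, (n q : ℂ)) * logSimplex I ε εs J y)
  have e : ∑ k, (if k ∈ I then -(n k : ℂ) * logZero I ε εs J k y else
        (n k : ℂ) * logZero I ε εs J k y - n k * logSimplex I ε εs J y) =
      ∑ k, (if k ∈ I then c k - 2 - (n k : ℂ) else b k - 1 + (n k : ℂ)) * logZero I ε εs J k y -
      ∑ k, (if k ∈ I then c k - 2 - ((0 : ℕ) : ℂ) else b k - 1 + ((0 : ℕ) : ℂ)) *
        logZero I ε εs J k y - ∑ q ∈ Iᶜ, (n q : ℂ) * logSimplex I ε εs J y := by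
    have hq : ∑ q ∈ Iᶜ, (n q : ℂ) * logSimplex I ε εs J y =
        ∑ k, if k ∈ I then 0 else (n k : ℂ) * logSimplex I ε εs J y := by
      rw [← Finset.sum_add_sum_compl I, Finset.sum_eq_zero fun k hk => if_pos hk, zero_add]
      exact Finset.sum_congr rfl fun k hk => (if_neg (Finset.mem_compl.1 hk)).symm
    rw [hq, ← Finset.sum_sub_distrib, ← Finset.sum_sub_distrib]
    refine Finset.sum_congr rfl fun k _ => ?_
    split_ifs <;> push_cast <;> ring
  rw [e, ← Finset.sum_mul, Nat.cast_zero, Finset.sum_const_zero]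
  ring

end pointwise

/-! ### Termwise integration -/

section termwise

open MeasureTheory

variable {m : ℕ} {a : ℂ} {b c : Fin m → ℂ} {I : Finset (Fin m)} {ε : ℝ} {εs x : Fin m → ℝ}
  {J : Finset (Factor m)}

/-- Bounds for the variables of the expansion on the cells. -/
def expansionBound (I : Finset (Fin m)) (ε : ℝ) (εs x : Fin m → ℝ) (k : Fin m) : ℝ :=
  if k ∈ I then x k / εs k else x k * (1 + εs k) / ε

theorem expansionBound_nonneg (hε : AdmissibleRadii ε εs) (hx : AdmissiblePoint ε εs x) (k : Fin m) :
    0 ≤ expansionBound I ε εs x k := by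
  have h1 := hε.pos k
  have h2 := hx.pos k
  have h3 := hε.pos_last
  unfold expansionBound
  split_ifs <;> positivity

theorem norm_expansionVar_le (hε : AdmissibleRadii ε εs) (hx : AdmissiblePoint ε εs x)
    (hJ : IsFaceSet I J) {y : Fin m → ℝ} (hy : y ∈ unitCube m) (k : Fin m) :
    ‖expansionVar I x (cellMap I ε εs J y) k‖ ≤ expansionBound I ε εs x k := by
  have h1 := hε.pos k
  have h2 := (hx.pos k).le
  have h3 := hε.pos_last
  unfold expansionBound expansionVar
  split_ifs with hk
  · rw [norm_div, Complex.norm_real, Real.norm_of_nonneg h2]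
    have := le_norm_cellMap (J := J) hε hy hk
    gcongr
  · rw [norm_div, norm_mul, Complex.norm_real, Real.norm_of_nonneg h2]
    have h4 := norm_cellMap_le hε hJ hy hk
    have h5 := le_norm_last hε hJ hy
    gcongr

theorem expansionBound_lt_one (hε : AdmissibleRadii ε εs) (hx : AdmissiblePoint ε εs x) {p : Fin m}
    (hp : p ∈ I) : expansionBound I ε εs x p < 1 := by
  rw [expansionBound, if_pos hp, div_lt_one (hε.pos p)]
  exact hx.lt p

theorem sum_expansionBound_lt_one (hε : AdmissibleRadii ε εs) (hx : AdmissiblePoint ε εs x) :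
    ∑ q ∈ Iᶜ, expansionBound I ε εs x q < 1 := by
  refine lt_of_eq_of_lt (Finset.sum_congr rfl fun q hq => ?_) (sum_compl_div_lt_one (I := I) hε hx)
  rw [expansionBound, if_neg (Finset.mem_compl.1 hq)]

theorem continuousOn_exp_sum_logFacet (hε : AdmissibleRadii ε εs) (hJ : IsFaceSet I J)
    (e : Factor m → ℂ) : ContinuousOn (fun y =>
      Complex.exp (∑ v ∈ facets I, e v * logFacet I ε εs J v y) * cellDet I ε εs J y) (unitCube m) :=
  (ContinuousOn.cexp (continuousOn_finsetSum _ fun _ hv =>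
    continuousOn_const.mul (continuousOn_logFacet hε hJ hv))).mul (continuousOn_cellDet hJ)

/-- Dominated convergence: the expansion evaluated at the bounds `expansionBound`, which still
satisfy its convergence conditions, is a majorant independent of the point of the cell. -/
theorem hasSum_cell_integral (hε : AdmissibleRadii ε εs) (hx : AdmissiblePoint ε εs x)
    (hJ : IsFaceSet I J) :
    HasSum (fun n : Fin m → ℕ => mixedCoeff I a (bI b c I) n * (∏ k, (x k : ℂ) ^ n k) *
      cellIntegral I ε εs J (shiftedExponents a b c I n))
      ((cell I ε εs x J).integral (exponents a b c) phiCoeff) := by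
  set G : (Fin m → ℝ) → ℂ := fun y =>
    Complex.exp (∑ v ∈ facets I, shiftedExponents a b c I 0 v * logFacet I ε εs J v y) *
      cellDet I ε εs J y with hG
  have hGc : ContinuousOn G (unitCube m) := continuousOn_exp_sum_logFacet hε hJ _
  obtain ⟨C, hC⟩ := (isCompact_unitCube m).exists_bound_of_continuousOn hGc
  have hterm : ∀ n : Fin m → ℕ, ∀ y ∈ unitCube m,
      mixedCoeff I a (bI b c I) n * (∏ k, (x k : ℂ) ^ n k) *
        (Complex.exp (∑ v ∈ facets I, shiftedExponents a b c I n v * logFacet I ε εs J v y) *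
          cellDet I ε εs J y) =
      G y * (mixedCoeff I a (bI b c I) n *
        ∏ k, expansionVar I x (cellMap I ε εs J y) k ^ n k) := fun n y hy => by
    linear_combination (-(mixedCoeff I a (bI b c I) n * cellDet I ε εs J y)) *
      exp_mul_prod_expansionVar (x := x) (a := a) (b := b) (c := c) hε hJ hy n
  have hb0 := expansionBound_nonneg (I := I) hε hx
  have hnorm : ∀ k, ‖(expansionBound I ε εs x k : ℂ)‖ = expansionBound I ε εs x k := fun k => by
    rw [Complex.norm_real, Real.norm_of_nonneg (hb0 k)]
  have hsum := (hasSum_mixedCoeff (I := I) a (bI b c I)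
    (z := fun k => (expansionBound I ε εs x k : ℂ))
    (fun p hp => (hnorm p).trans_lt (expansionBound_lt_one hε hx hp))
    (by simpa only [hnorm] using sum_expansionBound_lt_one hε hx)).summable.norm
  have hmain := hasSum_integral_of_dominated_convergence (μ := volume.restrict (unitCube m))
    (F := fun n y => mixedCoeff I a (bI b c I) n * (∏ k, (x k : ℂ) ^ n k) *
        (Complex.exp (∑ v ∈ facets I, shiftedExponents a b c I n v * logFacet I ε εs J v y) *
          cellDet I ε εs J y))
    (f := fun y => (cell I ε εs x J).load (exponents a b c) y * phiCoeff (cellMap I ε εs J y) *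
      cellDet I ε εs J y)
    (fun n _ => C * ‖mixedCoeff I a (bI b c I) n * ∏ k, (expansionBound I ε εs x k : ℂ) ^ n k‖)
    (fun n => (continuousOn_const.mul (continuousOn_exp_sum_logFacet hε hJ _)).aestronglyMeasurable
      (measurableSet_unitCube m))
    (fun n => (ae_restrict_iff' (measurableSet_unitCube m)).2 (Filter.Eventually.of_forall
      fun y hy => ?_))
    (Filter.Eventually.of_forall fun _ => hsum.mul_left C)
    (continuousOn_const.integrableOn_compact (isCompact_unitCube m))
    ((ae_restrict_iff' (measurableSet_unitCube m)).2 (Filter.Eventually.of_forall fun y hy => ?_))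
  · simp only [integral_const_mul] at hmain
    exact hmain
  · have hC0 : 0 ≤ C := (norm_nonneg _).trans (hC y hy)
    rw [hterm n y hy, norm_mul (G y), norm_mul (mixedCoeff I a (bI b c I) n),
      norm_mul (mixedCoeff I a (bI b c I) n), norm_prod, norm_prod]
    refine mul_le_mul (hC y hy) (mul_le_mul_of_nonneg_left (Finset.prod_le_prod
      (fun _ _ => norm_nonneg _) fun k _ => ?_) (norm_nonneg _)) (by positivity) hC0
    rw [norm_pow, norm_pow, hnorm]
    exact pow_le_pow_left₀ (norm_nonneg _) (norm_expansionVar_le hε hx hJ hy k) _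
  · rw [load_mul_phiCoeff hε hJ hy]
    have h := (hasSum_mixedCoeff (I := I) a (bI b c I)
      (z := expansionVar I x (cellMap I ε εs J y))
      (fun p hp => (norm_expansionVar_le hε hx hJ hy p).trans_lt (expansionBound_lt_one hε hx hp))
      ((Finset.sum_le_sum fun q _ => norm_expansionVar_le hε hx hJ hy q).trans_lt
        (sum_expansionBound_lt_one hε hx))).mul_left (G y)
    rw [hG] at h
    rw [mul_right_comm]
    exact hasSum_of_eq h fun n => hterm n y hy

theorem expTwoPiI_add_natCast (z : ℂ) (n : ℕ) : expTwoPiI (z + n) = expTwoPiI z := by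
  rw [expTwoPiI_add, ← Int.cast_natCast, expTwoPiI_intCast, mul_one]

theorem expTwoPiI_sub_natCast (z : ℂ) (n : ℕ) : expTwoPiI (z - n) = expTwoPiI z := by
  rw [← expTwoPiI_add_natCast (z - n) n, sub_add_cancel]

/-- The exponents differ from those defining `dCoeff` by integers, so all terms of the expansion
live on the same regularized cycle. -/
theorem cellCoeff_eq_cellWeight (hJ : IsFaceSet I J) (n : Fin m → ℕ) :
    cellCoeff I a b c J = cellWeight J (shiftedExponents a b c I n) := by
  refine Finset.prod_congr rfl fun j hj => ?_
  have hf := hJ.subset_facets hj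
  congr 1
  rcases j with k | k | ⟨⟩
  · change (if k ∈ I then expTwoPiI (c k) - 1 else expTwoPiI (b k) - 1) =
      expTwoPiI (if k ∈ I then c k - 2 - n k else b k - 1 + n k) - 1
    split_ifs
    · rw [expTwoPiI_sub_natCast, show c k - 2 = c k - (2 : ℕ) by push_cast; ring,
        expTwoPiI_sub_natCast]
    · rw [expTwoPiI_add_natCast, expTwoPiI_sub_one]
  · change expTwoPiI (c k) * (expTwoPiI (b k))⁻¹ - 1 = expTwoPiI (c k - b k - 1) - 1
    rw [expTwoPiI_sub_one, sub_eq_add_neg (c k), expTwoPiI_add, expTwoPiI_neg]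
  · change (expTwoPiI a)⁻¹ - 1 = expTwoPiI (-a - ∑ q ∈ Iᶜ, (n q : ℂ)) - 1
    rw [← Nat.cast_sum, expTwoPiI_sub_natCast, expTwoPiI_neg]

open Classical in
theorem hasSum_FInt (hε : AdmissibleRadii ε εs) (hx : AdmissiblePoint ε εs x) :
    HasSum (fun n : Fin m → ℕ => mixedCoeff I a (bI b c I) n * (∏ k, (x k : ℂ) ^ n k) *
      regularizedIntegral I ε εs (shiftedExponents a b c I n)) (FInt a b c I ε εs x) := by
  rw [FInt_eq_sum]
  have h := hasSum_sum (s := Finset.univ.filter fun J => IsFaceSet I J) fun J hJ =>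
    (hasSum_cell_integral (a := a) (b := b) (c := c) hε hx (Finset.mem_filter.1 hJ).2).mul_left
      (cellCoeff I a b c J)
  refine hasSum_of_eq h fun n => ?_
  rw [regularizedIntegral, Finset.mul_sum]
  refine Finset.sum_congr rfl fun J hJ => ?_
  rw [cellCoeff_eq_cellWeight (Finset.mem_filter.1 hJ).2 n]
  ring

end termwise

/-! ### Comparison of the coefficients -/

section coefficients

variable {m : ℕ} {a : ℂ} {b c : Fin m → ℂ} {I : Finset (Fin m)} {ε : ℝ} {εs x : Fin m → ℝ}

theorem Gamma_add_natCast {z : ℂ} (hz : ∀ n : ℤ, z ≠ n) (n : ℕ) :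
    Complex.Gamma (z + n) = poch z n * Complex.Gamma z := by
  induction n with
  | zero => rw [Nat.cast_zero, add_zero, poch_zero, one_mul]
  | succ n ih =>
    rw [Nat.cast_succ, ← add_assoc, Complex.Gamma_add_one, ih, poch_succ]
    · ring
    · intro h
      exact hz (-n) (by push_cast; linear_combination h)

/-- The functional equation read downwards; each step contributes `z - n - 1`, the negative of the
next factor of `poch (1 - z)`. -/
theorem Gamma_sub_natCast {z : ℂ} (hz : ∀ n : ℤ, z ≠ n) (n : ℕ) :
    Complex.Gamma (z - n) * poch (1 - z) n = (-1) ^ n * Complex.Gamma z := by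
  induction n with
  | zero => rw [Nat.cast_zero, sub_zero, poch_zero, pow_zero, mul_one, one_mul]
  | succ n ih =>
    have h : Complex.Gamma (z - n) = (z - n - 1) * Complex.Gamma (z - n - 1) := by
      rw [← Complex.Gamma_add_one, sub_add_cancel]
      intro h
      exact hz (n + 1) (by push_cast; linear_combination h)
    rw [h] at ih
    rw [Nat.cast_succ, ← sub_sub, poch_succ]
    linear_combination -ih

theorem Gamma_sub_natCast_inv {z : ℂ} (hz : ∀ n : ℤ, z ≠ n) (n : ℕ) :
    (Complex.Gamma (z - n))⁻¹ = (-1) ^ n * poch (1 - z) n * (Complex.Gamma z)⁻¹ := by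
  have h := Gamma_sub_natCast hz n
  have h1 : Complex.Gamma z ≠ 0 := Complex.Gamma_ne_zero fun k hk => hz (-k) (by push_cast; exact hk)
  have h2 : Complex.Gamma (z - n) ≠ 0 := Complex.Gamma_ne_zero fun k hk =>
    hz (n - k) (by push_cast; linear_combination hk)
  have h3 : ((-1 : ℂ) ^ n) * (-1) ^ n = 1 := by rw [← mul_pow]; norm_num
  field_simp
  linear_combination (-(-1 : ℂ) ^ n) * h + (-Complex.Gamma z) * h3

theorem shiftedExponents_ne_intCast (hb : ∀ k (n : ℤ), b k ≠ n) (hc : ∀ k (n : ℤ), c k ≠ n)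
    (hcb : ∀ k (n : ℤ), c k - b k ≠ n) (ha : ∀ n : ℤ, a ≠ n) (n : Fin m → ℕ) (v : Factor m) (l : ℤ) :
    shiftedExponents a b c I n v ≠ l := by
  rcases v with k | k | ⟨⟩
  · change (if k ∈ I then c k - 2 - n k else b k - 1 + n k) ≠ (l : ℂ)
    split_ifs
    · intro h
      exact hc k (l + 2 + n k) (by push_cast; linear_combination h)
    · intro h
      exact hb k (l + 1 - n k) (by push_cast; linear_combination h)
  · change c k - b k - 1 ≠ (l : ℂ)
    intro h
    exact hcb k (l + 1) (by push_cast; linear_combination h)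
  · change -a - ∑ q ∈ Iᶜ, (n q : ℂ) ≠ (l : ℂ)
    intro h
    exact ha (-l - ∑ q ∈ Iᶜ, (n q : ℤ)) (by push_cast; linear_combination -h)

/-- All gamma arguments are shifted by integers. `Γ(c_p - 1 - n_p)` produces `1 / (2 - c_p, n_p)`,
where `2 - c_p` is `cI` at `p`. `Γ(1 - a - ∑ n_q)` produces `1 / (a, ∑ n_q)`. The joint denominator,
lowered by the total degree, produces the Pochhammer symbol of `aI`. Off `I` the quotients of `(b_q,
n_q)` by `(c_q, n_q)` appear. -/
theorem dirichletValue_shiftedExponents (hb : ∀ k (n : ℤ), b k ≠ n) (hc : ∀ k (n : ℤ), c k ≠ n)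
    (ha : ∀ (K : Finset (Fin m)) (n : ℤ), a - ∑ p ∈ K, c p ≠ n) (n : Fin m → ℕ) :
    dirichletValue I (shiftedExponents a b c I n) * poch a (∑ q ∈ Iᶜ, n q) *
        (∏ k, poch (cI c I k) (n k)) =
      gammaFactor a b c I * poch (aI a c I) (∑ k, n k) * ∏ q ∈ Iᶜ, poch (b q) (n q) := by
  have ha0 : ∀ l : ℤ, 1 - a ≠ l := fun l h => ha ∅ (1 - l) (by
    rw [Finset.sum_empty]; push_cast; linear_combination -h)
  have hp : ∏ p ∈ I, Complex.Gamma (shiftedExponents a b c I n (atZero p) + 1) *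
      poch (cI c I p) (n p) = (-1) ^ (∑ p ∈ I, n p) * ∏ p ∈ I, Complex.Gamma (c p - 1) := by
    rw [← Finset.prod_pow_eq_pow_sum, ← Finset.prod_mul_distrib]
    refine Finset.prod_congr rfl fun p hp => ?_
    have h := Gamma_sub_natCast (z := c p - 1)
      (fun l h => hc p (l + 1) (by push_cast; linear_combination h)) (n p)
    rw [← h]
    congr 2
    · simp only [shiftedExponents, Sum.elim_inl, if_pos hp]
      ring
    · rw [cI, if_pos hp]
      ring
  have hlast : Complex.Gamma (shiftedExponents a b c I n last + 1) * poch a (∑ q ∈ Iᶜ, n q) =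
      (-1) ^ (∑ q ∈ Iᶜ, n q) * Complex.Gamma (1 - a) := by
    rw [← Gamma_sub_natCast ha0, sub_sub_cancel]
    congr 2
    simp only [shiftedExponents, Sum.elim_inr]
    push_cast
    ring
  have hsum : (Complex.Gamma (∑ p ∈ I, (shiftedExponents a b c I n (atZero p) + 1) +
      (shiftedExponents a b c I n last + 1)))⁻¹ = (-1) ^ (∑ k, n k) * poch (aI a c I) (∑ k, n k) *
      (Complex.Gamma ((∑ p ∈ I, c p) - a - (I.card : ℂ) + 1))⁻¹ := by
    have h := Gamma_sub_natCast_inv (z := (∑ p ∈ I, c p) - a - (I.card : ℂ) + 1)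
      (fun l h => ha I (1 - l - I.card) (by push_cast; linear_combination -h)) (∑ k, n k)
    rw [show 1 - ((∑ p ∈ I, c p) - a - (I.card : ℂ) + 1) = aI a c I by rw [aI]; ring] at h
    rw [← h]
    congr 2
    have hs : ∑ p ∈ I, (shiftedExponents a b c I n (atZero p) + 1) =
        ∑ p ∈ I, (c p - 1 - n p) := Finset.sum_congr rfl fun p hp => by
      simp only [shiftedExponents, Sum.elim_inl, if_pos hp]
      ring
    rw [hs, ← Finset.sum_add_sum_compl I n, Finset.sum_sub_distrib, Finset.sum_sub_distrib,
      Finset.sum_const, nsmul_eq_mul]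
    simp only [shiftedExponents, Sum.elim_inr]
    push_cast
    ring
  have hq : ∏ q ∈ Iᶜ, (Complex.Gamma (shiftedExponents a b c I n (atZero q) + 1) *
      Complex.Gamma (shiftedExponents a b c I n (atOne q) + 1) *
      (Complex.Gamma ((shiftedExponents a b c I n (atZero q) + 1) +
        (shiftedExponents a b c I n (atOne q) + 1)))⁻¹) * poch (cI c I q) (n q) =
      (∏ q ∈ Iᶜ, Complex.Gamma (b q) * Complex.Gamma (c q - b q) / Complex.Gamma (c q)) *
        ∏ q ∈ Iᶜ, poch (b q) (n q) := by
    rw [← Finset.prod_mul_distrib]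
    refine Finset.prod_congr rfl fun q hq => ?_
    have hq' := Finset.mem_compl.1 hq
    have e1 : shiftedExponents a b c I n (atZero q) + 1 = b q + n q := by
      simp only [shiftedExponents, Sum.elim_inl, if_neg hq']
      ring
    have e2 : shiftedExponents a b c I n (atOne q) + 1 = c q - b q := by
      simp only [shiftedExponents, Sum.elim_inr, Sum.elim_inl]
      ring
    rw [e1, e2, show b q + n q + (c q - b q) = c q + n q by ring, Gamma_add_natCast (hb q),
      Gamma_add_natCast (hc q), cI, if_neg hq', mul_inv, div_eq_mul_inv]
    have h0 := poch_ne_zero (hc q) (n q)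
    field_simp
  rw [Finset.prod_mul_distrib] at hp hq
  -- The signs from the numerators have the total degree as exponent, as does the sign from the
  -- joint denominator.
  have hsign : ((-1 : ℂ) ^ (∑ p ∈ I, n p)) * (-1) ^ (∑ q ∈ Iᶜ, n q) * (-1) ^ (∑ k, n k) = 1 := by
    rw [← Finset.sum_add_sum_compl I n, ← pow_add, ← mul_pow]
    norm_num
  rw [← Finset.prod_mul_prod_compl I fun k => poch (cI c I k) (n k), dirichletValue, gammaFactor, hsum]
  calc _ = ((∏ p ∈ I, Complex.Gamma (shiftedExponents a b c I n (atZero p) + 1)) *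
        ∏ p ∈ I, poch (cI c I p) (n p)) *
      (Complex.Gamma (shiftedExponents a b c I n last + 1) * poch a (∑ q ∈ Iᶜ, n q)) *
      ((∏ q ∈ Iᶜ, (Complex.Gamma (shiftedExponents a b c I n (atZero q) + 1) *
        Complex.Gamma (shiftedExponents a b c I n (atOne q) + 1) *
        (Complex.Gamma ((shiftedExponents a b c I n (atZero q) + 1) +
          (shiftedExponents a b c I n (atOne q) + 1)))⁻¹)) * ∏ q ∈ Iᶜ, poch (cI c I q) (n q)) *
      ((-1) ^ (∑ k, n k) * poch (aI a c I) (∑ k, n k) *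
        (Complex.Gamma ((∑ p ∈ I, c p) - a - (I.card : ℂ) + 1))⁻¹) := by ring
    _ = _ := by
      rw [hp, hlast, hq]
      linear_combination ((∏ p ∈ I, Complex.Gamma (c p - 1)) *
        (∏ q ∈ Iᶜ, Complex.Gamma (b q) * Complex.Gamma (c q - b q) / Complex.Gamma (c q)) *
        (Complex.Gamma (1 - a) / Complex.Gamma ((∑ p ∈ I, c p) - a - (I.card : ℂ) + 1)) *
        poch (aI a c I) (∑ k, n k) * ∏ q ∈ Iᶜ, poch (b q) (n q)) * hsign

/-- The symbol `(a, ∑ n_q)` of the expansion cancels against the one in the Dirichlet value, and the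
missing symbols `(b^I_p, n_p)` come from the binomial series in `x_p / s_p`. -/
theorem mixedCoeff_mul_dirichletValue (hb : ∀ k (n : ℤ), b k ≠ n) (hc : ∀ k (n : ℤ), c k ≠ n)
    (ha : ∀ (K : Finset (Fin m)) (n : ℤ), a - ∑ p ∈ K, c p ≠ n) (n : Fin m → ℕ) :
    mixedCoeff I a (bI b c I) n * (∏ k, (x k : ℂ) ^ n k) *
        dirichletValue I (shiftedExponents a b c I n) =
      gammaFactor a b c I * lauricellaTerm (aI a c I) (bI b c I) (cI c I) (fun k => (x k : ℂ)) n := by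
  have h := dirichletValue_shiftedExponents (I := I) hb hc ha n
  have h0 : ∏ k, poch (cI c I k) (n k) ≠ 0 :=
    Finset.prod_ne_zero_iff.2 fun k _ => poch_ne_zero (cI_ne_intCast hc k) _
  have hb' : ∏ q ∈ Iᶜ, poch (b q) (n q) = ∏ q ∈ Iᶜ, poch (bI b c I q) (n q) :=
    Finset.prod_congr rfl fun q hq => by rw [bI, if_neg (Finset.mem_compl.1 hq)]
  have h1 : ∀ s : Finset (Fin m), ∏ k ∈ s, ((n k).factorial : ℂ) ≠ 0 := fun s =>
    Finset.prod_ne_zero_iff.2 fun k _ => Nat.cast_ne_zero.2 (Nat.factorial_ne_zero _)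
  have h2 := h1 I
  have h3 := h1 Iᶜ
  rw [mixedCoeff, lauricellaTerm, ← Finset.prod_mul_prod_compl I fun k => ((n k).factorial : ℂ),
    ← Finset.prod_mul_prod_compl I fun k => poch (bI b c I k) (n k), Finset.prod_div_distrib, ← hb']
  field_simp
  linear_combination (∏ p ∈ I, poch (bI b c I p) (n p)) * (∏ k, (x k : ℂ) ^ n k) * h

/-- `F_I` is a constant multiple of Lauricella's series. -/
theorem FInt_eq (hb : ∀ k (n : ℤ), b k ≠ n) (hc : ∀ k (n : ℤ), c k ≠ n)
    (hcb : ∀ k (n : ℤ), c k - b k ≠ n) (ha : ∀ (K : Finset (Fin m)) (n : ℤ), a - ∑ p ∈ K, c p ≠ n)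
    (hε : AdmissibleRadii ε εs) (hx : AdmissiblePoint ε εs x) :
    FInt a b c I ε εs x = gammaFactor a b c I *
      lauricellaFA (aI a c I) (bI b c I) (cI c I) fun k => (x k : ℂ) := by
  rw [lauricellaFA, ← tsum_mul_left, ← (hasSum_FInt hε hx).tsum_eq]
  refine tsum_congr fun n => ?_
  rw [regularizedIntegral_eq hε fun v _ => shiftedExponents_ne_intCast hb hc hcb
    (fun l => by simpa using ha ∅ l) n v, mixedCoeff_mul_dirichletValue hb hc ha]

end coefficients

end LauricellaFA

end

theorem mainTheorem1 (m : ℕ) (a : ℂ) (b c : Fin m → ℂ)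
    (hb : ∀ (k : Fin m) (n : ℤ), b k ≠ n)
    (hc : ∀ (k : Fin m) (n : ℤ), c k ≠ n)
    (hcb : ∀ (k : Fin m) (n : ℤ), c k - b k ≠ n)
    (ha : ∀ (K : Finset (Fin m)) (n : ℤ), a - ∑ p ∈ K, c p ≠ n)
    (I : Finset (Fin m)) :
    -- the integrals over the twisted cycles
    (∀ (ε : ℝ) (εs x : Fin m → ℝ),
      0 < ε → (∀ k, 0 < εs k ∧ εs k < 1 / 4) → ε < 1 - ∑ k, εs k →
      (∀ k, 0 < x k ∧ x k < εs k) → ∑ k, x k * (1 + εs k) < ε →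
      IsTwistedCycle (polyMI I x) (exponents a b c) m (tildeDelta a b c I ε εs x) ∧
      IsTwistedCycle (polyM x) (exponents a b c) m (Delta a b c I ε εs x) ∧
      twistedIntegral (exponents a b c) phiCoeff (Delta a b c I ε εs x) =
        phaseFactor b c I * (∏ p ∈ I, (x p : ℂ) ^ (1 - c p)) * FInt a b c I ε εs x ∧
      twistedIntegral (exponents a b c) phiCoeff (Delta a b c I ε εs x) =
        phaseFactor b c I * gammaFactor a b c I * localSolution a b c I (fun k => (x k : ℂ))) ∧
    -- the constant factor does not vanish
    phaseFactor b c I * gammaFactor a b c I ≠ 0 ∧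
    -- the series in `f_I` converges on `D_A`, and `f_I` is a local solution of the system
    (∀ x ∈ domainDA m, Summable (lauricellaTerm (aI a c I) (bI b c I) (cI c I) x)) ∧
    IsSolutionEA a b c (cutDomain m) (localSolution a b c I) := by
  refine ⟨fun ε εs x h1 h2 h3 h4 h5 => ?_,
    mul_ne_zero phaseFactor_ne_zero (gammaFactor_ne_zero hb hc hcb ha),
    fun x hx => summable_localSolution hb hc hcb hx, isSolutionEA_localSolution hb hc hcb⟩
  have hε : AdmissibleRadii ε εs := ⟨h1, fun k => (h2 k).1, fun k => (h2 k).2, by linarith⟩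
  have hx : AdmissiblePoint ε εs x := ⟨fun k => (h4 k).1, fun k => (h4 k).2, h5⟩
  -- The label `last` needs `a` itself to be non-integral, which is the condition for the empty set.
  have hd : ∀ j, dCoeff I a b c j ≠ 0 :=
    dCoeff_ne_zero hb hc hcb fun n => by simpa using ha ∅ n
  refine ⟨isTwistedCycle_tildeDelta hε hx hd, isTwistedCycle_Delta hε hx hd,
    twistedIntegral_Delta hε hx, ?_⟩
  rw [twistedIntegral_Delta hε hx, FInt_eq hb hc hcb ha hε hx, localSolution]
  ring
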